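/- **Setting.** Let $\mathcal D_0,\dots,\mathcal D_{k-1}$ be Borel probability distributions of pairs $(x,y)\in\mathbb R^d\times\mathbb R$ and $\Sigma_i=\mathbb E_{\mathcal D_i}[xx^\top]$. There are a finite family $B_s$ of small batches with at least $2$ samples each, a finite family $B_m$ of medium batches with at least $n_m$ samples each, and one further batch $b^*$ with at least $n_m$ samples. The samples of each batch of $B_s\cup B_m$ are drawn i.i.d. from one of the $\mathcal D_i$ (which one is unknown to the algorithm), those of $b^*$ i.i.d. from $\mathcal D_0$, and all samples are independent. Assume for all $i$ that $\|\Sigma_i\|\le C_1$ (spectral norm) and $\|x\|\le C_2\sqrt d$ a.s., where $C_2>0$. Let $\sigma,\alpha_s,\alpha_m>0$ and let $I$ be the set of $i$ such that at least a fraction $\alpha_s$ of the batches of $B_s$ and a fraction $\alpha_m$ of those of $B_m$ are sampled from $\mathcal D_i$ and, under $\mathcal D_i$: (1) $\mathbb E[(x\cdot u)^4]\le C\,(\mathbb E[(x\cdot u)^2])^2$ for all $u\in\mathbb R^d$, $u^\top\Sigma_i u\ge1$ for all unit vectors $u$, and $\|\Sigma_i\|\le C_1$; (2) $y=w_i\cdot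 x+\eta$, where the noise $\eta$ is independent of $x$, symmetric about $0$, with $\mathbb E[\eta]=0$ and $\mathbb E[\eta^2]\le\sigma^2$. For $i\notin I$ the input-output relation is arbitrary. Assume $0\in I$ and $\|w_0\|\le M$. **Algorithm.** Input: $B_s,B_m,b^*,k,\alpha_s,C,C_1,\sigma,M,\epsilon,\delta$. There are universal constants $c_R,\epsilon_1,c_2,c_T,c_{T_1},c_{T_2}>0$. "Divide" means: into disjoint random parts of the same size (rounded down). For a sample $(x,y)$ and a point $w$, the clipped gradient is $\nabla f(x,y,w,\kappa)=\frac{x\cdot w-y}{|x\cdot w-y|\vee\kappa}\,\kappa x$; for a collection $S$ of samples, $\nabla f(S,w,\kappa)$ is the average over $S$. Put $R=\lceil c_RC_1\log(2+\frac{M}{\epsilon\sigma})\rceil$, $\epsilon_2=\frac{c_2}{C_1\sqrt{C+1}}\min\{\epsilon,\frac1{\sqrt{C_1}}\}$, $\ell=\min\{k,\lceil\frac1{2\alpha_s\epsilon_2^2}\rceil\}$, $\delta'=\frac{\delta}{5R}$. Divide $B_s$ and $B_m$ into $R$ parts $B_s^{(r)}$, $B_m^{(r)}$, and $b^*$ into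 $2R$ parts $S_1^{(r)},S_2^{(r)}$. Start with $\hat w=0$ and do the following for $r=1,\dots,R$, then return $\hat w$. (a) Divide $S_1^{(r)}$ into $T=\lceil c_T\log\frac1{\delta'}\rceil$ parts, let $\theta$ be the median over the parts of the average of $(x\cdot\hat w-y)^2$, and let $\kappa=\sqrt{32(C+1)C_1(\theta+17\sigma^2)/\epsilon_1}$. (b) Divide each $b\in B_s^{(r)}$ into halves $S^b_1,S^b_2$, put $g^b_j=\nabla f(S^b_j,\hat w,\kappa)$ and $A=\frac1{2|B_s^{(r)}|}\sum_b\big(g_1^b(g_2^b)^\top+g_2^b(g_1^b)^\top\big)$, and let $P$ be the orthogonal projection onto the span of the top $\ell$ singular vectors of $A$ (all $d$ of them if $\ell\ge d$). (c) Let $T_1=\lceil c_{T_1}\log\frac{|B_m^{(r)}|}{\delta'}\rceil$ and $T_2=\lceil c_{T_2}\log\frac1{\delta'}\rceil$. Divide each $b\in B_m^{(r)}$ into halves $S_1^b,S_2^b$, divide $S_1^b$ into $2T_1$ parts $S^b_{1,j}$, $S_2^b$ into $T_2$ parts $S^b_{2,i}$, and $S_2^{(r)}$ into $2T_1$ parts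 $S^*_j$. Let $z^b_j=P\big(\nabla f(S^b_{1,j},\hat w,\kappa)-\nabla f(S^*_j,\hat w,\kappa)\big)$, let $\widetilde B$ be the set of those $b$ for which the median over $j\le T_1$ of $z^b_j\cdot z^b_{T_1+j}$ is at most $\epsilon_2^2\kappa^2C_1$, let $\Delta_i=\frac1{|\widetilde B|}\sum_{b\in\widetilde B}P\nabla f(S^b_{2,i},\hat w,\kappa)$ for $i\le T_2$, and let $\Delta$ be the $\Delta_i$ that minimizes the median over $j$ of $\|\Delta_i-\Delta_j\|$ (the first one in case of a tie). (d) Replace $\hat w$ by $\hat w-\frac1{C_1}\Delta$. Running time is counted in the real-number random access model: unit cost for arithmetic operations, comparisons, square roots, logarithms and rounding of real numbers and for random draws, and $d^3+1$ steps for the singular vectors of a $d\times d$ matrix, which are supplied by an arbitrary Borel measurable routine. **Theorem.** The universal constants of the algorithm can be chosen such that the following two statements hold. (i) *Polynomial time.* For all data and all internal randomness, and all parameters with $C_1\ge1$, $\sigma>0$, $M\ge0$, $\epsilon,\delta\in(0,1]$, the number of steps is at most a fixed polynomial in $d$, the numbers of batches and of samples, $C_1$, $\log(2+\frac M{\epsilon\sigma})$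 and $\log\frac1\delta$. (ii) *Accuracy.* There is a universal exponent $q$, and for all $C,C_1$ and all $C_2>0$ there is a constant $c>0$ that depends only on $C,C_1,C_2$, such that in the setting above, for all $\epsilon,\delta\in(0,1]$, if $$|B_s|\ge c\,\frac{d}{\alpha_s^2\epsilon^4}\,\Lambda(d)^q,\qquad n_m\ge c\,\min\Big\{\sqrt k,\frac1{\epsilon\sqrt{\alpha_s}}\Big\}\frac1{\epsilon^2}\,\Lambda(|B_m|)^q,\qquad |B_m|\ge\frac c{\alpha_m}\min\Big\{\sqrt k,\frac1{\epsilon\sqrt{\alpha_s}}\Big\}\,\Lambda(1)^q,$$ where $\Lambda(t)=\log\!\big(2+\frac t\delta(1+\frac M{\epsilon\sigma})\big)$, then the output $\hat w$ satisfies $\|\hat w-w_0\|\le\epsilon\sigma$ with probability at least $1-\delta$ over the samples and the internal randomness of the algorithm. -/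

import Mathlib

open MeasureTheory ProbabilityTheory

noncomputable section

namespace BatchRegression

/-! ### Samples and data distributions -/

/-- The input space `ℝ^d` with its Euclidean norm. -/
abbrev Vec (d : ℕ) := EuclideanSpace ℝ (Fin d)

/-- A sample is an input-output pair `(x, y)`. -/
abbrev Sample (d : ℕ) := Vec d × ℝ

/-- The second-moment matrix `𝔼[x xᵀ]` of the input. -/
def secondMoment {d : ℕ} (D : Measure (Sample d)) : Matrix (Fin d) (Fin d) ℝ :=
  Matrix.of fun a b => ∫ z, z.1 a * z.1 b ∂D

/-- The output noise `y - w ⬝ x` relative to the regression vector `w`. -/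
def noise {d : ℕ} (w : Vec d) (z : Sample d) : ℝ := z.2 - inner ℝ w z.1

/-- The conditions on a component that is to be recovered: a hypercontractive input with bounded
condition number, and an output that is linear in the input up to an independent, centred,
symmetric noise of variance at most `σ ^ 2`. -/
structure IsRegressionComponent {d : ℕ} (D : Measure (Sample d)) (w : Vec d) (C C₁ σ : ℝ) :
    Prop where
  hypercontractive : ∀ u : Vec d,
    ∫ z, (inner ℝ z.1 u) ^ 4 ∂D ≤ C * (∫ z, (inner ℝ z.1 u) ^ 2 ∂D) ^ 2
  one_le : ∀ u : Vec d, ‖u‖ = 1 → 1 ≤ inner ℝ u (Matrix.toEuclideanCLM (𝕜 := ℝ) (secondMoment D) u)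
  norm_le : ‖Matrix.toEuclideanCLM (𝕜 := ℝ) (secondMoment D)‖ ≤ C₁
  indep : IndepFun (fun z : Sample d => z.1) (noise w) D
  memLp : MemLp (noise w) 2 D
  mean_zero : ∫ z, noise w z ∂D = 0
  variance_le : ∫ z, (noise w z) ^ 2 ∂D ≤ σ ^ 2
  symmetric : D.map (fun z => -noise w z) = D.map (noise w)

/-! ### Batches -/

/-- The shape of the data: the number of small and of medium batches, the number of samples in each
of them, and the number of samples in the additional batch `b*`. -/
structure Layout where
  numSmall : ℕ
  smallSize : Fin numSmall → ℕ
  numMedium : ℕ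
  mediumSize : Fin numMedium → ℕ
  starSize : ℕ

/-- The samples themselves: the small batches, the medium batches, and the batch `b*`. -/
abbrev Data (d : ℕ) (L : Layout) :=
  ((b : Fin L.numSmall) → Fin (L.smallSize b) → Sample d) ×
    ((b : Fin L.numMedium) → Fin (L.mediumSize b) → Sample d) × (Fin L.starSize → Sample d)

/-- The set `I`: indices of the components that satisfy the conditions above and are the source of
at least a fraction `αs` of the small and `αm` of the medium batches. Here `smallSource b` is the
index of the component from which the small batch `b` is sampled, and similarly for the medium
batches. -/
def recoverable {d k : ℕ} (L : Layout) (D : Fin k → ProbabilityMeasure (Sample d))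
    (smallSource : Fin L.numSmall → Fin k) (mediumSource : Fin L.numMedium → Fin k)
    (w : Fin k → Vec d) (C C₁ σ αs αm : ℝ) : Set (Fin k) :=
  {i | αs * L.numSmall ≤ ((Finset.univ.filter fun b => smallSource b = i).card : ℝ) ∧
    αm * L.numMedium ≤ ((Finset.univ.filter fun b => mediumSource b = i).card : ℝ) ∧
    IsRegressionComponent (D i : Measure (Sample d)) (w i) C C₁ σ}

/-- The joint law of all the samples: all samples are independent, those of a batch are distributed
according to its source component, and those of `b*` according to component `i₀`. -/
def dataLaw {d k : ℕ} (L : Layout) (D : Fin k → ProbabilityMeasure (Sample d))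
    (smallSource : Fin L.numSmall → Fin k) (mediumSource : Fin L.numMedium → Fin k)
    (i₀ : Fin k) : Measure (Data d L) :=
  (Measure.pi fun b => Measure.pi fun _ : Fin (L.smallSize b) =>
      (D (smallSource b) : Measure (Sample d))).prod
    ((Measure.pi fun b => Measure.pi fun _ : Fin (L.mediumSize b) =>
        (D (mediumSource b) : Measure (Sample d))).prod
      (Measure.pi fun _ : Fin L.starSize => (D i₀ : Measure (Sample d))))

/-- The internal randomness of the algorithm: a permutation of the small batches, one of the medium
batches, one of the samples of `b*`, and one of the samples of each small and each medium batch. -/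
abbrev Seed (L : Layout) :=
  Equiv.Perm (Fin L.numSmall) × Equiv.Perm (Fin L.numMedium) × Equiv.Perm (Fin L.starSize) ×
    ((b : Fin L.numSmall) → Equiv.Perm (Fin (L.smallSize b))) ×
    ((b : Fin L.numMedium) → Equiv.Perm (Fin (L.mediumSize b)))

/-- The probability of an event that depends on the samples and on an independent, uniformly
distributed seed. -/
def probability {d k : ℕ} (L : Layout) (D : Fin k → ProbabilityMeasure (Sample d))
    (smallSource : Fin L.numSmall → Fin k) (mediumSource : Fin L.numMedium → Fin k)
    (i₀ : Fin k) (event : Data d L → Seed L → Prop) : ℝ :=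
  (∑ s : Seed L, (dataLaw L D smallSource mediumSource i₀).real {X | event X s}) /
    Fintype.card (Seed L)

/-! ### Computations with a step count

The cost model is the real random access machine with unit cost for each operation on real numbers
(arithmetic, comparison, square root, logarithm, rounding) and for each random draw. Operations on
vectors and matrices are charged the number of their scalar operations. -/

/-- The result of a computation together with the number of steps it took. -/
structure Timed (α : Type) where
  val : α
  steps : ℕ

instance : Monad Timed where
  pure a := ⟨a, 0⟩
  bind x f := ⟨(f x.val).val, x.steps + (f x.val).steps⟩

/-- Compute `a` by elementary operations that take `n` steps. -/
def charge {α : Type} (n : ℕ) (a : α) : Timed α := ⟨a, n⟩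

/-- Run `f i` for each `i` and store the results. -/
def forEach {n : ℕ} {β : Type} (f : Fin n → Timed β) : Timed (Fin n → β) :=
  ⟨fun i => (f i).val, ∑ i, ((f i).steps + 1)⟩

/-- Run `f 0`, …, `f (n - 1)` in this order, each on the result of the one before. -/
def loop {α : Type} : (n : ℕ) → (Fin n → α → Timed α) → α → Timed α
  | 0, _, a => charge 1 a
  | n + 1, f, a => do
    let b ← loop n (fun i => f i.castSucc) a
    f (Fin.last n) b

/-- A finite collection (an array) of objects. -/
structure Coll (α : Type) where
  len : ℕ
  get : Fin len → α

/-- Part `j` when a collection is divided into `m` blocks of the same size `⌊len / m⌋`. -/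
def Coll.part {α : Type} (S : Coll α) (m : ℕ) (j : Fin m) : Coll α where
  len := S.len / m
  get q := S.get ⟨j * (S.len / m) + q, by
    calc (j : ℕ) * (S.len / m) + q < j * (S.len / m) + S.len / m := by have := q.2; omega
      _ = (j + 1) * (S.len / m) := by ring
      _ ≤ m * (S.len / m) := Nat.mul_le_mul_right _ j.2
      _ ≤ S.len := Nat.mul_div_le _ _⟩

/-- Divide a collection into `m` disjoint parts of the same size. -/
def divide {α : Type} (S : Coll α) (m : ℕ) : Timed (Fin m → Coll α) :=
  charge (S.len + m + 1) (S.part m)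

/-- The median of `n` real numbers (the mean of the two middle ones when `n` is even). -/
def median {n : ℕ} (v : Fin n → ℝ) : ℝ :=
  if h : 0 < n then
    (v (Tuple.sort v ⟨(n - 1) / 2, by omega⟩) + v (Tuple.sort v ⟨n / 2, by omega⟩)) / 2
  else 0

/-- The median, computed by sorting with at most `n ^ 2` comparisons. -/
def timedMedian {n : ℕ} (v : Fin n → ℝ) : Timed ℝ := charge (n ^ 2 + 3) (median v)

/-- The entry of `D` at the first index at which `v` is minimal. -/
def entryAtMin {n d : ℕ} (v : Fin n → ℝ) (D : Fin n → Vec d) : Vec d :=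
  if h : (Finset.univ.filter fun i => ∀ j, v i ≤ v j).Nonempty then
    D ((Finset.univ.filter fun i => ∀ j, v i ≤ v j).min' h)
  else 0

/-! ### Singular vectors -/

/-- `u 0, u 1, …` is an orthonormal system of (right) singular vectors of `A`, in decreasing order
of the corresponding singular values `‖A (u i)‖`. -/
structure IsSingularSystem {d : ℕ} (A : Matrix (Fin d) (Fin d) ℝ) (u : Fin d → Vec d) : Prop where
  orthonormal : Orthonormal ℝ u
  eigen : ∀ i, Matrix.toEuclideanLin (A.transpose * A) (u i)
    = ‖Matrix.toEuclideanLin A (u i)‖ ^ 2 • u i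
  antitone : ∀ i j, i ≤ j → ‖Matrix.toEuclideanLin A (u j)‖ ≤ ‖Matrix.toEuclideanLin A (u i)‖

/-- A routine for the singular value decomposition: a Borel measurable choice of a system of
singular vectors of each `d × d` matrix. -/
structure SingularVectorRoutine (d : ℕ) where
  vec : (Fin d → Fin d → ℝ) → Fin d → Vec d
  measurable : Measurable vec
  spec : ∀ A : Fin d → Fin d → ℝ, IsSingularSystem (Matrix.of A) (vec A)

/-! Such a routine exists: the graph of the relation is closed, with compact fibres. -/

theorem exists_measurable_selection {X Y ι : Type*} [TopologicalSpace X] [MeasurableSpace X]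
    [BorelSpace X] [SecondCountableTopology X] [TopologicalSpace Y] [Fintype ι]
    (φ : ι → Y → ℝ) (hφ : ∀ i, Continuous (φ i)) (K : Set Y) (hK : IsCompact K)
    (G : Set (X × Y)) (hG : IsClosed G) (hne : ∀ x, ∃ y ∈ K, (x, y) ∈ G) :
    ∃ F : X → ι → ℝ, Measurable F ∧ ∀ x, ∃ y ∈ K, (x, y) ∈ G ∧ ∀ i, φ i y = F x i := by
  classical
  suffices h : ∀ s : Finset ι, ∃ F : X → ι → ℝ, Measurable F ∧
      ∀ x, ∃ y ∈ K, (x, y) ∈ G ∧ ∀ i ∈ s, φ i y = F x i by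
    obtain ⟨F, h1, h2⟩ := h Finset.univ
    exact ⟨F, h1, fun x => by simpa using h2 x⟩
  intro s
  induction s using Finset.induction_on with
  | empty => exact ⟨fun _ _ => 0, measurable_const, fun x => by simpa using hne x⟩
  | insert a s ha ih =>
    obtain ⟨F, hF, hsel⟩ := ih
    have hcl : ∀ T : Set ((X × (ι → ℝ)) × Y), IsClosed T →
        IsClosed {p : X × (ι → ℝ) | ∃ y ∈ K, (p, y) ∈ T} := by
      intro T hT
      have : CompactSpace K := isCompact_iff_compactSpace.mp hK
      have hc : Continuous fun q : (X × (ι → ℝ)) × K => (q.1, (q.2 : Y)) := by fun_prop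
      have := isClosedMap_fst_of_compactSpace (X := X × (ι → ℝ)) (Y := K) _ (hT.preimage hc)
      convert this using 1
      ext p
      simp
    let S : X → Set Y := fun x => {y | y ∈ K ∧ (x, y) ∈ G ∧ ∀ i ∈ s, φ i y = F x i}
    have hmin : ∀ x, ∃ y ∈ S x, ∀ z ∈ S x, φ a y ≤ φ a z := by
      intro x
      have hS : IsCompact (S x) := by
        have : S x = K ∩ {y | (x, y) ∈ G ∧ ∀ i ∈ s, φ i y = F x i} := rfl
        rw [this]
        apply hK.inter_right
        apply IsClosed.inter
        · exact hG.preimage (by fun_prop : Continuous fun y : Y => (x, y))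
        · have : {y | ∀ i ∈ s, φ i y = F x i} = ⋂ i ∈ s, {y | φ i y = F x i} := by ext; simp
          change IsClosed {y | ∀ i ∈ s, φ i y = F x i}
          rw [this]
          exact isClosed_biInter fun i _ => isClosed_eq (hφ i) continuous_const
      obtain ⟨y, hy, hm⟩ := hS.exists_isMinOn (hsel x) (hφ a).continuousOn
      exact ⟨y, hy, fun z hz => hm hz⟩
    choose y hy hm using hmin
    have hmeas : Measurable fun x => φ a (y x) := by
      refine measurable_of_Iic fun t => ?_
      let T : Set ((X × (ι → ℝ)) × Y) :=
        {q | (q.1.1, q.2) ∈ G ∧ (∀ i ∈ s, φ i q.2 = q.1.2 i) ∧ φ a q.2 ≤ t}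
      have hT : IsClosed T := by
        apply IsClosed.inter
        · exact hG.preimage
            (by fun_prop : Continuous fun q : (X × (ι → ℝ)) × Y => (q.1.1, q.2))
        apply IsClosed.inter
        · have : {q : (X × (ι → ℝ)) × Y | ∀ i ∈ s, φ i q.2 = q.1.2 i} =
              ⋂ i ∈ s, {q | φ i q.2 = q.1.2 i} := by ext; simp
          change IsClosed {q : (X × (ι → ℝ)) × Y | ∀ i ∈ s, φ i q.2 = q.1.2 i}
          rw [this]
          exact isClosed_biInter fun i _ =>
            isClosed_eq ((hφ i).comp continuous_snd) (by fun_prop)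
        · exact isClosed_le ((hφ a).comp continuous_snd) continuous_const
      have hpre : (fun x => φ a (y x)) ⁻¹' Set.Iic t =
          (fun x => (x, F x)) ⁻¹' {p : X × (ι → ℝ) | ∃ y ∈ K, (p, y) ∈ T} := by
        ext x
        constructor
        · intro hx
          exact ⟨y x, (hy x).1, (hy x).2.1, (hy x).2.2, hx⟩
        · rintro ⟨z, hz, hzG, hzs, hzt⟩
          exact (hm x z ⟨hz, hzG, hzs⟩).trans hzt
      rw [hpre]
      exact (measurable_id.prodMk hF) (hcl T hT).measurableSet
    refine ⟨fun x => Function.update (F x) a (φ a (y x)), ?_, fun x => ?_⟩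
    · refine measurable_pi_lambda _ fun i => ?_
      by_cases hi : i = a
      · subst hi; simpa using hmeas
      · simpa [hi] using (measurable_pi_iff.mp hF) i
    · refine ⟨y x, (hy x).1, (hy x).2.1, fun i hi => ?_⟩
      by_cases h : i = a
      · subst h; simp
      · have : i ∈ s := by simpa [h] using hi
        simpa [h] using (hy x).2.2 i this

theorem exists_isSingularSystem {d : ℕ} (A : Matrix (Fin d) (Fin d) ℝ) :
    ∃ u : Fin d → Vec d, IsSingularSystem A u := by
  have hH : (A.transpose * A).IsHermitian := by
    simpa using Matrix.isHermitian_conjTranspose_mul_self A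
  have hT : (Matrix.toEuclideanLin (A.transpose * A)).IsSymmetric :=
    Matrix.isSymmetric_toEuclideanLin_iff.mpr hH
  have hn : Module.finrank ℝ (Vec d) = d := by simp
  have hinner : ∀ v : Vec d, inner ℝ v (Matrix.toEuclideanLin (A.transpose * A) v) =
      ‖Matrix.toEuclideanLin A v‖ ^ 2 := by
    intro v
    rw [← real_inner_self_eq_norm_sq]
    simp only [EuclideanSpace.inner_eq_star_dotProduct, Matrix.ofLp_toLpLin, Matrix.toLin'_apply, star_trivial]
    rw [← Matrix.mulVec_mulVec, dotProduct_comm, Matrix.mulVec_transpose, dotProduct_comm,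
      ← Matrix.dotProduct_mulVec]
  have hval : ∀ i, hT.eigenvalues hn i =
      ‖Matrix.toEuclideanLin A (hT.eigenvectorBasis hn i)‖ ^ 2 := by
    intro i
    rw [← hinner, hT.apply_eigenvectorBasis, inner_smul_right, real_inner_self_eq_norm_sq]
    simp
  refine ⟨hT.eigenvectorBasis hn, (hT.eigenvectorBasis hn).orthonormal, fun i => ?_, fun i j h => ?_⟩
  · rw [← hval, hT.apply_eigenvectorBasis]
    rfl
  · have := hT.eigenvalues_antitone hn h
    rw [hval, hval] at this
    exact le_of_sq_le_sq this (norm_nonneg _)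

instance (d : ℕ) : Nonempty (SingularVectorRoutine d) := by
  let φ : Fin d × Fin d → (Fin d → Vec d) → ℝ := fun p u => u p.1 p.2
  have hA : Continuous fun p : (Fin d → Fin d → ℝ) × (Fin d → Vec d) => Matrix.of p.1 :=
    continuous_fst
  have happ : ∀ (f : (Fin d → Fin d → ℝ) × (Fin d → Vec d) → Matrix (Fin d) (Fin d) ℝ),
      Continuous f → ∀ i : Fin d, Continuous fun p => Matrix.toEuclideanLin (f p) (p.2 i) := by
    intro f hf i
    have : Continuous fun p : (Fin d → Fin d → ℝ) × (Fin d → Vec d) =>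
        (f p).mulVec (WithLp.ofLp (p.2 i)) := by
      apply Continuous.matrix_mulVec hf
      fun_prop
    exact (PiLp.continuous_toLp 2 _).comp this
  obtain ⟨F, hF, hsel⟩ := exists_measurable_selection (X := Fin d → Fin d → ℝ) φ
    (fun p => by fun_prop) (Metric.closedBall (0 : Fin d → Vec d) 1)
    (isCompact_closedBall _ _) {p | IsSingularSystem (Matrix.of p.1) p.2} (by
      have : {p : (Fin d → Fin d → ℝ) × (Fin d → Vec d) | IsSingularSystem (Matrix.of p.1) p.2} =
        {p | ∀ i j, inner ℝ (p.2 i) (p.2 j) = if i = j then (1 : ℝ) else 0} ∩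
        ({p | ∀ i, Matrix.toEuclideanLin ((Matrix.of p.1).transpose * Matrix.of p.1) (p.2 i)
          = ‖Matrix.toEuclideanLin (Matrix.of p.1) (p.2 i)‖ ^ 2 • p.2 i} ∩
        {p | ∀ i j, i ≤ j → ‖Matrix.toEuclideanLin (Matrix.of p.1) (p.2 j)‖ ≤
          ‖Matrix.toEuclideanLin (Matrix.of p.1) (p.2 i)‖}) := by
        ext p
        exact ⟨fun h => ⟨orthonormal_iff_ite.mp h.1, h.2, h.3⟩,
          fun h => ⟨orthonormal_iff_ite.mpr h.1, h.2.1, h.2.2⟩⟩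
      rw [this]
      have h1 := happ _ hA
      have h2 := happ _ (hA.matrix_transpose.matrix_mul hA)
      refine IsClosed.inter ?_ (IsClosed.inter ?_ ?_)
      · simp only [Set.ofPred_forall]
        exact isClosed_iInter fun i => isClosed_iInter fun j =>
          isClosed_eq (by fun_prop) continuous_const
      · simp only [Set.ofPred_forall]
        exact isClosed_iInter fun i => isClosed_eq (h2 i)
          (((h1 i).norm.pow 2).smul (by fun_prop))
      · simp only [Set.ofPred_forall]
        exact isClosed_iInter fun i => isClosed_iInter fun j => isClosed_iInter fun _ =>
          isClosed_le (h1 j).norm (h1 i).norm) (by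
      intro A
      obtain ⟨u, hu⟩ := exists_isSingularSystem (Matrix.of A)
      refine ⟨u, ?_, hu⟩
      rw [mem_closedBall_zero_iff, pi_norm_le_iff_of_nonneg zero_le_one]
      exact fun i => (hu.1.1 i).le)
  refine ⟨⟨fun A i => WithLp.toLp 2 fun j => F A (i, j), ?_, fun A => ?_⟩⟩
  · refine measurable_pi_lambda _ fun i => ?_
    refine (WithLp.measurable_toLp 2 _).comp (measurable_pi_lambda _ fun j => ?_)
    exact (measurable_pi_apply (i, j)).comp hF
  · obtain ⟨u, -, hu, he⟩ := hsel A
    have hFu : (fun i => WithLp.toLp 2 fun j => F A (i, j)) = u := by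
      ext i j
      exact (he (i, j)).symm
    rw [hFu]
    exact hu

/-! ### The algorithm -/

/-- The universal constants that the description of the algorithm leaves open. -/
structure Constants where
  cR : ℝ
  ε₁ : ℝ
  cε₂ : ℝ
  cT : ℝ
  cT₁ : ℝ
  cT₂ : ℝ
  cR_pos : 0 < cR
  ε₁_pos : 0 < ε₁
  cε₂_pos : 0 < cε₂
  cT_pos : 0 < cT
  cT₁_pos : 0 < cT₁
  cT₂_pos : 0 < cT₂

/-- The numerical input of the algorithm. -/
structure Params where
  k : ℕ
  αs : ℝ
  C : ℝ
  C₁ : ℝ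
  σ : ℝ
  M : ℝ
  ε : ℝ
  δ : ℝ

/-- The clipped gradient of the squared loss of the sample `z = (x, y)` at the point `w`. -/
def clippedGradient {d : ℕ} (z : Sample d) (w : Vec d) (κ : ℝ) : Vec d :=
  ((inner ℝ z.1 w - z.2) / max |inner ℝ z.1 w - z.2| κ * κ) • z.1

/-- The average of the clipped gradients of a collection of samples. -/
def averageGradient {d : ℕ} (S : Coll (Sample d)) (w : Vec d) (κ : ℝ) : Timed (Vec d) := do
  let g ← forEach fun i => charge (3 * d + 8) (clippedGradient (S.get i) w κ)
  charge (S.len * d + d + 1) ((S.len : ℝ)⁻¹ • ∑ i, g i)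

/-- Estimation of the clipping parameter from a collection `S` of samples. -/
def clipEst {d : ℕ} (K : Constants) (S : Coll (Sample d)) (w : Vec d) (δ' σ C C₁ : ℝ) :
    Timed ℝ := do
  let T ← charge 4 ⌈K.cT * Real.log (1 / δ')⌉₊
  let part ← divide S T
  let loss ← forEach fun j => do
    let r ← forEach fun i =>
      charge (2 * d + 2) ((inner ℝ ((part j).get i).1 w - ((part j).get i).2) ^ 2)
    charge ((part j).len + 2) (((part j).len : ℝ)⁻¹ * ∑ i, r i)
  let θ ← timedMedian loss
  charge 12 (Real.sqrt (32 * (C + 1) * C₁ * (θ + 17 * σ ^ 2) / K.ε₁))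

/-- The orthogonal projection onto the span of the first `ℓ` vectors of the system `u` (of all of
them if `d ≤ ℓ`). -/
def projectionMatrix {d : ℕ} (u : Fin d → Vec d) (ℓ : ℕ) : Matrix (Fin d) (Fin d) ℝ :=
  ∑ i ∈ Finset.univ.filter (fun i : Fin d => (i : ℕ) < ℓ), Matrix.vecMulVec (u i) (u i)

/-- Subspace estimation from a collection `B` of batches: the projection onto the span of the top
`ℓ` singular vectors. The decomposition of a `d × d` matrix is charged `d ^ 3 + 1` steps. -/
def gradSubEst {d : ℕ} (svd : SingularVectorRoutine d) (B : Coll (Coll (Sample d))) (κ : ℝ)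
    (w : Vec d) (ℓ : ℕ) : Timed (Matrix (Fin d) (Fin d) ℝ) := do
  let half ← forEach fun b => divide (B.get b) 2
  let g₁ ← forEach fun b => averageGradient (half b 0) w κ
  let g₂ ← forEach fun b => averageGradient (half b 1) w κ
  let A ← charge (B.len * (4 * d ^ 2) + d ^ 2 + 2) ((2 * (B.len : ℝ))⁻¹ •
    ∑ b, (Matrix.vecMulVec (g₁ b) (g₂ b) + Matrix.vecMulVec (g₂ b) (g₁ b)))
  let u ← charge (d ^ 3 + 1) (svd.vec A)
  charge (2 * d ^ 3 + d) (projectionMatrix u ℓ)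

/-- Gradient estimation from a collection `B` of batches and a collection `S` of samples. -/
def gradEst {d : ℕ} (K : Constants) (B : Coll (Coll (Sample d))) (S : Coll (Sample d)) (κ : ℝ)
    (w : Vec d) (P : Matrix (Fin d) (Fin d) ℝ) (ε₂ δ' C₁ : ℝ) : Timed (Vec d) := do
  let T₁ ← charge 4 ⌈K.cT₁ * Real.log (B.len / δ')⌉₊
  let T₂ ← charge 4 ⌈K.cT₂ * Real.log (1 / δ')⌉₊
  let half ← forEach fun b => divide (B.get b) 2
  let part ← forEach fun b => divide (half b 0) (T₁ + T₁)
  let starPart ← divide S (T₁ + T₁)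
  let gStar ← forEach fun j => averageGradient (starPart j) w κ
  let score ← forEach fun b => do
    let g ← forEach fun j => averageGradient (part b j) w κ
    let ζ ← forEach fun j : Fin T₁ => charge (4 * d ^ 2 + 4 * d) (inner ℝ
      (Matrix.toEuclideanLin P (g (Fin.castAdd T₁ j) - gStar (Fin.castAdd T₁ j)))
      (Matrix.toEuclideanLin P (g (Fin.natAdd T₁ j) - gStar (Fin.natAdd T₁ j))))
    timedMedian ζ
  let kept ← charge (5 * B.len)
    (Finset.univ.filter fun b => score b ≤ ε₂ ^ 2 * κ ^ 2 * C₁)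
  let estPart ← forEach fun b => divide (half b 1) T₂
  let Δ ← forEach fun i : Fin T₂ => do
    let g ← forEach fun b => averageGradient (estPart b i) w κ
    charge (B.len * (2 * d ^ 2 + d + 1) + d + 1)
      ((kept.card : ℝ)⁻¹ • ∑ b ∈ kept, Matrix.toEuclideanLin P (g b))
  let ξ ← forEach fun i => do
    let v ← forEach fun j => charge (3 * d + 1) ‖Δ i - Δ j‖
    timedMedian v
  charge (T₂ + d) (entryAtMin ξ Δ)

/-- The number of rounds of gradient descent. -/
def numRounds (K : Constants) (p : Params) : ℕ :=
  ⌈K.cR * p.C₁ * Real.log (2 + p.M / (p.ε * p.σ))⌉₊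

/-- The accuracy parameter `ε₂` of the subroutines. -/
def accuracy (K : Constants) (p : Params) : ℝ :=
  K.cε₂ * min p.ε (1 / Real.sqrt p.C₁) / (p.C₁ * Real.sqrt (p.C + 1))

/-- The main algorithm. Everything is put in a uniformly random order at the start; the subsequent
divisions into blocks of consecutive elements are then divisions into random parts. -/
def mainAlgorithm {d : ℕ} (K : Constants) (svd : SingularVectorRoutine d) (p : Params)
    {L : Layout} (X : Data d L) (s : Seed L) : Timed (Vec d) := do
  let R ← charge 8 (numRounds K p)
  let ε₂ ← charge 8 (accuracy K p)
  let ℓ ← charge 6 (min p.k ⌈1 / (2 * p.αs * ε₂ ^ 2)⌉₊)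
  let δ' ← charge 2 (p.δ / (5 * R))
  let Bs : Coll (Coll (Sample d)) ← charge (L.numSmall + ∑ b, L.smallSize b)
    ⟨L.numSmall, fun i => ⟨L.smallSize (s.1 i), fun j => X.1 (s.1 i) (s.2.2.2.1 (s.1 i) j)⟩⟩
  let Bm : Coll (Coll (Sample d)) ← charge (L.numMedium + ∑ b, L.mediumSize b)
    ⟨L.numMedium, fun i =>
      ⟨L.mediumSize (s.2.1 i), fun j => X.2.1 (s.2.1 i) (s.2.2.2.2 (s.2.1 i) j)⟩⟩
  let star : Coll (Sample d) ← charge L.starSize ⟨L.starSize, fun j => X.2.2 (s.2.2.1 j)⟩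
  let smallPart ← divide Bs R
  let mediumPart ← divide Bm R
  let starPart ← divide star (R + R)
  loop R (fun r w => do
    let κ ← clipEst K (starPart (Fin.castAdd R r)) w δ' p.σ p.C p.C₁
    let P ← gradSubEst svd (smallPart r) κ w ℓ
    let Δ ← gradEst K (mediumPart r) (starPart (Fin.natAdd R r)) κ w P ε₂ δ' p.C₁
    charge (2 * d + 1) (w - (1 / p.C₁) • Δ)) 0

/-! ### Quantities in the statement -/

/-- The size of an instance: the dimension, the numbers of batches and of samples, and the
magnitudes that govern the number of repetitions. -/
def instanceSize (d : ℕ) (L : Layout) (p : Params) : ℝ :=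
  1 + d + L.numSmall + (∑ b, L.smallSize b : ℕ) + L.numMedium + (∑ b, L.mediumSize b : ℕ) +
    L.starSize + p.C₁ + Real.log (2 + p.M / (p.ε * p.σ)) + Real.log (1 / p.δ)

/-- The logarithmic factor `log (2 + (x / δ) (1 + M / (ε σ)))`. -/
def logFactor (x M σ ε δ : ℝ) : ℝ := Real.log (2 + x / δ * (1 + M / (ε * σ)))

end BatchRegression

end

open BatchRegression

/-! The algorithm is gradient descent on the squared loss of the component `i₀` with step 1/C₁. Let
v be the current error, Σ the second moment matrix of the component, with spectrum in [1, C₁], and G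
the mean of its clipped gradient at the current point. An exact step would multiply v by I - Σ/C₁,
which has norm at most 1 - 1/C₁. It therefore suffices that a round produces Δ with ‖Δ - Σv‖ ≤ ‖v‖/2
+ εσ/4. The error then satisfies e' ≤ (1 - 1/(2C₁)) e + εσ/(4C₁) (`norm_roundStep_sub_le`), a
recursion with fixed point εσ/2, and 4C₁ log(2 + M/(εσ)) rounds bring it below εσ
(`pow_mul_add_le`). In the following h stands for ε₂ √C₁ κ.

Clipping. It bounds the gradients of the components with arbitrary outputs: their second moments are
at most κ²C₁. The price is a bias of G. The function clip(r) - r is odd and the noise is symmetric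
and independent of x, so its mean at the pure noise vanishes; the bias stems only from the shift by
x·v, and hypercontractivity bounds it by ‖v‖/4 as soon as κ² is a suitable multiple of E(x·v)² + σ²
(`IsRegressionComponent.abs_bias_le`). The median loss provides such a κ which is not too large
either (`measureReal_lossEst_le`), so that h ≤ (‖v‖ + εσ)/32.

Subspace. The two halves of a small batch are independent with the same mean gradient, so the matrix
A has as its mean the average M of the products of the mean gradients with their transposes. M
dominates (αs/2) GGᵀ. It has rank at most k and trace at most κ²C₁, hence at most ℓ eigenvalues that
matter. The matrix Bernstein inequality, which rests on the Golden–Thompson inequality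
(`trace_exp_add_le`), shows that A is close to M (`measureReal_crossDeviation_le`). A perturbation
argument then shows that the top ℓ singular vectors of A contain G up to an error 3h
(`norm_sub_projection_le`).

Filter and average. The inner product of two independent projected estimates of G_b - G estimates
the squared length of its projection with a fluctuation of order √ℓ times the variance, where a
plain squared norm would have a bias of order ℓ (`measureReal_inner_projection_le`). Batches with a
small score include all those of the component `i₀`, and they have projected means within 2h of that
of G. Averaging their unused halves costs another 3h, so the gradient estimate is within 8h of G
(`norm_gradient_sub_le`).

Independence. The stages are adaptive, but each reads samples that were not read before. The
algorithm is rewritten as a computation on sample indices, so that freshness becomes disjointness of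
index sets. A failure event is bounded for each fixed outcome of the earlier stages, and the bound
passes to the random outcome by Fubini (`measureReal_section_le`). Estimates that hold with
probability 7/8 are amplified by medians (`measureReal_half_le`). The random arrangement is fixed
before the samples are considered; a count of permutations shows that most arrangements give each
round its share of the batches of `i₀` (`card_perms_few_hits_le`). With δ' = δ/(5R), bad
arrangements receive the share Rδ' of the failure probability and the rounds receive 4δ' each.

The running time is a sum of charges in which each loop length is at most quadratic in the size of
the instance. -/

noncomputable section

namespace BatchRegression

/-! ### Medians -/

theorem card_filter_comp_sort {n : ℕ} (v : Fin n → ℝ) (p : ℝ → Prop) [DecidablePred p] :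
    (Finset.univ.filter fun j => p ((v ∘ Tuple.sort v) j)).card =
      (Finset.univ.filter fun j => p (v j)).card :=
  Finset.card_equiv (Tuple.sort v) (by simp)

/-- An order statistic is at most `a` exactly when enough entries are. This turns statements about
medians, including their measurability, into statements about the number of entries below a
threshold. -/
theorem apply_sort_le_iff {n : ℕ} (v : Fin n → ℝ) (i : Fin n) (a : ℝ) :
    v (Tuple.sort v i) ≤ a ↔ (i : ℕ) < (Finset.univ.filter fun j => v j ≤ a).card := by
  have h := Tuple.lt_card_le_iff_apply_le_of_monotone (j := i) (a := a) (Tuple.monotone_sort v)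
  rw [card_filter_comp_sort v (· ≤ a)] at h
  exact h.symm

theorem apply_sort_lt_iff {n : ℕ} (v : Fin n → ℝ) (i : Fin n) (a : ℝ) :
    v (Tuple.sort v i) < a ↔ (i : ℕ) < (Finset.univ.filter fun j => v j < a).card := by
  have h := Tuple.lt_card_lt_iff_apply_lt_of_monotone (j := i) (a := a) (Tuple.monotone_sort v)
  rw [card_filter_comp_sort v (· < a)] at h
  exact h.symm

theorem median_le {n : ℕ} (v : Fin n → ℝ) (a : ℝ)
    (h : n < 2 * (Finset.univ.filter fun j => v j ≤ a).card) : median v ≤ a := by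
  have hle : (Finset.univ.filter fun j => v j ≤ a).card ≤ n := by
    simpa using Finset.card_filter_le (Finset.univ : Finset (Fin n)) fun j => v j ≤ a
  have hn : 0 < n := by omega
  -- Both middle positions, counted from 0, are below the size of a strict majority.
  have h1 := (apply_sort_le_iff v ⟨(n - 1) / 2, by omega⟩ a).2 (by simp only; omega)
  have h2 := (apply_sort_le_iff v ⟨n / 2, by omega⟩ a).2 (by simp only; omega)
  rw [median, dif_pos hn]
  linarith

theorem card_filter_lt_add_le {n : ℕ} (v : Fin n → ℝ) (a : ℝ) :
    (Finset.univ.filter fun j => v j < a).card + (Finset.univ.filter fun j => a ≤ v j).card = n := by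
  have := Finset.card_filter_add_card_filter_not (s := (Finset.univ : Finset (Fin n)))
    (fun j => v j < a)
  simpa using this

theorem le_median {n : ℕ} (v : Fin n → ℝ) (a : ℝ)
    (h : n < 2 * (Finset.univ.filter fun j => a ≤ v j).card) : a ≤ median v := by
  have hc := card_filter_lt_add_le v a
  have hn : 0 < n := by omega
  have h1 := mt (apply_sort_lt_iff v ⟨(n - 1) / 2, by omega⟩ a).1 (by simp only; omega)
  have h2 := mt (apply_sort_lt_iff v ⟨n / 2, by omega⟩ a).1 (by simp only; omega)
  rw [median, dif_pos hn]
  linarith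

/-- Only the lower of the two middle entries is certain to be at most `a`, so the count is at least
one half and not necessarily more. -/
theorem le_card_of_median_le {n : ℕ} (v : Fin n → ℝ) (a : ℝ) (hn : 0 < n) (h : median v ≤ a) :
    n ≤ 2 * (Finset.univ.filter fun j => v j ≤ a).card := by
  rw [median, dif_pos hn] at h
  have hm : v (Tuple.sort v ⟨(n - 1) / 2, by omega⟩) ≤ v (Tuple.sort v ⟨n / 2, by omega⟩) :=
    Tuple.monotone_sort v (by simp only [Fin.mk_le_mk]; omega)
  have h1 := (apply_sort_le_iff v ⟨(n - 1) / 2, by omega⟩ a).1 (by linarith)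
  simp only at h1
  omega

theorem exists_entryAtMin_eq {n d : ℕ} (v : Fin n → ℝ) (D : Fin n → Vec d) (hn : 0 < n) :
    ∃ i, entryAtMin v D = D i ∧ ∀ j, v i ≤ v j := by
  have : Nonempty (Fin n) := ⟨⟨0, hn⟩⟩
  have h : (Finset.univ.filter fun i => ∀ j, v i ≤ v j).Nonempty := by
    obtain ⟨i, hi⟩ := Finite.exists_min v
    exact ⟨i, by simpa using hi⟩
  refine ⟨_, by rw [entryAtMin, dif_pos h], ?_⟩
  have := Finset.min'_mem _ h
  simpa using this

/-- If most points lie in a ball, then a point with the smallest median distance from the others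
lies in the ball with the triple radius. -/
theorem norm_entryAtMin_sub_le {n d : ℕ} (Δ : Fin n → Vec d) (c : Vec d) (ρ : ℝ)
    (h : n < 2 * (Finset.univ.filter fun i => ‖Δ i - c‖ ≤ ρ).card) :
    ‖entryAtMin (fun i => median fun j => ‖Δ i - Δ j‖) Δ - c‖ ≤ 3 * ρ := by
  have hle : (Finset.univ.filter fun i => ‖Δ i - c‖ ≤ ρ).card ≤ n := by
    simpa using Finset.card_filter_le (Finset.univ : Finset (Fin n)) fun i => ‖Δ i - c‖ ≤ ρ
  have hn : 0 < n := by omega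
  obtain ⟨i, hi, hmin⟩ := exists_entryAtMin_eq (fun i => median fun j => ‖Δ i - Δ j‖) Δ hn
  rw [hi]
  obtain ⟨g, hg⟩ : (Finset.univ.filter fun i => ‖Δ i - c‖ ≤ ρ).Nonempty :=
    Finset.card_pos.mp (by omega)
  have hg' : ‖Δ g - c‖ ≤ ρ := by simpa using hg
  -- More than half of the points are within 2ρ of a point `g` of the ball, so the smallest median
  -- distance is at most 2ρ.
  have hmed : (median fun j => ‖Δ g - Δ j‖) ≤ 2 * ρ := by
    apply median_le
    refine h.trans_le (Nat.mul_le_mul_left _ (Finset.card_le_card fun j hj => ?_))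
    have hj' : ‖Δ j - c‖ ≤ ρ := by simpa using hj
    have : ‖Δ g - Δ j‖ ≤ ‖Δ g - c‖ + ‖Δ j - c‖ := by
      rw [← norm_neg (Δ j - c)]
      calc ‖Δ g - Δ j‖ = ‖(Δ g - c) + -(Δ j - c)‖ := by congr 1; abel
        _ ≤ _ := norm_add_le _ _
    simp only [Finset.mem_filter, Finset.mem_univ, true_and]
    linarith
  have hci := le_card_of_median_le _ _ hn ((hmin g).trans hmed)
  -- At least half of the points are within 2ρ of the minimizer and more than half are within ρ of
  -- `c`; some point does both.
  obtain ⟨j, hj⟩ : ((Finset.univ.filter fun j => ‖Δ i - Δ j‖ ≤ 2 * ρ) ∩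
      (Finset.univ.filter fun i => ‖Δ i - c‖ ≤ ρ)).Nonempty := by
    apply Finset.inter_nonempty_of_card_lt_card_add_card (s := Finset.univ)
      (Finset.subset_univ _) (Finset.subset_univ _)
    simp only [Finset.card_univ, Fintype.card_fin]
    omega
  simp only [Finset.mem_inter, Finset.mem_filter, Finset.mem_univ, true_and] at hj
  calc ‖Δ i - c‖ = ‖(Δ i - Δ j) + (Δ j - c)‖ := by congr 1; abel
    _ ≤ ‖Δ i - Δ j‖ + ‖Δ j - c‖ := norm_add_le _ _
    _ ≤ 3 * ρ := by linarith [hj.1, hj.2]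

theorem measurable_card_filter {Ω ι : Type*} [MeasurableSpace Ω] [Fintype ι] (p : ι → Ω → Prop)
    [∀ i ω, Decidable (p i ω)] (hp : ∀ i, MeasurableSet {ω | p i ω}) :
    Measurable fun ω => (Finset.univ.filter fun i => p i ω).card := by
  simp only [Finset.card_filter]
  exact Finset.measurable_sum _ fun i _ => Measurable.ite (hp i) measurable_const measurable_const

theorem measurable_median {Ω : Type*} [MeasurableSpace Ω] {n : ℕ} {v : Ω → Fin n → ℝ}
    (hv : ∀ j, Measurable fun ω => v ω j) : Measurable fun ω => median (v ω) := by
  have key : ∀ i : Fin n, Measurable fun ω => v ω (Tuple.sort (v ω) i) := by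
    intro i
    refine measurable_of_Iic fun a => ?_
    have : (fun ω => v ω (Tuple.sort (v ω) i)) ⁻¹' Set.Iic a =
        {ω | (i : ℕ) < (Finset.univ.filter fun j => v ω j ≤ a).card} := by
      ext ω
      exact apply_sort_le_iff (v ω) i a
    rw [this]
    exact measurableSet_lt measurable_const
      (measurable_card_filter _ fun j => measurableSet_le (hv j) measurable_const)
  unfold median
  by_cases h : 0 < n
  · simp only [h, dif_pos]
    exact ((key _).add (key _)).div_const _
  · simp only [h, dif_neg, not_false_iff]
    exact measurable_const

/-- At most one term survives, that of the first minimizer. In this form the dependence on `v` and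
`D` is visibly measurable. -/
theorem entryAtMin_eq_sum {n d : ℕ} (v : Fin n → ℝ) (D : Fin n → Vec d) :
    entryAtMin v D = ∑ i, if (∀ j, v i ≤ v j) ∧ ∀ i' < i, ∃ j, v j < v i' then D i else 0 := by
  classical
  by_cases h : (Finset.univ.filter fun i => ∀ j, v i ≤ v j).Nonempty
  · rw [entryAtMin, dif_pos h, Finset.sum_eq_single ((Finset.univ.filter _).min' h)]
    · rw [if_pos]
      refine ⟨by simpa using Finset.min'_mem _ h, fun i' hi' => ?_⟩
      by_contra hc
      push Not at hc
      exact absurd (Finset.min'_le _ i' (by simpa using hc)) (not_le.mpr hi')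
    · intro i _ hi
      rw [if_neg]
      rintro ⟨h1, h2⟩
      have hle := Finset.min'_le (Finset.univ.filter fun i => ∀ j, v i ≤ v j) i (by simpa using h1)
      obtain ⟨j, hj⟩ := h2 _ (lt_of_le_of_ne hle (Ne.symm hi))
      have := Finset.min'_mem _ h
      simp only [Finset.mem_filter, Finset.mem_univ, true_and] at this
      exact absurd (this j) (not_le.mpr hj)
    · simp
  · rw [entryAtMin, dif_neg h, Finset.sum_eq_zero]
    intro i _
    rw [if_neg]
    rintro ⟨h1, -⟩
    exact h ⟨i, by simpa using h1⟩

theorem measurable_entryAtMin {Ω : Type*} [MeasurableSpace Ω] {n d : ℕ} {v : Ω → Fin n → ℝ}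
    {D : Ω → Fin n → Vec d} (hv : ∀ j, Measurable fun ω => v ω j)
    (hD : ∀ j, Measurable fun ω => D ω j) : Measurable fun ω => entryAtMin (v ω) (D ω) := by
  classical
  simp only [entryAtMin_eq_sum]
  refine Finset.measurable_sum _ fun i _ => Measurable.ite ?_ (hD i) measurable_const
  have h : {ω | (∀ j, v ω i ≤ v ω j) ∧ ∀ i' < i, ∃ j, v ω j < v ω i'} =
      (⋂ j, {ω | v ω i ≤ v ω j}) ∩ ⋂ i', ⋂ _ : i' < i, ⋃ j, {ω | v ω j < v ω i'} := by
    ext; simp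
  rw [h]
  exact (MeasurableSet.iInter fun j => measurableSet_le (hv i) (hv j)).inter
    (MeasurableSet.iInter fun i' => MeasurableSet.iInter fun _ =>
      MeasurableSet.iUnion fun j => measurableSet_lt (hv j) (hv i'))

/-! ### Random permutations -/

section Permutations

variable {n : ℕ}

/-- The permutations that map `S` into `Z`. -/
def permsInto (S Z : Finset (Fin n)) : Finset (Equiv.Perm (Fin n)) :=
  Finset.univ.filter fun σ => ∀ i ∈ S, σ i ∈ Z

/-- Composition with the transposition of `a` and `c` fixes the values on `S` and exchanges the two
conditions: all positions outside `S` are equivalent. -/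
theorem card_permsInto_insert {S Z : Finset (Fin n)} {a c : Fin n} (ha : a ∉ S) (hc : c ∉ S) :
    (permsInto (insert a S) Z).card = ((permsInto S Z).filter fun σ => σ c ∈ Z).card := by
  refine Finset.card_equiv (Equiv.mulRight (Equiv.swap a c)) fun σ => ?_
  simp only [permsInto, Finset.mem_filter, Finset.mem_univ, true_and, Finset.mem_insert,
    forall_eq_or_imp, Equiv.coe_mulRight, Equiv.Perm.coe_mul, Function.comp_apply,
    Equiv.swap_apply_right]
  rw [and_comm]
  refine and_congr_left fun _ => forall₂_congr fun i hi => ?_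
  rw [Equiv.swap_apply_of_ne_of_ne (ne_of_mem_of_not_mem hi ha) (ne_of_mem_of_not_mem hi hc)]

/-- Once `S` is mapped into `Z`, the image of a further position is uniform on n - |S| values, of
which |Z| - |S| lie in `Z`, and (|Z| - |S|)/(n - |S|) ≤ |Z|/n. -/
theorem card_permsInto_insert_le (S Z : Finset (Fin n)) (a : Fin n) (ha : a ∉ S) :
    n * (permsInto (insert a S) Z).card ≤ Z.card * (permsInto S Z).card := by
  have hS : S.card < n := by
    have : (insert a S).card ≤ n := by simpa using Finset.card_le_univ (insert a S)
    rw [Finset.card_insert_of_notMem ha] at this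
    omega
  have hZ : Z.card ≤ n := by simpa using Finset.card_le_univ Z
  -- Double counting of the pairs (σ, c) with c outside `S` for which σ maps both `S` and c into
  -- `Z`. If |Z| < |S|, there are none, in accordance with the truncated subtraction.
  have hdc : (n - S.card) * (permsInto (insert a S) Z).card =
      (Z.card - S.card) * (permsInto S Z).card := by
    have h1 : ∑ c ∈ Sᶜ, ((permsInto S Z).filter fun σ => σ c ∈ Z).card =
        (n - S.card) * (permsInto (insert a S) Z).card := by
      rw [Finset.sum_congr rfl fun c hc =>
        (card_permsInto_insert ha (Finset.mem_compl.mp hc)).symm]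
      simp [Finset.card_compl]
    rw [← h1]
    simp only [Finset.card_filter]
    rw [Finset.sum_comm]
    rw [Finset.sum_congr rfl (g := fun _ => Z.card - S.card), Finset.sum_const, smul_eq_mul,
      mul_comm]
    intro σ hσ
    simp only [permsInto, Finset.mem_filter, Finset.mem_univ, true_and] at hσ
    rw [← Finset.card_filter]
    have hsub : S.map σ.toEmbedding ⊆ Z := by
      intro x hx
      obtain ⟨i, hi, rfl⟩ := Finset.mem_map.mp hx
      exact hσ i hi
    have : ((Sᶜ).filter fun c => σ c ∈ Z).card = (Z \ S.map σ.toEmbedding).card := by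
      refine Finset.card_equiv σ fun i => ?_
      simp [and_comm]
    rw [this, Finset.card_sdiff_of_subset hsub, Finset.card_map]
  by_cases hZS : S.card ≤ Z.card
  · obtain ⟨p, hp⟩ := Nat.exists_eq_add_of_le hZS
    obtain ⟨q, hq⟩ := Nat.exists_eq_add_of_le hZ
    have hpos : 0 < n - S.card := by omega
    refine Nat.le_of_mul_le_mul_left ?_ hpos
    calc (n - S.card) * (n * (permsInto (insert a S) Z).card)
        = n * ((Z.card - S.card) * (permsInto S Z).card) := by rw [← hdc]; ring
      _ = (n * (Z.card - S.card)) * (permsInto S Z).card := by ring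
      _ ≤ ((n - S.card) * Z.card) * (permsInto S Z).card := by
          refine Nat.mul_le_mul_right _ ?_
          have e1 : Z.card - S.card = p := by omega
          have e2 : n - S.card = p + q := by omega
          rw [e1, e2]
          nlinarith [Nat.zero_le (S.card * q)]
      _ = _ := by ring
  · have h0 : Z.card - S.card = 0 := by omega
    rw [h0, zero_mul] at hdc
    have : (permsInto (insert a S) Z).card = 0 := by
      rcases Nat.mul_eq_zero.mp hdc with h | h
      · omega
      · exact h
    simp [this]

/-- Iteration of the previous bound: draws without replacement are no more likely to stay in `Z`
than independent draws. -/
theorem pow_mul_card_permsInto_le (S Z : Finset (Fin n)) :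
    n ^ S.card * (permsInto S Z).card ≤ Z.card ^ S.card * n.factorial := by
  induction S using Finset.induction_on with
  | empty => simp [permsInto, Finset.card_univ, Fintype.card_perm]
  | insert a S ha ih =>
    rw [Finset.card_insert_of_notMem ha]
    calc n ^ (S.card + 1) * (permsInto (insert a S) Z).card
        = n ^ S.card * (n * (permsInto (insert a S) Z).card) := by ring
      _ ≤ n ^ S.card * (Z.card * (permsInto S Z).card) :=
          Nat.mul_le_mul_left _ (card_permsInto_insert_le S Z a ha)
      _ = Z.card * (n ^ S.card * (permsInto S Z).card) := by ring
      _ ≤ Z.card * (Z.card ^ S.card * n.factorial) := Nat.mul_le_mul_left _ ih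
      _ = _ := by ring

/-- The power 2^j counts the subsets of a set of j hits. Exchanging the sums leaves the
probabilities that all positions in T hit `Z`, each at most (|Z|/n)^|T|, and the binomial theorem
gives the value for independent draws. -/
theorem sum_two_pow_card_hits_le {m : ℕ} (pos : Fin m → Fin n) (hpos : Function.Injective pos)
    (Z : Finset (Fin n)) (hn : 0 < n) :
    ∑ σ : Equiv.Perm (Fin n), (2 : ℝ) ^ (Finset.univ.filter fun q => σ (pos q) ∈ Z).card ≤
      (1 + (Z.card : ℝ) / n) ^ m * n.factorial := by
  have hn' : (0 : ℝ) < n := by exact_mod_cast hn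
  have h1 : ∀ σ : Equiv.Perm (Fin n),
      (2 : ℝ) ^ (Finset.univ.filter fun q => σ (pos q) ∈ Z).card =
        ∑ T : Finset (Fin m), if ∀ q ∈ T, σ (pos q) ∈ Z then (1 : ℝ) else 0 := by
    intro σ
    rw [← Finset.sum_filter, Finset.sum_const, nsmul_one]
    have : (Finset.univ.filter fun T : Finset (Fin m) => ∀ q ∈ T, σ (pos q) ∈ Z) =
        (Finset.univ.filter fun q => σ (pos q) ∈ Z).powerset := by
      ext T
      simp [Finset.subset_iff]
    rw [this, Finset.card_powerset]
    norm_cast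
  have h2 : ∀ T : Finset (Fin m),
      (∑ σ : Equiv.Perm (Fin n), if ∀ q ∈ T, σ (pos q) ∈ Z then (1 : ℝ) else 0) ≤
        ((Z.card : ℝ) / n) ^ T.card * n.factorial := by
    intro T
    rw [← Finset.sum_filter, Finset.sum_const, nsmul_one]
    have h := pow_mul_card_permsInto_le (T.map ⟨pos, hpos⟩) Z
    rw [Finset.card_map] at h
    have he : permsInto (T.map ⟨pos, hpos⟩) Z =
        Finset.univ.filter fun σ : Equiv.Perm (Fin n) => ∀ q ∈ T, σ (pos q) ∈ Z := by
      ext σ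
      simp [permsInto]
    rw [he] at h
    have h' : (n : ℝ) ^ T.card * ((Finset.univ.filter fun σ : Equiv.Perm (Fin n) =>
        ∀ q ∈ T, σ (pos q) ∈ Z).card : ℝ) ≤ (Z.card : ℝ) ^ T.card * n.factorial := by
      exact_mod_cast h
    rw [div_pow, div_mul_eq_mul_div, le_div_iff₀ (by positivity)]
    linarith
  simp only [h1]
  rw [Finset.sum_comm]
  refine (Finset.sum_le_sum fun T _ => h2 T).trans ?_
  rw [← Finset.sum_mul]
  refine mul_le_mul_of_nonneg_right (le_of_eq ?_) (by positivity)
  have := Finset.sum_pow_mul_eq_add_pow ((Z.card : ℝ) / n) 1 (Finset.univ : Finset (Fin m))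
  simp only [one_pow, mul_one, Finset.powerset_univ, Finset.card_univ, Fintype.card_fin] at this
  rw [this, add_comm]

/-- A random part of a finite population contains, up to a factor of two, its share of each
class, except with exponentially small probability. -/
theorem card_perms_few_hits_le {m : ℕ} (pos : Fin m → Fin n) (hpos : Function.Injective pos)
    (good : Fin n → Prop) [DecidablePred good] (α : ℝ) (hα : 0 ≤ α) (hn : 0 < n)
    (hgood : α * n ≤ ((Finset.univ.filter good).card : ℝ)) :
    ((Finset.univ.filter fun σ : Equiv.Perm (Fin n) =>
      ((Finset.univ.filter fun q => good (σ (pos q))).card : ℝ) < α / 2 * m).card : ℝ) ≤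
      Real.exp (-(3 / 20 * α * m)) * n.factorial := by
  have hn' : (0 : ℝ) < n := by exact_mod_cast hn
  set Z : Finset (Fin n) := Finset.univ.filter fun i => ¬ good i with hZ
  have hcard : ((Finset.univ.filter good).card : ℝ) + Z.card = n := by
    have := Finset.card_filter_add_card_filter_not (s := (Finset.univ : Finset (Fin n))) good
    simp only [Finset.card_univ, Fintype.card_fin] at this
    exact_mod_cast this
  have hα1 : α ≤ 1 := by
    by_contra hc
    push Not at hc
    nlinarith [Nat.cast_nonneg (α := ℝ) Z.card]
  have hZn : (Z.card : ℝ) / n ≤ 1 - α := by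
    rw [div_le_iff₀ hn']
    linarith
  set Bad := Finset.univ.filter fun σ : Equiv.Perm (Fin n) =>
      ((Finset.univ.filter fun q => good (σ (pos q))).card : ℝ) < α / 2 * m with hBad
  have hsum := sum_two_pow_card_hits_le pos hpos Z hn
  -- Markov's inequality: fewer than (α/2)m good objects mean more than (1 - α/2)m objects of `Z`.
  have hlow : (Bad.card : ℝ) * Real.exp (Real.log 2 * ((1 - α / 2) * m)) ≤
      ∑ σ : Equiv.Perm (Fin n), (2 : ℝ) ^ (Finset.univ.filter fun q => σ (pos q) ∈ Z).card := by
    rw [← nsmul_eq_mul, ← Finset.sum_const]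
    refine (Finset.sum_le_sum fun σ hσ => ?_).trans
      (Finset.sum_le_univ_sum_of_nonneg (s := Bad) fun σ => by positivity)
    have hσ' : ((Finset.univ.filter fun q => good (σ (pos q))).card : ℝ) < α / 2 * m := by
      simpa [hBad] using hσ
    have hc : ((Finset.univ.filter fun q => good (σ (pos q))).card : ℝ) +
        (Finset.univ.filter fun q => σ (pos q) ∈ Z).card = m := by
      have := Finset.card_filter_add_card_filter_not (s := (Finset.univ : Finset (Fin m)))
        fun q => good (σ (pos q))
      simp only [Finset.card_univ, Fintype.card_fin] at this
      simp only [hZ, Finset.mem_filter, Finset.mem_univ, true_and]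
      exact_mod_cast this
    rw [← Real.rpow_natCast 2, Real.rpow_def_of_pos (by norm_num)]
    apply Real.exp_le_exp.mpr
    exact mul_le_mul_of_nonneg_left (by linarith) (Real.log_nonneg (by norm_num))
  have hup : (1 + (Z.card : ℝ) / n) ^ m ≤
      Real.exp (Real.log 2 * m) * Real.exp (-(α / 2) * m) := by
    -- 1 + (1 - α) = 2(1 - α/2) ≤ 2 exp(-α/2).
    have hb : 1 + (Z.card : ℝ) / n ≤ 2 * Real.exp (-(α / 2)) := by
      have := Real.add_one_le_exp (-(α / 2))
      linarith
    calc (1 + (Z.card : ℝ) / n) ^ m ≤ (2 * Real.exp (-(α / 2))) ^ m :=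
          pow_le_pow_left₀ (by positivity) hb m
      _ = _ := by
          rw [mul_pow, ← Real.exp_nat_mul, ← Real.rpow_natCast 2,
            Real.rpow_def_of_pos (by norm_num), mul_comm (m : ℝ)]
  have hall := (hlow.trans hsum).trans (mul_le_mul_of_nonneg_right hup (by positivity))
  rw [← le_div_iff₀ (Real.exp_pos _)] at hall
  refine hall.trans ?_
  rw [div_le_iff₀ (Real.exp_pos _), ← Real.exp_add, mul_right_comm, ← Real.exp_add]
  refine mul_le_mul_of_nonneg_right (Real.exp_le_exp.mpr ?_) (by positivity)
  -- The exponent is -(1 - log 2)/2 · αm, and (1 - log 2)/2 exceeds 3/20.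
  have h2 : Real.log 2 < 0.6931471808 := Real.log_two_lt_d9
  have hm : 0 ≤ α * m := by positivity
  nlinarith

end Permutations

/-! ### Independent groups of random variables -/

/-- If each section of an event has probability at most `p`, so has the event, for independent
coordinates. -/
theorem measureReal_section_le_of_indepFun {Ω α β : Type*} [MeasurableSpace Ω] [MeasurableSpace α]
    [MeasurableSpace β] {μ : Measure Ω} [IsProbabilityMeasure μ] {X : Ω → α} {Y : Ω → β}
    (hX : Measurable X) (hY : Measurable Y) (hind : X ⟂ᵢ[μ] Y) {A : Set α} (hA : MeasurableSet A)
    {Q : α → β → Prop} (hQ : MeasurableSet {p : α × β | Q p.1 p.2}) {p : ℝ} (hp : 0 ≤ p)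
    (h : ∀ a ∈ A, μ.real {ω | Q a (Y ω)} ≤ p) : μ.real {ω | X ω ∈ A ∧ Q (X ω) (Y ω)} ≤ p := by
  have hmap := (indepFun_iff_map_prod_eq_prod_map_map hX.aemeasurable hY.aemeasurable).mp hind
  have hAQ : MeasurableSet {p : α × β | p.1 ∈ A ∧ Q p.1 p.2} := (measurable_fst hA).inter hQ
  have e1 : μ {ω | X ω ∈ A ∧ Q (X ω) (Y ω)} =
      μ.map (fun ω => (X ω, Y ω)) {p : α × β | p.1 ∈ A ∧ Q p.1 p.2} := by
    rw [Measure.map_apply (hX.prodMk hY) hAQ]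
    rfl
  have hprob := Measure.isProbabilityMeasure_map (μ := μ) hY.aemeasurable
  have hprob' := Measure.isProbabilityMeasure_map (μ := μ) hX.aemeasurable
  rw [measureReal_def]
  refine (ENNReal.le_ofReal_iff_toReal_le (measure_ne_top _ _) hp).mp ?_
  rw [e1, hmap, Measure.prod_apply hAQ]
  calc _ ≤ ∫⁻ _, ENNReal.ofReal p ∂(μ.map X) := by
        refine lintegral_mono fun a => ?_
        rw [Measure.map_apply hY (measurable_prodMk_left hAQ)]
        by_cases ha : a ∈ A
        · have := h a ha
          rw [measureReal_def] at this
          exact le_trans (measure_mono fun ω hω => hω.2)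
            ((ENNReal.le_ofReal_iff_toReal_le (measure_ne_top _ _) hp).mpr this)
        · exact le_trans (measure_mono (t := ∅) fun ω hω => absurd hω.1 ha) (by simp)
    _ = ENNReal.ofReal p := by simp

/-- The form in which adaptivity is handled: `X` is the outcome of the earlier stages, `A` the set
of admissible outcomes, and `Q a` a failure event that reads only fresh samples, those of `m₂`. -/
theorem measureReal_section_le {Ω α : Type*} [MeasurableSpace α] {m₁ m₂ : MeasurableSpace Ω}
    [mΩ : MeasurableSpace Ω] {μ : Measure Ω} [IsProbabilityMeasure μ] (h₁ : m₁ ≤ mΩ)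
    (h₂ : m₂ ≤ mΩ) (hind : Indep m₁ m₂ μ) {X : Ω → α}
    (hX : Measurable[m₁] X) {A : Set α} (hA : MeasurableSet A) {Q : α → Ω → Prop}
    (hQ : MeasurableSet[@Prod.instMeasurableSpace α Ω _ m₂] {p : α × Ω | Q p.1 p.2}) {p : ℝ}
    (hp : 0 ≤ p) (h : ∀ a ∈ A, μ.real {ω | Q a ω} ≤ p) :
    μ.real {ω | X ω ∈ A ∧ Q (X ω) ω} ≤ p := by
  -- The identity, regarded as a random element of Ω with the smaller σ-algebra `m₂`, serves as the
  -- second coordinate.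
  have hI : @IndepFun Ω α Ω mΩ _ m₂ X id μ := by
    refine (IndepFun_iff_Indep (mγ := m₂) X id μ).mpr ?_
    rw [MeasurableSpace.comap_id]
    exact indep_of_indep_of_le_left hind hX.comap_le
  exact @measureReal_section_le_of_indepFun Ω α Ω mΩ _ m₂ μ _ X id (hX.mono h₁ le_rfl)
    (fun s hs => h₂ s hs) hI A hA Q hQ p hp h

section Independence

variable {Ω J E : Type*} [MeasurableSpace E]

/-- The `σ`-algebra generated by the variables `Z j` with `j ∈ U`. -/
abbrev sig (Z : J → Ω → E) (U : Set J) : MeasurableSpace Ω :=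
  ⨆ j ∈ U, MeasurableSpace.comap (Z j) inferInstance

theorem sig_mono (Z : J → Ω → E) {U V : Set J} (h : U ⊆ V) : sig Z U ≤ sig Z V :=
  biSup_mono h

theorem measurable_sig (Z : J → Ω → E) {U : Set J} {j : J} (hj : j ∈ U) :
    Measurable[sig Z U] (Z j) :=
  measurable_iff_comap_le.mpr
    (le_iSup₂ (f := fun (j : J) (_ : j ∈ U) => MeasurableSpace.comap (Z j) inferInstance) j hj)

variable [mΩ : MeasurableSpace Ω] {Z : J → Ω → E} {μ : Measure Ω}

theorem sig_le (hZ : ∀ j, Measurable (Z j)) (U : Set J) : sig Z U ≤ mΩ :=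
  iSup₂_le fun j _ => (hZ j).comap_le

theorem indep_sig (hZ : ∀ j, Measurable (Z j)) (hind : iIndepFun Z μ) {U V : Set J}
    (h : Disjoint U V) : Indep (sig Z U) (sig Z V) μ :=
  indep_iSup_of_disjoint (fun j => (hZ j).comap_le) hind h

/-- Induction on finite subfamilies: the union of the remaining groups is disjoint from the group
that is added, and two disjoint groups are independent. -/
theorem iIndep_sig {ι : Type*} (hZ : ∀ j, Measurable (Z j)) (hind : iIndepFun Z μ)
    (U : ι → Set J) (hU : Pairwise (Function.onFun Disjoint U)) :
    iIndep (fun i => sig Z (U i)) μ := by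
  classical
  have := hind.isProbabilityMeasure
  rw [iIndep_iff]
  intro s
  induction s using Finset.induction_on with
  | empty => simp
  | insert a s ha ih =>
    intro f hf
    rw [Finset.set_biInter_insert, Finset.prod_insert ha,
      ← ih fun i hi => hf i (Finset.mem_insert_of_mem hi)]
    have hd : Disjoint (U a) (⋃ i ∈ s, U i) := by
      rw [Set.disjoint_iUnion₂_right]
      exact fun i hi => hU (ne_of_mem_of_not_mem hi ha).symm
    refine (Indep_iff _ _ _).mp (indep_sig hZ hind hd) _ _ (hf a (Finset.mem_insert_self a s)) ?_
    refine MeasurableSet.biInter s.countable_toSet fun i hi => ?_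
    exact sig_mono Z (Set.subset_biUnion_of_mem (u := fun i => U i) hi) _
      (hf i (Finset.mem_insert_of_mem hi))

/-- Among `T` independent events of probability at most `1 / 8`, a half rarely occurs. -/
theorem measureReal_half_le {T : ℕ} [IsProbabilityMeasure μ] {m : Fin T → MeasurableSpace Ω}
    (hind : iIndep m μ) (B : Fin T → Set Ω) (hB : ∀ j, MeasurableSet[m j] (B j))
    (hp : ∀ j, μ.real (B j) ≤ 1 / 8) [∀ j ω, Decidable (ω ∈ B j)] :
    μ.real {ω | T ≤ 2 * (Finset.univ.filter fun j => ω ∈ B j).card} ≤ Real.exp (-(T / 3)) := by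
  classical
  set 𝒮 := Finset.univ.filter fun F : Finset (Fin T) => T ≤ 2 * F.card
  have hsub : {ω | T ≤ 2 * (Finset.univ.filter fun j => ω ∈ B j).card} ⊆
      ⋃ F ∈ 𝒮, ⋂ j ∈ F, B j := by
    intro ω hω
    simp only [Set.mem_iUnion, Set.mem_iInter]
    exact ⟨Finset.univ.filter fun j => ω ∈ B j, by simpa [𝒮] using hω, by simp⟩
  -- If a half of the events occurs, so does an intersection of at least T/2 of them, with
  -- probability at most 8^(-T/2) = s^T. There are at most 2^T such intersections, and 2s = 2^(-1/2)
  -- < exp(-1/3).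
  set s := Real.sqrt (1 / 8)
  have hs : s ^ 2 = 1 / 8 := Real.sq_sqrt (by norm_num)
  have hs0 : 0 ≤ s := Real.sqrt_nonneg _
  have hs1 : s ≤ 1 := by nlinarith
  have hterm : ∀ F ∈ 𝒮, μ.real (⋂ j ∈ F, B j) ≤ s ^ T := by
    intro F hF
    have hF' : T ≤ 2 * F.card := by simpa [𝒮] using hF
    rw [measureReal_def, hind.meas_biInter fun j _ => hB j, ENNReal.toReal_prod]
    calc ∏ j ∈ F, (μ (B j)).toReal ≤ ∏ _j ∈ F, (1 / 8 : ℝ) :=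
          Finset.prod_le_prod (fun _ _ => ENNReal.toReal_nonneg) fun j _ => hp j
      _ = s ^ (2 * F.card) := by rw [Finset.prod_const, pow_mul, hs]
      _ ≤ s ^ T := pow_le_pow_of_le_one hs0 hs1 hF'
  calc μ.real {ω | T ≤ 2 * (Finset.univ.filter fun j => ω ∈ B j).card}
      ≤ μ.real (⋃ F ∈ 𝒮, ⋂ j ∈ F, B j) := measureReal_mono hsub (measure_ne_top _ _)
    _ ≤ ∑ F ∈ 𝒮, μ.real (⋂ j ∈ F, B j) := measureReal_biUnion_finset_le 𝒮 _
    _ ≤ ∑ _F ∈ 𝒮, s ^ T := Finset.sum_le_sum hterm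
    _ ≤ ∑ _F : Finset (Fin T), s ^ T :=
        Finset.sum_le_univ_sum_of_nonneg fun _ => by positivity
    _ = (2 * s) ^ T := by simp [mul_pow]
    _ ≤ (Real.exp (-(1 / 3))) ^ T := by
        refine pow_le_pow_left₀ (by positivity) ?_ T
        have h1 : 2 * s ≤ 17 / 24 := by
          have : s ≤ 17 / 48 := Real.sqrt_le_iff.mpr ⟨by norm_num, by norm_num⟩
          linarith
        have h2 : Real.exp (1 / 3) ≤ 24 / 17 := by
          have h3 : Real.exp (1 / 3) ^ 3 ≤ (24 / 17) ^ 3 := by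
            rw [← Real.exp_nat_mul]
            norm_num
            exact (Real.exp_one_lt_d9.le).trans (by norm_num)
          exact le_of_pow_le_pow_left₀ (by norm_num) (by norm_num) h3
        rw [Real.exp_neg]
        refine h1.trans ?_
        rw [le_inv_comm₀ (by norm_num) (Real.exp_pos _)]
        exact h2.trans (by norm_num)
    _ = Real.exp (-(T / 3)) := by rw [← Real.exp_nat_mul]; congr 1; ring

/-- Markov's inequality. -/
theorem measureReal_ge_le_integral_div [IsFiniteMeasure μ] {f : Ω → ℝ} (hf : 0 ≤ᵐ[μ] f)
    (hi : Integrable f μ) {a : ℝ} (ha : 0 < a) : μ.real {ω | a ≤ f ω} ≤ (∫ ω, f ω ∂μ) / a := by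
  rw [le_div_iff₀ ha, mul_comm]
  exact mul_meas_ge_le_integral_of_nonneg hf hi a

theorem integral_mul_sq_le {f g : Ω → ℝ} (hf : Integrable (fun ω => f ω ^ 2) μ)
    (hg : Integrable (fun ω => g ω ^ 2) μ) (hfg : Integrable (fun ω => f ω * g ω) μ) :
    (∫ ω, f ω * g ω ∂μ) ^ 2 ≤ (∫ ω, f ω ^ 2 ∂μ) * ∫ ω, g ω ^ 2 ∂μ := by
  have key : ∀ t : ℝ, 0 ≤ (∫ ω, g ω ^ 2 ∂μ) * (t * t) + (2 * ∫ ω, f ω * g ω ∂μ) * t +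
      ∫ ω, f ω ^ 2 ∂μ := by
    intro t
    have h : ∫ ω, (f ω + t * g ω) ^ 2 ∂μ = (∫ ω, g ω ^ 2 ∂μ) * (t * t) +
        (2 * ∫ ω, f ω * g ω ∂μ) * t + ∫ ω, f ω ^ 2 ∂μ := by
      have e : ∀ ω, (f ω + t * g ω) ^ 2 = (t * t) * g ω ^ 2 + (2 * t) * (f ω * g ω) + f ω ^ 2 :=
        fun ω => by ring
      simp only [e]
      have i1 := hg.const_mul (t * t)
      have i2 := hfg.const_mul (2 * t)
      rw [integral_add (f := fun ω => t * t * g ω ^ 2 + 2 * t * (f ω * g ω)) (i1.add i2) hf,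
        integral_add i1 i2, integral_const_mul, integral_const_mul]
      ring
    rw [← h]
    exact integral_nonneg fun ω => sq_nonneg _
  have := discrim_le_zero key
  rw [discrim] at this
  nlinarith

end Independence

/-! ### The Golden–Thompson inequality -/

section GoldenThompson

open Matrix Filter Topology

variable {n : Type*} [Fintype n] [DecidableEq n]

theorem trace_mul_pow_comm (A B : Matrix n n ℝ) (m : ℕ) :
    ((A * B) ^ m).trace = ((B * A) ^ m).trace := by
  cases m with
  | zero => simp
  | succ m =>
    have h : ∀ k : ℕ, A * (B * A) ^ k = (A * B) ^ k * A := by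
      intro k
      induction k with
      | zero => simp
      | succ k ih =>
        rw [pow_succ, pow_succ, ← mul_assoc, ih]
        simp only [mul_assoc]
    rw [pow_succ, ← mul_assoc, ← h, pow_succ (B * A), mul_assoc, trace_mul_comm A]
    simp only [mul_assoc]

omit [DecidableEq n] in
theorem trace_mul_transpose_self_eq_sum (A B : Matrix n n ℝ) :
    (A * Bᵀ).trace = ∑ i, ∑ j, A i j * B i j := by
  simp [trace, mul_apply]

omit [DecidableEq n] in
theorem trace_mul_transpose_le (A B : Matrix n n ℝ) :
    |(A * Bᵀ).trace| ≤ ((A * Aᵀ).trace + (B * Bᵀ).trace) / 2 := by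
  simp only [trace_mul_transpose_self_eq_sum, ← Finset.sum_add_distrib, Finset.sum_div]
  refine (Finset.abs_sum_le_sum_abs _ _).trans (Finset.sum_le_sum fun i _ => ?_)
  refine (Finset.abs_sum_le_sum_abs _ _).trans (Finset.sum_le_sum fun j _ => ?_)
  rw [abs_le]
  constructor <;> nlinarith [sq_nonneg (A i j + B i j), sq_nonneg (A i j - B i j)]

/-- The two inequalities feed each other when the exponent is doubled. The second one for Y = PQ
leads, by cyclicity of the trace, from the power 2^(k+1) of PQ to the power 2^k of P²Q², where the
first applies. Conversely Y² in place of Y leads to the product of the symmetric matrices YYᵀ and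
YᵀY, whose powers have equal traces. -/
theorem trace_pow_le_aux (k : ℕ) :
    (∀ P Q : Matrix n n ℝ, P.IsSymm → Q.IsSymm →
      ((P * Q) ^ 2 ^ k).trace ≤ (P ^ 2 ^ k * Q ^ 2 ^ k).trace) ∧
    ∀ Y : Matrix n n ℝ, |(Y ^ 2 ^ (k + 1)).trace| ≤ ((Y * Yᵀ) ^ 2 ^ k).trace := by
  induction k with
  | zero =>
    refine ⟨fun P Q _ _ => by simp, fun Y => ?_⟩
    have h := trace_mul_transpose_le Y Yᵀ
    rw [transpose_transpose, trace_mul_comm Yᵀ] at h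
    simpa [pow_two] using h
  | succ k ih =>
    obtain ⟨ihS, ihH⟩ := ih
    have hS : ∀ P Q : Matrix n n ℝ, P.IsSymm → Q.IsSymm →
        ((P * Q) ^ 2 ^ (k + 1)).trace ≤ (P ^ 2 ^ (k + 1) * Q ^ 2 ^ (k + 1)).trace := by
      intro P Q hP hQ
      have hP2 : (P ^ 2).IsSymm := hP.pow 2
      have hQ2 : (Q ^ 2).IsSymm := hQ.pow 2
      calc ((P * Q) ^ 2 ^ (k + 1)).trace ≤ ((P * Q * (P * Q)ᵀ) ^ 2 ^ k).trace :=
            (le_abs_self _).trans (ihH _)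
        _ = ((P * (Q ^ 2 * P)) ^ 2 ^ k).trace := by
            rw [transpose_mul, hP.eq, hQ.eq, pow_two]
            simp only [mul_assoc]
        _ = ((P ^ 2 * Q ^ 2) ^ 2 ^ k).trace := by
            rw [trace_mul_pow_comm, mul_assoc, ← pow_two, trace_mul_pow_comm]
        _ ≤ ((P ^ 2) ^ 2 ^ k * (Q ^ 2) ^ 2 ^ k).trace := ihS _ _ hP2 hQ2
        _ = _ := by rw [← pow_mul, ← pow_mul, ← pow_succ']
    refine ⟨hS, fun Y => ?_⟩
    have hP : (Yᵀ * Y).IsSymm := by simp [IsSymm, transpose_mul]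
    have hQ : (Y * Yᵀ).IsSymm := by simp [IsSymm, transpose_mul]
    have hP' := hP.pow (2 ^ k)
    have hQ' := hQ.pow (2 ^ k)
    -- Cauchy–Schwarz for the Frobenius product of the two powers; both have the squared norm `((Y *
    -- Yᵀ) ^ 2 ^ (k + 1)).trace`.
    have h := trace_mul_transpose_le ((Yᵀ * Y) ^ 2 ^ k) ((Y * Yᵀ) ^ 2 ^ k)
    rw [hP'.eq, hQ'.eq, ← pow_add, ← pow_add, ← two_mul, ← pow_succ', trace_mul_pow_comm Yᵀ Y]
      at h
    calc |(Y ^ 2 ^ (k + 1 + 1)).trace| = |((Y ^ 2) ^ 2 ^ (k + 1)).trace| := by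
          rw [← pow_mul, ← pow_succ']
      _ ≤ ((Y ^ 2 * (Y ^ 2)ᵀ) ^ 2 ^ k).trace := ihH _
      _ = ((Y * (Y * Yᵀ * Yᵀ)) ^ 2 ^ k).trace := by
          rw [pow_two, transpose_mul]
          simp only [mul_assoc]
      _ = (((Y * Yᵀ) * (Yᵀ * Y)) ^ 2 ^ k).trace := by
          rw [trace_mul_pow_comm]
          simp only [mul_assoc]
      _ = (((Yᵀ * Y) * (Y * Yᵀ)) ^ 2 ^ k).trace := trace_mul_pow_comm _ _ _
      _ ≤ ((Yᵀ * Y) ^ 2 ^ k * (Y * Yᵀ) ^ 2 ^ k).trace := ihS _ _ hP hQ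
      _ ≤ _ := (le_abs_self _).trans (by linarith)

theorem norm_pow_sub_pow_le {𝔸 : Type*} [NormedRing 𝔸] [NormOneClass 𝔸] (x y : 𝔸) (K : ℝ)
    (hx : ‖x‖ ≤ K) (hy : ‖y‖ ≤ K) (m : ℕ) :
    ‖x ^ (m + 1) - y ^ (m + 1)‖ ≤ (m + 1) * K ^ m * ‖x - y‖ := by
  have hK : 0 ≤ K := (norm_nonneg x).trans hx
  induction m with
  | zero => simp
  | succ m ih =>
    have e : x ^ (m + 1 + 1) - y ^ (m + 1 + 1) =
        x * (x ^ (m + 1) - y ^ (m + 1)) + (x - y) * y ^ (m + 1) := by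
      rw [pow_succ' x, pow_succ' y (m + 1)]
      noncomm_ring
    rw [e]
    refine (norm_add_le _ _).trans ?_
    have h1 : ‖x * (x ^ (m + 1) - y ^ (m + 1))‖ ≤ K * ((m + 1) * K ^ m * ‖x - y‖) :=
      (norm_mul_le _ _).trans (mul_le_mul hx ih (norm_nonneg _) hK)
    have h2 : ‖(x - y) * y ^ (m + 1)‖ ≤ ‖x - y‖ * K ^ (m + 1) :=
      (norm_mul_le _ _).trans (mul_le_mul_of_nonneg_left
        ((norm_pow_le y (m + 1)).trans (pow_le_pow_left₀ (norm_nonneg _) hy _)) (norm_nonneg _))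
    push_cast
    calc _ ≤ K * ((m + 1) * K ^ m * ‖x - y‖) + ‖x - y‖ * K ^ (m + 1) := add_le_add h1 h2
      _ = _ := by ring

/-- The product formula of Lie and Trotter. -/
theorem tendsto_exp_mul_exp_pow {𝔸 : Type*} [NormedRing 𝔸] [NormedAlgebra ℝ 𝔸] [NormOneClass 𝔸]
    [CompleteSpace 𝔸] (A B : 𝔸) :
    Tendsto (fun m : ℕ => (NormedSpace.exp (((m : ℝ) + 1)⁻¹ • A) *
      NormedSpace.exp (((m : ℝ) + 1)⁻¹ • B)) ^ (m + 1)) atTop (𝓝 (NormedSpace.exp (A + B))) := by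
  let _ : NormedAlgebra ℚ 𝔸 := NormedAlgebra.restrictScalars ℚ ℝ 𝔸
  set f : ℝ → 𝔸 := fun t => NormedSpace.exp (t • A) * NormedSpace.exp (t • B)
  set g : ℝ → 𝔸 := fun t => NormedSpace.exp (t • (A + B))
  have hf : HasDerivAt f (A + B) 0 := by
    exact ((hasDerivAt_exp_smul_const (𝕂 := ℝ) A 0).mul
      (hasDerivAt_exp_smul_const (𝕂 := ℝ) B 0)).congr_deriv (by simp)
  have hg : HasDerivAt g (A + B) 0 := by
    exact (hasDerivAt_exp_smul_const (𝕂 := ℝ) (A + B) 0).congr_deriv (by simp)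
  have hf0 : f 0 = 1 := by simp [f]
  have hg0 : g 0 = 1 := by simp [g]
  -- Both curves have the derivative A + B at 0. Hence their norms are at most 1 + K|t| ≤ exp(K|t|)
  -- near 0, so that powers up to 1/t stay below exp K, while their difference is o(t).
  set K := ‖A + B‖ + 1
  have hK : 0 < K := by positivity
  have hbound : ∀ {F : ℝ → 𝔸}, HasDerivAt F (A + B) 0 → F 0 = 1 →
      ∀ᶠ t in 𝓝 (0 : ℝ), ‖F t‖ ≤ Real.exp (K * |t|) := by
    intro F hF h0
    have := hF.isLittleO.def (c := 1) one_pos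
    filter_upwards [this] with t ht
    simp only [sub_zero, h0, one_mul] at ht
    have : ‖F t‖ ≤ ‖F t - 1 - t • (A + B)‖ + ‖(1 : 𝔸)‖ + ‖t • (A + B)‖ := by
      calc ‖F t‖ = ‖(F t - 1 - t • (A + B)) + 1 + t • (A + B)‖ := by congr 1; abel
        _ ≤ _ := norm_add₃_le
    rw [norm_one, norm_smul, Real.norm_eq_abs] at this
    rw [Real.norm_eq_abs] at ht
    have h3 := Real.add_one_le_exp (K * |t|)
    simp only [K] at h3 ⊢
    nlinarith
  have htm : Tendsto (fun m : ℕ => ((m : ℝ) + 1)⁻¹) atTop (𝓝 0) :=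
    (tendsto_natCast_atTop_atTop.atTop_add tendsto_const_nhds).inv_tendsto_atTop
  have hlim : Tendsto (fun m : ℕ => f ((m : ℝ) + 1)⁻¹ ^ (m + 1) - g ((m : ℝ) + 1)⁻¹ ^ (m + 1))
      atTop (𝓝 0) := by
    rw [Metric.tendsto_nhds]
    intro ε hε
    have hsub : HasDerivAt (fun t => f t - g t) 0 0 := (hf.sub hg).congr_deriv (sub_self _)
    have ho := hsub.isLittleO.def (c := ε / (2 * Real.exp K)) (by positivity)
    filter_upwards [htm.eventually ho, htm.eventually (hbound hf hf0),
      htm.eventually (hbound hg hg0)] with m h1 h2 h3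
    set t := ((m : ℝ) + 1)⁻¹ with ht
    have htpos : 0 < t := by positivity
    simp only [hf0, hg0, sub_self, sub_zero, smul_zero, Real.norm_eq_abs] at h1
    rw [abs_of_pos htpos] at h1 h2 h3
    have h4 := norm_pow_sub_pow_le (f t) (g t) _ h2 h3 m
    rw [dist_zero_right]
    have h5 : Real.exp (K * t) ^ m ≤ Real.exp K := by
      rw [← Real.exp_nat_mul]
      apply Real.exp_le_exp.mpr
      have : (m : ℝ) * t ≤ 1 := by
        rw [ht, ← div_eq_mul_inv, div_le_one (by positivity)]
        linarith
      nlinarith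
    have h6 : ((m : ℝ) + 1) * t = 1 := mul_inv_cancel₀ (by positivity)
    calc _ ≤ _ := h4
      _ ≤ ((m : ℝ) + 1) * Real.exp K * (ε / (2 * Real.exp K) * t) := by gcongr
      _ = ε / 2 * (((m : ℝ) + 1) * t) := by
          have := Real.exp_pos K
          field_simp
      _ < ε := by rw [h6]; linarith
  have hgm : ∀ m : ℕ, g ((m : ℝ) + 1)⁻¹ ^ (m + 1) = NormedSpace.exp (A + B) := by
    intro m
    simp only [g]
    rw [← NormedSpace.exp_nsmul, ← Nat.cast_smul_eq_nsmul ℝ, smul_smul]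
    push_cast
    rw [mul_inv_cancel₀ (by positivity), one_smul]
  simp only [hgm] at hlim
  have := hlim.add_const (NormedSpace.exp (A + B))
  simpa using this

open scoped Matrix.Norms.L2Operator in
-- Lie–Trotter along the powers 2^k: `trace_pow_le_aux` bounds the trace of each approximant by one
-- and the same number, since the powers on its right-hand side recombine to the full exponentials.
theorem trace_exp_add_le [Nonempty n] {A B : Matrix n n ℝ} (hA : A.IsSymm) (hB : B.IsSymm) :
    (NormedSpace.exp (A + B)).trace ≤ (NormedSpace.exp A * NormedSpace.exp B).trace := by
  let _ : NormedAlgebra ℚ (Matrix n n ℝ) := NormedAlgebra.restrictScalars ℚ ℝ _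
  have : NormOneClass (Matrix n n ℝ) := CStarRing.instNormOneClassOfNontrivial
  have hlim := tendsto_exp_mul_exp_pow A B
  -- The product formula has the exponent m + 1, so the subsequence is m = 2^k - 1.
  have hsub : Tendsto (fun k : ℕ => 2 ^ k - 1) atTop atTop :=
    tendsto_atTop_mono (fun k => Nat.le_sub_one_of_lt Nat.lt_two_pow_self) tendsto_id
  have hlim2 := (continuous_id.matrix_trace.tendsto _).comp (hlim.comp hsub)
  refine le_of_tendsto hlim2 (Eventually.of_forall fun k => ?_)
  have h1 : 2 ^ k - 1 + 1 = 2 ^ k := Nat.sub_add_cancel Nat.one_le_two_pow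
  have hk : ∀ M : Matrix n n ℝ, M.IsSymm →
      (NormedSpace.exp ((((2 ^ k - 1 : ℕ) : ℝ) + 1)⁻¹ • M)).IsSymm :=
    fun M hM => (hM.smul _).exp
  have hp : ∀ M : Matrix n n ℝ,
      NormedSpace.exp ((((2 ^ k - 1 : ℕ) : ℝ) + 1)⁻¹ • M) ^ 2 ^ k = NormedSpace.exp M := by
    intro M
    rw [← NormedSpace.exp_nsmul, ← Nat.cast_smul_eq_nsmul ℝ, smul_smul]
    have : (((2 ^ k - 1 : ℕ) : ℝ) + 1) = ((2 ^ k : ℕ) : ℝ) := by exact_mod_cast h1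
    rw [this, mul_inv_cancel₀ (by positivity), one_smul]
  have h := (trace_pow_le_aux k).1 _ _ (hk A hA) (hk B hB)
  rw [hp, hp] at h
  simpa [Function.comp, h1] using h

end GoldenThompson

/-! ### Symmetric matrices -/

section Symmetric

open Matrix

variable {d : ℕ} {A B : Matrix (Fin d) (Fin d) ℝ}

theorem inner_toEuclideanLin_left (hA : A.IsSymm) (u v : Vec d) :
    inner ℝ (toEuclideanLin A u) v = inner ℝ u (toEuclideanLin A v) := by
  have hH : A.IsHermitian := by rw [IsHermitian, conjTranspose_eq_transpose_of_trivial, hA.eq]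
  exact isSymmetric_toEuclideanLin_iff.mpr hH u v

theorem toEuclideanLin_mul_apply (A B : Matrix (Fin d) (Fin d) ℝ) (u : Vec d) :
    toEuclideanLin (A * B) u = toEuclideanLin A (toEuclideanLin B u) := by
  rw [toEuclideanLin, toLpLin_mul_same]
  rfl

theorem trace_eq_sum_inner_basis (b : OrthonormalBasis (Fin d) ℝ (Vec d))
    (A : Matrix (Fin d) (Fin d) ℝ) : A.trace = ∑ i, inner ℝ (b i) (toEuclideanLin A (b i)) := by
  rw [← LinearMap.trace_eq_sum_inner, toEuclideanLin, toLpLin_eq_toLin, trace_toLin_eq]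

theorem exists_eigenbasis (hA : A.IsSymm) :
    ∃ (b : OrthonormalBasis (Fin d) ℝ (Vec d)) (c : Fin d → ℝ),
      ∀ i, toEuclideanLin A (b i) = c i • b i := by
  have hH : A.IsHermitian := by rw [IsHermitian, conjTranspose_eq_transpose_of_trivial, hA.eq]
  refine ⟨hH.eigenvectorBasis, hH.eigenvalues, fun i => ?_⟩
  rw [toEuclideanLin, toLpLin_apply, hH.mulVec_eigenvectorBasis]
  rfl

theorem toEuclideanLin_pow_apply_of_eigen {u : Vec d} {c : ℝ}
    (h : toEuclideanLin A u = c • u) (k : ℕ) : toEuclideanLin (A ^ k) u = c ^ k • u := by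
  induction k with
  | zero => simp [toEuclideanLin]
  | succ k ih => rw [pow_succ, toEuclideanLin_mul_apply, h, map_smul, ih, smul_smul, pow_succ']

open scoped Matrix.Norms.L2Operator in
theorem toEuclideanLin_exp_apply_of_eigen {u : Vec d} {c : ℝ}
    (h : toEuclideanLin A u = c • u) :
    toEuclideanLin (NormedSpace.exp A) u = Real.exp c • u := by
  let ev : Matrix (Fin d) (Fin d) ℝ →ₗ[ℝ] Vec d :=
    { toFun := fun M => toEuclideanLin M u
      map_add' := fun M N => by simp
      map_smul' := fun r M => by simp }
  have h1 := (NormedSpace.exp_series_hasSum_exp' (𝕂 := ℝ) A).mapL (LinearMap.toContinuousLinearMap ev)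
  have h2 := (NormedSpace.exp_series_hasSum_exp' (𝕂 := ℝ) c).smul_const u
  rw [← Real.exp_eq_exp_ℝ] at h2
  refine h1.unique ?_
  convert h2 using 2 with k
  simp only [LinearMap.coe_toContinuousLinearMap', map_smul, smul_eq_mul, mul_smul]
  congr 1
  exact toEuclideanLin_pow_apply_of_eigen h k

theorem inner_toEuclideanLin_eq_sum (b : OrthonormalBasis (Fin d) ℝ (Vec d)) {c : Fin d → ℝ}
    (h : ∀ i, toEuclideanLin A (b i) = c i • b i) (u v : Vec d) :
    inner ℝ u (toEuclideanLin A v) = ∑ i, c i * (inner ℝ (b i) u * inner ℝ (b i) v) := by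
  conv_lhs => rw [← b.sum_repr' v]
  rw [map_sum, inner_sum]
  refine Finset.sum_congr rfl fun i _ => ?_
  rw [map_smul, h, inner_smul_right, inner_smul_right, real_inner_comm u]
  ring

theorem sum_sq_inner_basis (b : OrthonormalBasis (Fin d) ℝ (Vec d)) (u : Vec d) :
    ∑ i, inner ℝ (b i) u ^ 2 = ‖u‖ ^ 2 := by
  rw [← b.sum_sq_norm_inner_right u]
  simp

theorem abs_eigenvalue_le {u : Vec d} {c L : ℝ} (hu : ‖u‖ = 1)
    (h : toEuclideanLin A u = c • u) (hL : ‖toEuclideanLin A u‖ ≤ L * ‖u‖) : |c| ≤ L := by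
  rwa [h, norm_smul, hu, mul_one, mul_one] at hL

/-- In an eigenbasis this is exp c ≤ 1 + c + c² for |c| ≤ 1. -/
theorem inner_exp_le (hA : A.IsSymm) (h1 : ∀ u, ‖toEuclideanLin A u‖ ≤ ‖u‖) (u : Vec d) :
    inner ℝ u (toEuclideanLin (NormedSpace.exp A) u) ≤
      ‖u‖ ^ 2 + inner ℝ u (toEuclideanLin A u) + ‖toEuclideanLin A u‖ ^ 2 := by
  obtain ⟨b, c, h⟩ := exists_eigenbasis hA
  have h2 : ‖toEuclideanLin A u‖ ^ 2 = inner ℝ u (toEuclideanLin (A ^ 2) u) := by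
    rw [pow_two A, toEuclideanLin_mul_apply, ← inner_toEuclideanLin_left hA,
      real_inner_self_eq_norm_sq]
  rw [h2, inner_toEuclideanLin_eq_sum b (fun i => toEuclideanLin_exp_apply_of_eigen (h i)),
    inner_toEuclideanLin_eq_sum b h,
    inner_toEuclideanLin_eq_sum b (fun i => toEuclideanLin_pow_apply_of_eigen (h i) 2),
    ← sum_sq_inner_basis b, ← Finset.sum_add_distrib, ← Finset.sum_add_distrib]
  refine Finset.sum_le_sum fun i _ => ?_
  have hc : |c i| ≤ 1 := abs_eigenvalue_le (b.norm_eq_one i) (h i) (by simpa using h1 (b i))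
  have he := (abs_le.mp (Real.abs_exp_sub_one_sub_id_le hc)).2
  nlinarith [sq_nonneg (inner ℝ (b i) u)]

/-- The number ⟨u, Au⟩ is an average of the eigenvalues with weights ⟨b i, u⟩² ≤ 1, and exp is
convex. -/
theorem exp_inner_le_trace (hA : A.IsSymm) {u : Vec d} (hu : ‖u‖ = 1) :
    Real.exp (inner ℝ u (toEuclideanLin A u)) ≤ (NormedSpace.exp A).trace := by
  obtain ⟨b, c, h⟩ := exists_eigenbasis hA
  have hs := sum_sq_inner_basis b u
  rw [hu, one_pow] at hs
  set a := inner ℝ u (toEuclideanLin A u) with ha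
  have ha' : a = ∑ i, c i * inner ℝ (b i) u ^ 2 := by
    rw [ha, inner_toEuclideanLin_eq_sum b h]
    simp only [pow_two]
  have htr : (NormedSpace.exp A).trace = ∑ i, Real.exp (c i) := by
    rw [trace_eq_sum_inner_basis b]
    refine Finset.sum_congr rfl fun i _ => ?_
    rw [toEuclideanLin_exp_apply_of_eigen (h i), inner_smul_right, real_inner_self_eq_norm_sq,
      b.norm_eq_one]
    simp
  -- Jensen's inequality by means of the tangent of exp at `a`, whose linear part averages to 0.
  calc Real.exp a = ∑ i, Real.exp a * (1 + (c i - a)) * inner ℝ (b i) u ^ 2 := by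
        have : ∑ i, Real.exp a * (1 + (c i - a)) * inner ℝ (b i) u ^ 2 =
            Real.exp a * ((1 - a) * ∑ i, inner ℝ (b i) u ^ 2 + ∑ i, c i * inner ℝ (b i) u ^ 2) := by
          rw [Finset.mul_sum, ← Finset.sum_add_distrib, Finset.mul_sum]
          refine Finset.sum_congr rfl fun i _ => ?_
          ring
        rw [this, hs, ← ha']
        ring
    _ ≤ ∑ i, Real.exp (c i) := by
        refine Finset.sum_le_sum fun i _ => ?_
        have h1 : inner ℝ (b i) u ^ 2 ≤ 1 := by
          rw [← hs]
          exact Finset.single_le_sum (f := fun i => inner ℝ (b i) u ^ 2)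
            (fun j _ => sq_nonneg _) (Finset.mem_univ i)
        have h2 : Real.exp a * (1 + (c i - a)) ≤ Real.exp (c i) := by
          have := Real.add_one_le_exp (c i - a)
          calc Real.exp a * (1 + (c i - a)) ≤ Real.exp a * Real.exp (c i - a) := by
                gcongr; linarith
            _ = Real.exp (c i) := by rw [← Real.exp_add]; congr 1; ring
        have h3 := Real.exp_pos (c i)
        nlinarith [sq_nonneg (inner ℝ (b i) u)]
    _ = _ := htr.symm

theorem trace_exp_mul_le (hA : A.IsSymm) {Q : Matrix (Fin d) (Fin d) ℝ} {q : ℝ}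
    (hQ : ∀ u, inner ℝ u (toEuclideanLin Q u) ≤ q * ‖u‖ ^ 2) :
    (NormedSpace.exp A * Q).trace ≤ q * (NormedSpace.exp A).trace := by
  obtain ⟨b, c, h⟩ := exists_eigenbasis hA
  rw [trace_eq_sum_inner_basis b, trace_eq_sum_inner_basis b (NormedSpace.exp A), Finset.mul_sum]
  refine Finset.sum_le_sum fun i _ => ?_
  rw [toEuclideanLin_mul_apply, ← inner_toEuclideanLin_left hA.exp,
    toEuclideanLin_exp_apply_of_eigen (h i), inner_smul_left, inner_smul_right,
    real_inner_self_eq_norm_sq, b.norm_eq_one]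
  have := hQ (b i)
  rw [b.norm_eq_one] at this
  have h3 := Real.exp_pos (c i)
  simp only [conj_trivial]
  nlinarith

/-- Cauchy–Schwarz in an eigenbasis. It provides the integrability of the entries of the random
exponentials below. -/
theorem abs_exp_entry_le (hA : A.IsSymm) {L : ℝ}
    (hL : ∀ u, ‖toEuclideanLin A u‖ ≤ L * ‖u‖) (i j : Fin d) :
    |NormedSpace.exp A i j| ≤ Real.exp L := by
  obtain ⟨b, c, h⟩ := exists_eigenbasis hA
  have he : NormedSpace.exp A i j = inner ℝ (EuclideanSpace.single i (1 : ℝ))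
      (toEuclideanLin (NormedSpace.exp A) (EuclideanSpace.single j 1)) := by
    simp [toEuclideanLin, toLpLin_apply, EuclideanSpace.inner_single_left]
  rw [he, inner_toEuclideanLin_eq_sum b (fun i => toEuclideanLin_exp_apply_of_eigen (h i))]
  set x : Vec d := EuclideanSpace.single i 1
  set y : Vec d := EuclideanSpace.single j 1
  have hx := sum_sq_inner_basis b x
  have hy := sum_sq_inner_basis b y
  have hx1 : ‖x‖ = 1 := by simp [x]
  have hy1 : ‖y‖ = 1 := by simp [y]
  rw [hx1] at hx
  rw [hy1] at hy
  calc _ ≤ ∑ k, Real.exp L * ((inner ℝ (b k) x ^ 2 + inner ℝ (b k) y ^ 2) / 2) := by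
        refine (Finset.abs_sum_le_sum_abs _ _).trans (Finset.sum_le_sum fun k _ => ?_)
        rw [abs_mul, abs_of_pos (Real.exp_pos _)]
        refine mul_le_mul (Real.exp_le_exp.mpr ?_) ?_ (abs_nonneg _) (Real.exp_pos _).le
        · exact (le_abs_self _).trans (abs_eigenvalue_le (b.norm_eq_one k) (h k) (hL _))
        · rw [abs_le]
          constructor <;> nlinarith [sq_nonneg (inner ℝ (b k) x + inner ℝ (b k) y),
            sq_nonneg (inner ℝ (b k) x - inner ℝ (b k) y)]
    _ = Real.exp L := by
        rw [← Finset.mul_sum, ← Finset.sum_div, Finset.sum_add_distrib, hx, hy]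
        ring

/-- A symmetric matrix is bounded by its quadratic form. -/
theorem norm_toEuclideanLin_le_of_quadratic (hA : A.IsSymm) {γ : ℝ}
    (h : ∀ u, |inner ℝ u (toEuclideanLin A u)| ≤ γ * ‖u‖ ^ 2) (u : Vec d) :
    ‖toEuclideanLin A u‖ ≤ γ * ‖u‖ := by
  obtain ⟨b, c, hb⟩ := exists_eigenbasis hA
  by_cases hd : d = 0
  · subst hd
    simp [Subsingleton.elim u 0]
  have hc : ∀ i, |c i| ≤ γ := by
    intro i
    have := h (b i)
    rwa [hb, inner_smul_right, real_inner_self_eq_norm_sq, b.norm_eq_one, one_pow, mul_one,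
      mul_one] at this
  have hγ : 0 ≤ γ := (abs_nonneg _).trans (hc ⟨0, Nat.pos_of_ne_zero hd⟩)
  have h2 : ‖toEuclideanLin A u‖ ^ 2 = inner ℝ u (toEuclideanLin (A ^ 2) u) := by
    rw [pow_two A, toEuclideanLin_mul_apply, ← inner_toEuclideanLin_left hA,
      real_inner_self_eq_norm_sq]
  refine abs_le_of_sq_le_sq' ?_ (by positivity) |>.2
  rw [h2, inner_toEuclideanLin_eq_sum b (fun i => toEuclideanLin_pow_apply_of_eigen (hb i) 2),
    mul_pow, ← sum_sq_inner_basis b, Finset.mul_sum]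
  refine Finset.sum_le_sum fun i _ => ?_
  rw [← pow_two]
  exact mul_le_mul_of_nonneg_right (sq_le_sq' (abs_le.mp (hc i)).1 (abs_le.mp (hc i)).2)
    (sq_nonneg _)

end Symmetric

/-! ### The matrix Bernstein inequality -/

section Bernstein

open Matrix

theorem indepFun_of_measurable {Ω α β : Type*} [mα : MeasurableSpace α] [mβ : MeasurableSpace β]
    {m₁ m₂ : MeasurableSpace Ω} [mΩ : MeasurableSpace Ω] {μ : Measure Ω} (h : Indep m₁ m₂ μ)
    {f : Ω → α} {g : Ω → β} (hf : Measurable[m₁] f) (hg : Measurable[m₂] g) : f ⟂ᵢ[μ] g :=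
  (IndepFun_iff_Indep f g μ).mpr (indep_of_indep_of_le h hf.comap_le hg.comap_le)

variable {Ω ι : Type*} {d : ℕ}

open scoped Matrix.Norms.L2Operator in
theorem measurable_exp_entry [MeasurableSpace Ω] {S : Ω → Matrix (Fin d) (Fin d) ℝ}
    (hS : ∀ a b, Measurable fun ω => S ω a b) (a b : Fin d) :
    Measurable fun ω => NormedSpace.exp (S ω) a b := by
  let _ : NormedAlgebra ℚ (Matrix (Fin d) (Fin d) ℝ) := NormedAlgebra.restrictScalars ℚ ℝ _
  have h1 : Continuous fun M : Fin d → Fin d → ℝ => NormedSpace.exp (Matrix.of M) a b :=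
    (NormedSpace.exp_continuous (𝔸 := Matrix (Fin d) (Fin d) ℝ)).matrix_elem a b
  have hm : Measurable fun ω a b => S ω a b :=
    measurable_pi_lambda _ fun a => measurable_pi_lambda _ fun b => hS a b
  exact h1.measurable.comp hm

variable [mΩ : MeasurableSpace Ω] {μ : Measure Ω} [IsProbabilityMeasure μ]
  {X : ι → Ω → Fin d → Fin d → ℝ}

omit [IsProbabilityMeasure μ] in
theorem integral_inner_toEuclideanLin {M : Ω → Matrix (Fin d) (Fin d) ℝ}
    (hM : ∀ a b, Integrable (fun ω => M ω a b) μ) (u v : Vec d) :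
    Integrable (fun ω => inner ℝ u (toEuclideanLin (M ω) v)) μ ∧
    ∫ ω, inner ℝ u (toEuclideanLin (M ω) v) ∂μ =
      inner ℝ u (toEuclideanLin (Matrix.of fun a b => ∫ ω, M ω a b ∂μ) v) := by
  have h : ∀ N : Matrix (Fin d) (Fin d) ℝ,
      inner ℝ u (toEuclideanLin N v) = ∑ a, ∑ b, N a b * (u a * v b) := by
    intro N
    rw [toEuclideanLin, toLpLin_apply, EuclideanSpace.inner_eq_star_dotProduct]
    simp only [dotProduct, mulVec, star_trivial, Finset.sum_mul]
    exact Finset.sum_congr rfl fun a _ => Finset.sum_congr rfl fun b _ => by ring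
  simp only [h, of_apply]
  constructor
  · exact integrable_finsetSum _ fun a _ => integrable_finsetSum _ fun b _ =>
      (hM a b).mul_const _
  · rw [integral_finsetSum _ fun a _ => integrable_finsetSum _ fun b _ => (hM a b).mul_const _]
    refine Finset.sum_congr rfl fun a _ => ?_
    rw [integral_finsetSum _ fun b _ => (hM a b).mul_const _]
    exact Finset.sum_congr rfl fun b _ => integral_mul_const _ _

/-- One summand is split off at a time. Golden–Thompson separates its exponential, independence
replaces that exponential by its mean, and the mean is at most 1 + v as a quadratic form, because
exp X ≤ 1 + X + X² and X is centred. The empty sum contributes the trace d of the identity. -/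
theorem integral_trace_exp_sum_le [Nonempty (Fin d)] (hXm : ∀ i, Measurable (X i))
    (hind : iIndepFun X μ) (hsymm : ∀ i ω, (Matrix.of (X i ω)).IsSymm)
    (h1 : ∀ i, ∀ᵐ ω ∂μ, ∀ u, ‖toEuclideanLin (Matrix.of (X i ω)) u‖ ≤ ‖u‖)
    (hmean : ∀ i a b, ∫ ω, X i ω a b ∂μ = 0) {v : ℝ} (hv : 0 ≤ v)
    (hvar : ∀ i u, ∫ ω, ‖toEuclideanLin (Matrix.of (X i ω)) u‖ ^ 2 ∂μ ≤ v * ‖u‖ ^ 2)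
    (s : Finset ι) :
    Integrable (fun ω => (NormedSpace.exp (∑ i ∈ s, Matrix.of (X i ω))).trace) μ ∧
      ∫ ω, (NormedSpace.exp (∑ i ∈ s, Matrix.of (X i ω))).trace ∂μ ≤ d * (1 + v) ^ s.card := by
  classical
  have hentry : ∀ i a b, Measurable fun ω => X i ω a b := fun i a b =>
    (measurable_pi_apply b).comp ((measurable_pi_apply a).comp (hXm i))
  have hSm : ∀ s : Finset ι, ∀ a b,
      Measurable fun ω => (∑ i ∈ s, Matrix.of (X i ω)) a b := by
    intro s a b
    simp only [Matrix.sum_apply, of_apply]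
    exact Finset.measurable_sum _ fun i _ => hentry i a b
  have hSsymm : ∀ (s : Finset ι) ω, (∑ i ∈ s, Matrix.of (X i ω)).IsSymm := by
    intro s ω
    rw [IsSymm, transpose_sum]
    exact Finset.sum_congr rfl fun i _ => (hsymm i ω).eq
  have hSb : ∀ s : Finset ι, ∀ᵐ ω ∂μ, ∀ u,
      ‖toEuclideanLin (∑ i ∈ s, Matrix.of (X i ω)) u‖ ≤ s.card * ‖u‖ := by
    intro s
    have := (ae_ball_iff (μ := μ) s.countable_toSet (p := fun ω i _ => ∀ u,
      ‖toEuclideanLin (Matrix.of (X i ω)) u‖ ≤ ‖u‖)).mpr fun i _ => h1 i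
    filter_upwards [this] with ω hω u
    rw [map_sum, LinearMap.sum_apply]
    refine (norm_sum_le _ _).trans ?_
    rw [← nsmul_eq_mul, ← Finset.sum_const]
    exact Finset.sum_le_sum fun i hi => hω i hi u
  have hEint : ∀ (s : Finset ι) a b,
      Integrable (fun ω => NormedSpace.exp (∑ i ∈ s, Matrix.of (X i ω)) a b) μ := by
    intro s a b
    refine Integrable.of_bound (measurable_exp_entry (hSm s) a b).aestronglyMeasurable
      (Real.exp s.card) ?_
    filter_upwards [hSb s] with ω hω
    exact abs_exp_entry_le (hSsymm s ω) hω a b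
  have hXint : ∀ i a b, Integrable (fun ω => X i ω a b) μ := by
    intro i a b
    refine Integrable.of_bound (hentry i a b).aestronglyMeasurable 1 ?_
    filter_upwards [h1 i] with ω hω
    have h2 := hω (EuclideanSpace.single b 1)
    have h3 : X i ω a b = inner ℝ (EuclideanSpace.single a (1 : ℝ))
        (toEuclideanLin (Matrix.of (X i ω)) (EuclideanSpace.single b 1)) := by
      simp [toEuclideanLin, toLpLin_apply, EuclideanSpace.inner_single_left]
    rw [h3]
    refine (norm_inner_le_norm _ _).trans ?_
    simpa using h2
  have hTint : ∀ s : Finset ι,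
      Integrable (fun ω => (NormedSpace.exp (∑ i ∈ s, Matrix.of (X i ω))).trace) μ := by
    intro s
    simp only [trace, diag_apply]
    exact integrable_finsetSum _ fun a _ => hEint s a a
  refine ⟨hTint s, ?_⟩
  induction s using Finset.induction_on with
  | empty => simp
  | insert i s hi ih =>
    set Q : Matrix (Fin d) (Fin d) ℝ :=
      Matrix.of fun a b => ∫ ω, NormedSpace.exp (Matrix.of (X i ω)) a b ∂μ with hQdef
    have hEX : ∀ a b, Integrable (fun ω => NormedSpace.exp (Matrix.of (X i ω)) a b) μ := by
      intro a b
      simpa using hEint {i} a b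
    have hQ : ∀ u, inner ℝ u (toEuclideanLin Q u) ≤ (1 + v) * ‖u‖ ^ 2 := by
      intro u
      have e1 := integral_inner_toEuclideanLin hEX u u
      have e2 := integral_inner_toEuclideanLin (M := fun ω => Matrix.of (X i ω)) (hXint i) u u
      have e3 : Integrable (fun ω => ‖toEuclideanLin (Matrix.of (X i ω)) u‖ ^ 2) μ := by
        refine Integrable.of_bound (C := ‖u‖ ^ 2) ?_ ?_
        · refine Measurable.aestronglyMeasurable ?_
          simp only [EuclideanSpace.norm_sq_eq]
          refine Finset.measurable_sum _ fun a _ => ?_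
          simp only [toEuclideanLin, toLpLin_apply, mulVec, dotProduct, of_apply]
          exact (Finset.measurable_sum _ fun b _ => (hentry i a b).mul_const _).norm.pow_const 2
        · filter_upwards [h1 i] with ω hω
          rw [Real.norm_eq_abs, abs_of_nonneg (sq_nonneg _)]
          exact pow_le_pow_left₀ (norm_nonneg _) (hω u) 2
      have e4 : inner ℝ u (toEuclideanLin (Matrix.of fun a b => ∫ ω, Matrix.of (X i ω) a b ∂μ) u)
          = 0 := by
        simp only [of_apply, hmean]
        have : (Matrix.of fun _ _ => (0 : ℝ) : Matrix (Fin d) (Fin d) ℝ) = 0 := rfl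
        rw [this, map_zero]
        simp
      rw [e4] at e2
      rw [hQdef, ← e1.2]
      calc _ ≤ ∫ ω, (‖u‖ ^ 2 + inner ℝ u (toEuclideanLin (Matrix.of (X i ω)) u) +
              ‖toEuclideanLin (Matrix.of (X i ω)) u‖ ^ 2) ∂μ := by
            refine integral_mono_ae e1.1 (((integrable_const _).add e2.1).add e3) ?_
            filter_upwards [h1 i] with ω hω
            exact inner_exp_le (hsymm i ω) hω u
        _ = ‖u‖ ^ 2 + 0 + ∫ ω, ‖toEuclideanLin (Matrix.of (X i ω)) u‖ ^ 2 ∂μ := by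
            have e5 : Integrable (fun ω => ‖u‖ ^ 2 +
                inner ℝ u (toEuclideanLin (Matrix.of (X i ω)) u)) μ :=
              (integrable_const _).add e2.1
            rw [integral_add e5 e3, integral_add (integrable_const _) e2.1, e2.2]
            simp
        _ ≤ (1 + v) * ‖u‖ ^ 2 := by linarith [hvar i u]
    have hindep : ∀ a b c e, (fun ω => NormedSpace.exp (∑ i ∈ s, Matrix.of (X i ω)) a b) ⟂ᵢ[μ]
        (fun ω => NormedSpace.exp (Matrix.of (X i ω)) c e) := by
      intro a b c e
      have hd : Disjoint (s : Set ι) {i} := by simpa using hi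
      refine indepFun_of_measurable (indep_sig hXm hind hd) ?_ ?_
      · refine @measurable_exp_entry Ω d (sig X s) _ (fun a b => ?_) a b
        simp only [Matrix.sum_apply, of_apply]
        refine Finset.measurable_sum _ fun j hj => ?_
        exact (measurable_pi_apply b).comp ((measurable_pi_apply a).comp
          (measurable_sig X (Finset.mem_coe.mpr hj)))
      · refine @measurable_exp_entry Ω d (sig X {i}) _ (fun a b => ?_) c e
        exact (measurable_pi_apply b).comp ((measurable_pi_apply a).comp
          (measurable_sig X (Set.mem_singleton i)))
    have hprod : ∀ a b, Integrable (fun ω => NormedSpace.exp (∑ i ∈ s, Matrix.of (X i ω)) a b *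
        NormedSpace.exp (Matrix.of (X i ω)) b a) μ := fun a b =>
      (hindep a b b a).integrable_mul (hEint s a b) (hEX b a)
    calc ∫ ω, (NormedSpace.exp (∑ j ∈ insert i s, Matrix.of (X j ω))).trace ∂μ
        ≤ ∫ ω, (NormedSpace.exp (∑ i ∈ s, Matrix.of (X i ω)) *
            NormedSpace.exp (Matrix.of (X i ω))).trace ∂μ := by
          refine integral_mono (hTint _) ?_ fun ω => ?_
          · simp only [trace, diag_apply, mul_apply]
            exact integrable_finsetSum _ fun a _ => integrable_finsetSum _ fun b _ => hprod a b
          · simp only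
            rw [Finset.sum_insert hi, add_comm]
            exact trace_exp_add_le (hSsymm s ω) (hsymm i ω)
      _ = ∫ ω, (NormedSpace.exp (∑ i ∈ s, Matrix.of (X i ω)) * Q).trace ∂μ := by
          simp only [trace, diag_apply, mul_apply]
          rw [integral_finsetSum _ fun a _ => integrable_finsetSum _ fun b _ => hprod a b,
            integral_finsetSum _ fun a _ => integrable_finsetSum _ fun b _ =>
              (hEint s a b).mul_const _]
          refine Finset.sum_congr rfl fun a _ => ?_
          rw [integral_finsetSum _ fun b _ => hprod a b,
            integral_finsetSum _ fun b _ => (hEint s a b).mul_const _]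
          refine Finset.sum_congr rfl fun b _ => ?_
          rw [(hindep a b b a).integral_fun_mul_eq_mul_integral
            (hEint s a b).aestronglyMeasurable (hEX b a).aestronglyMeasurable, integral_mul_const]
          rfl
      _ ≤ ∫ ω, (1 + v) * (NormedSpace.exp (∑ i ∈ s, Matrix.of (X i ω))).trace ∂μ := by
          refine integral_mono ?_ ((hTint s).const_mul _) fun ω => trace_exp_mul_le (hSsymm s ω) hQ
          simp only [trace, diag_apply, mul_apply]
          exact integrable_finsetSum _ fun a _ => integrable_finsetSum _ fun b _ =>
            (hEint s a b).mul_const _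
      _ = (1 + v) * ∫ ω, (NormedSpace.exp (∑ i ∈ s, Matrix.of (X i ω))).trace ∂μ :=
          integral_const_mul _ _
      _ ≤ (1 + v) * (d * (1 + v) ^ s.card) := mul_le_mul_of_nonneg_left ih (by linarith)
      _ = d * (1 + v) ^ (insert i s).card := by rw [Finset.card_insert_of_notMem hi]; ring

/-- An upper tail bound for the largest eigenvalue of a sum of independent centred bounded
symmetric random matrices. -/
theorem matrix_bernstein [Fintype ι] (hXm : ∀ i, Measurable (X i))
    (hind : iIndepFun X μ) (hsymm : ∀ i ω, (Matrix.of (X i ω)).IsSymm) {L θ v t : ℝ} (hθ : 0 < θ)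
    (hθL : θ * L ≤ 1)
    (hL : ∀ i, ∀ᵐ ω ∂μ, ∀ u, ‖toEuclideanLin (Matrix.of (X i ω)) u‖ ≤ L * ‖u‖)
    (hmean : ∀ i a b, ∫ ω, X i ω a b ∂μ = 0) (hv : 0 ≤ v)
    (hvar : ∀ i u, ∫ ω, ‖toEuclideanLin (Matrix.of (X i ω)) u‖ ^ 2 ∂μ ≤ v * ‖u‖ ^ 2) :
    μ.real {ω | ∃ u, t * ‖u‖ ^ 2 < inner ℝ u (toEuclideanLin (∑ i, Matrix.of (X i ω)) u)} ≤
      d * Real.exp (Fintype.card ι * (θ ^ 2 * v) - θ * t) := by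
  rcases Nat.eq_zero_or_pos d with hd | hd
  · subst hd
    have : {ω | ∃ u : Vec 0, t * ‖u‖ ^ 2 <
        inner ℝ u (toEuclideanLin (∑ i, Matrix.of (X i ω)) u)} = ∅ := by
      ext ω
      simp only [Set.mem_ofPred_eq, Set.mem_empty_iff_false, iff_false, not_exists]
      intro u
      simp [Subsingleton.elim u 0]
    rw [this]
    simp
  have : Nonempty (Fin d) := ⟨⟨0, hd⟩⟩
  have hmap : ∀ _ : ι, Measurable (fun (M : Fin d → Fin d → ℝ) (a b : Fin d) => θ * M a b) := by
    intro i
    fun_prop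
  have hof : ∀ i ω, Matrix.of (fun a b => θ * X i ω a b) = θ • Matrix.of (X i ω) := fun i ω => rfl
  have key := integral_trace_exp_sum_le (μ := μ) (X := fun i ω a b => θ * X i ω a b) (v := θ ^ 2 * v)
    (fun i => (hmap i).comp (hXm i)) (hind.comp _ hmap) (fun i ω => by
      rw [hof]; exact (hsymm i ω).smul θ)
    (fun i => by
      filter_upwards [hL i] with ω hω u
      rw [hof, map_smul, LinearMap.smul_apply, norm_smul, Real.norm_eq_abs, abs_of_pos hθ]
      have := hω u
      nlinarith [norm_nonneg u])
    (fun i a b => by rw [integral_const_mul, hmean, mul_zero]) (by positivity)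
    (fun i u => by
      simp only [hof, map_smul, LinearMap.smul_apply, norm_smul, mul_pow]
      rw [integral_const_mul, Real.norm_eq_abs, sq_abs, mul_assoc]
      exact mul_le_mul_of_nonneg_left (hvar i u) (sq_nonneg _)) Finset.univ
  simp only [hof, ← Finset.smul_sum] at key
  set S : Ω → Matrix (Fin d) (Fin d) ℝ := fun ω => ∑ i, Matrix.of (X i ω)
  have hSs : ∀ ω, (θ • S ω).IsSymm := by
    intro ω
    refine IsSymm.smul ?_ θ
    rw [IsSymm, transpose_sum]
    exact Finset.sum_congr rfl fun i _ => (hsymm i ω).eq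
  -- A direction in which the form of `S` exceeds t forces the trace of exp(θS) up to exp(θt), and
  -- Markov's inequality applies to this trace.
  have hsub : {ω | ∃ u, t * ‖u‖ ^ 2 < inner ℝ u (toEuclideanLin (S ω) u)} ⊆
      {ω | Real.exp (θ * t) ≤ (NormedSpace.exp (θ • S ω)).trace} := by
    rintro ω ⟨u, hu⟩
    have hu0 : u ≠ 0 := by
      rintro rfl
      simp at hu
    have hun : 0 < ‖u‖ := norm_pos_iff.mpr hu0
    refine le_trans ?_ (exp_inner_le_trace (hSs ω) (u := ‖u‖⁻¹ • u)
      (by rw [norm_smul, norm_inv, norm_norm, inv_mul_cancel₀ hun.ne']))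
    apply Real.exp_le_exp.mpr
    rw [map_smul, map_smul, LinearMap.smul_apply, inner_smul_left, inner_smul_right,
      inner_smul_right]
    simp only [conj_trivial]
    calc θ * t = ‖u‖⁻¹ * (θ * (‖u‖⁻¹ * (t * ‖u‖ ^ 2))) := by field_simp
      _ ≤ ‖u‖⁻¹ * (θ * (‖u‖⁻¹ * inner ℝ u (toEuclideanLin (S ω) u))) := by gcongr
      _ = _ := by ring
  have hnn : 0 ≤ᵐ[μ] fun ω => (NormedSpace.exp (θ • S ω)).trace := by
    refine Filter.Eventually.of_forall fun ω => ?_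
    refine le_trans (Real.exp_pos _).le (exp_inner_le_trace (hSs ω)
      (u := EuclideanSpace.single ⟨0, hd⟩ (1 : ℝ)) (by simp))
  refine (measureReal_mono hsub).trans ?_
  refine (measureReal_ge_le_integral_div hnn key.1 (Real.exp_pos _)).trans ?_
  rw [Real.exp_sub, ← mul_div_assoc]
  refine div_le_div_of_nonneg_right (key.2.trans ?_) (Real.exp_pos _).le
  refine mul_le_mul_of_nonneg_left ?_ (Nat.cast_nonneg d)
  rw [Finset.card_univ, Real.exp_nat_mul]
  refine pow_le_pow_left₀ (by positivity) ?_ _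
  linarith [Real.add_one_le_exp (θ ^ 2 * v)]

end Bernstein

/-! ### Projections and perturbation of singular subspaces -/

section Subspace

open Matrix

variable {d : ℕ}

theorem toEuclideanLin_vecMulVec (x y z : Vec d) :
    toEuclideanLin (vecMulVec x y) z = inner ℝ y z • x := by
  ext i
  simp only [toEuclideanLin, toLpLin_apply, mulVec, dotProduct, vecMulVec_apply,
    PiLp.smul_apply, smul_eq_mul, PiLp.inner_apply, RCLike.inner_apply, conj_trivial]
  rw [Finset.sum_mul]
  exact Finset.sum_congr rfl fun j _ => by ring

theorem exists_orthonormalBasis_eq {u : Fin d → Vec d} (hu : Orthonormal ℝ u) :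
    ∃ b : OrthonormalBasis (Fin d) ℝ (Vec d), ∀ i, b i = u i := by
  rcases Nat.eq_zero_or_pos d with hd | hd
  · subst hd
    exact ⟨EuclideanSpace.basisFun _ _, fun i => i.elim0⟩
  have : Nonempty (Fin d) := ⟨⟨0, hd⟩⟩
  have hc : Fintype.card (Fin d) = Module.finrank ℝ (Vec d) := by simp
  refine ⟨(basisOfOrthonormalOfCardEqFinrank hu hc).toOrthonormalBasis (by simpa using hu),
    fun i => by simp⟩

theorem toEuclideanLin_projectionMatrix (u : Fin d → Vec d) (ℓ : ℕ) (x : Vec d) :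
    toEuclideanLin (projectionMatrix u ℓ) x =
      ∑ i ∈ Finset.univ.filter (fun i : Fin d => (i : ℕ) < ℓ), inner ℝ (u i) x • u i := by
  rw [projectionMatrix, map_sum, LinearMap.sum_apply]
  exact Finset.sum_congr rfl fun i _ => toEuclideanLin_vecMulVec _ _ _

theorem inner_projectionMatrix {u : Fin d → Vec d} (hu : Orthonormal ℝ u) (ℓ : ℕ) (x : Vec d)
    (i : Fin d) : inner ℝ (u i) (toEuclideanLin (projectionMatrix u ℓ) x) =
      if (i : ℕ) < ℓ then inner ℝ (u i) x else 0 := by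
  rw [toEuclideanLin_projectionMatrix, inner_sum]
  simp only [inner_smul_right, orthonormal_iff_ite.mp hu, mul_ite, mul_one, mul_zero]
  rw [Finset.sum_ite_eq]
  simp

theorem inner_projectionMatrix_projectionMatrix {u : Fin d → Vec d} (hu : Orthonormal ℝ u)
    (ℓ : ℕ) (x y : Vec d) :
    inner ℝ (toEuclideanLin (projectionMatrix u ℓ) x) (toEuclideanLin (projectionMatrix u ℓ) y) =
      inner ℝ x (toEuclideanLin (projectionMatrix u ℓ) y) := by
  conv_lhs => rw [toEuclideanLin_projectionMatrix u ℓ x]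
  conv_rhs => rw [toEuclideanLin_projectionMatrix u ℓ y]
  rw [sum_inner, inner_sum]
  refine Finset.sum_congr rfl fun i hi => ?_
  rw [inner_smul_left, inner_smul_right, inner_projectionMatrix hu,
    if_pos (Finset.mem_filter.mp hi).2, conj_trivial, real_inner_comm x, mul_comm]

theorem norm_sq_projectionMatrix {u : Fin d → Vec d} (hu : Orthonormal ℝ u) (ℓ : ℕ) (x : Vec d) :
    ‖toEuclideanLin (projectionMatrix u ℓ) x‖ ^ 2 =
      ∑ i ∈ Finset.univ.filter (fun i : Fin d => (i : ℕ) < ℓ), inner ℝ (u i) x ^ 2 := by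
  rw [← real_inner_self_eq_norm_sq, inner_projectionMatrix_projectionMatrix hu,
    toEuclideanLin_projectionMatrix, inner_sum]
  refine Finset.sum_congr rfl fun i _ => ?_
  rw [inner_smul_right, real_inner_comm x, pow_two]

theorem card_filter_lt_le (d ℓ : ℕ) :
    (Finset.univ.filter (fun i : Fin d => (i : ℕ) < ℓ)).card ≤ ℓ := by
  calc _ = ((Finset.univ.filter (fun i : Fin d => (i : ℕ) < ℓ)).map Fin.valEmbedding).card :=
        (Finset.card_map _).symm
    _ ≤ (Finset.range ℓ).card := by
        refine Finset.card_le_card fun i hi => ?_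
        obtain ⟨j, hj, rfl⟩ := Finset.mem_map.mp hi
        exact Finset.mem_range.mpr (Finset.mem_filter.mp hj).2
    _ = ℓ := Finset.card_range ℓ

theorem inner_sub_projectionMatrix {u : Fin d → Vec d} (hu : Orthonormal ℝ u) (ℓ : ℕ)
    (x : Vec d) : inner ℝ x (x - toEuclideanLin (projectionMatrix u ℓ) x) =
      ‖x - toEuclideanLin (projectionMatrix u ℓ) x‖ ^ 2 := by
  have h := inner_projectionMatrix_projectionMatrix hu ℓ x x
  rw [← real_inner_self_eq_norm_sq]
  simp only [inner_sub_left, inner_sub_right]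
  rw [h, real_inner_comm x]
  have := real_inner_comm x (toEuclideanLin (projectionMatrix u ℓ) x)
  linarith

theorem IsSingularSystem.norm_sq_toEuclideanLin {A : Matrix (Fin d) (Fin d) ℝ} {u : Fin d → Vec d}
    (h : IsSingularSystem A u) (hA : A.IsSymm) (x : Vec d) :
    ‖toEuclideanLin A x‖ ^ 2 = ∑ i, ‖toEuclideanLin A (u i)‖ ^ 2 * inner ℝ (u i) x ^ 2 := by
  obtain ⟨b, hb⟩ := exists_orthonormalBasis_eq h.orthonormal
  have e := h.eigen
  simp only [← hb] at e ⊢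
  rw [hA.eq] at e
  rw [← real_inner_self_eq_norm_sq, inner_toEuclideanLin_left hA, ← toEuclideanLin_mul_apply,
    inner_toEuclideanLin_eq_sum b e]
  simp only [pow_two]

/-- Vectors orthogonal to the first `ℓ` singular vectors are mapped to short vectors. -/
theorem IsSingularSystem.norm_le_of_orthogonal {A : Matrix (Fin d) (Fin d) ℝ} {u : Fin d → Vec d}
    (h : IsSingularSystem A u) (hA : A.IsSymm) {ℓ : ℕ} (hℓ : ℓ < d) {x : Vec d}
    (hx : ∀ i : Fin d, (i : ℕ) < ℓ → inner ℝ (u i) x = 0) :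
    ‖toEuclideanLin A x‖ ≤ ‖toEuclideanLin A (u ⟨ℓ, hℓ⟩)‖ * ‖x‖ := by
  obtain ⟨b, hb⟩ := exists_orthonormalBasis_eq h.orthonormal
  refine le_of_sq_le_sq ?_ (by positivity)
  rw [h.norm_sq_toEuclideanLin hA, mul_pow, ← sum_sq_inner_basis b x, Finset.mul_sum]
  refine Finset.sum_le_sum fun i _ => ?_
  rw [hb]
  by_cases hi : (i : ℕ) < ℓ
  · simp [hx i hi]
  · refine mul_le_mul_of_nonneg_right ?_ (sq_nonneg _)
    exact pow_le_pow_left₀ (norm_nonneg _) (h.antitone _ _ (by simpa [Fin.le_def] using hi)) 2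

/-- The top singular vectors of a perturbation of `M` almost contain each direction that `M`
dominates. -/
theorem norm_sub_projection_le {A M : Matrix (Fin d) (Fin d) ℝ} {u : Fin d → Vec d}
    (h : IsSingularSystem A u) (hA : A.IsSymm) (hM : M.IsSymm) {ℓ : ℕ} {γ ν α : ℝ}
    (hγ : 0 ≤ γ) (hν : 0 ≤ ν)
    (hAM : ∀ y, |inner ℝ y (toEuclideanLin (A - M) y)| ≤ γ * ‖y‖ ^ 2)
    (hF : ℓ < d → ∃ F : Fin ℓ → Vec d, ∀ y, (∀ i, inner ℝ (F i) y = 0) →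
      ‖toEuclideanLin M y‖ ≤ ν * ‖y‖)
    {G : Vec d} (hG : ∀ y, α * inner ℝ G y ^ 2 ≤ inner ℝ y (toEuclideanLin M y)) :
    α * ‖G - toEuclideanLin (projectionMatrix u ℓ) G‖ ^ 2 ≤ ν + 2 * γ := by
  set y := G - toEuclideanLin (projectionMatrix u ℓ) G with hy
  obtain ⟨b, hb⟩ := exists_orthonormalBasis_eq h.orthonormal
  have hyi : ∀ i : Fin d, (i : ℕ) < ℓ → inner ℝ (u i) y = 0 := by
    intro i hi
    rw [hy, inner_sub_right, inner_projectionMatrix h.orthonormal, if_pos hi, sub_self]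
  by_cases hy0 : y = 0
  · rw [hy0]
    simp
    positivity
  -- For ℓ ≥ d the projection is the identity and y vanishes.
  have hℓ : ℓ < d := by
    by_contra hc
    apply hy0
    rw [← norm_eq_zero, ← sq_eq_zero_iff, ← sum_sq_inner_basis b]
    refine Finset.sum_eq_zero fun i _ => ?_
    rw [hb, hyi i (by have := i.2; omega)]
    simp
  have hyp : 0 < ‖y‖ := norm_pos_iff.mpr hy0
  set s := ‖toEuclideanLin A (u ⟨ℓ, hℓ⟩)‖ with hs
  have hAMsymm : (A - M).IsSymm := by
    rw [IsSymm, transpose_sub, hA.eq, hM.eq]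
  -- Courant–Fischer: the span of the first ℓ + 1 singular vectors contains a nonzero vector
  -- orthogonal to the ℓ vectors `F i`. On it `A` stretches by at least s, `M` by at most ν, and `A
  -- - M` by at most γ.
  have hsν : s ≤ ν + γ := by
    obtain ⟨F, hF⟩ := hF hℓ
    let φ : (Fin (ℓ + 1) → ℝ) →ₗ[ℝ] Vec d :=
      Fintype.linearCombination ℝ fun j : Fin (ℓ + 1) => u (Fin.castLE hℓ j)
    let ψ : (Fin (ℓ + 1) → ℝ) →ₗ[ℝ] (Fin ℓ → ℝ) :=
      LinearMap.pi fun i => (innerₛₗ ℝ (F i)).comp φ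
    have hker : LinearMap.ker ψ ≠ ⊥ := by
      apply LinearMap.ker_ne_bot_of_finrank_lt
      simp
    obtain ⟨c, hc, hc0⟩ := Submodule.exists_mem_ne_zero_of_ne_bot hker
    have hφ : φ c = ∑ j, c j • u (Fin.castLE hℓ j) := Fintype.linearCombination_apply ℝ _ c
    have hxF : ∀ i, inner ℝ (F i) (φ c) = 0 := fun i => congrFun (LinearMap.mem_ker.mp hc) i
    have hx1 : ∀ i : Fin d, ∀ hi : (i : ℕ) < ℓ + 1, inner ℝ (u i) (φ c) = c ⟨i, hi⟩ := by
      intro i hi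
      rw [hφ, inner_sum, Finset.sum_eq_single ⟨i, hi⟩]
      · rw [inner_smul_right, orthonormal_iff_ite.mp h.orthonormal, if_pos, mul_one]
        ext; rfl
      · intro j _ hj
        rw [inner_smul_right, orthonormal_iff_ite.mp h.orthonormal, if_neg, mul_zero]
        intro e
        apply hj
        ext
        exact (congrArg Fin.val e).symm
      · simp
    have hx2 : ∀ i : Fin d, ¬ (i : ℕ) < ℓ + 1 → inner ℝ (u i) (φ c) = 0 := by
      intro i hi
      rw [hφ, inner_sum]
      refine Finset.sum_eq_zero fun j _ => ?_
      rw [inner_smul_right, orthonormal_iff_ite.mp h.orthonormal, if_neg, mul_zero]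
      intro e
      apply hi
      rw [e]
      exact j.2
    have hx0 : φ c ≠ 0 := by
      intro e
      apply hc0
      ext j
      have := hx1 (Fin.castLE hℓ j) j.2
      rw [e, inner_zero_right] at this
      exact this.symm
    have hlow : s * ‖φ c‖ ≤ ‖toEuclideanLin A (φ c)‖ := by
      refine le_of_sq_le_sq ?_ (norm_nonneg _)
      rw [h.norm_sq_toEuclideanLin hA, mul_pow, ← sum_sq_inner_basis b (φ c), Finset.mul_sum]
      refine Finset.sum_le_sum fun i _ => ?_
      rw [hb]
      by_cases hi : (i : ℕ) < ℓ + 1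
      · refine mul_le_mul_of_nonneg_right ?_ (sq_nonneg _)
        exact pow_le_pow_left₀ (norm_nonneg _) (h.antitone _ _ (by
          simp only [Fin.le_def]; omega)) 2
      · simp [hx2 i hi]
    have hup : ‖toEuclideanLin A (φ c)‖ ≤ (ν + γ) * ‖φ c‖ := by
      have e : toEuclideanLin A (φ c) =
          toEuclideanLin M (φ c) + toEuclideanLin (A - M) (φ c) := by
        rw [map_sub, LinearMap.sub_apply]
        abel
      rw [e, add_mul]
      exact (norm_add_le _ _).trans (add_le_add (hF _ hxF)
        (norm_toEuclideanLin_le_of_quadratic hAMsymm hAM _))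
    exact le_of_mul_le_mul_right (hlow.trans hup) (norm_pos_iff.mpr hx0)
  -- Since ⟨G, y⟩ = ‖y‖², domination in the direction y itself gives α‖y‖⁴ ≤ ⟨y, My⟩.
  have h1 := hG y
  rw [hy, inner_sub_projectionMatrix h.orthonormal, ← hy] at h1
  have h2 : inner ℝ y (toEuclideanLin M y) ≤ s * ‖y‖ ^ 2 + γ * ‖y‖ ^ 2 := by
    have e : toEuclideanLin M y = toEuclideanLin A y - toEuclideanLin (A - M) y := by
      rw [map_sub toEuclideanLin, LinearMap.sub_apply]
      abel
    rw [e, inner_sub_right]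
    have h3 := (abs_le.mp (hAM y)).1
    have h4 := real_inner_le_norm y (toEuclideanLin A y)
    have h5 := h.norm_le_of_orthogonal hA hℓ hyi
    nlinarith
  have h6 : α * ‖y‖ ^ 2 * ‖y‖ ^ 2 ≤ (s + γ) * ‖y‖ ^ 2 := by nlinarith
  have h7 := le_of_mul_le_mul_right h6 (by positivity)
  linarith

/-- The average of the matrices `g gᵀ`. -/
def gramMatrix {N : ℕ} (g : Fin N → Vec d) : Matrix (Fin d) (Fin d) ℝ :=
  (N : ℝ)⁻¹ • ∑ b, vecMulVec (g b) (g b)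

theorem gramMatrix_isSymm {N : ℕ} (g : Fin N → Vec d) : (gramMatrix g).IsSymm := by
  refine IsSymm.smul ?_ _
  rw [IsSymm, transpose_sum]
  exact Finset.sum_congr rfl fun b _ => transpose_vecMulVec _ _

theorem toEuclideanLin_gramMatrix {N : ℕ} (g : Fin N → Vec d) (y : Vec d) :
    toEuclideanLin (gramMatrix g) y = (N : ℝ)⁻¹ • ∑ b, inner ℝ (g b) y • g b := by
  rw [gramMatrix, map_smul, map_sum, LinearMap.smul_apply, LinearMap.sum_apply]
  simp only [toEuclideanLin_vecMulVec]

theorem inner_gramMatrix {N : ℕ} (g : Fin N → Vec d) (y : Vec d) :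
    inner ℝ y (toEuclideanLin (gramMatrix g) y) = (N : ℝ)⁻¹ * ∑ b, inner ℝ (g b) y ^ 2 := by
  rw [toEuclideanLin_gramMatrix, inner_smul_right, inner_sum]
  congr 1
  refine Finset.sum_congr rfl fun b _ => ?_
  rw [inner_smul_right, real_inner_comm, pow_two]

theorem trace_gramMatrix {N : ℕ} (g : Fin N → Vec d) :
    (gramMatrix g).trace = (N : ℝ)⁻¹ * ∑ b, ‖g b‖ ^ 2 := by
  rw [gramMatrix, trace_smul, trace_sum, smul_eq_mul]
  congr 1
  refine Finset.sum_congr rfl fun b _ => ?_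
  rw [EuclideanSpace.real_norm_sq_eq, trace]
  exact Finset.sum_congr rfl fun i _ => by simp [vecMulVec_apply, pow_two]

/-- The matrix is built from only k different vectors; the list of these is padded with zeros up to
length ℓ. -/
theorem exists_vectors_of_factor {N k ℓ : ℕ} (hk : k ≤ ℓ) (f : Fin k → Vec d) (src : Fin N → Fin k) :
    ∃ F : Fin ℓ → Vec d, ∀ y, (∀ i, inner ℝ (F i) y = 0) →
      toEuclideanLin (gramMatrix fun b => f (src b)) y = 0 := by
  refine ⟨fun i => if hi : (i : ℕ) < k then f ⟨i, hi⟩ else 0, fun y hy => ?_⟩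
  rw [toEuclideanLin_gramMatrix, Finset.sum_eq_zero, smul_zero]
  intro b _
  have := hy (Fin.castLE hk (src b))
  simp only [Fin.val_castLE, Fin.is_lt, dite_true, Fin.eta] at this
  rw [this, zero_smul]

/-- The ℓ + 1 largest eigenvalues are nonnegative with sum at most τ, so the last of them is at most
τ/(ℓ + 1). The vectors are the eigenvectors of the ℓ largest. -/
theorem exists_vectors_of_trace {N ℓ : ℕ} (hℓ : ℓ < d) (g : Fin N → Vec d) {τ : ℝ}
    (hτ : (gramMatrix g).trace ≤ τ) :
    ∃ F : Fin ℓ → Vec d, ∀ y, (∀ i, inner ℝ (F i) y = 0) →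
      ‖toEuclideanLin (gramMatrix g) y‖ ≤ τ / (ℓ + 1) * ‖y‖ := by
  set M := gramMatrix g
  have hM : M.IsSymm := gramMatrix_isSymm g
  have hH : M.IsHermitian := by rw [IsHermitian, conjTranspose_eq_transpose_of_trivial, hM.eq]
  have hT : (toEuclideanLin M).IsSymmetric := isSymmetric_toEuclideanLin_iff.mpr hH
  have hn : Module.finrank ℝ (Vec d) = d := by simp
  set b := hT.eigenvectorBasis hn
  set c := hT.eigenvalues hn
  have hb : ∀ i, toEuclideanLin M (b i) = c i • b i := fun i => hT.apply_eigenvectorBasis hn i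
  have hc : ∀ i, c i = inner ℝ (b i) (toEuclideanLin M (b i)) := by
    intro i
    rw [hb, inner_smul_right, real_inner_self_eq_norm_sq, b.norm_eq_one]
    simp
  have hc0 : ∀ i, 0 ≤ c i := by
    intro i
    rw [hc, inner_gramMatrix]
    positivity
  have hsum : ∑ i, c i ≤ τ := by
    rw [trace_eq_sum_inner_basis b] at hτ
    simpa only [hc] using hτ
  have hcℓ : c ⟨ℓ, hℓ⟩ ≤ τ / (ℓ + 1) := by
    rw [le_div_iff₀ (by positivity)]
    refine le_trans ?_ hsum
    calc c ⟨ℓ, hℓ⟩ * (ℓ + 1) = ∑ _i : Fin (ℓ + 1), c ⟨ℓ, hℓ⟩ := by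
          rw [Finset.sum_const, Finset.card_univ, Fintype.card_fin, nsmul_eq_mul]
          push_cast
          ring
      _ ≤ ∑ i : Fin (ℓ + 1), c (Fin.castLE hℓ i) := by
          refine Finset.sum_le_sum fun i _ => hT.eigenvalues_antitone hn ?_
          have := i.2
          simp only [Fin.le_def, Fin.val_castLE]
          omega
      _ = ∑ i ∈ Finset.univ.map (Fin.castLEEmb hℓ), c i := by
          rw [Finset.sum_map]
          rfl
      _ ≤ ∑ i, c i := Finset.sum_le_sum_of_subset_of_nonneg (Finset.subset_univ _)
          fun i _ _ => hc0 i
  refine ⟨fun i => b (Fin.castLE hℓ.le i), fun y hy => ?_⟩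
  refine le_trans ?_ (mul_le_mul_of_nonneg_right hcℓ (norm_nonneg y))
  refine le_of_sq_le_sq ?_ (mul_nonneg (hc0 _) (norm_nonneg _))
  have h2 : ‖toEuclideanLin M y‖ ^ 2 = inner ℝ y (toEuclideanLin (M ^ 2) y) := by
    rw [pow_two M, toEuclideanLin_mul_apply, ← inner_toEuclideanLin_left hM,
      real_inner_self_eq_norm_sq]
  rw [h2, inner_toEuclideanLin_eq_sum b (fun i => toEuclideanLin_pow_apply_of_eigen (hb i) 2),
    mul_pow, ← sum_sq_inner_basis b, Finset.mul_sum]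
  refine Finset.sum_le_sum fun i _ => ?_
  by_cases hi : (i : ℕ) < ℓ
  · have := hy ⟨i, hi⟩
    simp only [Fin.castLE_mk, Fin.eta] at this
    simp [this]
  · rw [← pow_two]
    refine mul_le_mul_of_nonneg_right (pow_le_pow_left₀ (hc0 i) ?_ 2) (sq_nonneg _)
    exact hT.eigenvalues_antitone hn (by simpa [Fin.le_def] using hi)

end Subspace

/-! ### Moments of the clipped gradient -/

section Moments

open Matrix

variable {d : ℕ}

/-- The input is bounded by `B`, and its second moments by `C₁`. -/
structure BoundedInput (D : Measure (Sample d)) (C₁ B : ℝ) : Prop where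
  ae_norm_le : ∀ᵐ z ∂D, ‖z.1‖ ≤ B
  integral_sq_le : ∀ u : Vec d, ∫ z, inner ℝ z.1 u ^ 2 ∂D ≤ C₁ * ‖u‖ ^ 2

/-- The factor of `x` in the clipped gradient. -/
def clip (κ r : ℝ) : ℝ := r / max |r| κ * κ

/-- Truncation to [-κ, κ], a form that shows bounds and slopes better than the quotient in the
algorithm. -/
theorem clip_eq {κ : ℝ} (hκ : 0 < κ) (r : ℝ) : clip κ r = max (-κ) (min κ r) := by
  have hm : 0 < max |r| κ := lt_max_of_lt_right hκ
  unfold clip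
  rcases le_total |r| κ with h | h
  · rw [max_eq_right h, div_mul_cancel₀ _ hκ.ne']
    obtain ⟨h1, h2⟩ := abs_le.mp h
    rw [min_eq_right h2, max_eq_right h1]
  · rw [max_eq_left h]
    have hr : 0 < |r| := hκ.trans_le h
    rcases le_total 0 r with h0 | h0
    · rw [abs_of_nonneg h0] at h hr ⊢
      rw [div_self hr.ne', one_mul, min_eq_left h, max_eq_right (by linarith)]
    · rw [abs_of_nonpos h0] at h hr ⊢
      have hr' : r ≠ 0 := (by linarith : r < 0).ne
      rw [min_eq_right (by linarith), max_eq_left (by linarith)]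
      field_simp

theorem abs_clip_le {κ : ℝ} (hκ : 0 < κ) (r : ℝ) : |clip κ r| ≤ κ := by
  rw [clip_eq hκ, abs_le]
  exact ⟨le_max_left _ _, max_le (by linarith) (min_le_left _ _)⟩

theorem clip_neg (κ r : ℝ) : clip κ (-r) = -clip κ r := by
  unfold clip
  rw [abs_neg]
  ring

/-- The remainder clip(r) - r vanishes on [-κ, κ] and is 1-Lipschitz. If |a| and |t| are at most
κ/2, both values vanish; otherwise their difference is at most |a| and 4(t² + a²)/κ² ≥ 1. -/
theorem abs_clip_sub_le {κ : ℝ} (hκ : 0 < κ) (a t : ℝ) :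
    |(clip κ (a - t) - (a - t)) - (clip κ (-t) - -t)| ≤ 4 / κ ^ 2 * (|a| * (t ^ 2 + a ^ 2)) := by
  by_cases hcase : |t| ≤ κ / 2 ∧ |a| ≤ κ / 2
  · obtain ⟨h1, h2⟩ := hcase
    obtain ⟨h1, h1'⟩ := abs_le.mp h1
    obtain ⟨h2, h2'⟩ := abs_le.mp h2
    rw [clip_eq hκ, clip_eq hκ, min_eq_right (by linarith), max_eq_right (by linarith),
      min_eq_right (by linarith), max_eq_right (by linarith)]
    simp only [sub_self, abs_zero]
    positivity
  · have hle : |(clip κ (a - t) - (a - t)) - (clip κ (-t) - -t)| ≤ |a| := by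
      rw [clip_eq hκ, clip_eq hκ, abs_le]
      have h1 := le_abs_self a
      have h2 := neg_abs_le a
      simp only [max_def, min_def]
      split_ifs <;> constructor <;> linarith
    have h4 : κ ^ 2 ≤ 4 * (t ^ 2 + a ^ 2) := by
      rw [not_and_or, not_le, not_le] at hcase
      rcases hcase with h | h
      · have : (κ / 2) ^ 2 ≤ t ^ 2 := by
          rw [← sq_abs t]
          exact pow_le_pow_left₀ (by positivity) h.le 2
        nlinarith [sq_nonneg a]
      · have : (κ / 2) ^ 2 ≤ a ^ 2 := by
          rw [← sq_abs a]
          exact pow_le_pow_left₀ (by positivity) h.le 2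
        nlinarith [sq_nonneg t]
    refine hle.trans ?_
    have : (1 : ℝ) ≤ 4 / κ ^ 2 * (t ^ 2 + a ^ 2) := by
      rw [div_mul_eq_mul_div, le_div_iff₀ (by positivity)]
      linarith
    calc |a| = |a| * 1 := (mul_one _).symm
      _ ≤ |a| * (4 / κ ^ 2 * (t ^ 2 + a ^ 2)) := mul_le_mul_of_nonneg_left this (abs_nonneg a)
      _ = _ := by ring

theorem clippedGradient_eq (z : Sample d) (w : Vec d) (κ : ℝ) :
    clippedGradient z w κ = clip κ (inner ℝ z.1 w - z.2) • z.1 := rfl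

theorem inner_clippedGradient (z : Sample d) (w u : Vec d) (κ : ℝ) :
    inner ℝ (clippedGradient z w κ) u = clip κ (inner ℝ z.1 w - z.2) * inner ℝ z.1 u := by
  rw [clippedGradient_eq, real_inner_smul_left]

theorem inner_clippedGradient_sq_le {κ : ℝ} (hκ : 0 < κ) (z : Sample d) (w u : Vec d) :
    inner ℝ (clippedGradient z w κ) u ^ 2 ≤ κ ^ 2 * inner ℝ z.1 u ^ 2 := by
  rw [inner_clippedGradient, mul_pow]
  refine mul_le_mul_of_nonneg_right ?_ (sq_nonneg _)
  rw [← sq_abs]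
  exact pow_le_pow_left₀ (abs_nonneg _) (abs_clip_le hκ _) 2

theorem norm_clippedGradient_le {κ : ℝ} (hκ : 0 < κ) (z : Sample d) (w : Vec d) :
    ‖clippedGradient z w κ‖ ≤ κ * ‖z.1‖ := by
  rw [clippedGradient_eq, norm_smul]
  exact mul_le_mul_of_nonneg_right (abs_clip_le hκ _) (norm_nonneg _)

theorem measurable_clippedGradient {Ω : Type*} [MeasurableSpace Ω] {z : Ω → Sample d}
    {w : Ω → Vec d} {κ : Ω → ℝ} (hz : Measurable z) (hw : Measurable w) (hκ : Measurable κ) :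
    Measurable fun ω => clippedGradient (z ω) (w ω) (κ ω) := by
  have hr : Measurable fun ω => inner ℝ (z ω).1 (w ω) - (z ω).2 :=
    (hz.fst.inner hw).sub hz.snd
  have hm : Measurable fun ω => |inner ℝ (z ω).1 (w ω) - (z ω).2| := by
    simpa [Real.norm_eq_abs] using hr.norm
  exact ((hr.div (hm.max hκ)).mul hκ).smul hz.fst

/-- The expectation of the clipped gradient. -/
def gradMean (D : Measure (Sample d)) (w : Vec d) (κ : ℝ) : Vec d :=
  ∫ z, clippedGradient z w κ ∂D

variable {D : Measure (Sample d)} [IsProbabilityMeasure D] {C₁ B κ : ℝ}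

theorem measurable_inner_fst (u : Vec d) : Measurable fun z : Sample d => inner ℝ z.1 u :=
  measurable_fst.inner measurable_const

omit [IsProbabilityMeasure D] in
theorem BoundedInput.ae_abs_inner_le (h : BoundedInput D C₁ B) (u : Vec d) :
    ∀ᵐ z ∂D, |inner ℝ z.1 u| ≤ B * ‖u‖ := by
  filter_upwards [h.ae_norm_le] with z hz
  exact (abs_real_inner_le_norm _ _).trans (mul_le_mul_of_nonneg_right hz (norm_nonneg u))

omit [IsProbabilityMeasure D] in
/-- The projections of the input have all moments. -/
theorem BoundedInput.memLp_inner (h : BoundedInput D C₁ B) (u : Vec d) :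
    MemLp (fun z : Sample d => inner ℝ z.1 u) ⊤ D :=
  memLp_top_of_bound (measurable_inner_fst u).aestronglyMeasurable (B * ‖u‖) (h.ae_abs_inner_le u)

theorem BoundedInput.integrable_inner_pow (h : BoundedInput D C₁ B) (u : Vec d) (n : ℕ) :
    Integrable (fun z : Sample d => inner ℝ z.1 u ^ n) D := by
  refine Integrable.of_bound (C := (B * ‖u‖) ^ n)
    ((measurable_inner_fst u).pow_const n).aestronglyMeasurable ?_
  filter_upwards [h.ae_abs_inner_le u] with z hz
  rw [Real.norm_eq_abs, abs_pow]
  exact pow_le_pow_left₀ (abs_nonneg _) hz n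

theorem BoundedInput.integrable_clippedGradient (h : BoundedInput D C₁ B) (hκ : 0 < κ)
    (w : Vec d) : Integrable (fun z => clippedGradient z w κ) D := by
  refine Integrable.of_bound (C := κ * B) (measurable_clippedGradient measurable_id
    measurable_const measurable_const).aestronglyMeasurable ?_
  filter_upwards [h.ae_norm_le] with z hz
  exact (norm_clippedGradient_le hκ z w).trans (mul_le_mul_of_nonneg_left hz hκ.le)

theorem BoundedInput.integral_inner_clippedGradient (h : BoundedInput D C₁ B) (hκ : 0 < κ)
    (w u : Vec d) : ∫ z, inner ℝ (clippedGradient z w κ) u ∂D = inner ℝ (gradMean D w κ) u := by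
  simp only [real_inner_comm u]
  exact integral_inner (h.integrable_clippedGradient hκ w) u

theorem BoundedInput.memLp_inner_clippedGradient (h : BoundedInput D C₁ B) (hκ : 0 < κ)
    (w u : Vec d) : MemLp (fun z => inner ℝ (clippedGradient z w κ) u) 2 D := by
  have hm : Measurable fun z : Sample d => inner ℝ (clippedGradient z w κ) u :=
    (measurable_clippedGradient measurable_id measurable_const measurable_const).inner
      measurable_const
  refine MemLp.of_bound hm.aestronglyMeasurable (κ * B * ‖u‖) ?_
  filter_upwards [h.ae_norm_le] with z hz
  refine (norm_inner_le_norm _ _).trans (mul_le_mul_of_nonneg_right ?_ (norm_nonneg u))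
  exact (norm_clippedGradient_le hκ z w).trans (mul_le_mul_of_nonneg_left hz hκ.le)

theorem BoundedInput.integral_inner_clippedGradient_sq_le (h : BoundedInput D C₁ B) (hκ : 0 < κ)
    (w u : Vec d) :
    ∫ z, inner ℝ (clippedGradient z w κ) u ^ 2 ∂D ≤ κ ^ 2 * C₁ * ‖u‖ ^ 2 := by
  calc ∫ z, inner ℝ (clippedGradient z w κ) u ^ 2 ∂D ≤ ∫ z, κ ^ 2 * inner ℝ z.1 u ^ 2 ∂D :=
        integral_mono (h.memLp_inner_clippedGradient hκ w u).integrable_sq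
          ((h.integrable_inner_pow u 2).const_mul _) fun z => inner_clippedGradient_sq_le hκ z w u
    _ = κ ^ 2 * ∫ z, inner ℝ z.1 u ^ 2 ∂D := integral_const_mul _ _
    _ ≤ κ ^ 2 * (C₁ * ‖u‖ ^ 2) := mul_le_mul_of_nonneg_left (h.integral_sq_le u) (sq_nonneg _)
    _ = _ := by ring

theorem sq_integral_le {Ω : Type*} [MeasurableSpace Ω] {μ : Measure Ω} [IsProbabilityMeasure μ]
    {f : Ω → ℝ} (hf : MemLp f 2 μ) : (∫ ω, f ω ∂μ) ^ 2 ≤ ∫ ω, f ω ^ 2 ∂μ := by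
  have := variance_nonneg f μ
  rw [variance_eq_sub hf] at this
  simpa using this

/-! ### The bias of the clipped gradient -/

theorem integral_mul_inner_eq (h : BoundedInput D C₁ B) (u v : Vec d) :
    ∫ z, inner ℝ z.1 v * inner ℝ z.1 u ∂D = inner ℝ u (toEuclideanLin (secondMoment D) v) := by
  have hint : ∀ a b : Fin d, Integrable (fun z : Sample d => vecMulVec z.1 z.1 a b) D := by
    intro a b
    have e : ∀ z : Sample d, vecMulVec z.1 z.1 a b = inner ℝ z.1 (EuclideanSpace.single a (1 : ℝ)) *
        inner ℝ z.1 (EuclideanSpace.single b (1 : ℝ)) := by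
      intro z
      simp [vecMulVec_apply, EuclideanSpace.inner_single_right]
    simp only [e]
    exact ((h.memLp_inner _).mul (h.memLp_inner _) (r := ⊤)).integrable le_top
  have := (integral_inner_toEuclideanLin hint u v).2
  simp only [toEuclideanLin_vecMulVec, inner_smul_right] at this
  rw [← show toEuclideanLin (Matrix.of fun a b => ∫ z : Sample d, vecMulVec z.1 z.1 a b ∂D) =
    toEuclideanLin (secondMoment D) from rfl, ← this]
  simp only [real_inner_comm u]

variable {C σ : ℝ} {w₀ : Vec d}

omit [IsProbabilityMeasure D] in
theorem IsRegressionComponent.integral_noise_mul_inner (hD : IsRegressionComponent D w₀ C C₁ σ)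
    (f : Vec d → ℝ) (hf : Measurable f) : ∫ z, noise w₀ z * f z.1 ∂D = 0 := by
  have hi : noise w₀ ⟂ᵢ[D] (fun z : Sample d => f z.1) :=
    (hD.indep.comp hf measurable_id).symm
  rw [hi.integral_fun_mul_eq_mul_integral hD.memLp.1
    (hf.comp measurable_fst).aestronglyMeasurable, hD.mean_zero, zero_mul]

theorem measurable_clip (κ : ℝ) : Measurable (clip κ) := by
  unfold clip
  have : Measurable fun r : ℝ => |r| := continuous_abs.measurable
  exact (measurable_id.div (this.max measurable_const)).mul_const _

/-- Without clipping the mean gradient is Σ(w - w₀), so the bias is the mean of g(x·v - η) x with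
the odd function g(r) = clip(r) - r. By symmetry and independence of the noise, g(-η) x has mean 0
and can be subtracted. The remaining difference is at most 4|x·v|(η² + (x·v)²)/κ². Paired with x·u,
its noise term factorizes, and its fourth-order term is controlled by hypercontractivity. -/
theorem IsRegressionComponent.abs_bias_le (hD : IsRegressionComponent D w₀ C C₁ σ)
    (h : BoundedInput D C₁ B) (hC : 0 ≤ C) (hC₁ : 0 < C₁) (hκ : 0 < κ) (w u : Vec d)
    (hκ2 : 32 * (C + 1) * C₁ * (∫ z, inner ℝ z.1 (w - w₀) ^ 2 ∂D + 4 * σ ^ 2) ≤ κ ^ 2) :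
    |inner ℝ (gradMean D w κ - toEuclideanLin (secondMoment D) (w - w₀)) u| ≤
      1 / 4 * ‖w - w₀‖ * ‖u‖ := by
  set v := w - w₀ with hv
  set e := ∫ z, inner ℝ z.1 v ^ 2 ∂D
  set p := ∫ z, inner ℝ z.1 u ^ 2 ∂D
  have hη : Integrable (noise w₀) D := hD.memLp.integrable (by norm_num)
  have hηm : AEStronglyMeasurable (noise w₀) D := hD.memLp.1
  have hres : ∀ z : Sample d, inner ℝ z.1 w - z.2 = inner ℝ z.1 v - noise w₀ z := by
    intro z
    rw [hv, inner_sub_right, noise, real_inner_comm w₀]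
    ring
  -- the odd remainder `h(r) = clip r - r`
  set g : ℝ → ℝ := fun r => clip κ r - r
  have hgm : Measurable g := (measurable_clip κ).sub measurable_id
  have hgη : Integrable (fun z => g (-noise w₀ z)) D :=
    ((Integrable.of_bound ((measurable_clip κ).comp_aemeasurable
      hηm.aemeasurable.neg).aestronglyMeasurable κ
      (Filter.Eventually.of_forall fun z => abs_clip_le hκ _))).sub hη.neg
  have hg0 : ∫ z, g (-noise w₀ z) ∂D = 0 := by
    have h1 : ∫ z, g (-noise w₀ z) ∂D = ∫ z, g (noise w₀ z) ∂D := by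
      have m1 := integral_map (φ := fun z => -noise w₀ z) (f := g) (μ := D)
        hηm.aemeasurable.neg hgm.aestronglyMeasurable
      have m2 := integral_map (φ := noise w₀) (f := g) (μ := D) hηm.aemeasurable
        hgm.aestronglyMeasurable
      rw [← m1, ← m2, hD.symmetric]
    have h2 : ∫ z, g (-noise w₀ z) ∂D = -∫ z, g (noise w₀ z) ∂D := by
      rw [← integral_neg]
      congr 1
      ext z
      simp only [g, clip_neg]
      ring
    linarith
  have hxu := h.memLp_inner u
  have hxv := h.memLp_inner v
  have hgηu : Integrable (fun z => g (-noise w₀ z) * inner ℝ z.1 u) D :=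
    hgη.mul_of_top_left hxu
  have hgηu0 : ∫ z, g (-noise w₀ z) * inner ℝ z.1 u ∂D = 0 := by
    have hi : (fun z : Sample d => g (-noise w₀ z)) ⟂ᵢ[D] (fun z : Sample d => inner ℝ z.1 u) :=
      (hD.indep.comp (φ := fun x => inner ℝ x u) (ψ := fun t => g (-t))
        (measurable_id.inner measurable_const) (hgm.comp measurable_neg)).symm
    rw [hi.integral_fun_mul_eq_mul_integral hgη.1 hxu.1, hg0, zero_mul]
  have hηu : Integrable (fun z => noise w₀ z * inner ℝ z.1 u) D := hη.mul_of_top_left hxu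
  have hηu0 := hD.integral_noise_mul_inner (fun x => inner ℝ x u)
    (measurable_id.inner measurable_const)
  have hvu : Integrable (fun z : Sample d => inner ℝ z.1 v * inner ℝ z.1 u) D :=
    (hxu.mul hxv (r := ⊤)).integrable le_top
  have hcu := (h.memLp_inner_clippedGradient hκ w u).integrable (by norm_num)
  have hkey : inner ℝ (gradMean D w κ - toEuclideanLin (secondMoment D) v) u =
      ∫ z, (g (inner ℝ z.1 v - noise w₀ z) - g (-noise w₀ z)) * inner ℝ z.1 u ∂D := by
    have e1 : ∀ z : Sample d,
        (g (inner ℝ z.1 v - noise w₀ z) - g (-noise w₀ z)) * inner ℝ z.1 u =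
        inner ℝ (clippedGradient z w κ) u - inner ℝ z.1 v * inner ℝ z.1 u +
          noise w₀ z * inner ℝ z.1 u - g (-noise w₀ z) * inner ℝ z.1 u := by
      intro z
      rw [inner_clippedGradient, hres]
      simp only [g]
      ring
    simp only [e1]
    have i1 : Integrable (fun z => inner ℝ (clippedGradient z w κ) u -
      inner ℝ z.1 v * inner ℝ z.1 u) D := hcu.sub hvu
    have i2 : Integrable (fun z => inner ℝ (clippedGradient z w κ) u -
      inner ℝ z.1 v * inner ℝ z.1 u + noise w₀ z * inner ℝ z.1 u) D := i1.add hηu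
    rw [integral_sub i2 hgηu, integral_add i1 hηu,
      integral_sub hcu hvu, hgηu0, hηu0, h.integral_inner_clippedGradient hκ,
      integral_mul_inner_eq h, inner_sub_left,
      real_inner_comm u (toEuclideanLin (secondMoment D) v)]
    ring
  -- the moments that bound it
  have habs : ∀ x : Vec d, MemLp (fun z : Sample d => |inner ℝ z.1 x|) ⊤ D :=
    fun x => (h.memLp_inner x).abs
  have hP1 : MemLp (fun z : Sample d => |inner ℝ z.1 u| * |inner ℝ z.1 v|) ⊤ D :=
    (habs v).mul (habs u)
  have hη2 : Integrable (fun z => noise w₀ z ^ 2) D := hD.memLp.integrable_sq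
  have hQ1 : Integrable (fun z => noise w₀ z ^ 2 * (|inner ℝ z.1 u| * |inner ℝ z.1 v|)) D :=
    hη2.mul_of_top_left hP1
  have hv2 : MemLp (fun z : Sample d => inner ℝ z.1 v ^ 2) ⊤ D := by
    have := hxv.mul hxv (r := ⊤)
    simpa [pow_two, Pi.mul_def] using this
  have hQ2 : Integrable (fun z : Sample d => (|inner ℝ z.1 u| * |inner ℝ z.1 v|) *
      inner ℝ z.1 v ^ 2) D := (hv2.mul hP1 (r := ⊤)).integrable le_top
  have hsplit : ∫ z, noise w₀ z ^ 2 * (|inner ℝ z.1 u| * |inner ℝ z.1 v|) ∂D =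
      (∫ z, noise w₀ z ^ 2 ∂D) * ∫ z, |inner ℝ z.1 u| * |inner ℝ z.1 v| ∂D := by
    have hi : (fun z : Sample d => noise w₀ z ^ 2) ⟂ᵢ[D]
        (fun z : Sample d => |inner ℝ z.1 u| * |inner ℝ z.1 v|) :=
      (hD.indep.comp (φ := fun x => |inner ℝ x u| * |inner ℝ x v|) (ψ := fun t : ℝ => t ^ 2)
        (by fun_prop) (measurable_id.pow_const 2)).symm
    exact hi.integral_fun_mul_eq_mul_integral hη2.1 hP1.1
  have he0 : 0 ≤ e := integral_nonneg fun z => sq_nonneg _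
  have hp0 : 0 ≤ p := integral_nonneg fun z => sq_nonneg _
  have hpC : p ≤ C₁ * ‖u‖ ^ 2 := h.integral_sq_le u
  have heC : e ≤ C₁ * ‖v‖ ^ 2 := h.integral_sq_le v
  have hm1 : ∫ z, |inner ℝ z.1 u| * |inner ℝ z.1 v| ∂D ≤ C₁ * ‖u‖ * ‖v‖ := by
    refine le_of_sq_le_sq ?_ (by positivity)
    refine (integral_mul_sq_le ?_ ?_ (hP1.integrable le_top)).trans ?_
    · simpa using h.integrable_inner_pow u 2
    · simpa using h.integrable_inner_pow v 2
    · simp only [sq_abs]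
      calc p * e ≤ (C₁ * ‖u‖ ^ 2) * (C₁ * ‖v‖ ^ 2) := mul_le_mul hpC heC he0 (by positivity)
        _ = _ := by ring
  -- Cauchy–Schwarz is used twice, here for (x·u)²(x·v)² and then for |x·u||x·v| times (x·v)². Only
  -- fourth moments of projections occur.
  have hm22 : ∫ z, inner ℝ z.1 u ^ 2 * inner ℝ z.1 v ^ 2 ∂D ≤ C * p * e := by
    refine le_of_sq_le_sq ?_ (by positivity)
    refine (integral_mul_sq_le ?_ ?_ ?_).trans ?_
    · simpa [← pow_mul] using h.integrable_inner_pow u 4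
    · simpa [← pow_mul] using h.integrable_inner_pow v 4
    · exact (h.integrable_inner_pow u 2).mul_of_top_left hv2
    · simp only [← pow_mul]
      calc _ ≤ (C * p ^ 2) * (C * e ^ 2) :=
            mul_le_mul (hD.hypercontractive u) (hD.hypercontractive v)
              (integral_nonneg fun z => by positivity) (by positivity)
        _ = _ := by ring
  have hm2 : ∫ z, (|inner ℝ z.1 u| * |inner ℝ z.1 v|) * inner ℝ z.1 v ^ 2 ∂D ≤
      C * (C₁ * ‖u‖ * ‖v‖) * e := by
    refine le_of_sq_le_sq ?_ (by positivity)
    refine (integral_mul_sq_le ?_ ?_ hQ2).trans ?_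
    · simp only [mul_pow, sq_abs]
      exact (h.integrable_inner_pow u 2).mul_of_top_left hv2
    · simpa [← pow_mul] using h.integrable_inner_pow v 4
    · simp only [mul_pow, sq_abs, ← pow_mul]
      calc _ ≤ (C * p * e) * (C * e ^ 2) :=
            mul_le_mul hm22 (hD.hypercontractive v)
              (integral_nonneg fun z => by positivity) (by positivity)
        _ = C ^ 2 * (p * e) * e ^ 2 := by ring
        _ ≤ C ^ 2 * ((C₁ * ‖u‖ ^ 2) * (C₁ * ‖v‖ ^ 2)) * e ^ 2 := by
            refine mul_le_mul_of_nonneg_right (mul_le_mul_of_nonneg_left ?_ (sq_nonneg C))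
              (sq_nonneg e)
            exact mul_le_mul hpC heC he0 (by positivity)
        _ = _ := by ring
  rw [hkey]
  have hbd : |∫ z, (g (inner ℝ z.1 v - noise w₀ z) - g (-noise w₀ z)) * inner ℝ z.1 u ∂D| ≤
      ∫ z, 4 / κ ^ 2 * (noise w₀ z ^ 2 * (|inner ℝ z.1 u| * |inner ℝ z.1 v|) +
        (|inner ℝ z.1 u| * |inner ℝ z.1 v|) * inner ℝ z.1 v ^ 2) ∂D := by
    have hQ : Integrable (fun z => 4 / κ ^ 2 * (noise w₀ z ^ 2 *
        (|inner ℝ z.1 u| * |inner ℝ z.1 v|) + (|inner ℝ z.1 u| * |inner ℝ z.1 v|) *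
        inner ℝ z.1 v ^ 2)) D := (hQ1.add hQ2).const_mul _
    rw [← Real.norm_eq_abs]
    refine norm_integral_le_of_norm_le hQ (Filter.Eventually.of_forall fun z => ?_)
    rw [Real.norm_eq_abs, abs_mul]
    have := abs_clip_sub_le hκ (inner ℝ z.1 v) (noise w₀ z)
    calc _ ≤ 4 / κ ^ 2 * (|inner ℝ z.1 v| * (noise w₀ z ^ 2 + inner ℝ z.1 v ^ 2)) *
          |inner ℝ z.1 u| := mul_le_mul_of_nonneg_right this (abs_nonneg _)
      _ = _ := by ring
  refine hbd.trans ?_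
  rw [integral_const_mul, integral_add hQ1 hQ2, hsplit]
  have hσ := hD.variance_le
  have hσ0 : 0 ≤ ∫ z, noise w₀ z ^ 2 ∂D := integral_nonneg fun z => sq_nonneg _
  have hm10 : 0 ≤ ∫ z, |inner ℝ z.1 u| * |inner ℝ z.1 v| ∂D :=
    integral_nonneg fun z => by positivity
  rw [div_mul_eq_mul_div, div_le_iff₀ (by positivity)]
  have h1 : (∫ z, noise w₀ z ^ 2 ∂D) * ∫ z, |inner ℝ z.1 u| * |inner ℝ z.1 v| ∂D ≤
      σ ^ 2 * (C₁ * ‖u‖ * ‖v‖) := mul_le_mul hσ hm1 hm10 (sq_nonneg σ)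
  have huv : 0 ≤ ‖u‖ * ‖v‖ := by positivity
  have hC1uv : 0 ≤ C₁ * ‖u‖ * ‖v‖ := by positivity
  -- It would be enough that κ² ≥ 16 C₁ (σ² + C e).
  calc _ ≤ 4 * (σ ^ 2 * (C₁ * ‖u‖ * ‖v‖) + C * (C₁ * ‖u‖ * ‖v‖) * e) := by linarith
    _ ≤ 1 / 4 * (‖u‖ * ‖v‖) * (32 * (C + 1) * C₁ * (e + 4 * σ ^ 2)) := by
        have : 0 ≤ (C₁ * ‖u‖ * ‖v‖) * (C * σ ^ 2) := by positivity
        have : 0 ≤ (C₁ * ‖u‖ * ‖v‖) * (C * e) := by positivity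
        have : 0 ≤ (C₁ * ‖u‖ * ‖v‖) * e := by positivity
        have : 0 ≤ (C₁ * ‖u‖ * ‖v‖) * σ ^ 2 := by positivity
        nlinarith
    _ ≤ 1 / 4 * (‖u‖ * ‖v‖) * κ ^ 2 := mul_le_mul_of_nonneg_left hκ2 (by positivity)
    _ = _ := by ring

end Moments

/-! ### The algorithm on indexed samples -/

section Values

open Matrix

variable {α β : Type} {J : Type} {d : ℕ}

theorem Timed.val_bind (x : Timed α) (f : α → Timed β) : (x >>= f).val = (f x.val).val := rfl

theorem val_charge (n : ℕ) (a : α) : (charge n a).val = a := rfl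

theorem val_forEach {n : ℕ} (f : Fin n → Timed β) : (forEach f).val = fun i => (f i).val := rfl

/-- Apply `f` to each object of a collection. -/
def Coll.map (f : α → β) (S : Coll α) : Coll β := ⟨S.len, fun i => f (S.get i)⟩

theorem Coll.get_map (f : α → β) (S : Coll α) (i : Fin (S.map f).len) :
    (S.map f).get i = f (S.get i) := rfl

/-- Division only moves positions, so it commutes with looking up the samples. Hence the algorithm
can be run on sample indices, and which samples a stage reads depends on the seed alone. -/
theorem Coll.part_map (f : α → β) (S : Coll α) (m : ℕ) (j : Fin m) :
    (S.map f).part m j = (S.part m j).map f := rfl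

theorem val_divide (S : Coll α) (m : ℕ) : (divide S m).val = S.part m := rfl

theorem val_timedMedian {n : ℕ} (v : Fin n → ℝ) : (timedMedian v).val = median v := rfl

/-- The set of the objects of a collection. -/
def Coll.support (S : Coll α) : Set α := Set.range S.get

theorem Coll.support_part_subset (S : Coll α) (m : ℕ) (j : Fin m) :
    (S.part m j).support ⊆ S.support := by
  rintro _ ⟨q, rfl⟩
  exact ⟨_, rfl⟩

theorem Coll.get_part_injective {S : Coll α} (hS : Function.Injective S.get) (m : ℕ) (j : Fin m) :
    Function.Injective (S.part m j).get := by
  intro q q' h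
  have := congrArg Fin.val (hS h)
  simp only at this
  exact Fin.ext (by omega)

theorem Coll.part_index_ne {S : Coll α} {m : ℕ} {j j' : Fin m} (h : j ≠ j')
    (q q' : Fin (S.len / m)) : (j : ℕ) * (S.len / m) + q ≠ j' * (S.len / m) + q' := by
  intro e
  apply h
  have h1 := q.2
  have h2 := q'.2
  rcases lt_trichotomy (j : ℕ) j' with hlt | heq | hlt
  · have := Nat.mul_le_mul_right (S.len / m) (Nat.succ_le_of_lt hlt)
    rw [Nat.succ_mul] at this
    omega
  · exact Fin.ext heq
  · have := Nat.mul_le_mul_right (S.len / m) (Nat.succ_le_of_lt hlt)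
    rw [Nat.succ_mul] at this
    omega

theorem Coll.disjoint_support_part {S : Coll α} (hS : Function.Injective S.get) {m : ℕ}
    {j j' : Fin m} (h : j ≠ j') : Disjoint (S.part m j).support (S.part m j').support := by
  rw [Set.disjoint_left]
  rintro _ ⟨q, rfl⟩ ⟨q', hq⟩
  have := congrArg Fin.val (hS hq)
  exact Coll.part_index_ne h q q' this.symm

/-- The average of the clipped gradients of the samples with index in `S`. -/
def gbar (Z : J → Sample d) (S : Coll J) (w : Vec d) (κ : ℝ) : Vec d :=
  (S.len : ℝ)⁻¹ • ∑ i, clippedGradient (Z (S.get i)) w κ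

theorem averageGradient_val (Z : J → Sample d) (S : Coll J) (w : Vec d) (κ : ℝ) :
    (averageGradient (S.map Z) w κ).val = gbar Z S w κ := rfl

/-- The average squared residual of the samples with index in `S`. -/
def meanLoss (Z : J → Sample d) (S : Coll J) (w : Vec d) : ℝ :=
  (S.len : ℝ)⁻¹ * ∑ i, (inner ℝ (Z (S.get i)).1 w - (Z (S.get i)).2) ^ 2

/-- The estimate `θ` of the size of the residuals. -/
def lossEst (Z : J → Sample d) (S : Coll J) (w : Vec d) (T : ℕ) : ℝ :=
  median fun j : Fin T => meanLoss Z (S.part T j) w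

/-- The clipping parameter. -/
def clipVal (Z : J → Sample d) (S : Coll J) (w : Vec d) (T : ℕ) (ε₁ σ C C₁ : ℝ) : ℝ :=
  Real.sqrt (32 * (C + 1) * C₁ * (lossEst Z S w T + 17 * σ ^ 2) / ε₁)

theorem clipEst_val (K : Constants) (Z : J → Sample d) (S : Coll J) (w : Vec d)
    (δ' σ C C₁ : ℝ) : (clipEst K (S.map Z) w δ' σ C C₁).val =
      clipVal Z S w ⌈K.cT * Real.log (1 / δ')⌉₊ K.ε₁ σ C C₁ := rfl

/-- The symmetrized average of the products of the gradients of the two halves of the batches. -/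
def crossMatrix (Z : J → Sample d) (B : Coll (Coll J)) (w : Vec d) (κ : ℝ) :
    Matrix (Fin d) (Fin d) ℝ :=
  (2 * (B.len : ℝ))⁻¹ • ∑ b,
    (vecMulVec (gbar Z ((B.get b).part 2 0) w κ) (gbar Z ((B.get b).part 2 1) w κ) +
      vecMulVec (gbar Z ((B.get b).part 2 1) w κ) (gbar Z ((B.get b).part 2 0) w κ))

theorem gradSubEst_val (svd : SingularVectorRoutine d) (Z : J → Sample d) (B : Coll (Coll J))
    (κ : ℝ) (w : Vec d) (ℓ : ℕ) : (gradSubEst svd (B.map (Coll.map Z)) κ w ℓ).val =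
      projectionMatrix (svd.vec (crossMatrix Z B w κ)) ℓ := rfl

/-- The score of a batch: it estimates the squared distance of its projected mean gradient from
that of the collection `S`. -/
def score (Z : J → Sample d) (b S : Coll J) (w : Vec d) (κ : ℝ) (P : Matrix (Fin d) (Fin d) ℝ)
    (T : ℕ) : ℝ :=
  median fun j : Fin T => inner ℝ
    (toEuclideanLin P (gbar Z ((b.part 2 0).part (T + T) (Fin.castAdd T j)) w κ -
      gbar Z (S.part (T + T) (Fin.castAdd T j)) w κ))
    (toEuclideanLin P (gbar Z ((b.part 2 0).part (T + T) (Fin.natAdd T j)) w κ -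
      gbar Z (S.part (T + T) (Fin.natAdd T j)) w κ))

/-- The average projected gradient of the parts `i` of the batches in `kept`. -/
def partEst (Z : J → Sample d) (B : Coll (Coll J)) (w : Vec d) (κ : ℝ)
    (P : Matrix (Fin d) (Fin d) ℝ) (T : ℕ) (kept : Finset (Fin B.len)) (i : Fin T) : Vec d :=
  (kept.card : ℝ)⁻¹ • ∑ b ∈ kept,
    toEuclideanLin P (gbar Z (((B.get b).part 2 1).part T i) w κ)

/-- The entry that is closest to the other ones. -/
def centralEntry {T : ℕ} (Δ : Fin T → Vec d) : Vec d :=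
  entryAtMin (fun i => median fun j => ‖Δ i - Δ j‖) Δ

theorem gradEst_val (K : Constants) (Z : J → Sample d) (B : Coll (Coll J)) (S : Coll J) (κ : ℝ)
    (w : Vec d) (P : Matrix (Fin d) (Fin d) ℝ) (ε₂ δ' C₁ : ℝ) :
    (gradEst K (B.map (Coll.map Z)) (S.map Z) κ w P ε₂ δ' C₁).val =
      centralEntry (partEst Z B w κ P ⌈K.cT₂ * Real.log (1 / δ')⌉₊ (Finset.univ.filter fun b =>
        score Z (B.get b) S w κ P ⌈K.cT₁ * Real.log (B.len / δ')⌉₊ ≤ ε₂ ^ 2 * κ ^ 2 * C₁)) := by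
  simp only [gradEst, Timed.val_bind, val_charge, val_forEach, val_divide, val_timedMedian,
    Coll.get_map, Coll.part_map, averageGradient_val, centralEntry, partEst, score]
  rfl

/-! ### Measurability -/

variable {Ω : Type*} [m : MeasurableSpace Ω] {Z : J → Ω → Sample d} {w : Ω → Vec d}
  {κ : Ω → ℝ} {u : Ω → Fin d → Vec d}

/-- The σ-algebra on Ω is arbitrary and only the samples in the support have to be measurable. Thus
the statement also applies to the σ-algebra generated by the samples read so far, which is what
independence of the stages requires. -/
theorem measurable_gbar {S : Coll J} (hZ : ∀ j ∈ S.support, Measurable (Z j)) (hw : Measurable w)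
    (hκ : Measurable κ) : Measurable fun ω => gbar (fun j => Z j ω) S (w ω) (κ ω) :=
  Measurable.const_smul (M := ℝ) (g := fun ω => ∑ i, clippedGradient (Z (S.get i) ω) (w ω) (κ ω))
    (Finset.measurable_sum _ fun i _ =>
      measurable_clippedGradient (hZ (S.get i) ⟨i, rfl⟩) hw hκ) (S.len : ℝ)⁻¹

theorem measurable_meanLoss {S : Coll J} (hZ : ∀ j ∈ S.support, Measurable (Z j))
    (hw : Measurable w) : Measurable fun ω => meanLoss (fun j => Z j ω) S (w ω) :=
  (Finset.measurable_sum _ fun i _ =>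
    (((hZ (S.get i) ⟨i, rfl⟩).fst.inner hw).sub (hZ (S.get i) ⟨i, rfl⟩).snd).pow_const 2).const_mul _

theorem measurable_lossEst {S : Coll J} (hZ : ∀ j ∈ S.support, Measurable (Z j))
    (hw : Measurable w) (T : ℕ) : Measurable fun ω => lossEst (fun j => Z j ω) S (w ω) T :=
  measurable_median fun i =>
    measurable_meanLoss (fun j hj => hZ j (S.support_part_subset T i hj)) hw

theorem measurable_clipVal {S : Coll J} (hZ : ∀ j ∈ S.support, Measurable (Z j))
    (hw : Measurable w) (T : ℕ) (ε₁ σ C C₁ : ℝ) :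
    Measurable fun ω => clipVal (fun j => Z j ω) S (w ω) T ε₁ σ C C₁ :=
  ((((measurable_lossEst hZ hw T).add_const _).const_mul _).div_const _).sqrt

theorem measurable_crossMatrix {B : Coll (Coll J)}
    (hZ : ∀ b, ∀ j ∈ (B.get b).support, Measurable (Z j)) (hw : Measurable w) (hκ : Measurable κ) :
    Measurable (β := Fin d → Fin d → ℝ) fun ω =>
      crossMatrix (fun j => Z j ω) B (w ω) (κ ω) := by
  have hg : ∀ b i a, Measurable fun ω =>
      gbar (fun j => Z j ω) ((B.get b).part 2 i) (w ω) (κ ω) a := by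
    intro b i a
    have h : Measurable fun v : Vec d => v a := by fun_prop
    exact h.comp (measurable_gbar
      (fun j hj => hZ b j ((B.get b).support_part_subset 2 i hj)) hw hκ)
  refine measurable_pi_lambda _ fun a => measurable_pi_lambda _ fun c => ?_
  simp only [crossMatrix, Matrix.smul_apply, Matrix.sum_apply, smul_eq_mul, Matrix.add_apply,
    vecMulVec_apply]
  exact (Finset.measurable_sum _ fun b _ =>
    ((hg b 0 a).mul (hg b 1 c)).add ((hg b 1 a).mul (hg b 0 c))).const_mul _

theorem measurable_toEuclideanLin_projectionMatrix (hu : Measurable u) (ℓ : ℕ) {x : Ω → Vec d}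
    (hx : Measurable x) :
    Measurable fun ω => toEuclideanLin (projectionMatrix (u ω) ℓ) (x ω) := by
  simp only [toEuclideanLin_projectionMatrix]
  refine Finset.measurable_sum _ fun i _ => ?_
  have hi : Measurable fun ω => u ω i := (measurable_pi_apply i).comp hu
  exact (Measurable.inner (𝕜 := ℝ) hi hx).smul hi

theorem measurable_score {b S : Coll J} (hb : ∀ j ∈ (b.part 2 0).support, Measurable (Z j))
    (hS : ∀ j ∈ S.support, Measurable (Z j)) (hw : Measurable w) (hκ : Measurable κ)
    (hu : Measurable u) (ℓ T : ℕ) : Measurable fun ω =>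
      score (fun j => Z j ω) b S (w ω) (κ ω) (projectionMatrix (u ω) ℓ) T := by
  have h1 : ∀ i, Measurable fun ω =>
      gbar (fun j => Z j ω) ((b.part 2 0).part (T + T) i) (w ω) (κ ω) := fun i =>
    measurable_gbar (fun j hj => hb j ((b.part 2 0).support_part_subset _ i hj)) hw hκ
  have h2 : ∀ i, Measurable fun ω => gbar (fun j => Z j ω) (S.part (T + T) i) (w ω) (κ ω) :=
    fun i => measurable_gbar (fun j hj => hS j (S.support_part_subset _ i hj)) hw hκ
  refine measurable_median fun j => ?_
  exact Measurable.inner (𝕜 := ℝ)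
    (measurable_toEuclideanLin_projectionMatrix hu ℓ ((h1 (Fin.castAdd T j)).sub (h2 _)))
    (measurable_toEuclideanLin_projectionMatrix hu ℓ ((h1 (Fin.natAdd T j)).sub (h2 _)))

theorem measurable_partEst {B : Coll (Coll J)} (hB : ∀ b, ∀ j ∈ ((B.get b).part 2 1).support,
    Measurable (Z j)) (hw : Measurable w) (hκ : Measurable κ) (hu : Measurable u) (ℓ T : ℕ)
    {kept : Ω → Finset (Fin B.len)} (hk : ∀ b, MeasurableSet {ω | b ∈ kept ω}) (i : Fin T) :
    Measurable fun ω => partEst (fun j => Z j ω) B (w ω) (κ ω) (projectionMatrix (u ω) ℓ) T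
      (kept ω) i := by
  classical
  have hg : ∀ b, Measurable fun ω => toEuclideanLin (projectionMatrix (u ω) ℓ)
      (gbar (fun j => Z j ω) (((B.get b).part 2 1).part T i) (w ω) (κ ω)) := fun b =>
    measurable_toEuclideanLin_projectionMatrix hu ℓ
      (measurable_gbar (fun j hj => hB b j (((B.get b).part 2 1).support_part_subset _ i hj)) hw hκ)
  have hc : Measurable fun ω => ((kept ω).card : ℝ) := by
    have := measurable_card_filter (fun b ω => b ∈ kept ω) hk
    simp only [Finset.filter_univ_mem] at this
    exact (measurable_from_top (f := fun n : ℕ => (n : ℝ))).comp this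
  have e : ∀ ω, partEst (fun j => Z j ω) B (w ω) (κ ω) (projectionMatrix (u ω) ℓ) T (kept ω) i =
      ((kept ω).card : ℝ)⁻¹ • ∑ b, if b ∈ kept ω then toEuclideanLin (projectionMatrix (u ω) ℓ)
      (gbar (fun j => Z j ω) (((B.get b).part 2 1).part T i) (w ω) (κ ω)) else 0 := by
    intro ω
    rw [partEst, Finset.sum_ite_mem, Finset.univ_inter]
  simp only [e]
  exact hc.inv.smul (Finset.measurable_sum _ fun b _ => Measurable.ite (hk b) (hg b)
    measurable_const)

theorem measurable_centralEntry {T : ℕ} {Δ : Ω → Fin T → Vec d}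
    (hΔ : ∀ i, Measurable fun ω => Δ ω i) : Measurable fun ω => centralEntry (Δ ω) :=
  measurable_entryAtMin (fun i => measurable_median fun j => ((hΔ i).sub (hΔ j)).norm) hΔ

end Values

/-! ### Averages of independent samples -/

section Averages

open Matrix

variable {Ω : Type*} [MeasurableSpace Ω] {μ : Measure Ω} {d : ℕ}

theorem integral_sum_sq_le {ι : Type*} [IsProbabilityMeasure μ] (s : Finset ι) {X : ι → Ω → ℝ}
    (hX : ∀ i ∈ s, MemLp (X i) 2 μ) (hind : Set.Pairwise ↑s fun i j => X i ⟂ᵢ[μ] X j)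
    (hmean : ∀ i ∈ s, ∫ ω, X i ω ∂μ = 0) {τ : ℝ} (hτ : ∀ i ∈ s, ∫ ω, X i ω ^ 2 ∂μ ≤ τ) :
    ∫ ω, (∑ i ∈ s, X i ω) ^ 2 ∂μ ≤ s.card * τ := by
  have hsum : ∫ ω, (∑ i ∈ s, X i) ω ∂μ = 0 := by
    simp only [Finset.sum_apply]
    rw [integral_finsetSum s fun i hi => (hX i hi).integrable (by norm_num)]
    exact Finset.sum_eq_zero hmean
  have hm : AEMeasurable (∑ i ∈ s, X i) μ :=
    (memLp_finsetSum' s hX).1.aemeasurable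
  have h1 := variance_of_integral_eq_zero hm hsum
  simp only [Finset.sum_apply] at h1
  rw [← h1, IndepFun.variance_sum hX hind]
  calc ∑ i ∈ s, Var[X i; μ] ≤ ∑ _i ∈ s, τ := by
        refine Finset.sum_le_sum fun i hi => ?_
        rw [variance_of_integral_eq_zero (hX i hi).1.aemeasurable (hmean i hi)]
        exact hτ i hi
    _ = s.card * τ := by rw [Finset.sum_const, nsmul_eq_mul]

theorem integral_sub_integral_sq_le [IsProbabilityMeasure μ] {f : Ω → ℝ} (hf : MemLp f 2 μ) :
    ∫ ω, (f ω - ∫ ω, f ω ∂μ) ^ 2 ∂μ ≤ ∫ ω, f ω ^ 2 ∂μ := by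
  have h := variance_eq_sub hf
  rw [variance_eq_integral hf.1.aemeasurable] at h
  have : ∫ ω, (f ^ 2) ω ∂μ = ∫ ω, f ω ^ 2 ∂μ := rfl
  rw [h, this]
  linarith [sq_nonneg (∫ ω, f ω ∂μ)]

/-- A random vector with mean `G`, of length at most `b`, whose projections have second moments at
most `s` and variances at most `τ`. -/
structure MeanEstimate (μ : Measure Ω) (g : Ω → Vec d) (G : Vec d) (b s τ : ℝ) : Prop where
  measurable : Measurable g
  ae_norm_le : ∀ᵐ ω ∂μ, ‖g ω‖ ≤ b
  integral_inner : ∀ u, ∫ ω, inner ℝ (g ω) u ∂μ = inner ℝ G u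
  integral_sq_le : ∀ u, ∫ ω, inner ℝ (g ω) u ^ 2 ∂μ ≤ s * ‖u‖ ^ 2
  variance_le : ∀ u, ∫ ω, inner ℝ (g ω - G) u ^ 2 ∂μ ≤ τ * ‖u‖ ^ 2

section SampleAverage

variable {J : Type} {Z : J → Ω → Sample d} {S : Coll J} {D : Measure (Sample d)}
  [IsProbabilityMeasure μ]

omit [IsProbabilityMeasure μ] in
theorem integral_comp_law {z : Ω → Sample d} (hz : Measurable z) (h : μ.map z = D)
    {f : Sample d → ℝ} (hf : AEStronglyMeasurable f D) : ∫ ω, f (z ω) ∂μ = ∫ z, f z ∂D := by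
  subst h
  exact (integral_map hz.aemeasurable hf).symm

omit [IsProbabilityMeasure μ] in
theorem memLp_comp_law {z : Ω → Sample d} (hz : Measurable z) (h : μ.map z = D)
    {f : Sample d → ℝ} {p : ENNReal} (hf : MemLp f p D) : MemLp (fun ω => f (z ω)) p μ := by
  subst h
  exact hf.comp_of_map hz.aemeasurable

omit [IsProbabilityMeasure μ] in
theorem pairwise_indepFun_comp (hind : iIndepFun Z μ) (hS : Function.Injective S.get)
    {f : Sample d → ℝ} (hf : Measurable f) (s : Set (Fin S.len)) :
    s.Pairwise fun i j => (fun ω => f (Z (S.get i) ω)) ⟂ᵢ[μ] fun ω => f (Z (S.get j) ω) :=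
  fun _ _ _ _ hij => (hind.indepFun (hS.ne hij)).comp hf hf

/-- The variance of an average of independent samples. -/
theorem integral_average_sub_sq_le (hZ : ∀ j, Measurable (Z j)) (hind : iIndepFun Z μ)
    (hS : Function.Injective S.get) (hlen : 0 < S.len)
    (hlaw : ∀ i, μ.map (Z (S.get i)) = D) {f : Sample d → ℝ} (hfm : Measurable f)
    (hf : MemLp f 2 D) : ∫ ω, ((S.len : ℝ)⁻¹ * ∑ i, f (Z (S.get i) ω) - ∫ z, f z ∂D) ^ 2 ∂μ ≤
      (∫ z, f z ^ 2 ∂D) / S.len := by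
  have hm : (0 : ℝ) < S.len := by exact_mod_cast hlen
  have : IsProbabilityMeasure D := by
    rw [← hlaw ⟨0, hlen⟩]
    exact Measure.isProbabilityMeasure_map (hZ _).aemeasurable
  have hgm : Measurable fun z => f z - ∫ z, f z ∂D := hfm.sub_const _
  have hgL : MemLp (fun z => f z - ∫ z, f z ∂D) 2 D := hf.sub (memLp_const _)
  have key := integral_sum_sq_le (μ := μ) (Finset.univ : Finset (Fin S.len))
    (X := fun i ω => f (Z (S.get i) ω) - ∫ z, f z ∂D) (τ := ∫ z, f z ^ 2 ∂D)
    (fun i _ => memLp_comp_law (hZ _) (hlaw i) hgL)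
    (pairwise_indepFun_comp hind hS hgm _) (fun i _ => by
      rw [integral_comp_law (hZ _) (hlaw i) (f := fun z => f z - ∫ z, f z ∂D) hgL.1,
        integral_sub (hf.integrable (by norm_num)) (integrable_const _)]
      simp) (fun i _ => by
      rw [integral_comp_law (hZ _) (hlaw i) (f := fun z => (f z - ∫ z, f z ∂D) ^ 2)
        (hgm.pow_const 2).aestronglyMeasurable]
      exact integral_sub_integral_sq_le hf)
  have e : ∀ ω, ((S.len : ℝ)⁻¹ * ∑ i, f (Z (S.get i) ω) - ∫ z, f z ∂D) ^ 2 =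
      ((S.len : ℝ)⁻¹) ^ 2 * (∑ i, (f (Z (S.get i) ω) - ∫ z, f z ∂D)) ^ 2 := by
    intro ω
    rw [← mul_pow, Finset.sum_sub_distrib, Finset.sum_const, Finset.card_univ, Fintype.card_fin,
      nsmul_eq_mul, mul_sub, inv_mul_cancel_left₀ hm.ne']
  simp only [e]
  rw [integral_const_mul]
  rw [Finset.card_univ, Fintype.card_fin] at key
  calc _ ≤ ((S.len : ℝ)⁻¹) ^ 2 * (S.len * ∫ z, f z ^ 2 ∂D) :=
        mul_le_mul_of_nonneg_left key (sq_nonneg _)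
    _ = _ := by field_simp

omit [IsProbabilityMeasure μ] in
theorem integral_average_eq (hZ : ∀ j, Measurable (Z j)) (hlen : 0 < S.len)
    (hlaw : ∀ i, μ.map (Z (S.get i)) = D) {f : Sample d → ℝ} (hf : Integrable f D) :
    ∫ ω, (S.len : ℝ)⁻¹ * ∑ i, f (Z (S.get i) ω) ∂μ = ∫ z, f z ∂D := by
  have hm : (0 : ℝ) < S.len := by exact_mod_cast hlen
  rw [integral_const_mul, integral_finsetSum _ fun i _ =>
    memLp_one_iff_integrable.mp (memLp_comp_law (hZ _) (hlaw i) (memLp_one_iff_integrable.mpr hf))]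
  rw [Finset.sum_congr rfl fun i _ => integral_comp_law (hZ _) (hlaw i) hf.1]
  rw [Finset.sum_const, Finset.card_univ, Fintype.card_fin, nsmul_eq_mul,
    inv_mul_cancel_left₀ hm.ne']

/-- Averaging preserves the bounds on length and second moments and divides the variance by the
number of samples. No linear model is needed: clipping tames arbitrary outputs. -/
theorem meanEstimate_gbar (hZ : ∀ j, Measurable (Z j)) (hind : iIndepFun Z μ)
    (hS : Function.Injective S.get) (hlen : 0 < S.len)
    (hlaw : ∀ i, μ.map (Z (S.get i)) = D) {C₁ B κ : ℝ} (h : BoundedInput D C₁ B) (hκ : 0 < κ)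
    (w : Vec d) : MeanEstimate μ (fun ω => gbar (fun j => Z j ω) S w κ) (gradMean D w κ) (κ * B)
      (κ ^ 2 * C₁) (κ ^ 2 * C₁ / S.len) := by
  have hm : (0 : ℝ) < S.len := by exact_mod_cast hlen
  have : IsProbabilityMeasure D := by
    rw [← hlaw ⟨0, hlen⟩]
    exact Measure.isProbabilityMeasure_map (hZ _).aemeasurable
  have hfm : ∀ u : Vec d, Measurable fun z : Sample d => inner ℝ (clippedGradient z w κ) u :=
    fun u => (measurable_clippedGradient measurable_id measurable_const measurable_const).inner
      measurable_const
  have hinner : ∀ (ω : Ω) (u : Vec d), inner ℝ (gbar (fun j => Z j ω) S w κ) u =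
      (S.len : ℝ)⁻¹ * ∑ i, inner ℝ (clippedGradient (Z (S.get i) ω) w κ) u := by
    intro ω u
    rw [gbar, real_inner_smul_left, sum_inner]
  refine ⟨measurable_gbar (fun j _ => hZ j) measurable_const measurable_const, ?_, fun u => ?_,
    fun u => ?_, fun u => ?_⟩
  · have hall : ∀ i, ∀ᵐ ω ∂μ, ‖(Z (S.get i) ω).1‖ ≤ B := by
      intro i
      have := h.ae_norm_le
      rw [← hlaw i] at this
      exact ae_of_ae_map (hZ _).aemeasurable this
    filter_upwards [ae_all_iff.mpr hall] with ω hω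
    rw [gbar, norm_smul, norm_inv, Real.norm_natCast, inv_mul_le_iff₀ hm]
    refine (norm_sum_le _ _).trans ?_
    calc _ ≤ ∑ _i : Fin S.len, κ * B := Finset.sum_le_sum fun i _ =>
          (norm_clippedGradient_le hκ _ w).trans (mul_le_mul_of_nonneg_left (hω i) hκ.le)
      _ = _ := by simp
  · simp only [hinner]
    rw [integral_average_eq hZ hlen hlaw
      ((h.memLp_inner_clippedGradient hκ w u).integrable (by norm_num)),
      h.integral_inner_clippedGradient hκ]
  · simp only [hinner]
    have hmem := h.memLp_inner_clippedGradient hκ w u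
    refine le_trans ?_ (h.integral_inner_clippedGradient_sq_le hκ w u)
    rw [← integral_average_eq hZ hlen hlaw hmem.integrable_sq]
    have hint : ∀ i, MemLp (fun ω => inner ℝ (clippedGradient (Z (S.get i) ω) w κ) u) 2 μ :=
      fun i => memLp_comp_law (hZ _) (hlaw i) hmem
    refine integral_mono ?_ ?_ fun ω => ?_
    · exact ((memLp_finsetSum _ fun i _ => hint i).const_mul _).integrable_sq
    · exact (integrable_finsetSum _ fun i _ => (hint i).integrable_sq).const_mul _
    · have := sq_sum_le_card_mul_sum_sq (s := (Finset.univ : Finset (Fin S.len)))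
        (f := fun i => inner ℝ (clippedGradient (Z (S.get i) ω) w κ) u)
      rw [Finset.card_univ, Fintype.card_fin] at this
      simp only
      rw [mul_pow]
      calc _ ≤ ((S.len : ℝ)⁻¹) ^ 2 *
            (S.len * ∑ i, inner ℝ (clippedGradient (Z (S.get i) ω) w κ) u ^ 2) :=
            mul_le_mul_of_nonneg_left this (sq_nonneg _)
        _ = _ := by field_simp
  · have := integral_average_sub_sq_le hZ hind hS hlen hlaw (hfm u)
      (h.memLp_inner_clippedGradient hκ w u)
    rw [h.integral_inner_clippedGradient hκ] at this
    simp only [inner_sub_left, hinner]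
    refine this.trans ?_
    rw [div_mul_eq_mul_div]
    exact div_le_div_of_nonneg_right (h.integral_inner_clippedGradient_sq_le hκ w u) hm.le

end SampleAverage

/-! ### Elementary consequences of a mean estimate. -/

namespace MeanEstimate

variable [IsProbabilityMeasure μ] {g : Ω → Vec d} {G : Vec d} {b s τ : ℝ}

omit [IsProbabilityMeasure μ] in
theorem memLp_inner (h : MeanEstimate μ g G b s τ) (u : Vec d) :
    MemLp (fun ω => inner ℝ (g ω) u) ⊤ μ := by
  refine memLp_top_of_bound (h.measurable.inner measurable_const).aestronglyMeasurable
    (b * ‖u‖) ?_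
  filter_upwards [h.ae_norm_le] with ω hω
  exact (norm_inner_le_norm _ _).trans (mul_le_mul_of_nonneg_right hω (norm_nonneg u))

theorem memLp_inner_sub (h : MeanEstimate μ g G b s τ) (u : Vec d) :
    MemLp (fun ω => inner ℝ (g ω - G) u) ⊤ μ := by
  simp only [inner_sub_left]
  exact (h.memLp_inner u).sub (memLp_const _)

theorem integral_inner_sub (h : MeanEstimate μ g G b s τ) (u : Vec d) :
    ∫ ω, inner ℝ (g ω - G) u ∂μ = 0 := by
  simp only [inner_sub_left]
  rw [integral_sub ((h.memLp_inner u).integrable le_top) (integrable_const _), h.integral_inner]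
  simp

theorem inner_sq_le (h : MeanEstimate μ g G b s τ) (u : Vec d) :
    inner ℝ G u ^ 2 ≤ s * ‖u‖ ^ 2 := by
  rw [← h.integral_inner]
  exact (sq_integral_le ((h.memLp_inner u).mono_exponent le_top)).trans (h.integral_sq_le u)

theorem norm_mean_le (h : MeanEstimate μ g G b s τ) : ‖G‖ ≤ b := by
  have h1 : ‖G‖ ^ 2 ≤ b * ‖G‖ := by
    rw [← real_inner_self_eq_norm_sq, ← h.integral_inner]
    have := integral_mono_ae ((h.memLp_inner G).integrable le_top)
      (integrable_const (μ := μ) (b * ‖G‖)) (by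
        filter_upwards [h.ae_norm_le] with ω hω
        exact (real_inner_le_norm _ _).trans (mul_le_mul_of_nonneg_right hω (norm_nonneg G)))
    simpa using this
  rcases (norm_nonneg G).eq_or_lt with h0 | h0
  · rw [← h0]
    obtain ⟨ω, hω⟩ := h.ae_norm_le.exists
    exact (norm_nonneg _).trans hω
  · rw [pow_two] at h1
    exact le_of_mul_le_mul_right h1 h0

end MeanEstimate

end Averages

/-! ### Medians of independent estimates -/

section Medians

variable {Ω : Type*} [mΩ : MeasurableSpace Ω] {μ : Measure Ω} [IsProbabilityMeasure μ] {d T : ℕ}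
  {m : Fin T → MeasurableSpace Ω}

theorem lt_two_mul_card_of_not {p q : Fin T → Prop} [DecidablePred p] [DecidablePred q]
    (hpq : ∀ j, ¬ q j → p j)
    (h : ¬ T ≤ 2 * (Finset.univ.filter q).card) : T < 2 * (Finset.univ.filter p).card := by
  have h1 := Finset.card_filter_add_card_filter_not (s := (Finset.univ : Finset (Fin T))) q
  rw [Finset.card_univ, Fintype.card_fin] at h1
  have h2 : (Finset.univ.filter fun j => ¬ q j).card ≤ (Finset.univ.filter p).card :=
    Finset.card_le_card (Finset.monotone_filter_right _ fun j _ => hpq j)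
  omega

theorem measureReal_lt_median_le (hind : iIndep m μ) {v : Ω → Fin T → ℝ}
    (hv : ∀ j, Measurable[m j] fun ω => v ω j) (a : ℝ)
    (hp : ∀ j, μ.real {ω | a < v ω j} ≤ 1 / 8) :
    μ.real {ω | a < median (v ω)} ≤ Real.exp (-(T / 3)) := by
  classical
  refine le_trans (measureReal_mono ?_ (measure_ne_top _ _)) (measureReal_half_le hind
    (fun j => {ω | a < v ω j}) (fun j => hv j measurableSet_Ioi) hp)
  intro ω hω
  by_contra hc
  refine absurd (median_le (v ω) a ?_) (not_le.mpr hω)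
  exact lt_two_mul_card_of_not (fun j hj => not_lt.mp hj) hc

theorem measureReal_median_lt_le (hind : iIndep m μ) {v : Ω → Fin T → ℝ}
    (hv : ∀ j, Measurable[m j] fun ω => v ω j) (a : ℝ)
    (hp : ∀ j, μ.real {ω | v ω j < a} ≤ 1 / 8) :
    μ.real {ω | median (v ω) < a} ≤ Real.exp (-(T / 3)) := by
  classical
  refine le_trans (measureReal_mono ?_ (measure_ne_top _ _)) (measureReal_half_le hind
    (fun j => {ω | v ω j < a}) (fun j => hv j measurableSet_Iio) hp)
  intro ω hω
  by_contra hc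
  refine absurd (le_median (v ω) a ?_) (not_le.mpr hω)
  exact lt_two_mul_card_of_not (fun j hj => not_lt.mp hj) hc

theorem measureReal_lt_norm_centralEntry_sub_le (hind : iIndep m μ) {Δ : Ω → Fin T → Vec d}
    (hΔ : ∀ j, Measurable[m j] fun ω => Δ ω j) (c : Vec d) (ρ : ℝ)
    (hp : ∀ j, μ.real {ω | ρ < ‖Δ ω j - c‖} ≤ 1 / 8) :
    μ.real {ω | 3 * ρ < ‖centralEntry (Δ ω) - c‖} ≤ Real.exp (-(T / 3)) := by
  classical
  refine le_trans (measureReal_mono ?_ (measure_ne_top _ _)) (measureReal_half_le hind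
    (fun j => {ω | ρ < ‖Δ ω j - c‖}) (fun j => ?_) hp)
  · intro ω hω
    by_contra hc
    refine absurd (norm_entryAtMin_sub_le (Δ ω) c ρ ?_) (not_le.mpr hω)
    exact lt_two_mul_card_of_not (fun j hj => not_lt.mp hj) hc
  · have h : Measurable fun x : Vec d => ‖x - c‖ := by fun_prop
    exact (h.comp (hΔ j)) measurableSet_Ioi

end Medians

theorem median_nonneg {n : ℕ} {v : Fin n → ℝ} (hv : ∀ j, 0 ≤ v j) : 0 ≤ median v := by
  rcases Nat.eq_zero_or_pos n with hn | hn
  · rw [median, dif_neg (by omega)]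
  · refine le_median v 0 ?_
    rw [Finset.filter_true_of_mem fun j _ => hv j, Finset.card_univ, Fintype.card_fin]
    omega

theorem lossEst_nonneg {J : Type} {d : ℕ} (Z : J → Sample d) (S : Coll J) (w : Vec d) (T : ℕ) :
    0 ≤ lossEst Z S w T :=
  median_nonneg fun _ => mul_nonneg (by positivity) (Finset.sum_nonneg fun _ _ => sq_nonneg _)

/-! ### The size of the residuals -/

section Residuals

variable {Ω : Type*} [mΩ : MeasurableSpace Ω] {μ : Measure Ω} [IsProbabilityMeasure μ] {d : ℕ}
  {J : Type} {Z : J → Ω → Sample d} {S : Coll J} {D : Measure (Sample d)} {C C₁ B σ : ℝ}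
  {w₀ : Vec d}

/-- Chebyshev's inequality for the second moment: it is enough to average `64 C` samples. -/
theorem measureReal_average_sq_le (hZ : ∀ j, Measurable (Z j)) (hind : iIndepFun Z μ)
    (hS : Function.Injective S.get) (hlen : 0 < S.len) (hlaw : ∀ i, μ.map (Z (S.get i)) = D)
    (hD : IsRegressionComponent D w₀ C C₁ σ) (h : BoundedInput D C₁ B) (hC : 64 * C ≤ S.len)
    (v : Vec d) (he : 0 < ∫ z, inner ℝ z.1 v ^ 2 ∂D) :
    μ.real {ω | (S.len : ℝ)⁻¹ * ∑ i, inner ℝ (Z (S.get i) ω).1 v ^ 2 ≤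
      (∫ z, inner ℝ z.1 v ^ 2 ∂D) / 2} ≤ 1 / 16 := by
  have hm : (0 : ℝ) < S.len := by exact_mod_cast hlen
  have : IsProbabilityMeasure D := by
    rw [← hlaw ⟨0, hlen⟩]
    exact Measure.isProbabilityMeasure_map (hZ _).aemeasurable
  set e := ∫ z, inner ℝ z.1 v ^ 2 ∂D
  have hfm : Measurable fun z : Sample d => inner ℝ z.1 v ^ 2 := (measurable_inner_fst v).pow_const 2
  have hf : MemLp (fun z : Sample d => inner ℝ z.1 v ^ 2) 2 D :=
    (memLp_two_iff_integrable_sq hfm.aestronglyMeasurable).mpr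
      (by simpa [← pow_mul] using h.integrable_inner_pow v 4)
  have hvar := integral_average_sub_sq_le hZ hind hS hlen hlaw hfm hf
  have h4 : ∫ z : Sample d, (inner ℝ z.1 v ^ 2) ^ 2 ∂D ≤ C * e ^ 2 := by
    simpa [← pow_mul] using hD.hypercontractive v
  have hint : Integrable (fun ω => ((S.len : ℝ)⁻¹ * ∑ i, inner ℝ (Z (S.get i) ω).1 v ^ 2 - e) ^ 2)
      μ := (((memLp_finsetSum _ fun i _ => memLp_comp_law (hZ _) (hlaw i) hf).const_mul
        _).sub (memLp_const e)).integrable_sq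
  have hmarkov := measureReal_ge_le_integral_div (μ := μ)
    (Filter.Eventually.of_forall fun ω => sq_nonneg _) hint (a := (e / 2) ^ 2) (by positivity)
  refine le_trans (measureReal_mono ?_ (measure_ne_top _ _)) (hmarkov.trans ?_)
  · intro ω hω
    simp only [Set.mem_ofPred_eq] at hω ⊢
    nlinarith
  -- The variance is at most C e²/len ≤ e²/64, which is 1/16 of (e/2)².
  · rw [div_le_iff₀ (by positivity)]
    refine hvar.trans ?_
    rw [div_le_iff₀ hm]
    refine h4.trans ?_
    nlinarith [sq_nonneg e]

/-- The upper bound is Markov's inequality, as the expected loss is at most 2(C₁‖v‖² + σ²). For the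
lower bound the noise, of which only two moments are available, is split off by (a - t)² ≥ a²/2 -
t²: Chebyshev applies to the part with x·v, Markov to the noise. Each part fails with probability at
most 1/8, and the median amplifies. -/
theorem measureReal_lossEst_le (hZ : ∀ j, Measurable (Z j)) (hind : iIndepFun Z μ)
    (hS : Function.Injective S.get) {T : ℕ} (hlen : 0 < S.len / T)
    (hlaw : ∀ i, μ.map (Z (S.get i)) = D)
    (hD : IsRegressionComponent D w₀ C C₁ σ) (h : BoundedInput D C₁ B) (hσ : 0 < σ) (hC₁ : 0 ≤ C₁)
    (hC : 64 * C ≤ (S.len / T : ℕ)) (w : Vec d) :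
    μ.real {ω | ¬ ((∫ z, inner ℝ z.1 (w - w₀) ^ 2 ∂D) / 4 - 16 * σ ^ 2 ≤
        lossEst (fun j => Z j ω) S w T ∧
      lossEst (fun j => Z j ω) S w T ≤ 16 * (C₁ * ‖w - w₀‖ ^ 2 + σ ^ 2))} ≤
      2 * Real.exp (-(T / 3)) := by
  set v := w - w₀ with hv
  set e := ∫ z, inner ℝ z.1 v ^ 2 ∂D with he
  have hres : ∀ z : Sample d, inner ℝ z.1 w - z.2 = inner ℝ z.1 v - noise w₀ z := by
    intro z
    rw [hv, inner_sub_right, noise, real_inner_comm w₀]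
    ring
  have hTlen : 0 < S.len := lt_of_lt_of_le hlen (Nat.div_le_self _ _)
  have : IsProbabilityMeasure D := by
    rw [← hlaw ⟨0, hTlen⟩]
    exact Measure.isProbabilityMeasure_map (hZ _).aemeasurable
  have hm : (0 : ℝ) < (S.len / T : ℕ) := by exact_mod_cast hlen
  have hlaw' : ∀ j i, μ.map (Z ((S.part T j).get i)) = D := fun j i => hlaw _
  have hinj : ∀ j, Function.Injective (S.part T j).get := fun j => Coll.get_part_injective hS T j
  have hindep : iIndep (fun j => sig Z (S.part T j).support) μ :=
    iIndep_sig hZ hind _ fun j j' hj => Coll.disjoint_support_part hS hj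
  have hmeas : ∀ j, Measurable[sig Z (S.part T j).support] fun ω =>
      meanLoss (fun j => Z j ω) (S.part T j) w := fun j =>
    measurable_meanLoss (m := sig Z (S.part T j).support) (fun i hi => measurable_sig Z hi)
      measurable_const
  have hxv : MemLp (fun z : Sample d => inner ℝ z.1 v) 2 D := (h.memLp_inner v).mono_exponent le_top
  have hnoise := hD.memLp
  have hlossI : Integrable (fun z : Sample d => (inner ℝ z.1 w - z.2) ^ 2) D := by
    simp only [hres]
    exact (hxv.sub hnoise).integrable_sq
  have hup : μ.real {ω | 16 * (C₁ * ‖v‖ ^ 2 + σ ^ 2) < lossEst (fun j => Z j ω) S w T} ≤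
      Real.exp (-(T / 3)) := by
    refine measureReal_lt_median_le hindep hmeas _ fun j => ?_
    have hpos : 0 < 16 * (C₁ * ‖v‖ ^ 2 + σ ^ 2) := by positivity
    have hI : Integrable (fun ω => meanLoss (fun j => Z j ω) (S.part T j) w) μ := by
      refine (integrable_finsetSum _ fun i _ => ?_).const_mul _
      exact memLp_one_iff_integrable.mp (memLp_comp_law (hZ _) (hlaw' j i)
        (memLp_one_iff_integrable.mpr hlossI))
    have hE : ∫ ω, meanLoss (fun j => Z j ω) (S.part T j) w ∂μ =
        ∫ z : Sample d, (inner ℝ z.1 w - z.2) ^ 2 ∂D :=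
      integral_average_eq hZ (S := S.part T j) hlen (hlaw' j) hlossI
    have hle : ∫ z : Sample d, (inner ℝ z.1 w - z.2) ^ 2 ∂D ≤ 2 * (C₁ * ‖v‖ ^ 2 + σ ^ 2) := by
      calc _ ≤ ∫ z, (2 * inner ℝ z.1 v ^ 2 + 2 * noise w₀ z ^ 2) ∂D := by
            refine integral_mono hlossI
              ((hxv.integrable_sq.const_mul 2).add (hnoise.integrable_sq.const_mul 2)) fun z => ?_
            simp only [hres]
            nlinarith [sq_nonneg (inner ℝ z.1 v + noise w₀ z)]
        _ = 2 * e + 2 * ∫ z, noise w₀ z ^ 2 ∂D := by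
            rw [integral_add (hxv.integrable_sq.const_mul 2) (hnoise.integrable_sq.const_mul 2),
              integral_const_mul, integral_const_mul]
        _ ≤ _ := by
            have := h.integral_sq_le v
            have := hD.variance_le
            linarith
    refine le_trans (measureReal_mono (fun ω hω => ?_) (measure_ne_top _ _))
      ((measureReal_ge_le_integral_div (Filter.Eventually.of_forall fun ω => ?_) hI hpos).trans ?_)
    · rw [Set.mem_ofPred_eq] at hω ⊢
      exact hω.le
    · exact mul_nonneg (by positivity) (Finset.sum_nonneg fun _ _ => sq_nonneg _)
    · rw [div_le_iff₀ hpos, hE]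
      linarith
  have hlow : μ.real {ω | lossEst (fun j => Z j ω) S w T < e / 4 - 16 * σ ^ 2} ≤
      Real.exp (-(T / 3)) := by
    refine measureReal_median_lt_le hindep hmeas _ fun j => ?_
    have hloss0 : ∀ ω, 0 ≤ meanLoss (fun j => Z j ω) (S.part T j) w := fun ω =>
      mul_nonneg (by positivity) (Finset.sum_nonneg fun _ _ => sq_nonneg _)
    have he0 : 0 ≤ e := integral_nonneg fun z => sq_nonneg _
    -- Chebyshev's inequality needs e > 0. If e = 0, the lower bound is negative and the loss is
    -- not.
    rcases he0.eq_or_lt with h0 | h0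
    · have : {ω | meanLoss (fun j => Z j ω) (S.part T j) w < e / 4 - 16 * σ ^ 2} = ∅ := by
        ext ω
        simp only [Set.mem_ofPred_eq, Set.mem_empty_iff_false, iff_false, not_lt]
        rw [← h0]
        nlinarith [hloss0 ω]
      rw [this]
      simp
    set A : Ω → ℝ := fun ω => ((S.part T j).len : ℝ)⁻¹ *
      ∑ i, inner ℝ (Z ((S.part T j).get i) ω).1 v ^ 2
    set N : Ω → ℝ := fun ω => ((S.part T j).len : ℝ)⁻¹ *
      ∑ i, noise w₀ (Z ((S.part T j).get i) ω) ^ 2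
    have hA : μ.real {ω | A ω ≤ e / 2} ≤ 1 / 16 :=
      measureReal_average_sq_le hZ hind (hinj j) hlen (hlaw' j) hD h hC v h0
    have hN : μ.real {ω | 16 * σ ^ 2 ≤ N ω} ≤ 1 / 16 := by
      have hNI : Integrable N μ := by
        refine (integrable_finsetSum _ fun i _ => ?_).const_mul _
        exact memLp_one_iff_integrable.mp (memLp_comp_law (hZ _) (hlaw' j i)
          (f := fun z => noise w₀ z ^ 2) (memLp_one_iff_integrable.mpr hnoise.integrable_sq))
      refine (measureReal_ge_le_integral_div (Filter.Eventually.of_forall fun ω => ?_) hNI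
        (by positivity)).trans ?_
      · exact mul_nonneg (by positivity) (Finset.sum_nonneg fun _ _ => sq_nonneg _)
      · have hNE : ∫ ω, N ω ∂μ = ∫ z, noise w₀ z ^ 2 ∂D :=
          integral_average_eq hZ (S := S.part T j) hlen (hlaw' j) hnoise.integrable_sq
        rw [div_le_iff₀ (by positivity), hNE]
        linarith [hD.variance_le]
    have hsub : {ω | meanLoss (fun j => Z j ω) (S.part T j) w < e / 4 - 16 * σ ^ 2} ⊆
        {ω | A ω ≤ e / 2} ∪ {ω | 16 * σ ^ 2 ≤ N ω} := by
      intro ω hω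
      by_contra hc
      simp only [Set.mem_union, Set.mem_ofPred_eq, not_or, not_le] at hc hω
      have : A ω / 2 - N ω ≤ meanLoss (fun j => Z j ω) (S.part T j) w := by
        simp only [A, N, meanLoss]
        rw [mul_div_assoc, ← mul_sub, Finset.sum_div, ← Finset.sum_sub_distrib]
        refine mul_le_mul_of_nonneg_left (Finset.sum_le_sum fun i _ => ?_) (by positivity)
        rw [hres]
        nlinarith [sq_nonneg (inner ℝ (Z ((S.part T j).get i) ω).1 v -
          2 * noise w₀ (Z ((S.part T j).get i) ω))]
      linarith [hc.1, hc.2]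
    refine (measureReal_mono hsub (measure_ne_top _ _)).trans ((measureReal_union_le _ _).trans ?_)
    linarith
  have hsub : {ω | ¬ (e / 4 - 16 * σ ^ 2 ≤ lossEst (fun j => Z j ω) S w T ∧
      lossEst (fun j => Z j ω) S w T ≤ 16 * (C₁ * ‖v‖ ^ 2 + σ ^ 2))} ⊆
      {ω | 16 * (C₁ * ‖v‖ ^ 2 + σ ^ 2) < lossEst (fun j => Z j ω) S w T} ∪
      {ω | lossEst (fun j => Z j ω) S w T < e / 4 - 16 * σ ^ 2} := by
    intro ω hω
    rw [Set.mem_ofPred_eq, not_and_or, not_le, not_le] at hω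
    exact hω.symm
  refine (measureReal_mono hsub (measure_ne_top _ _)).trans ((measureReal_union_le _ _).trans ?_)
  linarith

end Residuals

/-! ### Projected mean estimates -/

section Projections

open Matrix

variable {Ω : Type*} [mΩ : MeasurableSpace Ω] {μ : Measure Ω} [IsProbabilityMeasure μ] {d : ℕ}
  {u : Fin d → Vec d} {b s τ : ℝ} {g g' : Ω → Vec d} {G G' : Vec d}

/-- The factor 4 stems from (a - b)² ≤ 2a² + 2b²; no independence is needed. -/
theorem MeanEstimate.sub (h : MeanEstimate μ g G b s τ) (h' : MeanEstimate μ g' G' b s τ) :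
    MeanEstimate μ (fun ω => g ω - g' ω) (G - G') (2 * b) (4 * s) (4 * τ) := by
  have key : ∀ (f f' : Ω → ℝ) (t : ℝ), MemLp f ⊤ μ → MemLp f' ⊤ μ → ∫ ω, f ω ^ 2 ∂μ ≤ t →
      ∫ ω, f' ω ^ 2 ∂μ ≤ t → ∫ ω, (f ω - f' ω) ^ 2 ∂μ ≤ 4 * t := by
    intro f f' t hf hf' ht ht'
    have i1 := (hf.mono_exponent (q := ⊤) (p := 2) le_top).integrable_sq.const_mul 2
    have i2 := (hf'.mono_exponent (q := ⊤) (p := 2) le_top).integrable_sq.const_mul 2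
    calc _ ≤ ∫ ω, (2 * f ω ^ 2 + 2 * f' ω ^ 2) ∂μ :=
          integral_mono ((hf.sub hf').mono_exponent (p := 2) le_top).integrable_sq (i1.add i2)
            fun ω => by simp only [Pi.sub_apply]; nlinarith [sq_nonneg (f ω + f' ω)]
      _ ≤ _ := by
          rw [integral_add i1 i2, integral_const_mul, integral_const_mul]
          linarith
  refine ⟨h.measurable.sub h'.measurable, ?_, fun x => ?_, fun x => ?_, fun x => ?_⟩
  · filter_upwards [h.ae_norm_le, h'.ae_norm_le] with ω h1 h2
    exact (norm_sub_le _ _).trans (by linarith)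
  · simp only [inner_sub_left]
    rw [integral_sub ((h.memLp_inner x).integrable le_top) ((h'.memLp_inner x).integrable le_top),
      h.integral_inner, h'.integral_inner]
  · simp only [inner_sub_left]
    rw [mul_assoc]
    exact key _ _ _ (h.memLp_inner x) (h'.memLp_inner x) (h.integral_sq_le x) (h'.integral_sq_le x)
  · have e : ∀ ω, inner ℝ (g ω - g' ω - (G - G')) x =
        inner ℝ (g ω - G) x - inner ℝ (g' ω - G') x := by
      intro ω
      simp only [inner_sub_left]
      ring
    simp only [e]
    rw [mul_assoc]
    exact key _ _ _ (h.memLp_inner_sub x) (h'.memLp_inner_sub x) (h.variance_le x)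
      (h'.variance_le x)

theorem MeanEstimate.measureReal_lt_abs_inner_le (h : MeanEstimate μ g G b s τ) (x : Vec d)
    {a p : ℝ} (ha : 0 < a) (hp : τ * ‖x‖ ^ 2 ≤ p * a ^ 2) :
    μ.real {ω | a < |inner ℝ (g ω - G) x|} ≤ p := by
  have hmarkov := measureReal_ge_le_integral_div (μ := μ)
    (Filter.Eventually.of_forall fun ω => sq_nonneg _)
    ((h.memLp_inner_sub x).mono_exponent (p := 2) le_top).integrable_sq (a := a ^ 2) (by positivity)
  refine le_trans (measureReal_mono (fun ω hω => ?_) (measure_ne_top _ _)) (hmarkov.trans ?_)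
  · rw [Set.mem_ofPred_eq] at hω ⊢
    rw [← sq_abs (inner ℝ (g ω - G) x)]
    exact pow_le_pow_left₀ ha.le hω.le 2
  · rw [div_le_iff₀ (by positivity)]
    exact (h.variance_le x).trans hp

omit [IsProbabilityMeasure μ] in
theorem integrable_norm_projection_sq (hu : Orthonormal ℝ u) (ℓ : ℕ) {y : Ω → Vec d}
    (hy : ∀ i, MemLp (fun ω => inner ℝ (u i) (y ω)) 2 μ) :
    Integrable (fun ω => ‖toEuclideanLin (projectionMatrix u ℓ) (y ω)‖ ^ 2) μ := by
  simp only [norm_sq_projectionMatrix hu]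
  exact integrable_finsetSum _ fun i _ => (hy i).integrable_sq

omit [IsProbabilityMeasure μ] in
theorem integral_norm_projection_sq_le (hu : Orthonormal ℝ u) (ℓ : ℕ) {y : Ω → Vec d}
    (hy : ∀ i, MemLp (fun ω => inner ℝ (u i) (y ω)) 2 μ) (hτ0 : 0 ≤ τ)
    (hτ : ∀ i, ∫ ω, inner ℝ (u i) (y ω) ^ 2 ∂μ ≤ τ) :
    ∫ ω, ‖toEuclideanLin (projectionMatrix u ℓ) (y ω)‖ ^ 2 ∂μ ≤ ℓ * τ := by
  simp only [norm_sq_projectionMatrix hu]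
  rw [integral_finsetSum _ fun i _ => (hy i).integrable_sq]
  calc _ ≤ ∑ _i ∈ Finset.univ.filter (fun i : Fin d => (i : ℕ) < ℓ), τ :=
        Finset.sum_le_sum fun i _ => hτ i
    _ = (Finset.univ.filter (fun i : Fin d => (i : ℕ) < ℓ)).card * τ := by
        rw [Finset.sum_const, nsmul_eq_mul]
    _ ≤ ℓ * τ := mul_le_mul_of_nonneg_right (by exact_mod_cast card_filter_lt_le d ℓ) hτ0

theorem MeanEstimate.memLp_inner_sub' (h : MeanEstimate μ g G b s τ) (x : Vec d) :
    MemLp (fun ω => inner ℝ x (g ω - G)) 2 μ := by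
  simp only [real_inner_comm _ x]
  exact (h.memLp_inner_sub x).mono_exponent le_top

theorem MeanEstimate.integral_norm_projection_sub_sq_le (h : MeanEstimate μ g G b s τ)
    (hu : Orthonormal ℝ u) (ℓ : ℕ) (hτ : 0 ≤ τ) :
    ∫ ω, ‖toEuclideanLin (projectionMatrix u ℓ) (g ω - G)‖ ^ 2 ∂μ ≤ ℓ * τ := by
  refine integral_norm_projection_sq_le hu ℓ (fun i => h.memLp_inner_sub' _) hτ fun i => ?_
  simp only [real_inner_comm _ (u i)]
  simpa [hu.1 i] using h.variance_le (u i)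

theorem measurable_toEuclideanLin (P : Matrix (Fin d) (Fin d) ℝ) :
    Measurable fun x : Vec d => toEuclideanLin P x :=
  (LinearMap.continuous_of_finiteDimensional _).measurable

/-- The inner product of two independent projected estimates of `G` estimates the squared norm of
the projection of `G`. -/
theorem measureReal_inner_projection_le (hg : MeanEstimate μ g G b s τ)
    (hg' : MeanEstimate μ g' G b s τ) (hind : g' ⟂ᵢ[μ] g) (hu : Orthonormal ℝ u) {ℓ : ℕ} {h : ℝ}
    (hh : 0 < h) (hℓ : 1 ≤ ℓ) (hτ0 : 0 < τ) (hτ : 640 * (τ * Real.sqrt ℓ) ≤ h ^ 2) :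
    μ.real {ω | ‖toEuclideanLin (projectionMatrix u ℓ) G‖ * h + h ^ 2 / 20 <
      |inner ℝ (toEuclideanLin (projectionMatrix u ℓ) (g ω))
        (toEuclideanLin (projectionMatrix u ℓ) (g' ω)) -
        ‖toEuclideanLin (projectionMatrix u ℓ) G‖ ^ 2|} ≤ 1 / 8 := by
  set P := toEuclideanLin (projectionMatrix u ℓ) with hP
  have hPP : ∀ x y, inner ℝ (P x) (P y) = inner ℝ x (P y) :=
    inner_projectionMatrix_projectionMatrix hu ℓ
  have hℓ' : (1 : ℝ) ≤ Real.sqrt ℓ := by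
    rw [Real.one_le_sqrt]
    exact_mod_cast hℓ
  have hτh : 640 * τ ≤ h ^ 2 := by nlinarith
  -- the two linear terms
  have hlin : ∀ f : Ω → Vec d, MeanEstimate μ f G b s τ →
      μ.real {ω | ‖P G‖ * h / 2 < |inner ℝ (f ω - G) (P G)|} ≤ 1 / 32 := by
    intro f hf
    rcases (norm_nonneg (P G)).eq_or_lt with h0 | h0
    · rw [eq_comm, norm_eq_zero] at h0
      rw [h0]
      simp
    · refine hf.measureReal_lt_abs_inner_le _ (by positivity) ?_
      nlinarith [mul_le_mul_of_nonneg_left hτh (sq_nonneg ‖P G‖)]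
  -- the quadratic term
  have hbig : μ.real {ω | ¬ ‖P (g' ω - G)‖ ^ 2 ≤ 32 * (ℓ * τ)} ≤ 1 / 32 := by
    have hpos : 0 < 32 * ((ℓ : ℝ) * τ) := by positivity
    have := measureReal_ge_le_integral_div (μ := μ)
      (Filter.Eventually.of_forall fun ω => sq_nonneg _)
      (integrable_norm_projection_sq hu ℓ fun i => hg'.memLp_inner_sub' (u i)) hpos
    refine le_trans (measureReal_mono (fun ω hω => ?_) (measure_ne_top _ _)) (this.trans ?_)
    · rw [Set.mem_ofPred_eq, not_le] at hω
      exact hω.le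
    · rw [div_le_iff₀ hpos]
      have := hg'.integral_norm_projection_sub_sq_le hu ℓ hτ0.le
      linarith
  -- For fixed g' the bilinear term is linear in g, with variance at most τ · 32ℓτ. The threshold
  -- h²/20 and the probability 1/32 lead to 640² = 32 · 32 · 400, and the square root turns ℓ into
  -- √ℓ.
  have hquad : μ.real {ω | g' ω ∈ {y | ‖P (y - G)‖ ^ 2 ≤ 32 * (ℓ * τ)} ∧
      h ^ 2 / 20 < |inner ℝ (g ω - G) (P (g' ω - G))|} ≤ 1 / 32 := by
    have hPm : Measurable fun y : Vec d => P (y - G) :=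
      (measurable_toEuclideanLin _).comp (measurable_id.sub_const G)
    refine measureReal_section_le_of_indepFun hg'.measurable hg.measurable hind
      (Q := fun y x => h ^ 2 / 20 < |inner ℝ (x - G) (P (y - G))|)
      (measurableSet_le (hPm.norm.pow_const 2) measurable_const) ?_ (by norm_num) fun y hy => ?_
    · have h1 : Measurable fun p : Vec d × Vec d => inner ℝ (p.2 - G) (P (p.1 - G)) :=
        Measurable.inner (𝕜 := ℝ) (measurable_snd.sub_const G) (hPm.comp measurable_fst)
      exact measurableSet_lt measurable_const h1.norm
    · refine hg.measureReal_lt_abs_inner_le _ (by positivity) ?_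
      have h2 : (640 * (τ * Real.sqrt ℓ)) ^ 2 ≤ (h ^ 2) ^ 2 :=
        pow_le_pow_left₀ (by positivity) hτ 2
      have h3 : (640 * (τ * Real.sqrt ℓ)) ^ 2 = 640 ^ 2 * (τ * (ℓ * τ)) := by
        rw [mul_pow, mul_pow, Real.sq_sqrt (Nat.cast_nonneg _)]
        ring
      rw [Set.mem_ofPred_eq] at hy
      calc τ * ‖P (y - G)‖ ^ 2 ≤ τ * (32 * (ℓ * τ)) := mul_le_mul_of_nonneg_left hy hτ0.le
        _ ≤ _ := by nlinarith
  have hsub : {ω | ‖P G‖ * h + h ^ 2 / 20 < |inner ℝ (P (g ω)) (P (g' ω)) - ‖P G‖ ^ 2|} ⊆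
      ({ω | ‖P G‖ * h / 2 < |inner ℝ (g ω - G) (P G)|} ∪
        {ω | ‖P G‖ * h / 2 < |inner ℝ (g' ω - G) (P G)|}) ∪
      ({ω | ¬ ‖P (g' ω - G)‖ ^ 2 ≤ 32 * (ℓ * τ)} ∪
        {ω | g' ω ∈ {y | ‖P (y - G)‖ ^ 2 ≤ 32 * (ℓ * τ)} ∧
          h ^ 2 / 20 < |inner ℝ (g ω - G) (P (g' ω - G))|}) := by
    intro ω hω
    by_contra hc
    simp only [Set.mem_union, Set.mem_ofPred_eq, not_or, not_and, not_lt, not_not] at hc hω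
    obtain ⟨⟨h1, h2⟩, h3, h4⟩ := hc
    have h4 := h4 h3
    have e : inner ℝ (P (g ω)) (P (g' ω)) - ‖P G‖ ^ 2 = inner ℝ (g ω - G) (P G) +
        inner ℝ (g' ω - G) (P G) + inner ℝ (g ω - G) (P (g' ω - G)) := by
      have hsymm : inner ℝ (g' ω) (P G) = inner ℝ G (P (g' ω)) :=
        (hPP _ _).symm.trans ((real_inner_comm _ _).trans (hPP _ _))
      rw [← real_inner_self_eq_norm_sq, hPP (g ω), hPP G]
      simp only [map_sub, inner_sub_left, inner_sub_right]
      rw [hsymm]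
      ring
    rw [e] at hω
    have := abs_add_three (inner ℝ (g ω - G) (P G)) (inner ℝ (g' ω - G) (P G))
      (inner ℝ (g ω - G) (P (g' ω - G)))
    linarith
  refine (measureReal_mono hsub (measure_ne_top _ _)).trans ((measureReal_union_le _ _).trans ?_)
  have e1 := measureReal_union_le (μ := μ) {ω | ‖P G‖ * h / 2 < |inner ℝ (g ω - G) (P G)|}
    {ω | ‖P G‖ * h / 2 < |inner ℝ (g' ω - G) (P G)|}
  have e2 := measureReal_union_le (μ := μ) {ω | ¬ ‖P (g' ω - G)‖ ^ 2 ≤ 32 * (ℓ * τ)}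
    {ω | g' ω ∈ {y | ‖P (y - G)‖ ^ 2 ≤ 32 * (ℓ * τ)} ∧
          h ^ 2 / 20 < |inner ℝ (g ω - G) (P (g' ω - G))|}
  linarith [hlin g hg, hlin g' hg']

/-- The median of such inner products. -/
theorem measureReal_median_inner_projection_le {T : ℕ} {m : Fin T → MeasurableSpace Ω}
    (hm : iIndep m μ) {g g' : Fin T → Ω → Vec d} (hgm : ∀ j, Measurable[m j] (g j))
    (hgm' : ∀ j, Measurable[m j] (g' j)) (hg : ∀ j, MeanEstimate μ (g j) G b s τ)
    (hg' : ∀ j, MeanEstimate μ (g' j) G b s τ) (hind : ∀ j, g' j ⟂ᵢ[μ] g j)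
    (hu : Orthonormal ℝ u) {ℓ : ℕ} {h : ℝ}
    (hh : 0 < h) (hℓ : 1 ≤ ℓ) (hτ0 : 0 < τ) (hτ : 640 * (τ * Real.sqrt ℓ) ≤ h ^ 2) :
    μ.real {ω | ‖toEuclideanLin (projectionMatrix u ℓ) G‖ * h + h ^ 2 / 20 <
      |(median fun j => inner ℝ (toEuclideanLin (projectionMatrix u ℓ) (g j ω))
        (toEuclideanLin (projectionMatrix u ℓ) (g' j ω))) -
        ‖toEuclideanLin (projectionMatrix u ℓ) G‖ ^ 2|} ≤ 2 * Real.exp (-(T / 3)) := by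
  set P := toEuclideanLin (projectionMatrix u ℓ) with hP
  have hmeas : ∀ j, Measurable[m j] fun ω => inner ℝ (P (g j ω)) (P (g' j ω)) := by
    intro j
    exact Measurable.inner (𝕜 := ℝ) ((measurable_toEuclideanLin _).comp (hgm j))
      ((measurable_toEuclideanLin _).comp (hgm' j))
  have hone := fun j => measureReal_inner_projection_le (hg j) (hg' j) (hind j) hu hh hℓ hτ0 hτ
  have h1 := measureReal_lt_median_le hm hmeas (‖P G‖ ^ 2 + (‖P G‖ * h + h ^ 2 / 20)) fun j => by
    refine le_trans (measureReal_mono (fun ω hω => ?_) (measure_ne_top _ _)) (hone j)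
    rw [Set.mem_ofPred_eq] at hω ⊢
    exact lt_of_lt_of_le (by linarith) (le_abs_self _)
  have h2 := measureReal_median_lt_le hm hmeas (‖P G‖ ^ 2 - (‖P G‖ * h + h ^ 2 / 20)) fun j => by
    refine le_trans (measureReal_mono (fun ω hω => ?_) (measure_ne_top _ _)) (hone j)
    rw [Set.mem_ofPred_eq] at hω ⊢
    exact lt_of_lt_of_le (by linarith) (neg_le_abs _)
  refine le_trans (measureReal_mono (fun ω hω => ?_) (measure_ne_top _ _))
    ((measureReal_union_le _ _).trans (add_le_add h1 h2) |>.trans_eq (by ring))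
  rw [Set.mem_ofPred_eq, lt_abs] at hω
  rcases hω with hω | hω
  · left
    rw [Set.mem_ofPred_eq]
    linarith
  · right
    rw [Set.mem_ofPred_eq]
    linarith

/-- The average of projected estimates from different batches. -/
theorem measureReal_average_projection_le {ι : Type*} {kept : Finset ι} (hk : kept.Nonempty)
    {g : ι → Ω → Vec d} {G : ι → Vec d} (hg : ∀ i ∈ kept, MeanEstimate μ (g i) (G i) b s τ)
    (hind : Set.Pairwise ↑kept fun i j => g i ⟂ᵢ[μ] g j) (hu : Orthonormal ℝ u) {ℓ : ℕ} {h : ℝ}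
    (hh : 0 < h) (hτ0 : 0 ≤ τ) (hτ : 8 * (ℓ * τ) ≤ kept.card * h ^ 2) :
    μ.real {ω | h < ‖(kept.card : ℝ)⁻¹ •
        ∑ i ∈ kept, toEuclideanLin (projectionMatrix u ℓ) (g i ω) -
      (kept.card : ℝ)⁻¹ • ∑ i ∈ kept, toEuclideanLin (projectionMatrix u ℓ) (G i)‖} ≤ 1 / 8 := by
  have hc : (0 : ℝ) < kept.card := by exact_mod_cast hk.card_pos
  set P := toEuclideanLin (projectionMatrix u ℓ) with hP
  set y : Ω → Vec d := fun ω => (kept.card : ℝ)⁻¹ • ∑ i ∈ kept, (g i ω - G i)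
  have hy : ∀ ω, (kept.card : ℝ)⁻¹ • ∑ i ∈ kept, P (g i ω) - (kept.card : ℝ)⁻¹ • ∑ i ∈ kept, P (G i)
      = P (y ω) := by
    intro ω
    simp only [y, map_smul, map_sum, map_sub, Finset.sum_sub_distrib, smul_sub]
  have hinner : ∀ x ω, inner ℝ x (y ω) =
      (kept.card : ℝ)⁻¹ * ∑ i ∈ kept, inner ℝ (g i ω - G i) x := by
    intro x ω
    simp only [y]
    rw [inner_smul_right, inner_sum]
    simp only [real_inner_comm x]
  have hmem : ∀ x : Vec d, ∀ i ∈ kept, MemLp (fun ω => inner ℝ (g i ω - G i) x) 2 μ :=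
    fun x i hi => ((hg i hi).memLp_inner_sub x).mono_exponent le_top
  have hymem : ∀ i, MemLp (fun ω => inner ℝ (u i) (y ω)) 2 μ := by
    intro i
    simp only [hinner]
    exact (memLp_finsetSum _ (hmem (u i))).const_mul _
  have hvar : ∀ i, ∫ ω, inner ℝ (u i) (y ω) ^ 2 ∂μ ≤ τ / kept.card := by
    intro i
    simp only [hinner, mul_pow]
    rw [integral_const_mul]
    have := integral_sum_sq_le (μ := μ) kept (hmem (u i)) (fun a ha c hc' hac =>
      (hind ha hc' hac).comp (φ := fun x => inner ℝ (x - G a) (u i))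
        (ψ := fun x => inner ℝ (x - G c) (u i))
        (Measurable.inner (𝕜 := ℝ) (measurable_id.sub_const _) measurable_const)
        (Measurable.inner (𝕜 := ℝ) (measurable_id.sub_const _) measurable_const))
      (fun a ha => (hg a ha).integral_inner_sub (u i)) (τ := τ)
      (fun a ha => by simpa [hu.1 i] using (hg a ha).variance_le (u i))
    calc _ ≤ ((kept.card : ℝ)⁻¹) ^ 2 * (kept.card * τ) :=
          mul_le_mul_of_nonneg_left this (sq_nonneg _)
      _ = _ := by field_simp
  simp only [hy]
  have hmarkov := measureReal_ge_le_integral_div (μ := μ)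
      (Filter.Eventually.of_forall fun ω => sq_nonneg _)
      (integrable_norm_projection_sq hu ℓ hymem) (a := h ^ 2) (by positivity)
  refine le_trans (measureReal_mono (fun ω hω => ?_) (measure_ne_top _ _)) (hmarkov.trans ?_)
  · rw [Set.mem_ofPred_eq] at hω ⊢
    exact pow_le_pow_left₀ hh.le hω.le 2
  · rw [div_le_iff₀ (by positivity)]
    refine (integral_norm_projection_sq_le hu ℓ hymem (div_nonneg hτ0 hc.le) hvar).trans ?_
    rw [← mul_div_assoc, div_le_iff₀ hc]
    linarith

end Projections

/-! ### Subspace estimation -/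

section Subspace

open Matrix

variable {Ω : Type*} [mΩ : MeasurableSpace Ω] {μ : Measure Ω} [IsProbabilityMeasure μ] {d N : ℕ}
  {β s τ : ℝ}

/-- The symmetrized product of two vectors, minus the square of a third one. -/
def crossDeviation (x y G : Vec d) : Matrix (Fin d) (Fin d) ℝ :=
  (1 / 2 : ℝ) • (vecMulVec x y + vecMulVec y x) - vecMulVec G G

theorem crossDeviation_apply (x y G : Vec d) (a c : Fin d) :
    crossDeviation x y G a c = 1 / 2 * (x a * y c + y a * x c) - G a * G c := by
  simp [crossDeviation, vecMulVec_apply]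
  ring

theorem crossDeviation_isSymm (x y G : Vec d) : (crossDeviation x y G).IsSymm := by
  ext a c
  rw [transpose_apply, crossDeviation_apply, crossDeviation_apply]
  ring

theorem toEuclideanLin_crossDeviation (x y G u : Vec d) :
    toEuclideanLin (crossDeviation x y G) u =
      (1 / 2 : ℝ) • (inner ℝ y u • x + inner ℝ x u • y) - inner ℝ G u • G := by
  simp only [crossDeviation, map_sub, map_smul, map_add, LinearMap.sub_apply, LinearMap.smul_apply,
    LinearMap.add_apply, toEuclideanLin_vecMulVec]

theorem norm_inner_smul_le {x : Vec d} (hx : ‖x‖ ≤ β) (t : ℝ) : ‖t • x‖ ≤ β * |t| := by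
  rw [norm_smul, Real.norm_eq_abs, mul_comm]
  exact mul_le_mul_of_nonneg_right hx (abs_nonneg t)

theorem norm_crossDeviation_le {x y G : Vec d} (hx : ‖x‖ ≤ β) (hy : ‖y‖ ≤ β) (hG : ‖G‖ ≤ β)
    (u : Vec d) : ‖toEuclideanLin (crossDeviation x y G) u‖ ≤ 2 * β ^ 2 * ‖u‖ := by
  have hβ : 0 ≤ β := (norm_nonneg x).trans hx
  have h : ∀ {x : Vec d}, ‖x‖ ≤ β → |inner ℝ x u| ≤ β * ‖u‖ := fun hx =>
    (abs_real_inner_le_norm _ _).trans (mul_le_mul_of_nonneg_right hx (norm_nonneg u))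
  rw [toEuclideanLin_crossDeviation]
  refine (norm_sub_le _ _).trans ?_
  rw [norm_smul, Real.norm_of_nonneg (by norm_num : (0 : ℝ) ≤ 1 / 2)]
  have h1 := norm_add_le (inner ℝ y u • x) (inner ℝ x u • y)
  have h2 := norm_inner_smul_le hx (inner ℝ y u)
  have h3 := norm_inner_smul_le hy (inner ℝ x u)
  have h4 := norm_inner_smul_le hG (inner ℝ G u)
  have h5 := mul_le_mul_of_nonneg_left (h hx) hβ
  have h6 := mul_le_mul_of_nonneg_left (h hy) hβ
  have h7 := mul_le_mul_of_nonneg_left (h hG) hβ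
  nlinarith

/-- For the matrix variance: one factor of each product is bounded by its length β, the other
contributes its second moment in the direction u. The mean is then of order β²s instead of β⁴. -/
theorem norm_crossDeviation_sq_le {x y G : Vec d} (hx : ‖x‖ ≤ β) (hy : ‖y‖ ≤ β) (hG : ‖G‖ ≤ β)
    (u : Vec d) : ‖toEuclideanLin (crossDeviation x y G) u‖ ^ 2 ≤
      β ^ 2 * (inner ℝ x u ^ 2 + inner ℝ y u ^ 2 + 2 * inner ℝ G u ^ 2) := by
  have hβ : 0 ≤ β := (norm_nonneg x).trans hx
  rw [toEuclideanLin_crossDeviation]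
  have h0 := norm_sub_le ((1 / 2 : ℝ) • (inner ℝ y u • x + inner ℝ x u • y)) (inner ℝ G u • G)
  rw [norm_smul, Real.norm_of_nonneg (by norm_num : (0 : ℝ) ≤ 1 / 2)] at h0
  have h1 := norm_add_le (inner ℝ y u • x) (inner ℝ x u • y)
  have h2 := norm_inner_smul_le hx (inner ℝ y u)
  have h3 := norm_inner_smul_le hy (inner ℝ x u)
  have h4 := norm_inner_smul_le hG (inner ℝ G u)
  set p := |inner ℝ x u|
  set q := |inner ℝ y u|
  set r := |inner ℝ G u|
  have hle : ‖(1 / 2 : ℝ) • (inner ℝ y u • x + inner ℝ x u • y) - inner ℝ G u • G‖ ≤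
      β * (1 / 2 * (q + p) + r) := by linarith
  calc _ ≤ (β * (1 / 2 * (q + p) + r)) ^ 2 := pow_le_pow_left₀ (norm_nonneg _) hle 2
    _ = β ^ 2 * (1 / 2 * (q + p) + r) ^ 2 := mul_pow _ _ _
    _ ≤ β ^ 2 * (p ^ 2 + q ^ 2 + 2 * r ^ 2) := by
        refine mul_le_mul_of_nonneg_left ?_ (sq_nonneg β)
        nlinarith [sq_nonneg (1 / 2 * (q + p) - r), sq_nonneg (q - p)]
    _ = _ := by simp only [p, q, r, sq_abs]

omit [IsProbabilityMeasure μ] in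
theorem MeanEstimate.integral_apply {g : Ω → Vec d} {G : Vec d} (h : MeanEstimate μ g G β s τ)
    (a : Fin d) : MemLp (fun ω => g ω a) ⊤ μ ∧ ∫ ω, g ω a ∂μ = G a := by
  have e : ∀ x : Vec d, x a = inner ℝ x (EuclideanSpace.single a (1 : ℝ)) := fun x => by
    simp [EuclideanSpace.inner_single_right]
  simp only [e]
  exact ⟨h.memLp_inner _, h.integral_inner _⟩

theorem MeanEstimate.norm_mean_sq_le {g : Ω → Vec d} {G : Vec d} (h : MeanEstimate μ g G β s τ)
    (hs : 0 ≤ s) : ‖G‖ ^ 2 ≤ s := by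
  have h1 := h.inner_sq_le G
  rw [real_inner_self_eq_norm_sq] at h1
  rcases (sq_nonneg ‖G‖).eq_or_lt with h0 | h0
  · rw [← h0]; exact hs
  · rw [pow_two (‖G‖ ^ 2)] at h1
    exact le_of_mul_le_mul_right h1 h0

/-- The deviations are centred, because the two estimates of a batch are independent with a common
mean. The sign `c` gives both tails of the quadratic form. -/
theorem measureReal_crossDeviation_le {g₁ g₂ : Fin N → Ω → Vec d} {G : Fin N → Vec d}
    (hg₁ : ∀ b, MeanEstimate μ (g₁ b) (G b) β s τ) (hg₂ : ∀ b, MeanEstimate μ (g₂ b) (G b) β s τ)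
    (hind : ∀ b, g₁ b ⟂ᵢ[μ] g₂ b) (hiind : iIndepFun (fun b ω => (g₁ b ω, g₂ b ω)) μ)
    (hβ : 0 < β) (hs : 0 < s) {γ : ℝ} (hγ : 0 < γ) {c : ℝ} (hc : |c| = 1) :
    μ.real {ω | ∃ u : Vec d, N * γ * ‖u‖ ^ 2 <
      inner ℝ u (toEuclideanLin (∑ b, c • crossDeviation (g₁ b ω) (g₂ b ω) (G b)) u)} ≤
      d * Real.exp (-(N * γ ^ 2 / (4 * β ^ 2 * (4 * s + γ)))) := by
  set X : Fin N → Ω → Fin d → Fin d → ℝ := fun b ω a e =>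
    c * (1 / 2 * (g₁ b ω a * g₂ b ω e + g₂ b ω a * g₁ b ω e) - G b a * G b e)
  have hX : ∀ b ω, Matrix.of (X b ω) = c • crossDeviation (g₁ b ω) (g₂ b ω) (G b) := by
    intro b ω
    ext a e
    simp only [X, Matrix.of_apply, Matrix.smul_apply, smul_eq_mul, crossDeviation_apply]
  have hcoord : ∀ a : Fin d, Measurable fun x : Vec d => x a := fun a => by fun_prop
  have hφ : ∀ b, Measurable fun (q : Vec d × Vec d) (a e : Fin d) =>
      c * (1 / 2 * (q.1 a * q.2 e + q.2 a * q.1 e) - G b a * G b e) := by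
    intro b
    refine measurable_pi_lambda _ fun a => measurable_pi_lambda _ fun e => ?_
    have h1 : ∀ a : Fin d, Measurable fun q : Vec d × Vec d => q.1 a := fun a =>
      (hcoord a).comp measurable_fst
    have h2 : ∀ a : Fin d, Measurable fun q : Vec d × Vec d => q.2 a := fun a =>
      (hcoord a).comp measurable_snd
    exact (((((h1 a).mul (h2 e)).add ((h2 a).mul (h1 e))).const_mul _).sub_const _).const_mul _
  have hXm : ∀ b, Measurable (X b) := fun b =>
    (hφ b).comp ((hg₁ b).measurable.prodMk (hg₂ b).measurable)
  have hXi : iIndepFun X μ := hiind.comp _ hφ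
  have hnorm : ∀ b ω u, ‖toEuclideanLin (Matrix.of (X b ω)) u‖ =
      ‖toEuclideanLin (crossDeviation (g₁ b ω) (g₂ b ω) (G b)) u‖ := by
    intro b ω u
    rw [hX, map_smul, LinearMap.smul_apply, norm_smul, Real.norm_eq_abs, hc, one_mul]
  have hden : 0 < 4 * β ^ 2 * (4 * s + γ) := by positivity
  -- With D = 4β²(4s + γ) and θ = 2γ/D, the product θ · 2β² = γ/(4s + γ) is at most 1 and θ² · 4β²s
  -- ≤ γ²/D. The exponent is then at most N(γ²/D - 2γ²/D).
  have key := matrix_bernstein (μ := μ) (X := X) hXm hXi (fun b ω => by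
      rw [hX]
      exact (crossDeviation_isSymm _ _ _).smul c) (L := 2 * β ^ 2) (v := 4 * β ^ 2 * s)
    (θ := 2 * γ / (4 * β ^ 2 * (4 * s + γ))) (t := N * γ) (by positivity) (by
      rw [div_mul_eq_mul_div, div_le_one hden]
      nlinarith [mul_pos (pow_pos hβ 2) hs])
    (fun b => by
      filter_upwards [(hg₁ b).ae_norm_le, (hg₂ b).ae_norm_le] with ω h1 h2 u
      rw [hnorm]
      exact norm_crossDeviation_le h1 h2 (hg₁ b).norm_mean_le u)
    (fun b a e => by
      obtain ⟨m1, i1⟩ := (hg₁ b).integral_apply a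
      obtain ⟨m2, i2⟩ := (hg₂ b).integral_apply a
      obtain ⟨m1', i1'⟩ := (hg₁ b).integral_apply e
      obtain ⟨m2', i2'⟩ := (hg₂ b).integral_apply e
      have I1 : Integrable (fun ω => g₁ b ω a * g₂ b ω e) μ :=
        (m2'.mul m1 (r := ⊤)).integrable le_top
      have I2 : Integrable (fun ω => g₂ b ω a * g₁ b ω e) μ :=
        (m1'.mul m2 (r := ⊤)).integrable le_top
      have E1 : ∫ ω, g₁ b ω a * g₂ b ω e ∂μ = G b a * G b e := by
        have := (hind b).comp (hcoord a) (hcoord e)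
        rw [← i1, ← i2']
        exact this.integral_fun_mul_eq_mul_integral m1.1 m2'.1
      have E2 : ∫ ω, g₂ b ω a * g₁ b ω e ∂μ = G b a * G b e := by
        have := ((hind b).comp (hcoord e) (hcoord a)).symm
        rw [← i2, ← i1']
        exact this.integral_fun_mul_eq_mul_integral m2.1 m1'.1
      have I3 : Integrable (fun ω => 1 / 2 * (g₁ b ω a * g₂ b ω e + g₂ b ω a * g₁ b ω e)) μ :=
        (I1.add I2).const_mul _
      simp only [X]
      rw [integral_const_mul, integral_sub I3 (integrable_const _), integral_const_mul,
        integral_add I1 I2, E1, E2]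
      simp
      ring_nf
      simp)
    (by positivity)
    (fun b u => by
      simp only [hnorm]
      have q1 := ((hg₁ b).memLp_inner u).mono_exponent (p := 2) le_top |>.integrable_sq
      have q2 := ((hg₂ b).memLp_inner u).mono_exponent (p := 2) le_top |>.integrable_sq
      have q12 : Integrable (fun ω => inner ℝ (g₁ b ω) u ^ 2 + inner ℝ (g₂ b ω) u ^ 2) μ :=
        q1.add q2
      have q : Integrable (fun ω => β ^ 2 * (inner ℝ (g₁ b ω) u ^ 2 + inner ℝ (g₂ b ω) u ^ 2 +
        2 * inner ℝ (G b) u ^ 2)) μ := (q12.add (integrable_const _)).const_mul _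
      refine (integral_mono_of_nonneg (Filter.Eventually.of_forall fun ω => sq_nonneg _) q
        ?_).trans ?_
      · filter_upwards [(hg₁ b).ae_norm_le, (hg₂ b).ae_norm_le] with ω h1 h2
        exact norm_crossDeviation_sq_le h1 h2 (hg₁ b).norm_mean_le u
      · rw [integral_const_mul, integral_add q12 (integrable_const _), integral_add q1 q2]
        have := (hg₁ b).integral_sq_le u
        have := (hg₂ b).integral_sq_le u
        have := (hg₁ b).inner_sq_le u
        rw [mul_assoc (4 : ℝ), mul_comm (4 : ℝ), mul_assoc, mul_assoc]
        refine mul_le_mul_of_nonneg_left ?_ (sq_nonneg β)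
        simp only [integral_const, probReal_univ, one_smul]
        linarith)
  simp only [hX] at key
  refine key.trans (mul_le_mul_of_nonneg_left (Real.exp_le_exp.mpr ?_) (Nat.cast_nonneg d))
  rw [Fintype.card_fin]
  have hN : (0 : ℝ) ≤ N := Nat.cast_nonneg N
  set δ := 4 * β ^ 2 * (4 * s + γ) with hδ
  have h1 : (2 * γ / δ) ^ 2 * (4 * β ^ 2 * s) ≤ γ ^ 2 / δ := by
    rw [div_pow, div_mul_eq_mul_div, div_le_div_iff₀ (by positivity) hden]
    have : 4 * (4 * β ^ 2 * s) ≤ δ := by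
      rw [hδ]
      nlinarith [mul_pos (pow_pos hβ 2) hγ]
    nlinarith [mul_le_mul_of_nonneg_left this (by positivity : 0 ≤ γ ^ 2 * δ)]
  have h2 : 2 * γ / δ * (N * γ) = N * (2 * (γ ^ 2 / δ)) := by ring
  rw [h2, mul_div_assoc (N : ℝ)]
  linarith [mul_le_mul_of_nonneg_left h1 hN]

/-- With high probability the top singular vectors of the cross matrix almost contain the mean of
each component that is the source of sufficiently many batches. -/
theorem measureReal_subspace_le {k : ℕ} {g₁ g₂ : Fin N → Ω → Vec d} {f : Fin k → Vec d}
    {src : Fin N → Fin k} (hg₁ : ∀ b, MeanEstimate μ (g₁ b) (f (src b)) β s τ)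
    (hg₂ : ∀ b, MeanEstimate μ (g₂ b) (f (src b)) β s τ)
    (hind : ∀ b, g₁ b ⟂ᵢ[μ] g₂ b) (hiind : iIndepFun (fun b ω => (g₁ b ω, g₂ b ω)) μ)
    (hβ : 0 < β) (hs : 0 < s) (svd : SingularVectorRoutine d) {i₀ : Fin k} {α h : ℝ} (hα : 0 < α)
    (hh : 0 < h) (hN : 0 < N)
    (hgood : α / 2 * N ≤ (Finset.univ.filter fun b => src b = i₀).card) {ℓ : ℕ}
    (hℓ : k ≤ ℓ ∨ s ≤ 2 * (α * h ^ 2) * (ℓ + 1)) :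
    μ.real {ω | 3 * h < ‖f i₀ - toEuclideanLin (projectionMatrix (svd.vec ((2 * (N : ℝ))⁻¹ •
      ∑ b, (vecMulVec (g₁ b ω) (g₂ b ω) + vecMulVec (g₂ b ω) (g₁ b ω)))) ℓ) (f i₀)‖} ≤
      2 * (d * Real.exp (-(N * (α * h ^ 2) ^ 2 / (4 * β ^ 2 * (4 * s + α * h ^ 2))))) := by
  have hN' : (0 : ℝ) < N := by exact_mod_cast hN
  have hγ : 0 < α * h ^ 2 := by positivity
  set γ := α * h ^ 2 with hγe
  have k1 := measureReal_crossDeviation_le hg₁ hg₂ hind hiind hβ hs hγ (c := 1) (by simp)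
  have k2 := measureReal_crossDeviation_le hg₁ hg₂ hind hiind hβ hs hγ (c := -1) (by simp)
  refine le_trans (measureReal_mono (fun ω hω => ?_) (measure_ne_top _ _))
    ((measureReal_union_le _ _).trans (add_le_add k1 k2) |>.trans_eq (by ring))
  by_contra hc
  simp only [Set.mem_union, Set.mem_ofPred_eq, not_or, not_exists, not_lt] at hc hω
  obtain ⟨c1, c2⟩ := hc
  refine absurd ?_ (not_le.mpr hω)
  set A : Matrix (Fin d) (Fin d) ℝ := (2 * (N : ℝ))⁻¹ •
      ∑ b, (vecMulVec (g₁ b ω) (g₂ b ω) + vecMulVec (g₂ b ω) (g₁ b ω)) with hA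
  set M := gramMatrix fun b => f (src b) with hM
  set S := ∑ b, crossDeviation (g₁ b ω) (g₂ b ω) (f (src b)) with hS
  have hAM : A - M = (N : ℝ)⁻¹ • S := by
    rw [hA, hM, gramMatrix, hS, ← smul_right_injective _ hN'.ne' |>.eq_iff]
    simp only [crossDeviation, Finset.sum_sub_distrib, ← Finset.smul_sum, smul_sub, smul_smul]
    congr 2
    · field_simp
  have hAsymm : A.IsSymm := by
    refine IsSymm.smul ?_ _
    rw [IsSymm, transpose_sum]
    refine Finset.sum_congr rfl fun b _ => ?_
    rw [transpose_add, transpose_vecMulVec, transpose_vecMulVec, add_comm]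
  have hquad : ∀ y, |inner ℝ y (toEuclideanLin (A - M) y)| ≤ γ * ‖y‖ ^ 2 := by
    intro y
    have h1 := c1 y
    have h2 := c2 y
    simp only [one_smul, neg_smul, Finset.sum_neg_distrib, map_neg, LinearMap.neg_apply,
      inner_neg_right] at h1 h2
    rw [hAM, map_smul, LinearMap.smul_apply, inner_smul_right, abs_mul, abs_of_pos (inv_pos.mpr hN'),
      inv_mul_le_iff₀ hN', abs_le]
    constructor <;> linarith
  have hnorm : ∀ b, ‖f (src b)‖ ^ 2 ≤ s := fun b => (hg₁ b).norm_mean_sq_le hs.le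
  have htrace : M.trace ≤ s := by
    rw [hM, trace_gramMatrix, inv_mul_le_iff₀ hN']
    calc _ ≤ ∑ _b : Fin N, s := Finset.sum_le_sum fun b _ => hnorm b
      _ = _ := by simp
  -- With ν = 2γ and the weight α/2 the conclusion reads (α/2)‖·‖² ≤ 4γ = 4αh², so the squared
  -- distance is at most 8h² ≤ (3h)².
  have key := norm_sub_projection_le (svd.spec A) hAsymm (gramMatrix_isSymm _) hγ.le
    (ν := 2 * γ) (α := α / 2) (G := f i₀) (ℓ := ℓ) (by positivity) hquad (fun hlt => by
      rcases hℓ with hℓ | hℓ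
      · obtain ⟨F, hF⟩ := exists_vectors_of_factor hℓ f src
        refine ⟨F, fun y hy => ?_⟩
        rw [hF y hy, norm_zero]
        positivity
      · obtain ⟨F, hF⟩ := exists_vectors_of_trace hlt (fun b => f (src b)) htrace
        refine ⟨F, fun y hy => (hF y hy).trans (mul_le_mul_of_nonneg_right ?_ (norm_nonneg y))⟩
        rw [div_le_iff₀ (by positivity)]
        exact hℓ) (fun y => by
      rw [inner_gramMatrix, ← div_eq_inv_mul, le_div_iff₀ hN']
      calc α / 2 * inner ℝ (f i₀) y ^ 2 * N = α / 2 * N * inner ℝ (f i₀) y ^ 2 := by ring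
        _ ≤ (Finset.univ.filter fun b => src b = i₀).card * inner ℝ (f i₀) y ^ 2 :=
            mul_le_mul_of_nonneg_right hgood (sq_nonneg _)
        _ = ∑ b ∈ Finset.univ.filter fun b => src b = i₀, inner ℝ (f (src b)) y ^ 2 := by
            rw [← nsmul_eq_mul, ← Finset.sum_const]
            refine Finset.sum_congr rfl fun b hb => ?_
            rw [(Finset.mem_filter.mp hb).2]
        _ ≤ _ := Finset.sum_le_sum_of_subset_of_nonneg (Finset.filter_subset _ _)
            fun _ _ _ => sq_nonneg _)
  refine le_of_sq_le_sq ?_ (by positivity)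
  have hAeq : (Matrix.of A : Matrix (Fin d) (Fin d) ℝ) = A := rfl
  have : α / 2 * ‖f i₀ - toEuclideanLin (projectionMatrix (svd.vec A) ℓ) (f i₀)‖ ^ 2 ≤
      α / 2 * (8 * h ^ 2) := key.trans_eq (by rw [hγe]; ring)
  have := le_of_mul_le_mul_left this (by positivity)
  nlinarith [sq_nonneg h]

end Subspace

/-! ### The failure events of a round -/

section Events

open Matrix

variable {J : Type} {d k : ℕ}

theorem measurable_gradMean (D : Measure (Sample d)) [SFinite D] :
    Measurable fun q : Vec d × ℝ => gradMean D q.1 q.2 := by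
  have h : Measurable fun p : (Vec d × ℝ) × Sample d => clippedGradient p.2 p.1.1 p.1.2 :=
    measurable_clippedGradient measurable_snd measurable_fst.fst measurable_fst.snd
  exact (h.stronglyMeasurable.integral_prod_right' (ν := D)).measurable

theorem measurable_integral_inner_sq (D : Measure (Sample d)) [SFinite D] :
    Measurable fun v : Vec d => ∫ z, inner ℝ z.1 v ^ 2 ∂D := by
  have h : Measurable fun p : Vec d × Sample d => inner ℝ p.2.1 p.1 ^ 2 :=
    (measurable_snd.fst.inner measurable_fst).pow_const 2
  exact (h.stronglyMeasurable.integral_prod_right' (ν := D)).measurable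

/-- The estimate of the size of the residuals at `w` is off. -/
def ClipFails (D : Measure (Sample d)) (w₀ : Vec d) (C₁ σ : ℝ) (S : Coll J) (T : ℕ) (w : Vec d)
    (Z : J → Sample d) : Prop :=
  ¬ ((∫ z, inner ℝ z.1 (w - w₀) ^ 2 ∂D) / 4 - 16 * σ ^ 2 ≤ lossEst Z S w T ∧
    lossEst Z S w T ≤ 16 * (C₁ * ‖w - w₀‖ ^ 2 + σ ^ 2))

/-- The estimated subspace misses the mean gradient. -/
def SubspaceFails (svd : SingularVectorRoutine d) (D : Measure (Sample d)) (B : Coll (Coll J))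
    (ℓ : ℕ) (c : ℝ) (q : Vec d × ℝ) (Z : J → Sample d) : Prop :=
  3 * (c * q.2) < ‖gradMean D q.1 q.2 - toEuclideanLin
    (projectionMatrix (svd.vec (crossMatrix Z B q.1 q.2)) ℓ) (gradMean D q.1 q.2)‖

/-- The score of some batch is off. -/
def ScoreFails (D : Fin k → Measure (Sample d)) (i₀ : Fin k) (B : Coll (Coll J))
    (src : Fin B.len → Fin k) (S : Coll J) (ℓ T : ℕ) (c : ℝ)
    (q : (Vec d × ℝ) × (Fin d → Vec d)) (Z : J → Sample d) : Prop :=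
  ∃ b, ‖toEuclideanLin (projectionMatrix q.2 ℓ)
      (gradMean (D (src b)) q.1.1 q.1.2 - gradMean (D i₀) q.1.1 q.1.2)‖ * (c * q.1.2) +
      (c * q.1.2) ^ 2 / 20 <
    |score Z (B.get b) S q.1.1 q.1.2 (projectionMatrix q.2 ℓ) T - ‖toEuclideanLin
      (projectionMatrix q.2 ℓ)
        (gradMean (D (src b)) q.1.1 q.1.2 - gradMean (D i₀) q.1.1 q.1.2)‖ ^ 2|

/-- The batches with a score at most `t`. -/
def keptSet {N : ℕ} (v : Fin N → ℝ) (t : ℝ) : Finset (Fin N) := Finset.univ.filter fun b => v b ≤ t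

/-- The gradient estimate is far from the average of the projected mean gradients of the batches
that are kept. -/
def EstimateFails (D : Fin k → Measure (Sample d)) (B : Coll (Coll J))
    (src : Fin B.len → Fin k) (ℓ T : ℕ) (c : ℝ)
    (q : ((Vec d × ℝ) × (Fin d → Vec d)) × (Fin B.len → ℝ)) (Z : J → Sample d) : Prop :=
  3 * (c * q.1.1.2) < ‖centralEntry (partEst Z B q.1.1.1 q.1.1.2 (projectionMatrix q.1.2 ℓ) T
      (keptSet q.2 ((c * q.1.1.2) ^ 2))) -
    ((keptSet q.2 ((c * q.1.1.2) ^ 2)).card : ℝ)⁻¹ • ∑ b ∈ keptSet q.2 ((c * q.1.1.2) ^ 2),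
      toEuclideanLin (projectionMatrix q.1.2 ℓ) (gradMean (D (src b)) q.1.1.1 q.1.1.2)‖

variable {Ω : Type*} [m : MeasurableSpace Ω] {Z : J → Ω → Sample d}

/-- Joint measurability in the earlier outcome and the fresh samples, as `measureReal_section_le`
requires; the σ-algebra on Ω can be that of the samples which the stage reads. -/
theorem measurableSet_clipFails (D : Measure (Sample d)) [SFinite D] (w₀ : Vec d) (C₁ σ : ℝ)
    {S : Coll J} (hZ : ∀ j ∈ S.support, Measurable (Z j)) (T : ℕ) :
    MeasurableSet {p : Vec d × Ω | ClipFails D w₀ C₁ σ S T p.1 fun j => Z j p.2} := by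
  have hL : Measurable fun p : Vec d × Ω => lossEst (fun j => Z j p.2) S p.1 T :=
    measurable_lossEst (Z := fun j (p : Vec d × Ω) => Z j p.2)
      (fun j hj => (hZ j hj).comp measurable_snd) measurable_fst T
  have hv : Measurable fun p : Vec d × Ω => p.1 - w₀ := measurable_fst.sub_const w₀
  have he : Measurable fun p : Vec d × Ω => ∫ z, inner ℝ z.1 (p.1 - w₀) ^ 2 ∂D :=
    (measurable_integral_inner_sq D).comp hv
  refine MeasurableSet.compl (MeasurableSet.inter ?_ ?_)
  · exact measurableSet_le ((he.div_const _).sub_const _) hL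
  · exact measurableSet_le hL ((((hv.norm.pow_const 2).const_mul _).add_const _).const_mul _)

theorem measurableSet_subspaceFails (svd : SingularVectorRoutine d) (D : Measure (Sample d))
    [SFinite D] {B : Coll (Coll J)} (hZ : ∀ b, ∀ j ∈ (B.get b).support, Measurable (Z j)) (ℓ : ℕ)
    (c : ℝ) :
    MeasurableSet {p : (Vec d × ℝ) × Ω | SubspaceFails svd D B ℓ c p.1 fun j => Z j p.2} := by
  have hG : Measurable fun p : (Vec d × ℝ) × Ω => gradMean D p.1.1 p.1.2 :=
    (measurable_gradMean D).comp measurable_fst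
  have hu : Measurable fun p : (Vec d × ℝ) × Ω =>
      svd.vec (crossMatrix (fun j => Z j p.2) B p.1.1 p.1.2) :=
    svd.measurable.comp (measurable_crossMatrix (Z := fun j (p : (Vec d × ℝ) × Ω) => Z j p.2)
      (fun b j hj => (hZ b j hj).comp measurable_snd) measurable_fst.fst measurable_fst.snd)
  exact measurableSet_lt ((measurable_fst.snd.const_mul c).const_mul 3)
    (hG.sub (measurable_toEuclideanLin_projectionMatrix hu ℓ hG)).norm

theorem measurableSet_scoreFails (D : Fin k → Measure (Sample d)) [∀ i, SFinite (D i)] (i₀ : Fin k)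
    {B : Coll (Coll J)} (src : Fin B.len → Fin k) {S : Coll J}
    (hB : ∀ b, ∀ j ∈ ((B.get b).part 2 0).support, Measurable (Z j))
    (hS : ∀ j ∈ S.support, Measurable (Z j)) (ℓ T : ℕ) (c : ℝ) :
    MeasurableSet {p : ((Vec d × ℝ) × (Fin d → Vec d)) × Ω |
      ScoreFails D i₀ B src S ℓ T c p.1 fun j => Z j p.2} := by
  have hset : {p : ((Vec d × ℝ) × (Fin d → Vec d)) × Ω |
      ScoreFails D i₀ B src S ℓ T c p.1 fun j => Z j p.2} = ⋃ b,
      {p : ((Vec d × ℝ) × (Fin d → Vec d)) × Ω | ‖toEuclideanLin (projectionMatrix p.1.2 ℓ)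
      (gradMean (D (src b)) p.1.1.1 p.1.1.2 - gradMean (D i₀) p.1.1.1 p.1.1.2)‖ * (c * p.1.1.2) +
      (c * p.1.1.2) ^ 2 / 20 <
    |score (fun j => Z j p.2) (B.get b) S p.1.1.1 p.1.1.2 (projectionMatrix p.1.2 ℓ) T -
      ‖toEuclideanLin (projectionMatrix p.1.2 ℓ)
        (gradMean (D (src b)) p.1.1.1 p.1.1.2 - gradMean (D i₀) p.1.1.1 p.1.1.2)‖ ^ 2|} := by
    ext p
    simp [ScoreFails]
  rw [hset]
  refine MeasurableSet.iUnion fun b => ?_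
  have hG : ∀ i, Measurable fun p : ((Vec d × ℝ) × (Fin d → Vec d)) × Ω =>
      gradMean (D i) p.1.1.1 p.1.1.2 := fun i =>
    (measurable_gradMean (D i)).comp measurable_fst.fst
  have hn : Measurable fun p : ((Vec d × ℝ) × (Fin d → Vec d)) × Ω =>
      ‖toEuclideanLin (projectionMatrix p.1.2 ℓ)
      (gradMean (D (src b)) p.1.1.1 p.1.1.2 - gradMean (D i₀) p.1.1.1 p.1.1.2)‖ :=
    (measurable_toEuclideanLin_projectionMatrix measurable_fst.snd ℓ ((hG _).sub (hG _))).norm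
  have hh : Measurable fun p : ((Vec d × ℝ) × (Fin d → Vec d)) × Ω => c * p.1.1.2 :=
    measurable_fst.fst.snd.const_mul c
  have hs : Measurable fun p : ((Vec d × ℝ) × (Fin d → Vec d)) × Ω =>
      score (fun j => Z j p.2) (B.get b) S p.1.1.1 p.1.1.2 (projectionMatrix p.1.2 ℓ) T :=
    measurable_score (Z := fun j (p : ((Vec d × ℝ) × (Fin d → Vec d)) × Ω) => Z j p.2)
      (fun j hj => (hB b j hj).comp measurable_snd) (fun j hj => (hS j hj).comp measurable_snd)
      measurable_fst.fst.fst measurable_fst.fst.snd measurable_fst.snd ℓ T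
  exact measurableSet_lt ((hn.mul hh).add ((hh.pow_const 2).div_const 20))
    (hs.sub (hn.pow_const 2)).norm

theorem measurableSet_mem_keptSet {N : ℕ} {v : Ω → Fin N → ℝ} {t : Ω → ℝ} (hv : Measurable v)
    (ht : Measurable t) (b : Fin N) : MeasurableSet {ω | b ∈ keptSet (v ω) (t ω)} := by
  simp only [keptSet, Finset.mem_filter, Finset.mem_univ, true_and]
  exact measurableSet_le ((measurable_pi_apply b).comp hv) ht

theorem measurable_card_finset {N : ℕ} {s : Ω → Finset (Fin N)}
    (hs : ∀ b, MeasurableSet {ω | b ∈ s ω}) : Measurable fun ω => ((s ω).card : ℝ) := by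
  classical
  have := measurable_card_filter (fun b ω => b ∈ s ω) hs
  simp only [Finset.filter_univ_mem] at this
  exact (measurable_from_top (f := fun n : ℕ => (n : ℝ))).comp this

theorem measurableSet_estimateFails (D : Fin k → Measure (Sample d)) [∀ i, SFinite (D i)]
    {B : Coll (Coll J)} (src : Fin B.len → Fin k)
    (hB : ∀ b, ∀ j ∈ ((B.get b).part 2 1).support, Measurable (Z j)) (ℓ T : ℕ) (c : ℝ) :
    MeasurableSet {p : (((Vec d × ℝ) × (Fin d → Vec d)) × (Fin B.len → ℝ)) × Ω |
      EstimateFails D B src ℓ T c p.1 fun j => Z j p.2} := by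
  classical
  have hG : ∀ i, Measurable fun p : (((Vec d × ℝ) × (Fin d → Vec d)) × (Fin B.len → ℝ)) × Ω =>
      gradMean (D i) p.1.1.1.1 p.1.1.1.2 := fun i =>
    (measurable_gradMean (D i)).comp measurable_fst.fst.fst
  have hu : Measurable fun p : (((Vec d × ℝ) × (Fin d → Vec d)) × (Fin B.len → ℝ)) × Ω =>
      p.1.1.2 := measurable_fst.fst.snd
  have hh : Measurable fun p : (((Vec d × ℝ) × (Fin d → Vec d)) × (Fin B.len → ℝ)) × Ω =>
      c * p.1.1.1.2 := measurable_fst.fst.fst.snd.const_mul c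
  have hk := measurableSet_mem_keptSet (N := B.len) (v := fun p :
      (((Vec d × ℝ) × (Fin d → Vec d)) × (Fin B.len → ℝ)) × Ω => p.1.2) measurable_fst.snd
      (hh.pow_const 2)
  have hPG : ∀ b, Measurable fun p : (((Vec d × ℝ) × (Fin d → Vec d)) × (Fin B.len → ℝ)) × Ω =>
      toEuclideanLin (projectionMatrix p.1.1.2 ℓ) (gradMean (D (src b)) p.1.1.1.1 p.1.1.1.2) :=
    fun b => measurable_toEuclideanLin_projectionMatrix hu ℓ (hG _)
  have hsum : Measurable fun p : (((Vec d × ℝ) × (Fin d → Vec d)) × (Fin B.len → ℝ)) × Ω =>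
      ∑ b ∈ keptSet p.1.2 ((c * p.1.1.1.2) ^ 2),
      toEuclideanLin (projectionMatrix p.1.1.2 ℓ) (gradMean (D (src b)) p.1.1.1.1 p.1.1.1.2) := by
    have e : ∀ p : (((Vec d × ℝ) × (Fin d → Vec d)) × (Fin B.len → ℝ)) × Ω,
        ∑ b ∈ keptSet p.1.2 ((c * p.1.1.1.2) ^ 2), toEuclideanLin (projectionMatrix p.1.1.2 ℓ)
          (gradMean (D (src b)) p.1.1.1.1 p.1.1.1.2) =
        ∑ b, if b ∈ keptSet p.1.2 ((c * p.1.1.1.2) ^ 2) then toEuclideanLin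
          (projectionMatrix p.1.1.2 ℓ) (gradMean (D (src b)) p.1.1.1.1 p.1.1.1.2) else 0 := by
      intro p
      rw [Finset.sum_ite_mem, Finset.univ_inter]
    simp only [e]
    exact Finset.measurable_sum _ fun b _ => Measurable.ite (hk b) (hPG b) measurable_const
  have hest := measurable_centralEntry fun i : Fin T => measurable_partEst (B := B)
    (Z := fun j (p : (((Vec d × ℝ) × (Fin d → Vec d)) × (Fin B.len → ℝ)) × Ω) => Z j p.2)
    (fun b j hj => (hB b j hj).comp measurable_snd) measurable_fst.fst.fst.fst
    measurable_fst.fst.fst.snd hu ℓ T hk i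
  exact measurableSet_lt (hh.const_mul 3)
    (hest.sub ((measurable_card_finset hk).inv.smul hsum)).norm

end Events

/-! ### Their probabilities -/

section Probabilities

open Matrix

variable {Ω : Type*} [mΩ : MeasurableSpace Ω] {μ : Measure Ω} [IsProbabilityMeasure μ] {d k : ℕ}
  {J : Type} {Z : J → Ω → Sample d} {D : Fin k → Measure (Sample d)}

/-- The samples with index in `S` are distributed according to `D`. -/
structure IsSampleOf (μ : Measure Ω) (Z : J → Ω → Sample d) (S : Coll J) (D : Measure (Sample d)) :
    Prop where
  injective : Function.Injective S.get
  law : ∀ q, μ.map (Z (S.get q)) = D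

omit [IsProbabilityMeasure μ] in
theorem IsSampleOf.part {S : Coll J} {D : Measure (Sample d)} (h : IsSampleOf μ Z S D) (m : ℕ)
    (j : Fin m) : IsSampleOf μ Z (S.part m j) D :=
  ⟨Coll.get_part_injective h.injective m j, fun _ => h.law _⟩

/-- The indices of the samples of a collection of batches. -/
def Coll.supports (B : Coll (Coll J)) : Set J := ⋃ b, (B.get b).support

theorem Coll.support_subset_supports (B : Coll (Coll J)) (b : Fin B.len) :
    (B.get b).support ⊆ B.supports := Set.subset_iUnion (fun b => (B.get b).support) b

/-- Batches without common samples, the samples of batch `b` being distributed according to the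
component `src b`. -/
structure IsBatches (μ : Measure Ω) (Z : J → Ω → Sample d) (D : Fin k → Measure (Sample d))
    (B : Coll (Coll J)) (src : Fin B.len → Fin k) : Prop where
  sample : ∀ b, IsSampleOf μ Z (B.get b) (D (src b))
  disjoint : Pairwise fun b b' => Disjoint (B.get b).support (B.get b').support

theorem measurableSet_orthonormal {α : Type*} [MeasurableSpace α] {u : α → Fin d → Vec d}
    (hu : Measurable u) : MeasurableSet {a | Orthonormal ℝ (u a)} := by
  have hi : ∀ i, Measurable fun a => u a i := fun i => (measurable_pi_apply i).comp hu
  have e : {a | Orthonormal ℝ (u a)} =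
      ⋂ i, ⋂ j, {a | inner ℝ (u a i) (u a j) = if i = j then (1 : ℝ) else 0} := by
    ext a
    simp only [orthonormal_iff_ite, Set.mem_ofPred_eq, Set.mem_iInter]
  rw [e]
  exact MeasurableSet.iInter fun i => MeasurableSet.iInter fun j =>
    measurableSet_eq_fun (Measurable.inner (𝕜 := ℝ) (hi i) (hi j)) measurable_const

/-- The current point depends only on samples with index in `U`, so it can be frozen and the
estimate for a fixed point applies. -/
theorem measureReal_clipFails_le (hZ : ∀ j, Measurable (Z j)) (hind : iIndepFun Z μ)
    {D₀ : Measure (Sample d)} [IsProbabilityMeasure D₀] {C C₁ B σ : ℝ} {w₀ : Vec d}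
    {S : Coll J} (hS : IsSampleOf μ Z S D₀) {T : ℕ} (hlen : 0 < S.len / T)
    (hD : IsRegressionComponent D₀ w₀ C C₁ σ) (h : BoundedInput D₀ C₁ B) (hσ : 0 < σ) (hC₁ : 0 ≤ C₁)
    (hC : 64 * C ≤ (S.len / T : ℕ)) {U : Set J} (hU : Disjoint U S.support) {w : Ω → Vec d}
    (hw : Measurable[sig Z U] w) :
    μ.real {ω | ClipFails D₀ w₀ C₁ σ S T (w ω) fun j => Z j ω} ≤ 2 * Real.exp (-(T / 3)) := by
  have := measureReal_section_le (sig_le hZ U) (sig_le hZ S.support) (indep_sig hZ hind hU) hw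
    MeasurableSet.univ (Q := fun a ω => ClipFails D₀ w₀ C₁ σ S T a fun j => Z j ω)
    (measurableSet_clipFails (m := sig Z S.support) D₀ w₀ C₁ σ (fun j hj => measurable_sig Z hj) T)
    (p := 2 * Real.exp (-(T / 3))) (by positivity) fun a _ =>
      measureReal_lossEst_le hZ hind hS.injective hlen hS.law hD h hσ hC₁ hC a
  simpa using this

theorem disjoint_half {S : Coll J} (hS : Function.Injective S.get) :
    Disjoint (S.part 2 0).support (S.part 2 1).support :=
  Coll.disjoint_support_part hS (by decide)

/-- For a frozen point and frozen κ the gradients have length at most κβ and second moments at most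
κ²C₁. A half may consist of a single sample, so nothing is gained from averaging within a batch. All
thresholds are proportional to powers of κ, which cancels from the exponent. -/
theorem measureReal_subspaceFails_le (hZ : ∀ j, Measurable (Z j)) (hind : iIndepFun Z μ)
    [∀ i, IsProbabilityMeasure (D i)] {C₁ β : ℝ} (hβ : 0 < β) (hC₁ : 0 < C₁)
    (h : ∀ i, BoundedInput (D i) C₁ β) {B : Coll (Coll J)} {src : Fin B.len → Fin k}
    (hB : IsBatches μ Z D B src) (hlen : ∀ b, 2 ≤ (B.get b).len) (hN : 0 < B.len)
    (svd : SingularVectorRoutine d) {i₀ : Fin k} {α ε₂ : ℝ} (hα : 0 < α) (hε₂ : 0 < ε₂)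
    (hgood : α / 2 * B.len ≤ (Finset.univ.filter fun b => src b = i₀).card) {ℓ : ℕ}
    (hℓ : k ≤ ℓ ∨ 1 ≤ 2 * α * ε₂ ^ 2 * (ℓ + 1)) {U : Set J} (hU : Disjoint U B.supports)
    {w : Ω → Vec d} {κ : Ω → ℝ} (hw : Measurable[sig Z U] w) (hκ : Measurable[sig Z U] κ)
    (hκ0 : ∀ ω, 0 < κ ω) :
    μ.real {ω | SubspaceFails svd (D i₀) B ℓ (ε₂ * Real.sqrt C₁) (w ω, κ ω) fun j => Z j ω} ≤
      2 * (d * Real.exp (-(B.len * (α * ε₂ ^ 2) ^ 2 * C₁ / (4 * β ^ 2 * (4 + α * ε₂ ^ 2))))) := by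
  have hsupp : ∀ b, ∀ j ∈ (B.get b).support, j ∈ B.supports := fun b j hj =>
    B.support_subset_supports b hj
  have := measureReal_section_le (sig_le hZ U) (sig_le hZ B.supports) (indep_sig hZ hind hU)
    (X := fun ω => (w ω, κ ω)) (Measurable.prodMk hw hκ)
    (A := {q : Vec d × ℝ | 0 < q.2}) (measurableSet_lt measurable_const measurable_snd)
    (Q := fun a ω => SubspaceFails svd (D i₀) B ℓ (ε₂ * Real.sqrt C₁) a fun j => Z j ω)
    (measurableSet_subspaceFails (m := sig Z B.supports) svd (D i₀)
      (fun b j hj => measurable_sig Z (hsupp b j hj)) ℓ (ε₂ * Real.sqrt C₁))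
    (p := 2 * (d * Real.exp
      (-(B.len * (α * ε₂ ^ 2) ^ 2 * C₁ / (4 * β ^ 2 * (4 + α * ε₂ ^ 2)))))) (by positivity) ?_
  · refine le_trans (measureReal_mono (fun ω hω => ?_) (measure_ne_top _ _)) this
    exact ⟨hκ0 ω, hω⟩
  rintro ⟨a, κ⟩ hκ
  simp only [Set.mem_ofPred_eq] at hκ
  have hC₁s : Real.sqrt C₁ ^ 2 = C₁ := Real.sq_sqrt hC₁.le
  have hhalf : ∀ b (i : Fin 2), MeanEstimate μ
      (fun ω => gbar (fun j => Z j ω) ((B.get b).part 2 i) a κ) (gradMean (D (src b)) a κ) (κ * β)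
      (κ ^ 2 * C₁) (κ ^ 2 * C₁) := by
    intro b i
    have hp := (hB.sample b).part 2 i
    have hl : 0 < ((B.get b).part 2 i).len := Nat.div_pos (hlen b) (by norm_num)
    have hm := meanEstimate_gbar hZ hind hp.injective hl hp.law (h (src b)) hκ a
    refine ⟨hm.1, hm.2, hm.3, hm.4, fun u => (hm.5 u).trans ?_⟩
    refine mul_le_mul_of_nonneg_right (div_le_self (by positivity) ?_) (sq_nonneg _)
    exact_mod_cast hl
  have hmeas : ∀ b (i : Fin 2), Measurable[sig Z ((B.get b).part 2 i).support]
      fun ω => gbar (fun j => Z j ω) ((B.get b).part 2 i) a κ := fun b i =>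
    measurable_gbar (m := sig Z ((B.get b).part 2 i).support) (fun j hj => measurable_sig Z hj)
      measurable_const measurable_const
  have hmeas' : ∀ b (i : Fin 2), Measurable[sig Z (B.get b).support]
      fun ω => gbar (fun j => Z j ω) ((B.get b).part 2 i) a κ := fun b i =>
    (hmeas b i).mono (sig_mono Z ((B.get b).support_part_subset 2 i)) le_rfl
  have key := measureReal_subspace_le (f := fun i => gradMean (D i) a κ) (src := src)
    (fun b => hhalf b 0) (fun b => hhalf b 1)
    (fun b => indepFun_of_measurable
      (indep_sig hZ hind (disjoint_half (hB.sample b).injective)) (hmeas b 0) (hmeas b 1))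
    ((iIndepFun_iff_iIndep _ _ _).mpr (iIndep_of_iIndep_of_le
      (iIndep_sig hZ hind (fun b => (B.get b).support) hB.disjoint)
      fun b => (Measurable.prodMk (hmeas' b 0) (hmeas' b 1)).comap_le))
    (mul_pos hκ hβ) (by positivity : 0 < κ ^ 2 * C₁) svd (i₀ := i₀) (α := α)
    (h := ε₂ * Real.sqrt C₁ * κ) hα (by positivity) hN hgood (ℓ := ℓ) (by
      refine hℓ.imp id fun hℓ => ?_
      rw [mul_pow, mul_pow, hC₁s]
      have : 0 ≤ κ ^ 2 * C₁ := by positivity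
      nlinarith)
  refine key.trans_eq ?_
  congr 4
  have hsq : (ε₂ * Real.sqrt C₁ * κ) ^ 2 = ε₂ ^ 2 * C₁ * κ ^ 2 := by rw [mul_pow, mul_pow, hC₁s]
  rw [hsq]
  field_simp

/-- The j-th inner product reads the parts j and T + j of the batch and of the additional batch.
These parts are disjoint for different j, so the inner products are independent. The batches share
the samples of the additional batch, whence a union bound over the batches. -/
theorem measureReal_scoreFails_le (hZ : ∀ j, Measurable (Z j)) (hind : iIndepFun Z μ)
    [∀ i, IsProbabilityMeasure (D i)] {C₁ β : ℝ} (hC₁ : 0 < C₁)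
    (h : ∀ i, BoundedInput (D i) C₁ β) {B : Coll (Coll J)} {src : Fin B.len → Fin k}
    (hB : IsBatches μ Z D B src) {S : Coll J} {i₀ : Fin k} (hS : IsSampleOf μ Z S (D i₀))
    (hBS : Disjoint B.supports S.support) {ℓ T n : ℕ} (hℓ : 1 ≤ ℓ) (hn : 0 < n)
    (hlenB : ∀ b, n ≤ (B.get b).len / 2 / (T + T)) (hlenS : n ≤ S.len / (T + T)) {ε₂ : ℝ}
    (hε₂ : 0 < ε₂) (hsize : 2560 * Real.sqrt ℓ ≤ n * ε₂ ^ 2) {U : Set J}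
    (hU : Disjoint U (B.supports ∪ S.support)) {w : Ω → Vec d} {κ : Ω → ℝ}
    {u : Ω → Fin d → Vec d} (hw : Measurable[sig Z U] w) (hκ : Measurable[sig Z U] κ)
    (hu : Measurable[sig Z U] u) (hκ0 : ∀ ω, 0 < κ ω) (hu0 : ∀ ω, Orthonormal ℝ (u ω)) :
    μ.real {ω | ScoreFails D i₀ B src S ℓ T (ε₂ * Real.sqrt C₁) ((w ω, κ ω), u ω) fun j => Z j ω} ≤
      B.len * (2 * Real.exp (-(T / 3))) := by
  set V := B.supports ∪ S.support with hV
  have hBV : ∀ b, ∀ j ∈ (B.get b).support, j ∈ V := fun b j hj =>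
    Or.inl (B.support_subset_supports b hj)
  have := measureReal_section_le (sig_le hZ U) (sig_le hZ V) (indep_sig hZ hind hU)
    (X := fun ω => ((w ω, κ ω), u ω)) (Measurable.prodMk (Measurable.prodMk hw hκ) hu)
    (A := {q : (Vec d × ℝ) × (Fin d → Vec d) | 0 < q.1.2 ∧ Orthonormal ℝ q.2})
    (MeasurableSet.inter (measurableSet_lt measurable_const measurable_fst.snd)
      (measurableSet_orthonormal measurable_snd))
    (Q := fun a ω => ScoreFails D i₀ B src S ℓ T (ε₂ * Real.sqrt C₁) a fun j => Z j ω)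
    (measurableSet_scoreFails (m := sig Z V) D i₀ src
      (fun b j hj => measurable_sig Z (hBV b j ((B.get b).support_part_subset 2 0 hj)))
      (fun j hj => measurable_sig Z (Or.inr hj)) ℓ T (ε₂ * Real.sqrt C₁))
    (p := B.len * (2 * Real.exp (-(T / 3)))) (by positivity) ?_
  · refine le_trans (measureReal_mono (fun ω hω => ?_) (measure_ne_top _ _)) this
    exact ⟨⟨hκ0 ω, hu0 ω⟩, hω⟩
  rintro ⟨⟨a, κ⟩, u⟩ ⟨hκ, hu⟩
  simp only at hκ hu
  have hC₁s : Real.sqrt C₁ ^ 2 = C₁ := Real.sq_sqrt hC₁.le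
  have hn' : (0 : ℝ) < n := by exact_mod_cast hn
  -- the union bound
  have hsub : {ω | ScoreFails D i₀ B src S ℓ T (ε₂ * Real.sqrt C₁) ((a, κ), u) fun j => Z j ω} ⊆
      ⋃ b, {ω | ‖toEuclideanLin (projectionMatrix u ℓ)
      (gradMean (D (src b)) a κ - gradMean (D i₀) a κ)‖ * (ε₂ * Real.sqrt C₁ * κ) +
      (ε₂ * Real.sqrt C₁ * κ) ^ 2 / 20 <
    |score (fun j => Z j ω) (B.get b) S a κ (projectionMatrix u ℓ) T - ‖toEuclideanLin
      (projectionMatrix u ℓ) (gradMean (D (src b)) a κ - gradMean (D i₀) a κ)‖ ^ 2|} := by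
    intro ω hω
    exact Set.mem_iUnion.mpr hω
  refine (measureReal_mono hsub (measure_ne_top _ _)).trans
    ((measureReal_iUnion_fintype_le _).trans ?_)
  calc _ ≤ ∑ _b : Fin B.len, 2 * Real.exp (-(T / 3)) := Finset.sum_le_sum fun b _ => ?_
    _ = _ := by simp
  have hbase : ∀ (S' : Coll J) (i : Fin k), IsSampleOf μ Z S' (D i) → ∀ j : Fin (T + T),
      n ≤ S'.len / (T + T) → MeanEstimate μ
      (fun ω => gbar (fun j => Z j ω) (S'.part (T + T) j) a κ) (gradMean (D i) a κ) (κ * β)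
      (κ ^ 2 * C₁) (κ ^ 2 * C₁ / n) := by
    intro S' i hS' j hl
    have hp := hS'.part (T + T) j
    have hl0 : 0 < (S'.part (T + T) j).len := hn.trans_le hl
    have hm := meanEstimate_gbar hZ hind hp.injective hl0 hp.law (h i) hκ a
    refine ⟨hm.1, hm.2, hm.3, hm.4, fun u => (hm.5 u).trans ?_⟩
    refine mul_le_mul_of_nonneg_right (div_le_div_of_nonneg_left (by positivity) hn' ?_)
      (sq_nonneg _)
    exact_mod_cast hl
  set b₁ := (B.get b).part 2 0 with hb₁
  have hb₁s : IsSampleOf μ Z b₁ (D (src b)) := (hB.sample b).part 2 0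
  have hdiff := fun j => (hbase b₁ (src b) hb₁s j (hlenB b)).sub (hbase S i₀ hS j hlenS)
  set W : Fin (T + T) → Set J := fun j => (b₁.part (T + T) j).support ∪ (S.part (T + T) j).support
  have hb₁S : Disjoint b₁.support S.support := hBS.mono_left
    (((B.get b).support_part_subset 2 0).trans (B.support_subset_supports b))
  have hW : ∀ i j, i ≠ j → Disjoint (W i) (W j) := by
    intro i j hij
    simp only [W, Set.disjoint_union_left, Set.disjoint_union_right]
    refine ⟨⟨Coll.disjoint_support_part hb₁s.injective hij, ?_⟩, ?_,
      Coll.disjoint_support_part hS.injective hij⟩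
    · exact hb₁S.symm.mono (S.support_part_subset _ _) (b₁.support_part_subset _ _)
    · exact hb₁S.mono (b₁.support_part_subset _ _) (S.support_part_subset _ _)
  have hmeas : ∀ j, Measurable[sig Z (W j)] fun ω => gbar (fun j => Z j ω) (b₁.part (T + T) j) a κ -
      gbar (fun j => Z j ω) (S.part (T + T) j) a κ := fun j =>
    Measurable.sub
      (measurable_gbar (m := sig Z (W j)) (fun i hi => measurable_sig Z (Or.inl hi))
        measurable_const measurable_const)
      (measurable_gbar (m := sig Z (W j)) (fun i hi => measurable_sig Z (Or.inr hi))
        measurable_const measurable_const)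
  have hcn : ∀ i j : Fin T, Fin.castAdd T i ≠ Fin.natAdd T j := by
    intro i j hij
    have := congrArg Fin.val hij
    simp only [Fin.val_castAdd, Fin.val_natAdd] at this
    omega
  have hm : iIndep (fun j : Fin T => sig Z (W (Fin.castAdd T j) ∪ W (Fin.natAdd T j))) μ := by
    refine iIndep_sig hZ hind _ fun i j hij => ?_
    simp only [Function.onFun, Set.disjoint_union_left, Set.disjoint_union_right]
    exact ⟨⟨hW _ _ fun e => hij (Fin.castAdd_injective T T e), hW _ _ (hcn j i).symm⟩,
      hW _ _ (hcn i j), hW _ _ fun e => hij (Fin.natAdd_injective T T e)⟩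
  refine measureReal_median_inner_projection_le hm
    (fun j => (hmeas (Fin.castAdd T j)).mono (sig_mono Z Set.subset_union_left) le_rfl)
    (fun j => (hmeas (Fin.natAdd T j)).mono (sig_mono Z Set.subset_union_right) le_rfl)
    (fun j => hdiff _) (fun j => hdiff _)
    (fun j => indepFun_of_measurable (indep_sig hZ hind (hW _ _ (hcn j j).symm)) (hmeas _) (hmeas _))
    hu (h := ε₂ * Real.sqrt C₁ * κ) (by positivity) hℓ (by positivity) ?_
  rw [mul_pow, mul_pow, hC₁s]
  -- The difference of two estimates has four times the variance bound, and 4 · 640 = 2560.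
  calc 640 * (4 * (κ ^ 2 * C₁ / n) * Real.sqrt ℓ) =
        (2560 * Real.sqrt ℓ) * (κ ^ 2 * C₁) / n := by ring
    _ ≤ (n * ε₂ ^ 2) * (κ ^ 2 * C₁) / n := by gcongr
    _ = _ := by field_simp

/-- The scores read the first halves of the batches and the averages the second halves. Hence `U`
has to avoid only the second halves, and the set of kept batches can be frozen. That at least `t`
batches are kept is part of the event, since the variance is divided by their number. -/
theorem measureReal_estimateFails_le (hZ : ∀ j, Measurable (Z j)) (hind : iIndepFun Z μ)
    [∀ i, IsProbabilityMeasure (D i)] {C₁ β : ℝ} (hC₁ : 0 < C₁)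
    (h : ∀ i, BoundedInput (D i) C₁ β) {B : Coll (Coll J)} {src : Fin B.len → Fin k}
    (hB : IsBatches μ Z D B src) {ℓ T n : ℕ} (hn : 0 < n)
    (hlenB : ∀ b, n ≤ (B.get b).len / 2 / T) {ε₂ t : ℝ} (ht : 0 < t)
    (hε₂ : 0 < ε₂) (hsize : 8 * ℓ ≤ t * n * ε₂ ^ 2) {U : Set J}
    (hU : ∀ b, Disjoint U ((B.get b).part 2 1).support) {w : Ω → Vec d} {κ : Ω → ℝ}
    {u : Ω → Fin d → Vec d} {v : Ω → Fin B.len → ℝ} (hw : Measurable[sig Z U] w)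
    (hκ : Measurable[sig Z U] κ) (hu : Measurable[sig Z U] u) (hv : Measurable[sig Z U] v)
    (hκ0 : ∀ ω, 0 < κ ω) (hu0 : ∀ ω, Orthonormal ℝ (u ω)) :
    μ.real {ω | t ≤ (keptSet (v ω) ((ε₂ * Real.sqrt C₁ * κ ω) ^ 2)).card ∧
      EstimateFails D B src ℓ T (ε₂ * Real.sqrt C₁) (((w ω, κ ω), u ω), v ω) fun j => Z j ω} ≤
      Real.exp (-(T / 3)) := by
  set V := ⋃ b, ((B.get b).part 2 1).support with hV
  have hUV : Disjoint U V := Set.disjoint_iUnion_right.mpr hU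
  have hBV : ∀ b, ∀ j ∈ ((B.get b).part 2 1).support, j ∈ V := fun b j hj =>
    Set.mem_iUnion.mpr ⟨b, hj⟩
  have hA : MeasurableSet {q : ((Vec d × ℝ) × (Fin d → Vec d)) × (Fin B.len → ℝ) |
      (0 < q.1.1.2 ∧ Orthonormal ℝ q.1.2) ∧
        t ≤ (keptSet q.2 ((ε₂ * Real.sqrt C₁ * q.1.1.2) ^ 2)).card} := by
    refine MeasurableSet.inter (MeasurableSet.inter
      (measurableSet_lt measurable_const measurable_fst.fst.snd)
      (measurableSet_orthonormal measurable_fst.snd)) ?_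
    exact measurableSet_le measurable_const (measurable_card_finset
      (measurableSet_mem_keptSet measurable_snd
        ((measurable_fst.fst.snd.const_mul _).pow_const 2)))
  have := measureReal_section_le (sig_le hZ U) (sig_le hZ V) (indep_sig hZ hind hUV)
    (X := fun ω => (((w ω, κ ω), u ω), v ω))
    (Measurable.prodMk (Measurable.prodMk (Measurable.prodMk hw hκ) hu) hv) hA
    (Q := fun a ω => EstimateFails D B src ℓ T (ε₂ * Real.sqrt C₁) a fun j => Z j ω)
    (measurableSet_estimateFails (m := sig Z V) D src
      (fun b j hj => measurable_sig Z (hBV b j hj)) ℓ T (ε₂ * Real.sqrt C₁))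
    (p := Real.exp (-(T / 3))) (by positivity) ?_
  · refine le_trans (measureReal_mono (fun ω hω => ?_) (measure_ne_top _ _)) this
    exact ⟨⟨⟨hκ0 ω, hu0 ω⟩, hω.1⟩, hω.2⟩
  rintro ⟨⟨⟨a, κ⟩, u⟩, v⟩ ⟨⟨hκ, hu⟩, hkept⟩
  simp only at hκ hu hkept
  have hC₁s : Real.sqrt C₁ ^ 2 = C₁ := Real.sq_sqrt hC₁.le
  have hn' : (0 : ℝ) < n := by exact_mod_cast hn
  set kept := keptSet v ((ε₂ * Real.sqrt C₁ * κ) ^ 2) with hk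
  have hk0 : (0 : ℝ) < kept.card := ht.trans_le hkept
  have hkne : kept.Nonempty := Finset.card_pos.mp (by exact_mod_cast hk0)
  set W : Fin T → Fin B.len → Set J := fun i b => (((B.get b).part 2 1).part T i).support
  have hhalf := fun b => (hB.sample b).part 2 1
  have hWb : ∀ i b, W i b ⊆ (B.get b).support := fun i b =>
    (((B.get b).part 2 1).support_part_subset T i).trans ((B.get b).support_part_subset 2 1)
  have hest : ∀ i b, MeanEstimate μ
      (fun ω => gbar (fun j => Z j ω) (((B.get b).part 2 1).part T i) a κ)
      (gradMean (D (src b)) a κ) (κ * β) (κ ^ 2 * C₁) (κ ^ 2 * C₁ / n) := by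
    intro i b
    have hp := (hhalf b).part T i
    have hl0 : 0 < (((B.get b).part 2 1).part T i).len := hn.trans_le (hlenB b)
    have hm := meanEstimate_gbar hZ hind hp.injective hl0 hp.law (h (src b)) hκ a
    refine ⟨hm.1, hm.2, hm.3, hm.4, fun u => (hm.5 u).trans ?_⟩
    refine mul_le_mul_of_nonneg_right (div_le_div_of_nonneg_left (by positivity) hn' ?_)
      (sq_nonneg _)
    exact_mod_cast hlenB b
  have hmeas : ∀ i b, Measurable[sig Z (W i b)]
      fun ω => gbar (fun j => Z j ω) (((B.get b).part 2 1).part T i) a κ := fun i b =>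
    measurable_gbar (m := sig Z (W i b)) (fun j hj => measurable_sig Z hj)
      measurable_const measurable_const
  have hm : iIndep (fun i : Fin T => sig Z (⋃ b, W i b)) μ := by
    refine iIndep_sig hZ hind _ fun i j hij => ?_
    simp only [Function.onFun, Set.disjoint_iUnion_left, Set.disjoint_iUnion_right]
    intro b' b
    by_cases hbb : b = b'
    · subst hbb
      exact Coll.disjoint_support_part (hhalf b).injective hij
    · exact (hB.disjoint hbb).mono (hWb _ _) (hWb _ _)
  refine measureReal_lt_norm_centralEntry_sub_le hm (fun i => ?_) _ _ fun i => ?_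
  · refine Measurable.const_smul (M := ℝ) (g := fun ω => ∑ b ∈ kept, toEuclideanLin
      (projectionMatrix u ℓ) (gbar (fun j => Z j ω) (((B.get b).part 2 1).part T i) a κ))
      (Finset.measurable_sum _ fun b _ => ?_) _
    exact (measurable_toEuclideanLin _).comp
      ((hmeas i b).mono (sig_mono Z (Set.subset_iUnion (W i) b)) le_rfl)
  · refine measureReal_average_projection_le hkne (fun b _ => hest i b) (fun b _ b' _ hbb => ?_) hu
      (by positivity) (by positivity) ?_
    · exact indepFun_of_measurable
        (indep_sig hZ hind ((hB.disjoint hbb).mono (hWb _ _) (hWb _ _))) (hmeas i b) (hmeas i b')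
    · rw [mul_pow, mul_pow, hC₁s]
      calc 8 * (ℓ * (κ ^ 2 * C₁ / n)) = (8 * ℓ) * (κ ^ 2 * C₁) / n := by ring
        _ ≤ (t * n * ε₂ ^ 2) * (κ ^ 2 * C₁) / n := by gcongr
        _ = t * (ε₂ ^ 2 * C₁ * κ ^ 2) := by field_simp
        _ ≤ _ := mul_le_mul_of_nonneg_right hkept (by positivity)

end Probabilities

/-! ### One round -/

section Round

open Matrix

variable {d k : ℕ} {J : Type}

theorem toEuclideanCLM_apply_eq (A : Matrix (Fin d) (Fin d) ℝ) (u : Vec d) :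
    Matrix.toEuclideanCLM (𝕜 := ℝ) A u = toEuclideanLin A u := rfl

/-- An almost surely bounded input has the second moments of its covariance matrix. -/
theorem boundedInput_of_norm_le {D : Measure (Sample d)} [IsProbabilityMeasure D] {B C₁ : ℝ}
    (hB : ∀ᵐ z ∂D, ‖z.1‖ ≤ B) (hC₁ : ‖Matrix.toEuclideanCLM (𝕜 := ℝ) (secondMoment D)‖ ≤ C₁) :
    BoundedInput D C₁ B := by
  -- The crude constant B² comes first: it gives the integrability that identifies the second
  -- moments with the quadratic form of the matrix.
  have h0 : BoundedInput D (B ^ 2) B := by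
    refine ⟨hB, fun u => ?_⟩
    have hle : ∀ᵐ z ∂D, inner ℝ z.1 u ^ 2 ≤ B ^ 2 * ‖u‖ ^ 2 := by
      filter_upwards [hB] with z hz
      rw [← mul_pow, ← sq_abs]
      exact pow_le_pow_left₀ (abs_nonneg _) ((abs_real_inner_le_norm _ _).trans
        (mul_le_mul_of_nonneg_right hz (norm_nonneg u))) 2
    refine (integral_mono_of_nonneg (Filter.Eventually.of_forall fun z => sq_nonneg _)
      (integrable_const _) hle).trans ?_
    simp
  refine ⟨hB, fun u => ?_⟩
  have h1 := integral_mul_inner_eq h0 u u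
  simp only [← pow_two] at h1
  rw [h1, ← toEuclideanCLM_apply_eq]
  calc _ ≤ ‖u‖ * ‖Matrix.toEuclideanCLM (𝕜 := ℝ) (secondMoment D) u‖ := real_inner_le_norm _ _
    _ ≤ ‖u‖ * (C₁ * ‖u‖) := by
        refine mul_le_mul_of_nonneg_left ?_ (norm_nonneg u)
        exact ((Matrix.toEuclideanCLM (𝕜 := ℝ) (secondMoment D)).le_opNorm u).trans
          (mul_le_mul_of_nonneg_right hC₁ (norm_nonneg u))
    _ = _ := by ring

theorem secondMoment_isSymm (D : Measure (Sample d)) : (secondMoment D).IsSymm := by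
  ext a b
  simp only [transpose_apply, secondMoment, of_apply, mul_comm]

theorem IsRegressionComponent.norm_sq_le {D : Measure (Sample d)} {w₀ : Vec d} {C C₁ σ : ℝ}
    (hD : IsRegressionComponent D w₀ C C₁ σ) (u : Vec d) :
    ‖u‖ ^ 2 ≤ inner ℝ u (toEuclideanLin (secondMoment D) u) := by
  by_cases hu : u = 0
  · simp [hu]
  have hn : 0 < ‖u‖ := norm_pos_iff.mpr hu
  have := hD.one_le (‖u‖⁻¹ • u) (by rw [norm_smul, norm_inv, norm_norm, inv_mul_cancel₀ hn.ne'])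
  rw [toEuclideanCLM_apply_eq, map_smul, real_inner_smul_left, inner_smul_right, ← mul_assoc,
    ← mul_inv, inv_mul_eq_div, one_le_div (by positivity)] at this
  rw [pow_two]
  exact this

/-- A step of gradient descent contracts. -/
theorem IsRegressionComponent.norm_sub_smul_le {D : Measure (Sample d)} [IsProbabilityMeasure D]
    {w₀ : Vec d} {C C₁ σ B : ℝ} (hD : IsRegressionComponent D w₀ C C₁ σ)
    (h : BoundedInput D C₁ B) (hC₁ : 1 ≤ C₁) (v : Vec d) :
    ‖v - (1 / C₁) • toEuclideanLin (secondMoment D) v‖ ≤ (1 - 1 / C₁) * ‖v‖ := by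
  have hC₁' : 0 < C₁ := by linarith
  have hA : ((1 : Matrix (Fin d) (Fin d) ℝ) - (1 / C₁) • secondMoment D).IsSymm :=
    IsSymm.sub isSymm_one ((secondMoment_isSymm D).smul _)
  have happ : ∀ u : Vec d, toEuclideanLin ((1 : Matrix (Fin d) (Fin d) ℝ) -
      (1 / C₁) • secondMoment D) u = u - (1 / C₁) • toEuclideanLin (secondMoment D) u := by
    intro u
    rw [map_sub, map_smul, LinearMap.sub_apply, LinearMap.smul_apply]
    congr 1
    simp [toEuclideanLin]
  rw [← happ]
  -- The spectrum of I - Σ/C₁ lies in [0, 1 - 1/C₁].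
  refine norm_toEuclideanLin_le_of_quadratic hA (fun u => ?_) v
  rw [happ, inner_sub_right, inner_smul_right, real_inner_self_eq_norm_sq]
  have h1 := hD.norm_sq_le u
  have h2 : inner ℝ u (toEuclideanLin (secondMoment D) u) ≤ C₁ * ‖u‖ ^ 2 := by
    rw [← integral_mul_inner_eq h]
    simpa only [← pow_two] using h.integral_sq_le u
  rw [abs_le]
  have h3 : 1 / C₁ * inner ℝ u (toEuclideanLin (secondMoment D) u) ≤ ‖u‖ ^ 2 := by
    rw [one_div, inv_mul_le_iff₀ hC₁']
    exact h2
  have h4 : 1 / C₁ * ‖u‖ ^ 2 ≤ 1 / C₁ * inner ℝ u (toEuclideanLin (secondMoment D) u) :=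
    mul_le_mul_of_nonneg_left h1 (by positivity)
  have h5 : 1 / C₁ ≤ 1 := (div_le_one hC₁').mpr hC₁
  constructor
  · nlinarith [mul_nonneg (sub_nonneg.mpr h5) (sq_nonneg ‖u‖)]
  · linarith

/-- The update of the estimate in one round. -/
def roundStep (svd : SingularVectorRoutine d) (S₁ : Coll J) (Bs Bm : Coll (Coll J)) (S₂ : Coll J)
    (T T₁ T₂ ℓ : ℕ) (ε₁ ε₂ σ C C₁ : ℝ) (Z : J → Sample d) (w : Vec d) : Vec d :=
  let κ := clipVal Z S₁ w T ε₁ σ C C₁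
  let P := projectionMatrix (svd.vec (crossMatrix Z Bs w κ)) ℓ
  w - (1 / C₁) • centralEntry (partEst Z Bm w κ P T₂ (Finset.univ.filter fun b =>
    score Z (Bm.get b) S₂ w κ P T₁ ≤ ε₂ ^ 2 * κ ^ 2 * C₁))

/-- Some part of a round fails. -/
def RoundFails (D : Fin k → Measure (Sample d)) (i₀ : Fin k) (w₀ : Vec d)
    (svd : SingularVectorRoutine d) (S₁ : Coll J) (Bs Bm : Coll (Coll J)) (S₂ : Coll J)
    (srcM : Fin Bm.len → Fin k)
    (T T₁ T₂ ℓ : ℕ) (ε₁ ε₂ σ C C₁ t : ℝ) (Z : J → Sample d) (w : Vec d) : Prop :=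
  let κ := clipVal Z S₁ w T ε₁ σ C C₁
  let u := svd.vec (crossMatrix Z Bs w κ)
  let v := fun b => score Z (Bm.get b) S₂ w κ (projectionMatrix u ℓ) T₁
  let c := ε₂ * Real.sqrt C₁
  ClipFails (D i₀) w₀ C₁ σ S₁ T w Z ∨ SubspaceFails svd (D i₀) Bs ℓ c (w, κ) Z ∨
    ScoreFails D i₀ Bm srcM S₂ ℓ T₁ c ((w, κ), u) Z ∨
    t ≤ (keptSet v ((c * κ) ^ 2)).card ∧ EstimateFails D Bm srcM ℓ T₂ c (((w, κ), u), v) Z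

theorem clipVal_pos (Z : J → Sample d) (S : Coll J) (w : Vec d) (T : ℕ) {ε₁ σ C C₁ : ℝ}
    (hε₁ : 0 < ε₁) (hσ : 0 < σ) (hC : 0 ≤ C) (hC₁ : 0 < C₁) : 0 < clipVal Z S w T ε₁ σ C C₁ := by
  have := lossEst_nonneg Z S w T
  exact Real.sqrt_pos.mpr (by positivity)

theorem clipVal_sq (Z : J → Sample d) (S : Coll J) (w : Vec d) (T : ℕ) {ε₁ σ C C₁ : ℝ}
    (hε₁ : 0 < ε₁) (hC : 0 ≤ C) (hC₁ : 0 < C₁) : clipVal Z S w T ε₁ σ C C₁ ^ 2 =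
      32 * (C + 1) * C₁ * (lossEst Z S w T + 17 * σ ^ 2) / ε₁ := by
  have := lossEst_nonneg Z S w T
  exact Real.sq_sqrt (by positivity)

/-- The distance of the gradient estimate from the mean gradient. -/
theorem norm_gradient_sub_le {D : Fin k → Measure (Sample d)} {i₀ : Fin k}
    {u : Fin d → Vec d} {ℓ T₁ T₂ : ℕ} {c κ t : ℝ}
    {S₂ : Coll J} {Bm : Coll (Coll J)} {srcM : Fin Bm.len → Fin k}
    {Z : J → Sample d} {w : Vec d} (hκ : 0 < κ) (hc : 0 < c)
    (ht : t ≤ (Finset.univ.filter fun b => srcM b = i₀).card) (ht0 : 0 < t)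
    (hsub : ‖gradMean (D i₀) w κ - toEuclideanLin (projectionMatrix u ℓ) (gradMean (D i₀) w κ)‖ ≤
      3 * (c * κ))
    (hscore : ¬ ScoreFails D i₀ Bm srcM S₂ ℓ T₁ c ((w, κ), u) Z)
    (hest : ¬ (t ≤ (keptSet (fun b => score Z (Bm.get b) S₂ w κ (projectionMatrix u ℓ) T₁)
      ((c * κ) ^ 2)).card ∧ EstimateFails D Bm srcM ℓ T₂ c (((w, κ), u),
        fun b => score Z (Bm.get b) S₂ w κ (projectionMatrix u ℓ) T₁) Z)) :
    ‖centralEntry (partEst Z Bm w κ (projectionMatrix u ℓ) T₂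
      (keptSet (fun b => score Z (Bm.get b) S₂ w κ (projectionMatrix u ℓ) T₁) ((c * κ) ^ 2))) -
      gradMean (D i₀) w κ‖ ≤ 8 * (c * κ) := by
  set h := c * κ with hh
  have hh0 : 0 < h := mul_pos hc hκ
  set v := fun b => score Z (Bm.get b) S₂ w κ (projectionMatrix u ℓ) T₁ with hv
  set P := toEuclideanLin (projectionMatrix u ℓ) with hP
  set G₀ := gradMean (D i₀) w κ
  set G := fun b => gradMean (D (srcM b)) w κ
  set kept := keptSet v (h ^ 2)
  have hs : ∀ b, |v b - ‖P (G b - G₀)‖ ^ 2| ≤ ‖P (G b - G₀)‖ * h + h ^ 2 / 20 := by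
    intro b
    by_contra hb
    exact hscore ⟨b, not_le.mp hb⟩
  -- For x = ‖P(G_b - G₀)‖ a score of at most h² implies x² ≤ xh + 21h²/20, which fails for x > 2h.
  have hkept : ∀ b ∈ kept, ‖P (G b - G₀)‖ ≤ 2 * h := by
    intro b hb
    have hb' : v b ≤ h ^ 2 := (Finset.mem_filter.mp hb).2
    have h1 := (abs_le.mp (hs b)).1
    by_contra hlt
    nlinarith [norm_nonneg (P (G b - G₀))]
  -- A batch of `i₀` has the mean difference 0, so its score is at most h²/20.
  have hmem : (Finset.univ.filter fun b => srcM b = i₀) ⊆ kept := by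
    intro b hb
    have hb' : srcM b = i₀ := (Finset.mem_filter.mp hb).2
    have h1 := (abs_le.mp (hs b)).2
    have h0 : G b - G₀ = 0 := by simp only [G, G₀, hb', sub_self]
    rw [h0, map_zero, norm_zero] at h1
    refine Finset.mem_filter.mpr ⟨Finset.mem_univ b, ?_⟩
    nlinarith
  have htk : t ≤ kept.card := ht.trans (by exact_mod_cast Finset.card_le_card hmem)
  have hk0 : (0 : ℝ) < kept.card := ht0.trans_le htk
  have hest' : ‖centralEntry (partEst Z Bm w κ (projectionMatrix u ℓ) T₂ kept) -
      (kept.card : ℝ)⁻¹ • ∑ b ∈ kept, P (G b)‖ ≤ 3 * h := by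
    by_contra hlt
    exact hest ⟨htk, not_le.mp hlt⟩
  have havg : ‖(kept.card : ℝ)⁻¹ • ∑ b ∈ kept, P (G b) - P G₀‖ ≤ 2 * h := by
    have e : (kept.card : ℝ)⁻¹ • ∑ b ∈ kept, P (G b) - P G₀ =
        (kept.card : ℝ)⁻¹ • ∑ b ∈ kept, P (G b - G₀) := by
      simp only [map_sub, Finset.sum_sub_distrib, Finset.sum_const, smul_sub]
      rw [← Nat.cast_smul_eq_nsmul ℝ, smul_smul, inv_mul_cancel₀ hk0.ne', one_smul]
    rw [e, norm_smul, norm_inv, Real.norm_natCast, inv_mul_le_iff₀ hk0]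
    refine (norm_sum_le _ _).trans ((Finset.sum_le_sum hkept).trans_eq ?_)
    rw [Finset.sum_const, nsmul_eq_mul]
  rw [norm_sub_rev] at hsub
  -- The three terms are the statistical error, the contamination by kept batches of other
  -- components, and the part of G₀ outside the subspace.
  calc _ = ‖(centralEntry (partEst Z Bm w κ (projectionMatrix u ℓ) T₂ kept) -
      (kept.card : ℝ)⁻¹ • ∑ b ∈ kept, P (G b)) +
      ((kept.card : ℝ)⁻¹ • ∑ b ∈ kept, P (G b) - P G₀) + (P G₀ - G₀)‖ := by
        congr 1
        abel
    _ ≤ 3 * h + 2 * h + 3 * h := norm_add₃_le.trans (by linarith)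
    _ = 8 * h := by ring

/-- A round in which no part fails contracts the error. -/
theorem norm_roundStep_sub_le {D : Fin k → Measure (Sample d)} [∀ i, IsProbabilityMeasure (D i)]
    {i₀ : Fin k} {w₀ : Vec d} {C C₁ σ β ε ε₂ t : ℝ}
    (hD : IsRegressionComponent (D i₀) w₀ C C₁ σ) (hB : BoundedInput (D i₀) C₁ β) (hC : 0 ≤ C)
    (hC₁ : 1 ≤ C₁) (hσ : 0 < σ) (hε : 0 < ε)
    (hε₂ : ε₂ = 1 / 4000 * min ε (1 / Real.sqrt C₁) / (C₁ * Real.sqrt (C + 1)))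
    {svd : SingularVectorRoutine d} {S₁ S₂ : Coll J} {Bs Bm : Coll (Coll J)}
    {srcM : Fin Bm.len → Fin k} {T T₁ T₂ ℓ : ℕ}
    (ht : t ≤ (Finset.univ.filter fun b => srcM b = i₀).card) (ht0 : 0 < t)
    {Z : J → Sample d} {w : Vec d}
    (h : ¬ RoundFails D i₀ w₀ svd S₁ Bs Bm S₂ srcM T T₁ T₂ ℓ (1 / 4) ε₂ σ C C₁ t Z w) :
    ‖roundStep svd S₁ Bs Bm S₂ T T₁ T₂ ℓ (1 / 4) ε₂ σ C C₁ Z w - w₀‖ ≤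
      (1 - 1 / (2 * C₁)) * ‖w - w₀‖ + ε * σ / (4 * C₁) := by
  have hC₁' : 0 < C₁ := by linarith
  have hsC₁ : Real.sqrt C₁ ^ 2 = C₁ := Real.sq_sqrt hC₁'.le
  have hsC : Real.sqrt (C + 1) ^ 2 = C + 1 := Real.sq_sqrt (by linarith)
  have hsC₁0 : 0 < Real.sqrt C₁ := Real.sqrt_pos.mpr hC₁'
  have hsC0 : 0 < Real.sqrt (C + 1) := Real.sqrt_pos.mpr (by linarith)
  set κ := clipVal Z S₁ w T (1 / 4) σ C C₁ with hκ
  set u := svd.vec (crossMatrix Z Bs w κ) with hu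
  set P := projectionMatrix u ℓ with hP
  have hκ0 : 0 < κ := clipVal_pos Z S₁ w T (by norm_num) hσ hC hC₁'
  have hκ2 : κ ^ 2 = 32 * (C + 1) * C₁ * (lossEst Z S₁ w T + 17 * σ ^ 2) / (1 / 4) :=
    clipVal_sq Z S₁ w T (by norm_num) hC hC₁'
  set M := min ε (1 / Real.sqrt C₁) with hM
  have hM0 : 0 < M := lt_min hε (by positivity)
  have hMε : M ^ 2 ≤ ε ^ 2 := pow_le_pow_left₀ hM0.le (min_le_left _ _) 2
  have hMC : M ^ 2 * C₁ ≤ 1 := by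
    have : M ^ 2 ≤ (1 / Real.sqrt C₁) ^ 2 := pow_le_pow_left₀ hM0.le (min_le_right _ _) 2
    rw [div_pow, one_pow, hsC₁, le_div_iff₀ hC₁'] at this
    exact this
  have hε₂0 : 0 < ε₂ := by rw [hε₂]; positivity
  set c := ε₂ * Real.sqrt C₁ with hc
  have hc0 : 0 < c := by positivity
  have hcκ : (c * κ) ^ 2 = ε₂ ^ 2 * κ ^ 2 * C₁ := by
    rw [hc, mul_pow, mul_pow, hsC₁]
    ring
  have hε₂2 : ε₂ ^ 2 * ((C + 1) * C₁ ^ 2) = M ^ 2 / 16000000 := by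
    rw [hε₂, div_pow, mul_pow C₁, hsC, mul_pow]
    field_simp
    norm_num
  unfold RoundFails at h
  simp only [not_or] at h
  obtain ⟨hclip, hsub, hscore, hest⟩ := h
  rw [ClipFails, not_not] at hclip
  rw [SubspaceFails, not_lt] at hsub
  obtain ⟨hlow, hup⟩ := hclip
  set v := w - w₀ with hv
  have hgrad := norm_gradient_sub_le hκ0 hc0 ht ht0
    hsub hscore hest
  set G₀ := gradMean (D i₀) w κ with hG₀
  set Δ := centralEntry (partEst Z Bm w κ P T₂ (keptSet (fun b =>
    score Z (Bm.get b) S₂ w κ P T₁) ((c * κ) ^ 2))) with hΔ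
  have hstep : roundStep svd S₁ Bs Bm S₂ T T₁ T₂ ℓ (1 / 4) ε₂ σ C C₁ Z w = w - (1 / C₁) • Δ := by
    rw [hΔ, hcκ]
    rfl
  -- the accuracy of the gradient
  have hcκle : c * κ ≤ (‖v‖ + ε * σ) / 32 := by
    refine le_of_sq_le_sq ?_ (by positivity)
    -- The upper bound for the loss estimate gives κ² ≤ 128(C + 1)C₁(16C₁‖v‖² + 33σ²), and ε₂²(C +
    -- 1)C₁² = M²/4000². Of the two bounds in the minimum M, M²C₁ ≤ 1 serves the term with ‖v‖² and
    -- M ≤ ε the term with σ².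
    have h1 : (c * κ) ^ 2 ≤ M ^ 2 / 16000000 * (128 * (16 * C₁ * ‖v‖ ^ 2 + 33 * σ ^ 2)) := by
      rw [hcκ, hκ2, ← hε₂2]
      have : lossEst Z S₁ w T + 17 * σ ^ 2 ≤ 16 * C₁ * ‖v‖ ^ 2 + 33 * σ ^ 2 := by linarith
      calc _ = ε₂ ^ 2 * ((C + 1) * C₁ ^ 2) * (128 * (lossEst Z S₁ w T + 17 * σ ^ 2)) := by ring
        _ ≤ _ := by gcongr
    have h2 : M ^ 2 * C₁ * ‖v‖ ^ 2 ≤ ‖v‖ ^ 2 := by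
      simpa using mul_le_mul_of_nonneg_right hMC (sq_nonneg ‖v‖)
    have h3 : M ^ 2 * σ ^ 2 ≤ ε ^ 2 * σ ^ 2 := mul_le_mul_of_nonneg_right hMε (sq_nonneg σ)
    have h4 : 0 ≤ ‖v‖ * (ε * σ) := by positivity
    nlinarith [sq_nonneg ‖v‖, sq_nonneg (ε * σ)]
  have hbias : ‖G₀ - toEuclideanLin (secondMoment (D i₀)) v‖ ≤ 1 / 4 * ‖v‖ := by
    set y := G₀ - toEuclideanLin (secondMoment (D i₀)) v with hy
    -- Since the loss estimate is at least e/4 - 16σ², κ² ≥ 128(C + 1)C₁(e/4 + σ²), which is the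
    -- threshold of the bias bound. This is the reason for 17σ² and for ε₁ = 1/4.
    have h1 := hD.abs_bias_le hB hC hC₁' hκ0 w y (by
      rw [hκ2]
      have := mul_le_mul_of_nonneg_left hlow (by positivity : 0 ≤ 128 * (C + 1) * C₁)
      calc _ ≤ 128 * (C + 1) * C₁ * ((∫ z, inner ℝ z.1 v ^ 2 ∂(D i₀)) / 4 - 16 * σ ^ 2 +
          17 * σ ^ 2) := le_of_eq (by ring)
        _ ≤ 128 * (C + 1) * C₁ * (lossEst Z S₁ w T + 17 * σ ^ 2) :=
            mul_le_mul_of_nonneg_left (by linarith) (by positivity)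
        _ = _ := by ring)
    rw [real_inner_self_eq_norm_sq, abs_of_nonneg (sq_nonneg _), pow_two] at h1
    rcases (norm_nonneg y).eq_or_lt with h0 | h0
    · rw [← h0]; positivity
    · exact le_of_mul_le_mul_right h1 h0
  have hcontr := hD.norm_sub_smul_le hB hC₁ v
  rw [hstep]
  -- Exact step, bias, and error of the gradient estimate. The last two contribute at most ‖v‖/4 and
  -- 8h ≤ (‖v‖ + εσ)/4, each divided by C₁.
  calc ‖w - (1 / C₁) • Δ - w₀‖ = ‖(v - (1 / C₁) • toEuclideanLin (secondMoment (D i₀)) v) +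
        (-(1 / C₁)) • (G₀ - toEuclideanLin (secondMoment (D i₀)) v) + (-(1 / C₁)) • (Δ - G₀)‖ := by
        congr 1
        rw [hv]
        module
    _ ≤ (1 - 1 / C₁) * ‖v‖ + 1 / C₁ * (1 / 4 * ‖v‖) + 1 / C₁ * (8 * (c * κ)) := by
        refine norm_add₃_le.trans (add_le_add (add_le_add hcontr ?_) ?_)
        · rw [norm_smul, norm_neg, Real.norm_of_nonneg (by positivity)]
          gcongr
        · rw [norm_smul, norm_neg, Real.norm_of_nonneg (by positivity)]
          gcongr
    _ ≤ (1 - 1 / C₁) * ‖v‖ + 1 / C₁ * (1 / 4 * ‖v‖) + 1 / C₁ * (8 * ((‖v‖ + ε * σ) / 32)) := by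
        gcongr
    _ = _ := by
        field_simp
        ring

end Round

/-! ### The probability that a round fails -/

section RoundProbability

open Matrix

variable {Ω : Type*} [mΩ : MeasurableSpace Ω] {μ : Measure Ω} {d k : ℕ} {J : Type}
  {Z : J → Ω → Sample d} {D : Fin k → Measure (Sample d)}

/-- The indices of the samples of a round. -/
def roundIndices (S₁ : Coll J) (Bs Bm : Coll (Coll J)) (S₂ : Coll J) : Set J :=
  S₁.support ∪ Bs.supports ∪ (Bm.supports ∪ S₂.support)

/-- The samples of a round: they are all distinct and have the right distributions. -/
structure IsRound (μ : Measure Ω) (Z : J → Ω → Sample d) (D : Fin k → Measure (Sample d))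
    (i₀ : Fin k) (S₁ : Coll J) (Bs Bm : Coll (Coll J)) (S₂ : Coll J) (srcS : Fin Bs.len → Fin k)
    (srcM : Fin Bm.len → Fin k) : Prop where
  star₁ : IsSampleOf μ Z S₁ (D i₀)
  small : IsBatches μ Z D Bs srcS
  medium : IsBatches μ Z D Bm srcM
  star₂ : IsSampleOf μ Z S₂ (D i₀)
  disjoint_star₁_small : Disjoint S₁.support Bs.supports
  disjoint_star₁_medium : Disjoint S₁.support Bm.supports
  disjoint_star₁_star₂ : Disjoint S₁.support S₂.support
  disjoint_small_medium : Disjoint Bs.supports Bm.supports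
  disjoint_small_star₂ : Disjoint Bs.supports S₂.support
  disjoint_medium_star₂ : Disjoint Bm.supports S₂.support

/-- The numbers of samples are large enough for the accuracy `ε₂`. -/
structure IsLargeRound (S₁ : Coll J) (Bs Bm : Coll (Coll J)) (S₂ : Coll J)
    (srcS : Fin Bs.len → Fin k) (i₀ : Fin k) (T T₁ T₂ ℓ n₁ n₂ : ℕ) (C α ε₂ t : ℝ) : Prop where
  star₁_pos : 0 < S₁.len / T
  star₁_le : 64 * C ≤ (S₁.len / T : ℕ)
  small_pos : 0 < Bs.len
  two_le_small : ∀ b, 2 ≤ (Bs.get b).len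
  small_good : α / 2 * Bs.len ≤ (Finset.univ.filter fun b => srcS b = i₀).card
  rank : k ≤ ℓ ∨ 1 ≤ 2 * α * ε₂ ^ 2 * (ℓ + 1)
  one_le_rank : 1 ≤ ℓ
  n₁_pos : 0 < n₁
  le_medium₁ : ∀ b, n₁ ≤ (Bm.get b).len / 2 / (T₁ + T₁)
  le_star₂ : n₁ ≤ S₂.len / (T₁ + T₁)
  n₁_le : 2560 * Real.sqrt ℓ ≤ n₁ * ε₂ ^ 2
  n₂_pos : 0 < n₂
  le_medium₂ : ∀ b, n₂ ≤ (Bm.get b).len / 2 / T₂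
  n₂_le : 8 * ℓ ≤ t * n₂ * ε₂ ^ 2

/-! ### Measurability of a round with respect to its own samples. -/

section Measurability

variable {m : MeasurableSpace Ω} {S₁ S₂ : Coll J} {Bs Bm : Coll (Coll J)}
  {svd : SingularVectorRoutine d} {w : Ω → Vec d}

omit mΩ in
theorem measurable_roundStep
    (hZ : ∀ j ∈ roundIndices S₁ Bs Bm S₂, Measurable[m] (Z j)) (hw : Measurable[m] w)
    (T T₁ T₂ ℓ : ℕ) (ε₁ ε₂ σ C C₁ : ℝ) :
    Measurable[m] fun ω => roundStep svd S₁ Bs Bm S₂ T T₁ T₂ ℓ ε₁ ε₂ σ C C₁ (fun j => Z j ω)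
      (w ω) := by
  have hκ := measurable_clipVal (m := m) (S := S₁) (fun j hj => hZ j (Or.inl (Or.inl hj))) hw T ε₁ σ
    C C₁
  have hu := svd.measurable.comp (measurable_crossMatrix (m := m) (B := Bs)
    (fun b j hj => hZ j (Or.inl (Or.inr (Bs.support_subset_supports b hj)))) hw hκ)
  have hv : ∀ b, Measurable[m] _ := fun b => measurable_score (m := m) (b := Bm.get b) (S := S₂)
    (fun j hj => hZ j (Or.inr (Or.inl (Bm.support_subset_supports b
      ((Bm.get b).support_part_subset 2 0 hj)))))
    (fun j hj => hZ j (Or.inr (Or.inr hj))) hw hκ hu ℓ T₁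
  have hk : ∀ b, MeasurableSet[m] _ := fun b => measurableSet_le (hv b)
    (((hκ.pow_const 2).const_mul (ε₂ ^ 2)).mul_const C₁)
  refine Measurable.sub hw (Measurable.const_smul (M := ℝ) ?_ _)
  refine measurable_centralEntry (m := m) fun i => measurable_partEst (m := m) (B := Bm)
    (fun b j hj => hZ j (Or.inr (Or.inl (Bm.support_subset_supports b
      ((Bm.get b).support_part_subset 2 1 hj))))) hw hκ hu ℓ T₂ (fun b => ?_) i
  simp only [Finset.mem_filter, Finset.mem_univ, true_and]
  exact hk b

end Measurability

/-- The set of the indices read so far grows from stage to stage. At each stage all previous results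
are measurable with respect to the samples in the current set, and the stage reads samples outside
it, so the four conditional bounds add up. -/
theorem measureReal_roundFails_le [IsProbabilityMeasure μ] (hZ : ∀ j, Measurable (Z j))
    (hind : iIndepFun Z μ)
    [∀ i, IsProbabilityMeasure (D i)] {C C₁ β σ : ℝ} (hβ : 0 < β) (hC : 0 ≤ C) (hC₁ : 0 < C₁)
    (hσ : 0 < σ) (h : ∀ i, BoundedInput (D i) C₁ β) {S₁ S₂ : Coll J} {Bs Bm : Coll (Coll J)}
    {srcS : Fin Bs.len → Fin k} {srcM : Fin Bm.len → Fin k} {i₀ : Fin k} {w₀ : Vec d}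
    (hD : IsRegressionComponent (D i₀) w₀ C C₁ σ)
    (hR : IsRound μ Z D i₀ S₁ Bs Bm S₂ srcS srcM) {T T₁ T₂ ℓ n₁ n₂ : ℕ} {α ε₂ t : ℝ}
    (hα : 0 < α) (hε₂ : 0 < ε₂) (ht : 0 < t)
    (hL : IsLargeRound S₁ Bs Bm S₂ srcS i₀ T T₁ T₂ ℓ n₁ n₂ C α ε₂ t)
    (svd : SingularVectorRoutine d) {ε₁ : ℝ} (hε₁ : 0 < ε₁) {U : Set J}
    (hU : Disjoint U (roundIndices S₁ Bs Bm S₂)) {w : Ω → Vec d} (hw : Measurable[sig Z U] w) :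
    μ.real {ω | RoundFails D i₀ w₀ svd S₁ Bs Bm S₂ srcM T T₁ T₂ ℓ ε₁ ε₂ σ C C₁ t (fun j => Z j ω)
      (w ω)} ≤ 2 * Real.exp (-(T / 3)) +
      2 * (d * Real.exp (-(Bs.len * (α * ε₂ ^ 2) ^ 2 * C₁ / (4 * β ^ 2 * (4 + α * ε₂ ^ 2))))) +
      Bm.len * (2 * Real.exp (-(T₁ / 3))) + Real.exp (-(T₂ / 3)) := by
  simp only [roundIndices, Set.disjoint_union_right] at hU
  obtain ⟨⟨hU1, hU2⟩, hU3, hU4⟩ := hU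
  set κ : Ω → ℝ := fun ω => clipVal (fun j => Z j ω) S₁ (w ω) T ε₁ σ C C₁ with hκe
  have hκ0 : ∀ ω, 0 < κ ω := fun ω => clipVal_pos _ _ _ _ hε₁ hσ hC hC₁
  set U₁ := U ∪ S₁.support
  have hκ : Measurable[sig Z U₁] κ := measurable_clipVal (m := sig Z U₁) (S := S₁)
    (fun j hj => measurable_sig Z (Or.inr hj)) (hw.mono (sig_mono Z Set.subset_union_left) le_rfl)
    T ε₁ σ C C₁
  have hw1 : Measurable[sig Z U₁] w := hw.mono (sig_mono Z Set.subset_union_left) le_rfl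
  set U₂ := U₁ ∪ Bs.supports
  have hκ2 : Measurable[sig Z U₂] κ := hκ.mono (sig_mono Z Set.subset_union_left) le_rfl
  have hw2 : Measurable[sig Z U₂] w := hw1.mono (sig_mono Z Set.subset_union_left) le_rfl
  set u : Ω → Fin d → Vec d := fun ω => svd.vec (crossMatrix (fun j => Z j ω) Bs (w ω) (κ ω))
  have hu0 : ∀ ω, Orthonormal ℝ (u ω) := fun ω => (svd.spec _).orthonormal
  have hu : Measurable[sig Z U₂] u := svd.measurable.comp (measurable_crossMatrix (m := sig Z U₂)
    (B := Bs) (fun b j hj => measurable_sig Z (Or.inr (Bs.support_subset_supports b hj))) hw2 hκ2)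
  -- Only the first halves of the medium batches are added; the second halves stay fresh for the
  -- averages.
  set U₃ := U₂ ∪ ((⋃ b, ((Bm.get b).part 2 0).support) ∪ S₂.support)
  have hκ3 : Measurable[sig Z U₃] κ := hκ2.mono (sig_mono Z Set.subset_union_left) le_rfl
  have hw3 : Measurable[sig Z U₃] w := hw2.mono (sig_mono Z Set.subset_union_left) le_rfl
  have hu3 : Measurable[sig Z U₃] u := hu.mono (sig_mono Z Set.subset_union_left) le_rfl
  set v : Ω → Fin Bm.len → ℝ := fun ω b => score (fun j => Z j ω) (Bm.get b) S₂ (w ω) (κ ω)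
    (projectionMatrix (u ω) ℓ) T₁
  have hv : Measurable[sig Z U₃] v := @measurable_pi_lambda _ _ _ (sig Z U₃) _ _ fun b =>
    measurable_score (m := sig Z U₃)
    (fun j hj => measurable_sig Z (Or.inr (Or.inl (Set.mem_iUnion.mpr ⟨b, hj⟩))))
    (fun j hj => measurable_sig Z (Or.inr (Or.inr hj))) hw3 hκ3 hu3 ℓ T₁
  have hBmsub : ∀ b i, ((Bm.get b).part 2 i).support ⊆ Bm.supports := fun b i =>
    ((Bm.get b).support_part_subset 2 i).trans (Bm.support_subset_supports b)
  have p1 := measureReal_clipFails_le hZ hind hR.star₁ hL.star₁_pos hD (h i₀) hσ hC₁.le hL.star₁_le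
    hU1 hw
  have p2 := measureReal_subspaceFails_le hZ hind hβ hC₁ h hR.small hL.two_le_small hL.small_pos
    svd hα hε₂ hL.small_good hL.rank
    (Set.disjoint_union_left.mpr ⟨hU2, hR.disjoint_star₁_small⟩) hw1 hκ hκ0
  have p3 := measureReal_scoreFails_le hZ hind hC₁ h hR.medium hR.star₂ hR.disjoint_medium_star₂
    hL.one_le_rank hL.n₁_pos hL.le_medium₁ hL.le_star₂ hε₂ hL.n₁_le (U := U₂) (by
      simp only [U₂, U₁, Set.disjoint_union_left, Set.disjoint_union_right]
      exact ⟨⟨⟨hU3, hR.disjoint_star₁_medium⟩, hR.disjoint_small_medium⟩,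
        ⟨hU4, hR.disjoint_star₁_star₂⟩, hR.disjoint_small_star₂⟩) hw2 hκ2 hu hκ0 hu0
  have p4 := measureReal_estimateFails_le hZ hind hC₁ h hR.medium hL.n₂_pos hL.le_medium₂ ht hε₂
    hL.n₂_le (U := U₃) (fun b => by
      simp only [U₃, U₂, U₁, Set.disjoint_union_left, Set.disjoint_iUnion_left]
      refine ⟨⟨⟨hU3.mono_right (hBmsub b 1), hR.disjoint_star₁_medium.mono_right (hBmsub b 1)⟩,
        hR.disjoint_small_medium.mono_right (hBmsub b 1)⟩, fun b' => ?_,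
        hR.disjoint_medium_star₂.symm.mono_right (hBmsub b 1)⟩
      by_cases hbb : b' = b
      · subst hbb
        exact disjoint_half (hR.medium.sample b').injective
      · exact (hR.medium.disjoint hbb).mono ((Bm.get b').support_part_subset 2 0)
          ((Bm.get b).support_part_subset 2 1)) hw3 hκ3 hu3 hv hκ0 hu0
  have hsub : {ω | RoundFails D i₀ w₀ svd S₁ Bs Bm S₂ srcM T T₁ T₂ ℓ ε₁ ε₂ σ C C₁ t
      (fun j => Z j ω) (w ω)} ⊆
      (({ω | ClipFails (D i₀) w₀ C₁ σ S₁ T (w ω) fun j => Z j ω} ∪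
      {ω | SubspaceFails svd (D i₀) Bs ℓ (ε₂ * Real.sqrt C₁) (w ω, κ ω) fun j => Z j ω}) ∪
      {ω | ScoreFails D i₀ Bm srcM S₂ ℓ T₁ (ε₂ * Real.sqrt C₁) ((w ω, κ ω), u ω) fun j => Z j ω}) ∪
      {ω | t ≤ (keptSet (v ω) ((ε₂ * Real.sqrt C₁ * κ ω) ^ 2)).card ∧
      EstimateFails D Bm srcM ℓ T₂ (ε₂ * Real.sqrt C₁) (((w ω, κ ω), u ω), v ω) fun j => Z j ω} := by
    rintro ω (hω | hω | hω | hω)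
    · exact Or.inl (Or.inl (Or.inl hω))
    · exact Or.inl (Or.inl (Or.inr hω))
    · exact Or.inl (Or.inr hω)
    · exact Or.inr hω
  refine (measureReal_mono hsub (measure_ne_top _ _)).trans ?_
  refine (measureReal_union_le _ _).trans (add_le_add ?_ p4)
  refine (measureReal_union_le _ _).trans (add_le_add ?_ p3)
  exact (measureReal_union_le _ _).trans (add_le_add p1 p2)

end RoundProbability

/-! ### All rounds for a fixed arrangement of the samples -/

/-- Apply `f 0`, …, `f (n - 1)` in this order. -/
def iterateFin {α : Type} : (n : ℕ) → (Fin n → α → α) → α → α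
  | 0, _, a => a
  | n + 1, f, a => f (Fin.last n) (iterateFin n (fun i => f i.castSucc) a)

theorem val_loop {α : Type} (n : ℕ) (f : Fin n → α → Timed α) (a : α) :
    (loop n f a).val = iterateFin n (fun i b => (f i b).val) a := by
  induction n with
  | zero => rfl
  | succ n ih => exact congrArg (fun b => (f (Fin.last n) b).val) (ih _)

section Rounds

variable {Ω : Type*} [mΩ : MeasurableSpace Ω] {μ : Measure Ω} {d k : ℕ} {J : Type}
  {Z : J → Ω → Sample d} {D : Fin k → Measure (Sample d)}

omit mΩ in
-- The iterate is a function of the samples of the completed rounds only, hence independent of those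
-- of the next round.
theorem measurable_iterateFin_roundStep (svd : SingularVectorRoutine d)
    {n : ℕ}
    (S₁ : Fin n → Coll J) (Bs Bm : Fin n → Coll (Coll J)) (S₂ : Fin n → Coll J)
    (T T₁ T₂ ℓ : ℕ) (ε₁ ε₂ σ C C₁ : ℝ) (a : Vec d) :
    Measurable[sig Z (⋃ r, roundIndices (S₁ r) (Bs r) (Bm r) (S₂ r))] fun ω =>
      iterateFin n (fun r w => roundStep svd (S₁ r) (Bs r) (Bm r) (S₂ r) T T₁ T₂ ℓ ε₁ ε₂ σ C C₁
        (fun j => Z j ω) w) a := by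
  induction n with
  | zero => exact measurable_const
  | succ n ih =>
    refine measurable_roundStep (m := sig Z _) (fun j hj => measurable_sig Z ?_)
      ((ih (fun r => S₁ r.castSucc) (fun r => Bs r.castSucc) (fun r => Bm r.castSucc)
        (fun r => S₂ r.castSucc)).mono (sig_mono Z ?_) le_rfl) T T₁ T₂ ℓ ε₁ ε₂ σ C C₁
    · exact Set.mem_iUnion.mpr ⟨Fin.last n, hj⟩
    · exact Set.iUnion_subset fun r => Set.subset_iUnion
        (fun r => roundIndices (S₁ r) (Bs r) (Bm r) (S₂ r)) r.castSucc

theorem measureReal_norm_iterateFin_sub_le [IsProbabilityMeasure μ] (hZ : ∀ j, Measurable (Z j))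
    (hind : iIndepFun Z μ)
    [∀ i, IsProbabilityMeasure (D i)] {C C₁ β σ ε M : ℝ} (hβ : 0 < β) (hC : 0 ≤ C) (hC₁ : 1 ≤ C₁)
    (hσ : 0 < σ) (hε : 0 < ε) (h : ∀ i, BoundedInput (D i) C₁ β) {i₀ : Fin k} {w₀ : Vec d}
    (hM : ‖w₀‖ ≤ M)
    (hD : IsRegressionComponent (D i₀) w₀ C C₁ σ) {n : ℕ}
    {S₁ : Fin n → Coll J} {Bs Bm : Fin n → Coll (Coll J)} {S₂ : Fin n → Coll J}
    {srcS : ∀ r, Fin (Bs r).len → Fin k} {srcM : ∀ r, Fin (Bm r).len → Fin k}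
    {T T₁ T₂ ℓ n₁ n₂ : ℕ} {α ε₂ t p : ℝ}
    (hε₂ : ε₂ = 1 / 4000 * min ε (1 / Real.sqrt C₁) / (C₁ * Real.sqrt (C + 1)))
    (hα : 0 < α) (ht : 0 < t)
    (hR : ∀ r, IsRound μ Z D i₀ (S₁ r) (Bs r) (Bm r) (S₂ r) (srcS r) (srcM r))
    (hdis : Pairwise fun r r' => Disjoint (roundIndices (S₁ r) (Bs r) (Bm r) (S₂ r))
      (roundIndices (S₁ r') (Bs r') (Bm r') (S₂ r')))
    (hL : ∀ r, IsLargeRound (S₁ r) (Bs r) (Bm r) (S₂ r) (srcS r) i₀ T T₁ T₂ ℓ n₁ n₂ C α ε₂ t)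
    (hsrc : ∀ r, t ≤ (Finset.univ.filter fun b => srcM r b = i₀).card)
    (hp : ∀ r, 2 * Real.exp (-(T / 3)) + 2 * (d * Real.exp (-((Bs r).len * (α * ε₂ ^ 2) ^ 2 * C₁ /
      (4 * β ^ 2 * (4 + α * ε₂ ^ 2))))) + (Bm r).len * (2 * Real.exp (-(T₁ / 3))) +
      Real.exp (-(T₂ / 3)) ≤ p)
    (svd : SingularVectorRoutine d) :
    μ.real {ω | ¬ ‖iterateFin n (fun r w => roundStep svd (S₁ r) (Bs r) (Bm r) (S₂ r) T T₁ T₂ ℓ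
        (1 / 4) ε₂ σ C C₁ (fun j => Z j ω) w) 0 - w₀‖ ≤
        (1 - 1 / (2 * C₁)) ^ n * M + ε * σ / 2} ≤ n * p := by
  have hε₂' : 0 < ε₂ := by
    have : 0 < min ε (1 / Real.sqrt C₁) := lt_min hε (by positivity)
    rw [hε₂]
    positivity
  induction n with
  | zero =>
    have : {ω : Ω | ¬ ‖(0 : Vec d) - w₀‖ ≤ (1 - 1 / (2 * C₁)) ^ 0 * M + ε * σ / 2} = ∅ := by
      ext ω
      simp only [zero_sub, norm_neg, pow_zero, one_mul, Set.mem_ofPred_eq, Set.mem_empty_iff_false,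
        iff_false, not_not]
      have : 0 < ε * σ := by positivity
      linarith
    simp only [iterateFin]
    rw [this]
    simp
  | succ n ih =>
    have ih' := ih (fun r => hR r.castSucc)
      (fun r r' hr => hdis fun e => hr (Fin.castSucc_injective n e)) (fun r => hL r.castSucc)
      (fun r => hsrc r.castSucc) (fun r => hp r.castSucc)
    set W : Ω → Vec d := fun ω => iterateFin n (fun r w => roundStep svd (S₁ r.castSucc)
      (Bs r.castSucc) (Bm r.castSucc) (S₂ r.castSucc) T T₁ T₂ ℓ (1 / 4) ε₂ σ C C₁
      (fun j => Z j ω) w) 0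
    set l := Fin.last n
    have hW : Measurable[sig Z (⋃ r : Fin n, roundIndices (S₁ r.castSucc) (Bs r.castSucc)
        (Bm r.castSucc) (S₂ r.castSucc))] W :=
      measurable_iterateFin_roundStep svd (fun r => S₁ r.castSucc) (fun r => Bs r.castSucc)
        (fun r => Bm r.castSucc) (fun r => S₂ r.castSucc) T T₁ T₂ ℓ (1 / 4) ε₂ σ C C₁ 0
    have hf := (measureReal_roundFails_le hZ hind hβ hC (by linarith) hσ h hD (hR l) hα hε₂' ht
      (hL l) svd (by norm_num : (0 : ℝ) < 1 / 4)
      (Set.disjoint_iUnion_left.mpr fun r => hdis (Fin.castSucc_lt_last r).ne) hW).trans (hp l)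
    have hsub : {ω | ¬ ‖iterateFin (n + 1) (fun r w => roundStep svd (S₁ r) (Bs r) (Bm r) (S₂ r) T
        T₁ T₂ ℓ (1 / 4) ε₂ σ C C₁ (fun j => Z j ω) w) 0 - w₀‖ ≤
        (1 - 1 / (2 * C₁)) ^ (n + 1) * M + ε * σ / 2} ⊆
        {ω | ¬ ‖W ω - w₀‖ ≤ (1 - 1 / (2 * C₁)) ^ n * M + ε * σ / 2} ∪
        {ω | RoundFails D i₀ w₀ svd (S₁ l) (Bs l) (Bm l) (S₂ l) (srcM l) T T₁ T₂ ℓ (1 / 4) ε₂ σ C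
          C₁ t (fun j => Z j ω) (W ω)} := by
      intro ω hω
      by_contra hn
      simp only [Set.mem_union, Set.mem_ofPred_eq, not_or, not_not] at hn
      apply hω
      refine (norm_roundStep_sub_le hD (h i₀) hC hC₁ hσ hε hε₂ (hsrc l) ht hn.2).trans ?_
      have hx : 0 ≤ 1 - 1 / (2 * C₁) := by
        have : 1 / (2 * C₁) ≤ 1 := by
          rw [div_le_one (by positivity)]
          linarith
        linarith
      -- The additive part εσ/2 is the fixed point of the recursion, so it does not grow with the
      -- number of rounds.
      calc _ ≤ (1 - 1 / (2 * C₁)) * ((1 - 1 / (2 * C₁)) ^ n * M + ε * σ / 2)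
            + ε * σ / (4 * C₁) := by gcongr; exact hn.1
        _ = _ := by
          rw [pow_succ]
          field_simp
          ring
    calc _ ≤ _ := measureReal_mono hsub
      _ ≤ _ := measureReal_union_le _ _
      _ ≤ n * p + p := add_le_add ih' hf
      _ = _ := by push_cast; ring

/-- The number of rounds suffices for the accuracy `ε σ`. -/
theorem pow_mul_add_le {C₁ M ε σ : ℝ} (hC₁ : 1 ≤ C₁) (hM : 0 ≤ M) (hε : 0 < ε)
    (hσ : 0 < σ) {n : ℕ} (hn : 4 * C₁ * Real.log (2 + M / (ε * σ)) ≤ n) :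
    (1 - 1 / (2 * C₁)) ^ n * M + ε * σ / 2 ≤ ε * σ := by
  have hεσ : 0 < ε * σ := by positivity
  set x := M / (ε * σ) with hx
  have hx0 : 0 ≤ x := by positivity
  -- For this n the contraction is at most (2 + x)⁻², which reduces M = x εσ to at most εσ/2.
  have h1 : (1 - 1 / (2 * C₁)) ^ n ≤ Real.exp (-(2 * Real.log (2 + x))) := by
    calc (1 - 1 / (2 * C₁)) ^ n ≤ Real.exp (-(1 / (2 * C₁))) ^ n := by
          refine pow_le_pow_left₀ ?_ (Real.one_sub_le_exp_neg _) n
          have : 1 / (2 * C₁) ≤ 1 := by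
            rw [div_le_one (by positivity)]
            linarith
          linarith
      _ = Real.exp (-(n / (2 * C₁))) := by
          rw [← Real.exp_nat_mul]
          congr 1
          ring
      _ ≤ _ := by
          apply Real.exp_le_exp.mpr
          rw [neg_le_neg_iff, le_div_iff₀ (by positivity)]
          linarith
  have h2 : Real.exp (-(2 * Real.log (2 + x))) = 1 / (2 + x) ^ 2 := by
    rw [Real.exp_neg, mul_comm, Real.exp_mul, Real.exp_log (by positivity), one_div]
    norm_num
  have h3 : M = x * (ε * σ) := by rw [hx]; field_simp
  have h4 : 1 / (2 + x) ^ 2 * x ≤ 1 / 2 := by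
    rw [div_mul_eq_mul_div, div_le_div_iff₀ (by positivity) (by norm_num)]
    nlinarith
  calc (1 - 1 / (2 * C₁)) ^ n * M + ε * σ / 2 ≤ 1 / (2 + x) ^ 2 * M + ε * σ / 2 := by
        gcongr
        exact h1.trans h2.le
    _ = (1 / (2 + x) ^ 2 * x) * (ε * σ) + ε * σ / 2 := by rw [h3]; ring
    _ ≤ 1 / 2 * (ε * σ) + ε * σ / 2 := by gcongr
    _ = _ := by ring

end Rounds

/-! ### The joint law of the samples -/

section DataLaw

variable {d k : ℕ} {L : Layout}

/-- The indices of the samples. -/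
abbrev Index (L : Layout) : Type :=
  (Σ b : Fin L.numSmall, Fin (L.smallSize b)) ⊕ (Σ b : Fin L.numMedium, Fin (L.mediumSize b)) ⊕
    Fin L.starSize

/-- The sample with a given index. -/
def coord : Index L → Data d L → Sample d
  | .inl p, X => X.1 p.1 p.2
  | .inr (.inl p), X => X.2.1 p.1 p.2
  | .inr (.inr q), X => X.2.2 q

/-- The component from which a sample is drawn. -/
def source (smallSource : Fin L.numSmall → Fin k) (mediumSource : Fin L.numMedium → Fin k)
    (i₀ : Fin k) : Index L → Fin k
  | .inl p => smallSource p.1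
  | .inr (.inl p) => mediumSource p.1
  | .inr (.inr _) => i₀

theorem measurable_coord (j : Index L) : Measurable (coord (d := d) j) := by
  rcases j with p | p | q
  · exact (measurable_pi_apply p.2).comp ((measurable_pi_apply p.1).comp measurable_fst)
  · exact (measurable_pi_apply p.2).comp
      ((measurable_pi_apply p.1).comp (measurable_fst.comp measurable_snd))
  · exact (measurable_pi_apply q).comp (measurable_snd.comp measurable_snd)

variable (D : Fin k → ProbabilityMeasure (Sample d)) (smallSource : Fin L.numSmall → Fin k)
  (mediumSource : Fin L.numMedium → Fin k) (i₀ : Fin k)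

instance : IsProbabilityMeasure (dataLaw L D smallSource mediumSource i₀) := by
  unfold dataLaw
  infer_instance

/-- A product measure is determined by its values on boxes, and on a box both sides are the same
product over all samples. The joint law thus becomes a product over a single index set. -/
theorem map_coord_dataLaw : (dataLaw L D smallSource mediumSource i₀).map (fun X j => coord j X) =
    Measure.pi fun j => (D (source smallSource mediumSource i₀ j) : Measure (Sample d)) := by
  refine (Measure.pi_eq fun s hs => ?_).symm
  rw [Measure.map_apply (measurable_pi_lambda _ measurable_coord) (MeasurableSet.univ_pi hs)]
  have : (fun (X : Data d L) j => coord j X) ⁻¹' Set.univ.pi s =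
      (Set.univ.pi fun b => Set.univ.pi fun q => s (.inl ⟨b, q⟩)) ×ˢ
        ((Set.univ.pi fun b => Set.univ.pi fun q => s (.inr (.inl ⟨b, q⟩))) ×ˢ
          Set.univ.pi fun q => s (.inr (.inr q))) := by
    ext X
    simp only [Set.mem_preimage, Set.mem_univ_pi, Set.mem_prod, Sum.forall, Sigma.forall]
    rfl
  rw [this]
  unfold dataLaw
  simp only [Measure.prod_prod, Measure.pi_pi, Fintype.prod_sum_type, Fintype.prod_sigma]
  rfl

theorem map_coord_apply (j : Index L) : (dataLaw L D smallSource mediumSource i₀).map (coord j) =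
    (D (source smallSource mediumSource i₀ j) : Measure (Sample d)) := by
  rw [← (measurePreserving_eval
    (fun j => (D (source smallSource mediumSource i₀ j) : Measure (Sample d))) j).map_eq,
    ← map_coord_dataLaw, Measure.map_map (measurable_pi_apply j)
      (measurable_pi_lambda _ measurable_coord)]
  rfl

theorem iIndepFun_coord : iIndepFun (fun j => coord (d := d) (L := L) j)
    (dataLaw L D smallSource mediumSource i₀) := by
  rw [iIndepFun_iff_map_fun_eq_pi_map fun j => (measurable_coord j).aemeasurable]
  simp only [map_coord_apply]
  exact map_coord_dataLaw D smallSource mediumSource i₀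

end DataLaw

/-! ### The rounds of the algorithm -/

section Arrangement

variable {d k : ℕ} {L : Layout}

/-- The indices of the samples of the small batches in the order given by the seed. -/
def smallIndex (s : Seed L) : Coll (Coll (Index L)) :=
  ⟨L.numSmall, fun i => ⟨L.smallSize (s.1 i), fun j => .inl ⟨s.1 i, s.2.2.2.1 (s.1 i) j⟩⟩⟩

/-- The indices of the samples of the medium batches in the order given by the seed. -/
def mediumIndex (s : Seed L) : Coll (Coll (Index L)) :=
  ⟨L.numMedium, fun i =>
    ⟨L.mediumSize (s.2.1 i), fun j => .inr (.inl ⟨s.2.1 i, s.2.2.2.2 (s.2.1 i) j⟩)⟩⟩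

/-- The indices of the samples of the additional batch in the order given by the seed. -/
def starIndex (s : Seed L) : Coll (Index L) := ⟨L.starSize, fun j => .inr (.inr (s.2.2.1 j))⟩

/-- Every division commutes with the lookup of samples, so after erasing the step count the
algorithm is an iteration of `roundStep` on index collections that the seed determines. -/
theorem mainAlgorithm_val (K : Constants) (svd : SingularVectorRoutine d) (p : Params)
    (X : Data d L) (s : Seed L) {R : ℕ} {δ' : ℝ} (hR : R = numRounds K p)
    (hδ' : δ' = p.δ / (5 * R)) :
    (mainAlgorithm K svd p X s).val = iterateFin R (fun r w => roundStep svd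
      ((starIndex s).part (R + R) (Fin.castAdd R r)) ((smallIndex s).part R r)
      ((mediumIndex s).part R r) ((starIndex s).part (R + R) (Fin.natAdd R r))
      ⌈K.cT * Real.log (1 / δ')⌉₊ ⌈K.cT₁ * Real.log ((L.numMedium / R : ℕ) / δ')⌉₊
      ⌈K.cT₂ * Real.log (1 / δ')⌉₊ (min p.k ⌈1 / (2 * p.αs * accuracy K p ^ 2)⌉₊) K.ε₁
      (accuracy K p) p.σ p.C p.C₁ (fun j => coord j X) w) 0 := by
  unfold mainAlgorithm
  rw [← hR]
  generalize accuracy K p = ε₂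
  simp only [Timed.val_bind, val_charge, val_divide, ← hδ', val_loop]
  refine congrArg (fun f => iterateFin R f 0) ?_
  funext r w
  have hs : Coll.part ⟨L.numSmall, fun i => ⟨L.smallSize (s.1 i), fun j =>
      X.1 (s.1 i) (s.2.2.2.1 (s.1 i) j)⟩⟩ R r =
      ((smallIndex s).part R r).map (Coll.map fun j => coord j X) := rfl
  have hm : Coll.part ⟨L.numMedium, fun i => ⟨L.mediumSize (s.2.1 i), fun j =>
      X.2.1 (s.2.1 i) (s.2.2.2.2 (s.2.1 i) j)⟩⟩ R r =
      ((mediumIndex s).part R r).map (Coll.map fun j => coord j X) := rfl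
  have ht : ∀ a, Coll.part ⟨L.starSize, fun j => X.2.2 (s.2.2.1 j)⟩ (R + R)
      a = ((starIndex s).part (R + R) a).map (fun j => coord j X) :=
    fun _ => rfl
  rw [hs, hm, ht, ht, clipEst_val, gradSubEst_val, gradEst_val]
  rfl

theorem Coll.supports_part_subset {J : Type} (B : Coll (Coll J)) (m : ℕ) (j : Fin m) :
    (B.part m j).supports ⊆ B.supports :=
  Set.iUnion_subset fun b => B.support_subset_supports ⟨j * (B.len / m) + b, _⟩

theorem Coll.disjoint_supports_part {J : Type} {B : Coll (Coll J)}
    (h : Pairwise fun b b' => Disjoint (B.get b).support (B.get b').support) {m : ℕ} {j j' : Fin m}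
    (hj : j ≠ j') : Disjoint (B.part m j).supports (B.part m j').supports :=
  Set.disjoint_iUnion_left.mpr fun b => Set.disjoint_iUnion_right.mpr fun b' =>
    h fun e => Coll.part_index_ne hj b b' (congrArg Fin.val e)

/-! ### Parts of a collection of batches. -/

section Parts

variable {Ω : Type*} [mΩ : MeasurableSpace Ω] {μ : Measure Ω} {J : Type}
  {Z : J → Ω → Sample d} {D : Fin k → Measure (Sample d)}

theorem IsBatches.part {B : Coll (Coll J)} {src : Fin B.len → Fin k} (h : IsBatches μ Z D B src)
    (m : ℕ) (j : Fin m) :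
    IsBatches μ Z D (B.part m j) (Coll.part ⟨B.len, src⟩ m j).get where
  sample b := h.sample _
  disjoint b b' hb := h.disjoint fun e => hb (Fin.ext (by
    have := congrArg Fin.val e
    simp only at this
    omega))

end Parts

theorem supports_smallIndex_subset (s : Seed L) :
    (smallIndex s).supports ⊆ Set.range Sum.inl := by
  refine Set.iUnion_subset fun b => ?_
  rintro _ ⟨q, rfl⟩
  exact ⟨_, rfl⟩

theorem supports_mediumIndex_subset (s : Seed L) :
    (mediumIndex s).supports ⊆ Set.range (Sum.inr ∘ Sum.inl) := by
  refine Set.iUnion_subset fun b => ?_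
  rintro _ ⟨q, rfl⟩
  exact ⟨_, rfl⟩

theorem support_starIndex_subset (s : Seed L) :
    (starIndex s).support ⊆ Set.range (Sum.inr ∘ Sum.inr) := by
  rintro _ ⟨q, rfl⟩
  exact ⟨_, rfl⟩

theorem disjoint_smallIndex_mediumIndex (s : Seed L) :
    Disjoint (smallIndex s).supports (mediumIndex s).supports :=
  Set.disjoint_of_subset (supports_smallIndex_subset s) (supports_mediumIndex_subset s)
    (Set.disjoint_left.mpr (by rintro _ ⟨a, rfl⟩ ⟨b, hb⟩; simp at hb))

theorem disjoint_smallIndex_starIndex (s : Seed L) :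
    Disjoint (smallIndex s).supports (starIndex s).support :=
  Set.disjoint_of_subset (supports_smallIndex_subset s) (support_starIndex_subset s)
    (Set.disjoint_left.mpr (by rintro _ ⟨a, rfl⟩ ⟨b, hb⟩; simp at hb))

theorem disjoint_mediumIndex_starIndex (s : Seed L) :
    Disjoint (mediumIndex s).supports (starIndex s).support :=
  Set.disjoint_of_subset (supports_mediumIndex_subset s) (support_starIndex_subset s)
    (Set.disjoint_left.mpr (by rintro _ ⟨a, rfl⟩ ⟨b, hb⟩; simp at hb))

theorem injective_starIndex (s : Seed L) : Function.Injective (starIndex s).get := by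
  intro q q' h
  exact (s.2.2.1).injective (Sum.inr_injective (Sum.inr_injective h))

theorem pairwise_disjoint_smallIndex (s : Seed L) : Pairwise fun b b' =>
    Disjoint ((smallIndex s).get b).support ((smallIndex s).get b').support := by
  intro b b' hb
  rw [Set.disjoint_left]
  rintro _ ⟨q, rfl⟩ ⟨q', h⟩
  exact hb (s.1.injective (congrArg Sigma.fst (Sum.inl_injective h))).symm

theorem pairwise_disjoint_mediumIndex (s : Seed L) : Pairwise fun b b' =>
    Disjoint ((mediumIndex s).get b).support ((mediumIndex s).get b').support := by
  intro b b' hb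
  rw [Set.disjoint_left]
  rintro _ ⟨q, rfl⟩ ⟨q', h⟩
  exact hb (s.2.1.injective (congrArg Sigma.fst (Sum.inl_injective (Sum.inr_injective h)))).symm

variable (D : Fin k → ProbabilityMeasure (Sample d)) (smallSource : Fin L.numSmall → Fin k)
  (mediumSource : Fin L.numMedium → Fin k) (i₀ : Fin k)

theorem isBatches_smallIndex (s : Seed L) :
    IsBatches (dataLaw L D smallSource mediumSource i₀) (fun j => coord (d := d) j)
      (fun i => (D i : Measure (Sample d))) (smallIndex s) fun b => smallSource (s.1 b) where
  sample b := by
    refine ⟨fun q q' h => ?_, fun q => map_coord_apply D smallSource mediumSource i₀ _⟩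
    exact (s.2.2.2.1 (s.1 b)).injective (by simpa [smallIndex] using h)
  disjoint := pairwise_disjoint_smallIndex s

theorem isBatches_mediumIndex (s : Seed L) :
    IsBatches (dataLaw L D smallSource mediumSource i₀) (fun j => coord (d := d) j)
      (fun i => (D i : Measure (Sample d))) (mediumIndex s) fun b => mediumSource (s.2.1 b) where
  sample b := by
    refine ⟨fun q q' h => ?_, fun q => map_coord_apply D smallSource mediumSource i₀ _⟩
    exact (s.2.2.2.2 (s.2.1 b)).injective (by simpa [mediumIndex] using h)
  disjoint := pairwise_disjoint_mediumIndex s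

theorem isSampleOf_starIndex (s : Seed L) :
    IsSampleOf (dataLaw L D smallSource mediumSource i₀) (fun j => coord (d := d) j) (starIndex s)
      (D i₀ : Measure (Sample d)) :=
  ⟨injective_starIndex s, fun _ => map_coord_apply D smallSource mediumSource i₀ _⟩

/-- The sources of the small batches of round `r`. -/
def smallSourcePart (s : Seed L) (R : ℕ) (r : Fin R) : Fin ((smallIndex s).part R r).len → Fin k :=
  (Coll.part ⟨L.numSmall, fun b => smallSource (s.1 b)⟩ R r).get

/-- The sources of the medium batches of round `r`. -/
def mediumSourcePart (s : Seed L) (R : ℕ) (r : Fin R) :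
    Fin ((mediumIndex s).part R r).len → Fin k :=
  (Coll.part ⟨L.numMedium, fun b => mediumSource (s.2.1 b)⟩ R r).get

theorem isRound_part (s : Seed L) (R : ℕ) (r : Fin R) :
    IsRound (dataLaw L D smallSource mediumSource i₀) (fun j => coord (d := d) j)
      (fun i => (D i : Measure (Sample d))) i₀ ((starIndex s).part (R + R) (Fin.castAdd R r))
      ((smallIndex s).part R r) ((mediumIndex s).part R r)
      ((starIndex s).part (R + R) (Fin.natAdd R r)) (smallSourcePart smallSource s R r)
      (mediumSourcePart mediumSource s R r) where
  star₁ := (isSampleOf_starIndex D smallSource mediumSource i₀ s).part _ _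
  small := (isBatches_smallIndex D smallSource mediumSource i₀ s).part R r
  medium := (isBatches_mediumIndex D smallSource mediumSource i₀ s).part R r
  star₂ := (isSampleOf_starIndex D smallSource mediumSource i₀ s).part _ _
  disjoint_star₁_small := (disjoint_smallIndex_starIndex s).symm.mono
    ((starIndex s).support_part_subset _ _) ((smallIndex s).supports_part_subset _ _)
  disjoint_star₁_medium := (disjoint_mediumIndex_starIndex s).symm.mono
    ((starIndex s).support_part_subset _ _) ((mediumIndex s).supports_part_subset _ _)
  disjoint_star₁_star₂ := Coll.disjoint_support_part (injective_starIndex s) (by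
    intro e
    have := congrArg Fin.val e
    simp only [Fin.val_castAdd, Fin.val_natAdd] at this
    omega)
  disjoint_small_medium := (disjoint_smallIndex_mediumIndex s).mono
    ((smallIndex s).supports_part_subset _ _) ((mediumIndex s).supports_part_subset _ _)
  disjoint_small_star₂ := (disjoint_smallIndex_starIndex s).mono
    ((smallIndex s).supports_part_subset _ _) ((starIndex s).support_part_subset _ _)
  disjoint_medium_star₂ := (disjoint_mediumIndex_starIndex s).mono
    ((mediumIndex s).supports_part_subset _ _) ((starIndex s).support_part_subset _ _)

theorem disjoint_roundIndices_part (s : Seed L) (R : ℕ) {r r' : Fin R} (h : r ≠ r') :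
    Disjoint
      (roundIndices ((starIndex s).part (R + R) (Fin.castAdd R r)) ((smallIndex s).part R r)
        ((mediumIndex s).part R r) ((starIndex s).part (R + R) (Fin.natAdd R r)))
      (roundIndices ((starIndex s).part (R + R) (Fin.castAdd R r')) ((smallIndex s).part R r')
        ((mediumIndex s).part R r') ((starIndex s).part (R + R) (Fin.natAdd R r'))) := by
  have hs := fun a => (smallIndex s).supports_part_subset R a
  have hm := fun a => (mediumIndex s).supports_part_subset R a
  have ht := fun a => (starIndex s).support_part_subset (R + R) a
  have hv : (r : ℕ) ≠ r' := fun e => h (Fin.ext e)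
  have hstar : ∀ a b : Fin (R + R), (a : ℕ) ≠ b →
      Disjoint ((starIndex s).part (R + R) a).support ((starIndex s).part (R + R) b).support :=
    fun a b hab => Coll.disjoint_support_part (injective_starIndex s)
      fun e => hab (congrArg Fin.val e)
  have h1 := r.2
  have h2 := r'.2
  simp only [roundIndices, Set.disjoint_union_left, Set.disjoint_union_right]
  have hsm := disjoint_smallIndex_mediumIndex s
  have hst := disjoint_smallIndex_starIndex s
  have hmt := disjoint_mediumIndex_starIndex s
  refine ⟨⟨⟨⟨?_, ?_⟩, ?_, ?_⟩, ⟨?_, ?_⟩, ?_, ?_⟩, ⟨⟨?_, ?_⟩, ?_, ?_⟩, ⟨?_, ?_⟩, ?_, ?_⟩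
  all_goals first
    | exact hst.mono (hs _) (ht _)
    | exact hst.symm.mono (ht _) (hs _)
    | exact hmt.mono (hm _) (ht _)
    | exact hmt.symm.mono (ht _) (hm _)
    | exact hsm.mono (hs _) (hm _)
    | exact hsm.symm.mono (hm _) (hs _)
    | exact Coll.disjoint_supports_part (pairwise_disjoint_smallIndex s) h
    | exact Coll.disjoint_supports_part (pairwise_disjoint_mediumIndex s) h
    | exact hstar _ _ (by simp only [Fin.val_castAdd, Fin.val_natAdd]; omega)

end Arrangement

/-! ### The internal randomness -/

section Seeds

variable {d k : ℕ} {L : Layout}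

/-- Most permutations put a good share of the objects with source `i₀` into a given block. -/
theorem card_perms_part_lt_le {n : ℕ} (src : Fin n → Fin k) (i₀ : Fin k) {α : ℝ} (hα : 0 ≤ α)
    (hn : 0 < n) (h : α * n ≤ (Finset.univ.filter fun b => src b = i₀).card) (R : ℕ) (r : Fin R) :
    ((Finset.univ.filter fun s : Equiv.Perm (Fin n) =>
      ((Finset.univ.filter fun b => (Coll.part ⟨n, fun b => src (s b)⟩ R r).get b = i₀).card : ℝ) <
        α / 2 * (n / R : ℕ)).card : ℝ) ≤
      Real.exp (-(3 / 20 * α * (n / R : ℕ))) * Fintype.card (Equiv.Perm (Fin n)) := by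
  rw [Fintype.card_perm, Fintype.card_fin]
  exact card_perms_few_hits_le (Coll.part ⟨n, id⟩ R r).get
    (Coll.get_part_injective Function.injective_id R r) (fun b => src b = i₀) α hα hn h

theorem card_seed_fst (P : Equiv.Perm (Fin L.numSmall) → Prop) [DecidablePred P] {a : ℝ}
    (h : ((Finset.univ.filter P).card : ℝ) ≤ a * Fintype.card (Equiv.Perm (Fin L.numSmall))) :
    ((Finset.univ.filter fun s : Seed L => P s.1).card : ℝ) ≤ a * Fintype.card (Seed L) := by
  have e : (Finset.univ.filter fun s : Seed L => P s.1) = (Finset.univ.filter P) ×ˢ Finset.univ := by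
    ext s
    simp
  rw [e, Finset.card_product, Fintype.card_prod]
  push_cast
  rw [← mul_assoc, Finset.card_univ]
  gcongr

theorem card_seed_snd (P : Equiv.Perm (Fin L.numMedium) → Prop) [DecidablePred P] {a : ℝ}
    (h : ((Finset.univ.filter P).card : ℝ) ≤ a * Fintype.card (Equiv.Perm (Fin L.numMedium))) :
    ((Finset.univ.filter fun s : Seed L => P s.2.1).card : ℝ) ≤ a * Fintype.card (Seed L) := by
  have e : (Finset.univ.filter fun s : Seed L => P s.2.1) =
      Finset.univ ×ˢ ((Finset.univ.filter P) ×ˢ Finset.univ) := by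
    ext s
    simp
  rw [e, Finset.card_product, Finset.card_product, Fintype.card_prod, Fintype.card_prod]
  push_cast
  rw [Finset.card_univ, Finset.card_univ, mul_left_comm a, ← mul_assoc a]
  gcongr

/-- The seed gives each round a good share of the small and medium batches with source `i₀`. -/
def IsGoodSeed (smallSource : Fin L.numSmall → Fin k) (mediumSource : Fin L.numMedium → Fin k)
    (i₀ : Fin k) (αs αm : ℝ) (R : ℕ) (s : Seed L) : Prop :=
  ∀ r, αs / 2 * (L.numSmall / R : ℕ) ≤
      (Finset.univ.filter fun b => smallSourcePart smallSource s R r b = i₀).card ∧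
    αm / 2 * (L.numMedium / R : ℕ) ≤
      (Finset.univ.filter fun b => mediumSourcePart mediumSource s R r b = i₀).card

open Classical in
theorem card_not_isGoodSeed_le {smallSource : Fin L.numSmall → Fin k}
    {mediumSource : Fin L.numMedium → Fin k} {i₀ : Fin k} {αs αm : ℝ} (hαs : 0 ≤ αs) (hαm : 0 ≤ αm)
    (hs0 : 0 < L.numSmall) (hm0 : 0 < L.numMedium)
    (hs : αs * L.numSmall ≤ (Finset.univ.filter fun b => smallSource b = i₀).card)
    (hm : αm * L.numMedium ≤ (Finset.univ.filter fun b => mediumSource b = i₀).card) (R : ℕ) :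
    ((Finset.univ.filter fun s : Seed L =>
      ¬ IsGoodSeed smallSource mediumSource i₀ αs αm R s).card : ℝ) ≤
      R * (Real.exp (-(3 / 20 * αs * (L.numSmall / R : ℕ))) +
        Real.exp (-(3 / 20 * αm * (L.numMedium / R : ℕ)))) * Fintype.card (Seed L) := by
  have h1 := fun r => card_seed_fst (L := L) _
    (card_perms_part_lt_le smallSource i₀ hαs hs0 hs R r)
  have h2 := fun r => card_seed_snd (L := L) _
    (card_perms_part_lt_le mediumSource i₀ hαm hm0 hm R r)
  have hsub : (Finset.univ.filter fun s : Seed L =>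
      ¬ IsGoodSeed smallSource mediumSource i₀ αs αm R s) ⊆ Finset.univ.biUnion fun r : Fin R =>
      (Finset.univ.filter fun s : Seed L => ((Finset.univ.filter fun b =>
        (Coll.part ⟨L.numSmall, fun b => smallSource (s.1 b)⟩ R r).get b = i₀).card : ℝ) <
        αs / 2 * (L.numSmall / R : ℕ)) ∪
      (Finset.univ.filter fun s : Seed L => ((Finset.univ.filter fun b =>
        (Coll.part ⟨L.numMedium, fun b => mediumSource (s.2.1 b)⟩ R r).get b = i₀).card : ℝ) <
        αm / 2 * (L.numMedium / R : ℕ)) := by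
    intro s hs
    simp only [IsGoodSeed, not_forall, not_and_or, not_le, Finset.mem_filter, Finset.mem_univ,
      true_and] at hs
    obtain ⟨r, hr⟩ := hs
    simp only [Finset.mem_biUnion, Finset.mem_union, Finset.mem_filter, Finset.mem_univ, true_and]
    exact ⟨r, hr⟩
  calc _ ≤ ((Finset.univ.biUnion _).card : ℝ) := by exact_mod_cast Finset.card_le_card hsub
    _ ≤ ∑ r : Fin R, (Real.exp (-(3 / 20 * αs * (L.numSmall / R : ℕ))) * Fintype.card (Seed L) +
        Real.exp (-(3 / 20 * αm * (L.numMedium / R : ℕ))) * Fintype.card (Seed L)) := by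
      refine (Nat.cast_le.mpr Finset.card_biUnion_le).trans ?_
      push_cast
      refine Finset.sum_le_sum fun r _ => ?_
      refine (Nat.cast_le.mpr (Finset.card_union_le _ _)).trans ?_
      push_cast
      exact add_le_add (h1 r) (h2 r)
    _ = _ := by
      rw [Finset.sum_const, Finset.card_univ, Fintype.card_fin, nsmul_eq_mul]
      ring

open Classical in
-- The probability is an average over the seeds. Bad seeds are given up entirely; for a good one the
-- arrangement is fixed and only the samples are random.
theorem le_probability {D : Fin k → ProbabilityMeasure (Sample d)}
    {smallSource : Fin L.numSmall → Fin k} {mediumSource : Fin L.numMedium → Fin k} {i₀ : Fin k}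
    {event : Data d L → Seed L → Prop} {good : Seed L → Prop} {a b : ℝ} (hb : 0 ≤ b)
    (hbad : ((Finset.univ.filter fun s => ¬ good s).card : ℝ) ≤ a * Fintype.card (Seed L))
    (hgood : ∀ s, good s →
      (dataLaw L D smallSource mediumSource i₀).real {X | ¬ event X s} ≤ b) :
    1 - (a + b) ≤ probability L D smallSource mediumSource i₀ event := by
  have hcard : (0 : ℝ) < Fintype.card (Seed L) := by exact_mod_cast Fintype.card_pos
  rw [probability, le_div_iff₀ hcard]
  have key : ∀ s, 1 - b - (if ¬ good s then 1 else 0) ≤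
      (dataLaw L D smallSource mediumSource i₀).real {X | event X s} := by
    intro s
    by_cases hs : good s
    · have h1 := measureReal_union_le (μ := dataLaw L D smallSource mediumSource i₀)
        {X | event X s} {X | ¬ event X s}
      have h2 : {X | event X s} ∪ {X | ¬ event X s} = Set.univ := by
        ext X
        simp [_root_.em]
      rw [h2, probReal_univ] at h1
      have := hgood s hs
      simp only [hs, not_true, if_false]
      linarith
    · simp only [hs, not_false_iff, if_true]
      have := measureReal_nonneg (μ := dataLaw L D smallSource mediumSource i₀)
        (s := {X | event X s})
      linarith
  calc (1 - (a + b)) * Fintype.card (Seed L)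
      ≤ (1 - b) * Fintype.card (Seed L) - ((Finset.univ.filter fun s => ¬ good s).card : ℝ) := by
        linarith
    _ = ∑ s : Seed L, (1 - b - (if ¬ good s then 1 else 0)) := by
        rw [Finset.sum_sub_distrib, Finset.sum_const, Finset.card_univ, nsmul_eq_mul,
          Finset.sum_boole]
        ring
    _ ≤ _ := Finset.sum_le_sum fun s _ => key s

end Seeds

/-! ### Accuracy for sufficiently large sizes -/

/-- The constants of the algorithm. -/
def algorithmConstants : Constants where
  cR := 4
  ε₁ := 1 / 4
  cε₂ := 1 / 4000
  cT := 12
  cT₁ := 12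
  cT₂ := 12
  cR_pos := by norm_num
  ε₁_pos := by norm_num
  cε₂_pos := by norm_num
  cT_pos := by norm_num
  cT₁_pos := by norm_num
  cT₂_pos := by norm_num

section Accuracy

variable {d k : ℕ} {L : Layout}

/-- For a unit vector u, 1 ≤ E(x·u)² ≤ C₁, and Jensen's inequality gives (E(x·u)²)² ≤ E(x·u)⁴. In
positive dimension the theorem is therefore vacuous for smaller constants. -/
theorem one_le_of_isRegressionComponent (hd : 0 < d) {D : Measure (Sample d)}
    [IsProbabilityMeasure D] {w₀ : Vec d} {C C₁ σ β : ℝ} (hD : IsRegressionComponent D w₀ C C₁ σ)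
    (h : BoundedInput D C₁ β) : 1 ≤ C ∧ 1 ≤ C₁ := by
  set u : Vec d := EuclideanSpace.single ⟨0, hd⟩ 1
  have hu : ‖u‖ = 1 := by simp [u]
  have h1 : 1 ≤ ∫ z, inner ℝ z.1 u ^ 2 ∂D := by
    have := integral_mul_inner_eq h u u
    simp only [← pow_two] at this
    rw [this, ← toEuclideanCLM_apply_eq]
    exact hD.one_le u hu
  refine ⟨?_, by simpa [hu] using h1.trans (h.integral_sq_le u)⟩
  have h2 : (∫ z, inner ℝ z.1 u ^ 2 ∂D) ^ 2 ≤ ∫ z, inner ℝ z.1 u ^ 4 ∂D := by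
    have hm : MemLp (fun z : Sample d => inner ℝ z.1 u ^ 2) 2 D := by
      rw [memLp_two_iff_integrable_sq ((measurable_inner_fst u).pow_const 2).aestronglyMeasurable]
      simpa only [← pow_mul] using h.integrable_inner_pow u 4
    simpa only [← pow_mul] using sq_integral_le hm
  have h3 := h2.trans (hD.hypercontractive u)
  have h4 : 0 < (∫ z, inner ℝ z.1 u ^ 2 ∂D) ^ 2 := by positivity
  nlinarith

/-- The sizes suffice for the desired accuracy. -/
structure SufficientSizes (L : Layout) (d k R T T₁ ℓ n₁ n₂ : ℕ) (C C₁ β αs αm ε₂ δ' : ℝ) :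
    Prop where
  star₁_pos : 0 < L.starSize / (R + R) / T
  star₁_le : 64 * C ≤ (L.starSize / (R + R) / T : ℕ)
  small_pos : 0 < L.numSmall / R
  two_le_small : ∀ b, 2 ≤ L.smallSize b
  rank : k ≤ ℓ ∨ 1 ≤ 2 * αs * ε₂ ^ 2 * (ℓ + 1)
  one_le_rank : 1 ≤ ℓ
  n₁_pos : 0 < n₁
  le_medium₁ : ∀ b, n₁ ≤ L.mediumSize b / 2 / (T₁ + T₁)
  le_star₂ : n₁ ≤ L.starSize / (R + R) / (T₁ + T₁)
  n₁_le : 2560 * Real.sqrt ℓ ≤ n₁ * ε₂ ^ 2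
  n₂_pos : 0 < n₂
  le_medium₂ : ∀ b, n₂ ≤ L.mediumSize b / 2 / T
  n₂_le : 8 * ℓ ≤ αm / 2 * (L.numMedium / R : ℕ) * n₂ * ε₂ ^ 2
  medium_pos : 0 < L.numMedium / R
  log_le_small : Real.log (2 * d / δ') ≤ (L.numSmall / R : ℕ) * (αs * ε₂ ^ 2) ^ 2 * C₁ /
    (4 * β ^ 2 * (4 + αs * ε₂ ^ 2))
  log_le_seed_small : Real.log (2 / δ') ≤ 3 / 20 * αs * (L.numSmall / R : ℕ)
  log_le_seed_medium : Real.log (2 / δ') ≤ 3 / 20 * αm * (L.numMedium / R : ℕ)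

theorem exp_neg_le_div {x y z : ℝ} (hx : 0 < x) (hy : 0 < y) (h : Real.log (x / y) ≤ z) :
    Real.exp (-z) ≤ y / x := by
  rw [← inv_div, ← Real.exp_log (inv_pos.mpr (div_pos hx hy)), Real.log_inv]
  exact Real.exp_le_exp.mpr (neg_le_neg h)

theorem exp_neg_div_three_le {y : ℝ} (hy : 0 < y) {n : ℕ}
    (h : 12 * Real.log (1 / y) ≤ n) : Real.exp (-(n / 3)) ≤ y ^ 4 := by
  rw [← Real.exp_log hy, ← Real.exp_nat_mul]
  rw [one_div, Real.log_inv] at h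
  apply Real.exp_le_exp.mpr
  push_cast
  linarith

/-- The failure probability is spent as follows: Rδ' for bad seeds and 4δ' for each of the R rounds,
in total 5Rδ' = δ. -/
theorem le_probability_of_sufficientSizes {D : Fin k → ProbabilityMeasure (Sample d)}
    {w : Fin k → Vec d} {smallSource : Fin L.numSmall → Fin k}
    {mediumSource : Fin L.numMedium → Fin k} {i₀ : Fin k} {C C₁ β αs αm σ M ε δ : ℝ}
    {n₁ n₂ R : ℕ} {δ' ε₂ : ℝ}
    (hd : 0 < d) (hβ : 0 < β) (hαs : 0 < αs) (hαm : 0 < αm) (hσ : 0 < σ) (hε : 0 < ε) (hδ : 0 < δ)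
    (hδ1 : δ ≤ 1)
    (hbdd : ∀ i, BoundedInput (D i : Measure (Sample d)) C₁ β)
    (hrec : i₀ ∈ recoverable L D smallSource mediumSource w C C₁ σ αs αm) (hM : ‖w i₀‖ ≤ M)
    (hR : R = numRounds algorithmConstants ⟨k, αs, C, C₁, σ, M, ε, δ⟩)
    (hδ' : δ' = δ / (5 * R))
    (hε₂ : ε₂ = accuracy algorithmConstants ⟨k, αs, C, C₁, σ, M, ε, δ⟩)
    (h : SufficientSizes L d k R ⌈12 * Real.log (1 / δ')⌉₊
      ⌈12 * Real.log ((L.numMedium / R : ℕ) / δ')⌉₊ (min k ⌈1 / (2 * αs * ε₂ ^ 2)⌉₊) n₁ n₂ C C₁ β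
      αs αm ε₂ δ') (svd : SingularVectorRoutine d) :
    1 - δ ≤ probability L D smallSource mediumSource i₀ fun X s =>
      ‖(mainAlgorithm algorithmConstants svd ⟨k, αs, C, C₁, σ, M, ε, δ⟩ X s).val - w i₀‖ ≤
        ε * σ := by
  obtain ⟨hs, hm, hD⟩ := hrec
  obtain ⟨hC, hC₁⟩ := one_le_of_isRegressionComponent hd hD (hbdd i₀)
  have hM0 : 0 ≤ M := (norm_nonneg _).trans hM
  have hR0 : 0 < R := by
    rw [Nat.pos_iff_ne_zero]
    rintro rfl
    exact absurd h.small_pos (by simp)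
  have hR0' : (0 : ℝ) < R := by exact_mod_cast hR0
  have hR1 : (1 : ℝ) ≤ R := by exact_mod_cast hR0
  have hδ0 : 0 < δ' := by rw [hδ']; positivity
  have hδ5 : δ' ≤ 1 / 5 := by
    rw [hδ', div_le_div_iff₀ (by positivity) (by norm_num)]
    nlinarith
  have hRδ : R * δ' = δ / 5 := by
    rw [hδ']
    field_simp
  have hnm : (0 : ℝ) < (L.numMedium / R : ℕ) := by exact_mod_cast h.medium_pos
  have hnm1 : (1 : ℝ) ≤ (L.numMedium / R : ℕ) := by exact_mod_cast h.medium_pos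
  have hd0 : (0 : ℝ) < d := by exact_mod_cast hd
  have hε₂0 : 0 < ε₂ := by
    have : 0 < min ε (1 / Real.sqrt C₁) := lt_min hε (by positivity)
    rw [hε₂, accuracy, algorithmConstants]
    positivity
  have hN : (R : ℝ) * (Real.exp (-(3 / 20 * αs * (L.numSmall / R : ℕ))) +
      Real.exp (-(3 / 20 * αm * (L.numMedium / R : ℕ)))) ≤ R * δ' := by
    have h1 := exp_neg_le_div two_pos hδ0 h.log_le_seed_small
    have h2 := exp_neg_le_div two_pos hδ0 h.log_le_seed_medium
    gcongr
    linarith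
  classical
  have hbad := card_not_isGoodSeed_le (L := L) hαs.le hαm.le
    (h.small_pos.trans_le (Nat.div_le_self _ _)) (h.medium_pos.trans_le (Nat.div_le_self _ _)) hs hm R
  have hδe : δ = R * δ' + R * (4 * δ') := by linarith
  refine (sub_le_sub_left hδe.ge 1).trans ?_
  refine le_probability (by positivity) (hbad.trans (mul_le_mul_of_nonneg_right hN (by positivity)))
    fun s hgood => ?_
  -- The factor 12 makes a median fail with probability of order δ'⁴. In `T₁` the logarithm also
  -- contains the number of batches, for the union bound over the scores.
  have hT : Real.exp (-((⌈12 * Real.log (1 / δ')⌉₊ : ℝ) / 3)) ≤ δ' ^ 4 :=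
    exp_neg_div_three_le hδ0 (Nat.le_ceil _)
  have hT₁ : Real.exp (-((⌈12 * Real.log ((L.numMedium / R : ℕ) / δ')⌉₊ : ℝ) / 3)) ≤
      (δ' / (L.numMedium / R : ℕ)) ^ 4 := by
    refine exp_neg_div_three_le (by positivity) ?_
    rw [one_div_div]
    exact Nat.le_ceil _
  have hδ4 : δ' ^ 4 ≤ δ' / 125 := by
    have : δ' ^ 3 ≤ (1 / 5) ^ 3 := pow_le_pow_left₀ hδ0.le hδ5 3
    nlinarith
  have hfail := measureReal_norm_iterateFin_sub_le (p := 4 * δ')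
    (fun j => measurable_coord (L := L) (d := d) j)
    (iIndepFun_coord D smallSource mediumSource i₀) hβ (by linarith) hC₁ hσ hε hbdd hM hD
    (T := ⌈12 * Real.log (1 / δ')⌉₊) (T₂ := ⌈12 * Real.log (1 / δ')⌉₊) hε₂ hαs
    (show 0 < αm / 2 * (L.numMedium / R : ℕ) by positivity)
    (fun r => isRound_part D smallSource mediumSource i₀ s R r)
    (fun r r' hr => disjoint_roundIndices_part s R hr)
    (fun r => {
      star₁_pos := h.star₁_pos
      star₁_le := h.star₁_le
      small_pos := h.small_pos
      two_le_small := fun b => h.two_le_small _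
      small_good := (hgood r).1
      rank := h.rank
      one_le_rank := h.one_le_rank
      n₁_pos := h.n₁_pos
      le_medium₁ := fun b => h.le_medium₁ _
      le_star₂ := h.le_star₂
      n₁_le := h.n₁_le
      n₂_pos := h.n₂_pos
      le_medium₂ := fun b => h.le_medium₂ _
      n₂_le := h.n₂_le })
    (fun r => (hgood r).2) (fun r => ?_) svd
  · refine le_trans (measureReal_mono ?_) hfail
    intro X hX hle
    apply hX
    rw [mainAlgorithm_val _ svd _ X s hR hδ', ← hε₂]
    refine hle.trans (pow_mul_add_le hC₁ hM0 hε hσ ?_)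
    rw [hR]
    exact Nat.le_ceil _
  -- The four terms of a round are at most 2δ'⁴, δ', 2δ'⁴ and δ'⁴.
  · have h3 := exp_neg_le_div (by positivity) hδ0 h.log_le_small
    have e1 : (((smallIndex s).part R r).len : ℝ) = (L.numSmall / R : ℕ) := rfl
    have e2 : (((mediumIndex s).part R r).len : ℝ) = (L.numMedium / R : ℕ) := rfl
    rw [e1, e2]
    have h4 : (d : ℝ) * Real.exp (-((L.numSmall / R : ℕ) * (αs * ε₂ ^ 2) ^ 2 * C₁ /
        (4 * β ^ 2 * (4 + αs * ε₂ ^ 2)))) ≤ δ' / 2 := by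
      calc _ ≤ d * (δ' / (2 * d)) := by gcongr
        _ = _ := by field_simp
    have h5 : ((L.numMedium / R : ℕ) : ℝ) * (2 * Real.exp (-((⌈12 * Real.log ((L.numMedium / R : ℕ)
        / δ')⌉₊ : ℝ) / 3))) ≤ 2 * δ' ^ 4 := by
      calc _ ≤ ((L.numMedium / R : ℕ) : ℝ) * (2 * (δ' / (L.numMedium / R : ℕ)) ^ 4) := by gcongr
        _ = 2 * δ' ^ 4 * (1 / ((L.numMedium / R : ℕ) : ℝ) ^ 3) := by field_simp
        _ ≤ 2 * δ' ^ 4 * 1 := by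
          gcongr
          rw [div_le_one (by positivity)]
          exact one_le_pow₀ hnm1
        _ = _ := mul_one _
    linarith

end Accuracy

/-! ### The sizes in the statement suffice -/

section Sizes

/-- Rounding down costs at most a factor of 2 where the rounded quotient has to be at least 1. -/
theorem le_natDiv {a b : ℕ} {y : ℝ} (hb : 0 < b) (hy : 1 ≤ y) (h : 2 * y * b ≤ a) :
    y ≤ (a / b : ℕ) := by
  have h1 : (a : ℝ) < b * ((a / b : ℕ) + 1) := by exact_mod_cast Nat.lt_mul_div_succ a hb
  have hb' : (0 : ℝ) < b := by exact_mod_cast hb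
  have h2 : 2 * y < (a / b : ℕ) + 1 := by
    by_contra hn
    push Not at hn
    nlinarith
  linarith

variable {M σ ε δ : ℝ}

theorem logFactor_mono (hM : 0 ≤ M) (hσ : 0 < σ) (hε : 0 < ε) (hδ : 0 < δ) {x y : ℝ} (hx : 0 ≤ x)
    (h : x ≤ y) : logFactor x M σ ε δ ≤ logFactor y M σ ε δ := by
  unfold logFactor
  have : 0 ≤ M / (ε * σ) := by positivity
  gcongr

theorem one_le_logFactor (hM : 0 ≤ M) (hσ : 0 < σ) (hε : 0 < ε) (hδ : 0 < δ) (hδ1 : δ ≤ 1) {x : ℝ}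
    (hx : 1 ≤ x) : 1 ≤ logFactor x M σ ε δ := by
  have h0 : 0 ≤ M / (ε * σ) := by positivity
  have h1 : 1 ≤ x / δ := (one_le_div hδ).mpr (hδ1.trans hx)
  have h2 : 1 ≤ x / δ * (1 + M / (ε * σ)) := by nlinarith
  rw [logFactor, Real.le_log_iff_exp_le (by linarith)]
  linarith [Real.exp_one_lt_three]

theorem numRounds_le {p : Params} (hC₁ : 1 ≤ p.C₁) (hM : 0 ≤ p.M) (hσ : 0 < p.σ) (hε : 0 < p.ε)
    (hδ : 0 < p.δ) (hδ1 : p.δ ≤ 1) :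
    (numRounds algorithmConstants p : ℝ) ≤ 5 * p.C₁ * logFactor 1 p.M p.σ p.ε p.δ := by
  have h0 : 0 ≤ p.M / (p.ε * p.σ) := by positivity
  have h1 : Real.log (2 + p.M / (p.ε * p.σ)) ≤ logFactor 1 p.M p.σ p.ε p.δ := by
    unfold logFactor
    have : 1 ≤ 1 / p.δ := (one_le_div hδ).mpr hδ1
    refine Real.log_le_log (by positivity) ?_
    nlinarith
  have h2 := one_le_logFactor hM hσ hε hδ hδ1 le_rfl
  have h3 : 0 ≤ Real.log (2 + p.M / (p.ε * p.σ)) := Real.log_nonneg (by linarith)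
  unfold numRounds algorithmConstants
  refine (Nat.ceil_lt_add_one (by positivity)).le.trans ?_
  nlinarith

theorem numRounds_pos {p : Params} (hC₁ : 1 ≤ p.C₁) (hM : 0 ≤ p.M) (hσ : 0 < p.σ) (hε : 0 < p.ε) :
    0 < numRounds algorithmConstants p := by
  have h0 : 0 ≤ p.M / (p.ε * p.σ) := by positivity
  have := Real.log_pos (by linarith : 1 < 2 + p.M / (p.ε * p.σ))
  unfold numRounds algorithmConstants
  exact Nat.ceil_pos.mpr (by positivity)

/-- The crude bound log y ≤ y for y = 5aR is harmless, because R itself is only logarithmic in the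
parameters. -/
theorem log_mul_div_le (hM : 0 ≤ M) (hσ : 0 < σ) (hε : 0 < ε) (hδ : 0 < δ) {x a R : ℝ}
    (hx : 0 < x) (ha : 0 < a) (hR : 0 < R) :
    Real.log (a * x / (δ / (5 * R))) ≤ logFactor x M σ ε δ + 5 * a * R := by
  have h0 : 0 ≤ M / (ε * σ) := by positivity
  have e : a * x / (δ / (5 * R)) = x / δ * (5 * a * R) := by field_simp
  rw [e, Real.log_mul (by positivity) (by positivity)]
  have h1 : Real.log (x / δ) ≤ logFactor x M σ ε δ := by
    have : 0 < x / δ := by positivity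
    exact Real.log_le_log this (by nlinarith)
  linarith [Real.log_le_self (by positivity : 0 ≤ 5 * a * R)]

theorem accuracy_le {k : ℕ} {αs C C₁ : ℝ} (hC : 0 ≤ C) (hC₁ : 1 ≤ C₁) (hε1 : ε ≤ 1) :
    accuracy algorithmConstants ⟨k, αs, C, C₁, σ, M, ε, δ⟩ ≤ 1 := by
  have h1 : 1 ≤ Real.sqrt (C + 1) := Real.one_le_sqrt.mpr (by linarith)
  have h2 : 1 ≤ C₁ * Real.sqrt (C + 1) := by nlinarith
  have h3 : min ε (1 / Real.sqrt C₁) ≤ 1 := (min_le_left _ _).trans hε1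
  unfold accuracy algorithmConstants
  rw [div_le_one (by linarith)]
  simp only
  linarith

/-- The numbers ε and 1/√C₁ are at most 1, so their product is below their minimum. Thus ε₂ is at
least ε times a constant that depends on C and C₁ only. -/
theorem le_accuracy {k : ℕ} {αs C C₁ : ℝ} (hC : 0 ≤ C) (hC₁ : 1 ≤ C₁) (hε1 : ε ≤ 1) (hε : 0 < ε) :
    1 / 4000 * (1 / Real.sqrt C₁) / (C₁ * Real.sqrt (C + 1)) * ε ≤
      accuracy algorithmConstants ⟨k, αs, C, C₁, σ, M, ε, δ⟩ := by
  have h1 : 1 ≤ Real.sqrt C₁ := Real.one_le_sqrt.mpr hC₁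
  have h3 : 1 / Real.sqrt C₁ * ε ≤ min ε (1 / Real.sqrt C₁) := by
    have h4 : 1 / Real.sqrt C₁ ≤ 1 := (div_le_one (by linarith)).mpr h1
    have h5 : 0 < 1 / Real.sqrt C₁ := by positivity
    exact le_min (by nlinarith) (by nlinarith)
  unfold accuracy algorithmConstants
  rw [div_mul_eq_mul_div, mul_assoc]
  simp only
  gcongr

/-- The rank is at most a constant times `min k (1 / (ε² α))`. -/
theorem min_ceil_le {k : ℕ} {α e ε₂ : ℝ} (hα : 0 < α) (hα1 : α ≤ 1) (he : 0 < e) (hε : 0 < ε)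
    (hε1 : ε ≤ 1) (h : e * ε ≤ ε₂) :
    ((min k ⌈1 / (2 * α * ε₂ ^ 2)⌉₊ : ℕ) : ℝ) ≤
      (1 / (2 * e ^ 2) + 1) * min (Real.sqrt k) (1 / (ε * Real.sqrt α)) ^ 2 := by
  have hs : Real.sqrt α ^ 2 = α := Real.sq_sqrt hα.le
  have h1 : 1 / (2 * α * ε₂ ^ 2) ≤ 1 / (2 * e ^ 2) * (1 / (α * ε ^ 2)) := by
    rw [one_div_mul_one_div]
    apply one_div_le_one_div_of_le (by positivity)
    have := pow_le_pow_left₀ (by positivity) h 2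
    nlinarith
  -- This absorbs the unit that is lost by rounding up.
  have h2 : 1 ≤ 1 / (α * ε ^ 2) := by
    rw [one_le_div (by positivity)]
    have : ε ^ 2 ≤ 1 := by nlinarith
    nlinarith
  have h3 : (⌈1 / (2 * α * ε₂ ^ 2)⌉₊ : ℝ) ≤ (1 / (2 * e ^ 2) + 1) * (1 / (α * ε ^ 2)) := by
    have h0 : 0 < ε₂ := lt_of_lt_of_le (by positivity) h
    refine (Nat.ceil_lt_add_one (by positivity)).le.trans ?_
    linarith
  have hA : 1 ≤ 1 / (2 * e ^ 2) + 1 := by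
    have : 0 < 1 / (2 * e ^ 2) := by positivity
    linarith
  rcases le_total (Real.sqrt k) (1 / (ε * Real.sqrt α)) with hm | hm
  · rw [min_eq_left hm, Real.sq_sqrt (Nat.cast_nonneg k)]
    have : ((min k ⌈1 / (2 * α * ε₂ ^ 2)⌉₊ : ℕ) : ℝ) ≤ k := by exact_mod_cast min_le_left _ _
    nlinarith [(Nat.cast_nonneg k : (0 : ℝ) ≤ k)]
  · rw [min_eq_right hm, div_pow, mul_pow, hs, one_pow, mul_comm (ε ^ 2)]
    refine le_trans ?_ h3
    exact_mod_cast min_le_right _ _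

end Sizes

/-! ### The required sizes with explicit constants. -/

section Sizes

/-- `W` stands for min(√k, 1/(ε√αs)), and the rank is at most A W². The scores need parts of about
√ℓ/ε², that is W/ε², samples. The average over the kept batches needs about ℓ/ε² samples in total,
supplied by W batches of `i₀` with W/ε² samples each. Of the two logarithmic factors in each size
one pays for the division into R rounds and the other for the parts of a batch or for the failure
probability. -/
theorem sufficientSizes_of_le {L : Layout} {d k n_m R T T₁ ℓ : ℕ}
    {C C₁ C₂ αs αm ε ε₂ δ' e A l lm ld W : ℝ} (hd : 0 < d) (hC : 1 ≤ C) (hC₁ : 1 ≤ C₁)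
    (hC₂ : 0 < C₂) (hαs : 0 < αs) (hαs1 : αs ≤ 1) (hαm : 0 < αm) (hε : 0 < ε) (hε1 : ε ≤ 1)
    (he : 0 < e) (he1 : e ≤ 1) (he2 : e * ε ≤ ε₂) (hε₂1 : ε₂ ≤ 1) (hA : 1 ≤ A) (hW : 1 ≤ W)
    (hl : 1 ≤ l)
    (hlm : l ≤ lm) (hld : l ≤ ld) (h2 : ∀ b, 2 ≤ L.smallSize b) (hmed : ∀ b, n_m ≤ L.mediumSize b)
    (hstar : n_m ≤ L.starSize) (hR0 : 0 < R) (hR : (R : ℝ) ≤ 5 * C₁ * l) (hT0 : 0 < T)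
    (hT : (T : ℝ) ≤ 313 * C₁ * l) (hT₁0 : 0 < T₁) (hT₁ : (T₁ : ℝ) ≤ 313 * C₁ * lm)
    (hrank : k ≤ ℓ ∨ 1 ≤ 2 * αs * ε₂ ^ 2 * (ℓ + 1)) (hℓ1 : 1 ≤ ℓ) (hℓ : (ℓ : ℝ) ≤ A * W ^ 2)
    (hlog : Real.log (2 * d / δ') ≤ 51 * C₁ * ld) (hlog1 : Real.log (2 / δ') ≤ 51 * C₁ * l)
    (hsmall : 10 * C₁ * (340 * C₁ + 1020 * C₂ ^ 2 / e ^ 4) * (d / (αs ^ 2 * ε ^ 4)) * ld ^ 2 ≤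
      L.numSmall)
    (hn : 400640 * C * C₁ ^ 2 * (W / ε ^ 2) * lm ^ 2 ≤ n_m)
    (hn' : 128204800 * (A / e ^ 2) * C₁ ^ 2 * (W / ε ^ 2) * lm ^ 2 ≤ n_m)
    (hnm : 340 * C₁ * (W / αm) * l ≤ (L.numMedium / R : ℕ)) :
    SufficientSizes L d k R T T₁ ℓ (n_m / ((R + R) * (T₁ + T₁))) (n_m / ((R + R) * T)) C C₁
      (C₂ * Real.sqrt d) αs αm ε₂ δ' := by
  have hd1 : (1 : ℝ) ≤ d := by exact_mod_cast hd
  have hR1 : (1 : ℝ) ≤ R := by exact_mod_cast hR0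
  have hC₁0 : 0 < C₁ := by linarith
  have hε₂0 : 0 < ε₂ := lt_of_lt_of_le (by positivity) he2
  have hlm1 : 1 ≤ lm := hl.trans hlm
  have hld1 : 1 ≤ ld := hl.trans hld
  have hRlm : (R : ℝ) ≤ 5 * C₁ * lm := hR.trans (by gcongr)
  have hRld : (R : ℝ) ≤ 5 * C₁ * ld := hR.trans (by gcongr)
  have hW2 : 1 ≤ W / ε ^ 2 := by
    rw [one_le_div (by positivity)]
    exact (pow_le_one₀ hε.le hε1).trans hW
  have hαnm : 340 * C₁ * W * l ≤ αm * (L.numMedium / R : ℕ) := by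
    calc 340 * C₁ * W * l = αm * (340 * C₁ * (W / αm) * l) := by field_simp
      _ ≤ _ := by gcongr
  have hsℓ : Real.sqrt ℓ ≤ A * W := by
    refine Real.sqrt_le_iff.mpr ⟨by positivity, hℓ.trans ?_⟩
    rw [mul_pow]
    gcongr
    exact le_self_pow₀ hA two_ne_zero
  have hRT : 0 < (R + R) * T := by positivity
  have hRT₁ : 0 < (R + R) * (T₁ + T₁) := by positivity
  -- the number of samples in a part
  set y : ℝ := 10240 * (A / e ^ 2) * (W / ε ^ 2) with hy
  have hy1 : 1 ≤ y := by
    have h1 : 1 ≤ A / e ^ 2 := by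
      rw [one_le_div (by positivity)]
      exact (pow_le_one₀ he.le he1).trans hA
    exact one_le_mul_of_one_le_of_one_le (by linarith) hW2
  have hyε : 10240 * A * W ≤ y * ε₂ ^ 2 := by
    calc 10240 * A * W = y * (e * ε) ^ 2 := by rw [hy]; field_simp
      _ ≤ _ := by gcongr
  have hpart : ∀ b : ℕ, 0 < b → (b : ℝ) ≤ 626 * C₁ * lm → y ≤ (n_m / ((R + R) * b) : ℕ) := by
    intro b hb h1
    refine le_natDiv (by positivity) hy1 ?_
    push_cast
    calc 2 * y * ((R + R) * b) ≤ 2 * y * ((5 * C₁ * lm + 5 * C₁ * lm) * (626 * C₁ * lm)) := by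
          gcongr
      _ = 128204800 * (A / e ^ 2) * C₁ ^ 2 * (W / ε ^ 2) * lm ^ 2 := by rw [hy]; ring
      _ ≤ _ := hn'
  have hn₁ : y ≤ (n_m / ((R + R) * (T₁ + T₁)) : ℕ) := hpart _ (by omega) (by
    push_cast
    linarith)
  have hn₂ : y ≤ (n_m / ((R + R) * T) : ℕ) := hpart _ hT0 (hT.trans (by gcongr; norm_num))
  have hstar₁ : 64 * C ≤ (L.starSize / (R + R) / T : ℕ) := by
    rw [Nat.div_div_eq_div_mul]
    refine le_natDiv hRT (by linarith) ?_
    push_cast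
    calc 2 * (64 * C) * ((R + R) * T) ≤
        2 * (64 * C) * ((5 * C₁ * lm + 5 * C₁ * lm) * (313 * C₁ * lm)) := by
          gcongr
          exact hT.trans (by gcongr)
      _ = 400640 * C * C₁ ^ 2 * 1 * lm ^ 2 := by ring
      _ ≤ 400640 * C * C₁ ^ 2 * (W / ε ^ 2) * lm ^ 2 := by gcongr
      _ ≤ n_m := hn
      _ ≤ L.starSize := by exact_mod_cast hstar
  -- the small batches of a round
  set Q : ℝ := d / (αs ^ 2 * ε ^ 4) with hQ
  have hε4 : ε ^ 4 ≤ 1 := pow_le_one₀ hε.le hε1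
  have hαQ : 1 ≤ αs * Q := by
    rw [hQ, mul_div_assoc', one_le_div (by positivity)]
    calc αs ^ 2 * ε ^ 4 = αs * (αs * ε ^ 4) := by ring
      _ ≤ αs * (1 * 1) := by gcongr
      _ ≤ αs * d := by gcongr; linarith
  have hQ1 : 1 ≤ Q := hαQ.trans (by
    calc αs * Q ≤ 1 * Q := by gcongr
      _ = Q := one_mul Q)
  set Y : ℝ := 340 * C₁ + 1020 * C₂ ^ 2 / e ^ 4 with hY
  have hY1 : 340 * C₁ ≤ Y := le_add_of_nonneg_right (by positivity)
  have hY2 : 1020 * C₂ ^ 2 / e ^ 4 ≤ Y := le_add_of_nonneg_left (by positivity)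
  have hns : Y * Q * ld ≤ (L.numSmall / R : ℕ) := by
    refine le_natDiv hR0 (one_le_mul_of_one_le_of_one_le
      (one_le_mul_of_one_le_of_one_le (by linarith) hQ1) hld1) ?_
    calc 2 * (Y * Q * ld) * R ≤ 2 * (Y * Q * ld) * (5 * C₁ * ld) := by gcongr
      _ = 10 * C₁ * Y * Q * ld ^ 2 := by ring
      _ ≤ _ := hsmall
  have hpos : ∀ {n : ℕ} {x : ℝ}, 1 ≤ x → x ≤ n → 0 < n := by
    intro n x h1 h3
    exact_mod_cast zero_lt_one.trans_le (h1.trans h3)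
  have hWα : 1 ≤ αm * (L.numMedium / R : ℕ) := by
    refine le_trans ?_ hαnm
    exact one_le_mul_of_one_le_of_one_le (one_le_mul_of_one_le_of_one_le (by linarith) hW) hl
  -- As 2R ≥ 2, a part size that fits the additional batch, divided by 2R, also fits the medium
  -- batches, which are only halved.
  have hdiv : ∀ N b : ℕ, n_m ≤ N → n_m / ((R + R) * b) ≤ N / 2 / b := by
    intro N b hN
    rw [← Nat.div_div_eq_div_mul]
    exact Nat.div_le_div_right (Nat.div_le_div hN (by omega) (by norm_num))
  exact {
    star₁_pos := hpos (by linarith) hstar₁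
    star₁_le := hstar₁
    small_pos := hpos (one_le_mul_of_one_le_of_one_le
      (one_le_mul_of_one_le_of_one_le (by linarith) hQ1) hld1) hns
    two_le_small := h2
    rank := hrank
    one_le_rank := hℓ1
    n₁_pos := hpos hy1 hn₁
    le_medium₁ := fun b => hdiv _ _ (hmed b)
    le_star₂ := by
      rw [← Nat.div_div_eq_div_mul]
      exact Nat.div_le_div_right (Nat.div_le_div_right hstar)
    n₁_le := by
      calc 2560 * Real.sqrt ℓ ≤ 10240 * (A * W) := by gcongr; norm_num
        _ ≤ y * ε₂ ^ 2 := by rwa [← mul_assoc]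
        _ ≤ _ := by gcongr
    n₂_pos := hpos hy1 hn₂
    le_medium₂ := fun b => hdiv _ _ (hmed b)
    n₂_le := by
      have h3 : W ≤ αm / 2 * (L.numMedium / R : ℕ) := by
        have h4 : 1 * 1 ≤ C₁ * l := by gcongr
        have h5 : W * 1 ≤ W * (C₁ * l) := by gcongr; linarith
        linarith
      calc 8 * (ℓ : ℝ) ≤ 10240 * (A * W ^ 2) := by gcongr; norm_num
        _ = W * (10240 * A * W) := by ring
        _ ≤ αm / 2 * (L.numMedium / R : ℕ) * (y * ε₂ ^ 2) := by gcongr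
        _ ≤ αm / 2 * (L.numMedium / R : ℕ) * ((n_m / ((R + R) * T) : ℕ) * ε₂ ^ 2) := by gcongr
        _ = _ := by ring
    medium_pos := by
      rw [Nat.pos_iff_ne_zero]
      intro h0
      rw [h0, Nat.cast_zero, mul_zero] at hWα
      linarith
    -- With β² = C₂²d and 4 + αs ε₂² ≤ 5 the constant is 51 · 4 · 5 = 1020.
    log_le_small := by
      refine hlog.trans ?_
      rw [le_div_iff₀ (by positivity), mul_pow C₂, Real.sq_sqrt (by positivity)]
      have h3 : αs * ε₂ ^ 2 ≤ 1 := mul_le_one₀ hαs1 (by positivity) (pow_le_one₀ hε₂0.le hε₂1)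
      calc 51 * C₁ * ld * (4 * (C₂ ^ 2 * d) * (4 + αs * ε₂ ^ 2)) ≤
          51 * C₁ * ld * (4 * (C₂ ^ 2 * d) * (4 + 1)) := by gcongr
        _ = 1020 * C₂ ^ 2 / e ^ 4 * Q * ld * (αs * (e * ε) ^ 2) ^ 2 * C₁ := by
          rw [hQ]
          field_simp
          ring
        _ ≤ Y * Q * ld * (αs * ε₂ ^ 2) ^ 2 * C₁ := by gcongr
        _ ≤ _ := by gcongr
    log_le_seed_small := by
      calc Real.log (2 / δ') ≤ 51 * C₁ * l := hlog1
        _ ≤ 51 * C₁ * ld * 1 := by rw [mul_one]; gcongr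
        _ ≤ 51 * C₁ * ld * (αs * Q) := by gcongr
        _ = 3 / 20 * αs * (340 * C₁ * Q * ld) := by ring
        _ ≤ 3 / 20 * αs * (Y * Q * ld) := by gcongr
        _ ≤ _ := by gcongr
    log_le_seed_medium := by
      calc Real.log (2 / δ') ≤ 51 * C₁ * l := hlog1
        _ = 3 / 20 * (340 * C₁ * 1 * l) := by ring
        _ ≤ 3 / 20 * (340 * C₁ * W * l) := by gcongr
        _ ≤ 3 / 20 * (αm * (L.numMedium / R : ℕ)) := by gcongr
        _ = _ := by ring }

end Sizes

/-! ### A single constant for all size conditions. -/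

section Sizes

theorem natCeil_mul_le {C₁ x y : ℝ} (hC₁ : 1 ≤ C₁) (hy : 0 ≤ y) (h : y ≤ 26 * C₁ * x)
    (hx : 1 ≤ x) : ((⌈12 * y⌉₊ : ℕ) : ℝ) ≤ 313 * C₁ * x := by
  have h1 : 1 ≤ C₁ * x := one_le_mul_of_one_le_of_one_le hC₁ hx
  refine (Nat.ceil_lt_add_one (by positivity)).le.trans ?_
  linarith

theorem exists_sufficientSizes {C C₁ C₂ : ℝ} (hC : 1 ≤ C) (hC₁ : 1 ≤ C₁) (hC₂ : 0 < C₂) :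
    ∃ c : ℝ, 0 < c ∧ ∀ (d k : ℕ) (L : Layout) (n_m R : ℕ) (αs αm σ M ε δ δ' ε₂ : ℝ),
      0 < d → 0 < k → 0 < αs → αs ≤ 1 → 0 < αm → αm ≤ 1 → 0 < σ → 0 < ε → ε ≤ 1 → 0 < δ →
      δ ≤ 1 → 0 ≤ M → (∀ b, 2 ≤ L.smallSize b) → (∀ b, n_m ≤ L.mediumSize b) → n_m ≤ L.starSize →
      0 < L.numMedium →
      c * (d / (αs ^ 2 * ε ^ 4)) * logFactor d M σ ε δ ^ 2 ≤ L.numSmall →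
      c * (min (Real.sqrt k) (1 / (ε * Real.sqrt αs)) / ε ^ 2) *
        logFactor L.numMedium M σ ε δ ^ 2 ≤ n_m →
      c * (min (Real.sqrt k) (1 / (ε * Real.sqrt αs)) / αm) *
        logFactor 1 M σ ε δ ^ 2 ≤ L.numMedium →
      R = numRounds algorithmConstants ⟨k, αs, C, C₁, σ, M, ε, δ⟩ → δ' = δ / (5 * R) →
      ε₂ = accuracy algorithmConstants ⟨k, αs, C, C₁, σ, M, ε, δ⟩ →
      ∃ n₁ n₂, SufficientSizes L d k R ⌈12 * Real.log (1 / δ')⌉₊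
        ⌈12 * Real.log ((L.numMedium / R : ℕ) / δ')⌉₊ (min k ⌈1 / (2 * αs * ε₂ ^ 2)⌉₊) n₁ n₂ C C₁
        (C₂ * Real.sqrt d) αs αm ε₂ δ' := by
  obtain ⟨e, he⟩ : ∃ e : ℝ, e = 1 / 4000 * (1 / Real.sqrt C₁) / (C₁ * Real.sqrt (C + 1)) := ⟨_, rfl⟩
  have he0 : 0 < e := by rw [he]; positivity
  have he1 : e ≤ 1 := by
    have := (le_accuracy (M := 0) (σ := 0) (δ := 0) (k := 0) (αs := 0) (zero_le_one.trans hC) hC₁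
      le_rfl one_pos).trans (accuracy_le (zero_le_one.trans hC) hC₁ le_rfl)
    rwa [mul_one, ← he] at this
  obtain ⟨A, hA⟩ : ∃ A : ℝ, A = 1 / (2 * e ^ 2) + 1 := ⟨_, rfl⟩
  have hA1 : 1 ≤ A := hA ▸ le_add_of_nonneg_left (by positivity)
  obtain ⟨c₁, hc₁⟩ : ∃ c : ℝ, c = 400640 * C * C₁ ^ 2 := ⟨_, rfl⟩
  obtain ⟨c₂, hc₂⟩ : ∃ c : ℝ, c = 128204800 * (A / e ^ 2) * C₁ ^ 2 := ⟨_, rfl⟩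
  obtain ⟨c₃, hc₃⟩ : ∃ c : ℝ, c = 10 * C₁ * (340 * C₁ + 1020 * C₂ ^ 2 / e ^ 4) := ⟨_, rfl⟩
  obtain ⟨c₄, hc₄⟩ : ∃ c : ℝ, c = 3400 * C₁ ^ 2 := ⟨_, rfl⟩
  have hc₁0 : 0 < c₁ := by rw [hc₁]; positivity
  have hc₂0 : 0 < c₂ := by rw [hc₂]; positivity
  have hc₃0 : 0 < c₃ := by rw [hc₃]; positivity
  have hc₄0 : 0 < c₄ := by rw [hc₄]; positivity
  refine ⟨c₁ + c₂ + c₃ + c₄, by positivity, ?_⟩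
  intro d k L n_m R αs αm σ M ε δ δ' ε₂ hd hk hαs hαs1 hαm hαm1 hσ hε hε1 hδ hδ1 hM h2 hmed hstar
    hNm hsmall hn hm hR hδ' hε₂
  have hd1 : (1 : ℝ) ≤ d := by exact_mod_cast hd
  have hNm1 : (1 : ℝ) ≤ L.numMedium := by exact_mod_cast hNm
  have hl1 : 1 ≤ logFactor 1 M σ ε δ := one_le_logFactor hM hσ hε hδ hδ1 le_rfl
  have hlm1 := logFactor_mono hM hσ hε hδ zero_le_one hNm1
  have hld1 := logFactor_mono hM hσ hε hδ zero_le_one hd1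
  have hR0 : 0 < R := hR ▸ numRounds_pos hC₁ hM hσ hε
  have hRle : (R : ℝ) ≤ 5 * C₁ * logFactor 1 M σ ε δ := hR ▸ numRounds_le hC₁ hM hσ hε hδ hδ1
  have hR1 : (1 : ℝ) ≤ R := by exact_mod_cast hR0
  -- The coefficient comes from R ≤ 5C₁l; it is at most 26C₁ for a = 1 and at most 51C₁ for a = 2.
  have hlog : ∀ x a : ℝ, 1 ≤ x → 0 < a →
      Real.log (a * x / δ') ≤ (1 + 25 * a * C₁) * logFactor x M σ ε δ := by
    intro x a hx ha
    rw [hδ']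
    have h3 := logFactor_mono hM hσ hε hδ zero_le_one hx
    have h4 : 5 * a * (R : ℝ) ≤ 5 * a * (5 * C₁ * logFactor x M σ ε δ) := by
      gcongr
      exact hRle.trans (by gcongr)
    linarith [log_mul_div_le hM hσ hε hδ (zero_lt_one.trans_le hx) ha (zero_lt_one.trans_le hR1)]
  have he2 : e * ε ≤ ε₂ := by
    rw [he, hε₂]
    exact le_accuracy (zero_le_one.trans hC) hC₁ hε1 hε
  have hε₂1 : ε₂ ≤ 1 := hε₂ ▸ accuracy_le (zero_le_one.trans hC) hC₁ hε1
  have hε₂0 : 0 < ε₂ := lt_of_lt_of_le (by positivity) he2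
  have hδ0 : 0 < δ' := by rw [hδ']; positivity
  have hδ2 : δ' < 1 := by
    rw [hδ', div_lt_one (by positivity)]
    linarith
  have hlogδ : 0 < Real.log (1 / δ') := Real.log_pos ((one_lt_div hδ0).mpr hδ2)
  obtain ⟨l, hl⟩ : ∃ l, l = logFactor 1 M σ ε δ := ⟨_, rfl⟩
  obtain ⟨lm, hlm⟩ : ∃ l, l = logFactor L.numMedium M σ ε δ := ⟨_, rfl⟩
  obtain ⟨ld, hld⟩ : ∃ l, l = logFactor d M σ ε δ := ⟨_, rfl⟩
  have hℓ := min_ceil_le (k := k) hαs hαs1 he0 hε hε1 he2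
  have hW1 : 1 ≤ min (Real.sqrt k) (1 / (ε * Real.sqrt αs)) := by
    refine le_min (Real.one_le_sqrt.mpr (by exact_mod_cast hk)) ?_
    have h3 : Real.sqrt αs ≤ 1 := Real.sqrt_le_one.mpr hαs1
    have h4 := Real.sqrt_pos.mpr hαs
    rw [one_le_div (by positivity)]
    exact mul_le_one₀ hε1 h4.le h3
  generalize min (Real.sqrt k) (1 / (ε * Real.sqrt αs)) = W at *
  rw [← hA] at hℓ
  rw [← hl] at hm hl1 hlm1 hld1 hRle
  rw [← hlm] at hn hlm1
  rw [← hld] at hsmall hld1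
  have hW0 : 0 < W := zero_lt_one.trans_le hW1
  have hWα : 1 ≤ W / αm := (one_le_div hαm).mpr (hαm1.trans hW1)
  have h1 : 1 ≤ C₁ * (W / αm) * l :=
    one_le_mul_of_one_le_of_one_le (one_le_mul_of_one_le_of_one_le hC₁ hWα) hl1
  have hnm : 340 * C₁ * (W / αm) * l ≤ (L.numMedium / R : ℕ) := by
    refine le_natDiv hR0 (by linarith) ?_
    calc 2 * (340 * C₁ * (W / αm) * l) * R ≤ 2 * (340 * C₁ * (W / αm) * l) * (5 * C₁ * l) := by
          gcongr
      _ = c₄ * (W / αm) * l ^ 2 := by rw [hc₄]; ring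
      _ ≤ (c₁ + c₂ + c₃ + c₄) * (W / αm) * l ^ 2 := by gcongr; linarith
      _ ≤ _ := hm
  have hnm1 : (1 : ℝ) ≤ (L.numMedium / R : ℕ) := by linarith
  have hlogm : 0 < Real.log ((L.numMedium / R : ℕ) / δ') :=
    Real.log_pos ((one_lt_div hδ0).mpr (hδ2.trans_le hnm1))
  have hl0 : 0 < l := zero_lt_one.trans_le hl1
  have hlm0 : 0 < lm := hl0.trans_le hlm1
  have hld0 : 0 < ld := hl0.trans_le hld1
  refine ⟨_, _, sufficientSizes_of_le (lm := lm) (ld := ld) hd hC hC₁ hC₂ hαs hαs1 hαm hε hε1 he0 he1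
    he2 hε₂1 hA1 hW1 hl1 hlm1 hld1 h2 hmed hstar hR0 hRle (Nat.ceil_pos.mpr (by positivity))
    (natCeil_mul_le hC₁ hlogδ.le ?_ hl1) (Nat.ceil_pos.mpr (by positivity))
    (natCeil_mul_le hC₁ hlogm.le ?_ (hl1.trans hlm1)) ?_
    (le_min hk (Nat.ceil_pos.mpr (by positivity))) hℓ ?_ ?_ ?_ ?_ ?_ hnm⟩
  · have h3 := hlog 1 1 le_rfl one_pos
    rw [one_mul, ← hl] at h3
    refine h3.trans ?_
    gcongr
    linarith
  · have h3 := hlog (L.numMedium / R : ℕ) 1 hnm1 one_pos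
    rw [one_mul] at h3
    have h4 : logFactor ((L.numMedium / R : ℕ) : ℝ) M σ ε δ ≤ lm := hlm ▸
      logFactor_mono hM hσ hε hδ (zero_le_one.trans hnm1) (by exact_mod_cast Nat.div_le_self _ _)
    calc _ ≤ (1 + 25 * 1 * C₁) * lm := h3.trans (by gcongr)
      _ ≤ _ := by gcongr; linarith
  -- If the rank is cut off below k, rounding 1/(2αs ε₂²) up ensures 2αs ε₂² ℓ ≥ 1.
  · rcases le_total k ⌈1 / (2 * αs * ε₂ ^ 2)⌉₊ with h3 | h3
    · exact Or.inl (le_min le_rfl h3)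
    · right
      rw [min_eq_right h3]
      have h4 := Nat.le_ceil (1 / (2 * αs * ε₂ ^ 2))
      rw [div_le_iff₀ (by positivity)] at h4
      have : 0 < 2 * αs * ε₂ ^ 2 := by positivity
      linarith
  · have h3 := hlog d 2 hd1 two_pos
    rw [← hld] at h3
    refine h3.trans ?_
    gcongr
    linarith
  · have h3 := hlog 1 2 le_rfl two_pos
    rw [← hl, mul_one] at h3
    refine h3.trans ?_
    gcongr
    linarith
  · refine le_trans ?_ hsmall
    rw [← hc₃]
    gcongr
    linarith
  · refine le_trans ?_ hn
    rw [← hc₁]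
    gcongr
    linarith
  · refine le_trans ?_ hn
    rw [← hc₂]
    gcongr
    linarith

end Sizes

/-! ### The running time -/

section Steps

variable {α β : Type} {d V : ℕ}

theorem Timed.steps_bind_le {x : Timed α} {f : α → Timed β} {a b : ℕ} (hx : x.steps ≤ a)
    (hf : (f x.val).steps ≤ b) : (x >>= f).steps ≤ a + b :=
  add_le_add hx hf

theorem steps_forEach_le {n N b : ℕ} {f : Fin n → Timed β} (hn : n ≤ N)
    (h : ∀ i, (f i).steps ≤ b) : (forEach f).steps ≤ N * (b + 1) := by
  calc (forEach f).steps = ∑ i, ((f i).steps + 1) := rfl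
    _ ≤ ∑ _i : Fin n, (b + 1) := Finset.sum_le_sum fun i _ => Nat.add_le_add_right (h i) 1
    _ = n * (b + 1) := by simp
    _ ≤ _ := Nat.mul_le_mul_right _ hn

theorem steps_loop_le {b : ℕ} (n : ℕ) {f : Fin n → α → Timed α} (h : ∀ i a, (f i a).steps ≤ b)
    (a : α) : (loop n f a).steps ≤ 1 + n * b := by
  induction n with
  | zero => exact Nat.le_add_right _ _
  | succ n ih =>
    refine (Timed.steps_bind_le (ih fun i => h i.castSucc) (h _ _)).trans ?_
    rw [Nat.succ_mul, Nat.add_assoc]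

theorem steps_averageGradient_le (hV : 1 ≤ V) (hd : d ≤ V) {S : Coll (Sample d)} (hS : S.len ≤ V)
    (w : Vec d) (κ : ℝ) : (averageGradient S w κ).steps ≤ 15 * V ^ 2 := by
  refine (Timed.steps_bind_le (steps_forEach_le (b := 3 * V + 8) hS fun i => ?_)
    (b := V * V + V + 1) ?_).trans ?_
  · change 3 * d + 8 ≤ _
    omega
  · change S.len * d + d + 1 ≤ _
    gcongr
  · nlinarith

theorem steps_divide_le (S : Coll α) {m a b : ℕ} (hS : S.len ≤ a) (hm : m ≤ b) :
    (divide S m).steps ≤ a + b + 1 := by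
  change S.len + m + 1 ≤ _
  omega

theorem steps_timedMedian_le {n : ℕ} (hn : n ≤ V) (v : Fin n → ℝ) :
    (timedMedian v).steps ≤ V ^ 2 + 3 := by
  change n ^ 2 + 3 ≤ _
  gcongr

theorem Coll.len_part_le {S : Coll α} (hS : S.len ≤ V) (m : ℕ) (j : Fin m) :
    (S.part m j).len ≤ V :=
  (Nat.div_le_self _ _).trans hS

/-- One number `V` bounds the dimension, all lengths and all numbers of repetitions, so that the
step count becomes a polynomial in `V`. The nested sum in `h` follows the binds of the program one
by one; the same pattern serves the other subroutines. -/
theorem steps_clipEst_le (hV : 1 ≤ V) (hd : d ≤ V) (K : Constants) {S : Coll (Sample d)}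
    (hS : S.len ≤ V) (w : Vec d) {δ' : ℝ} (hT : ⌈K.cT * Real.log (1 / δ')⌉₊ ≤ V) (σ C C₁ : ℝ) :
    (clipEst K S w δ' σ C C₁).steps ≤ 32 * V ^ 3 := by
  have h : (clipEst K S w δ' σ C C₁).steps ≤ 4 + ((V + V + 1) +
      (V * (V * (2 * V + 2 + 1) + (V + 2) + 1) + ((V ^ 2 + 3) + 12))) := by
    refine Timed.steps_bind_le le_rfl ?_
    refine Timed.steps_bind_le (steps_divide_le S hS hT) ?_
    refine Timed.steps_bind_le (steps_forEach_le hT fun j => ?_) ?_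
    · have hl := S.len_part_le hS _ j
      refine Timed.steps_bind_le (steps_forEach_le hl fun i => ?_) ?_
      · change 2 * d + 2 ≤ _
        omega
      · exact Nat.add_le_add_right hl 2
    · exact Timed.steps_bind_le (steps_timedMedian_le hT _) le_rfl
  have h2 : V ^ 1 ≤ V ^ 3 := Nat.pow_le_pow_right hV (by norm_num)
  have h3 : V ^ 2 ≤ V ^ 3 := Nat.pow_le_pow_right hV (by norm_num)
  have h4 : 1 ≤ V ^ 3 := Nat.one_le_pow _ _ hV
  linarith

theorem steps_gradSubEst_le (hV : 1 ≤ V) (hd : d ≤ V) (svd : SingularVectorRoutine d)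
    {B : Coll (Coll (Sample d))} (hB : B.len ≤ V) (hb : ∀ b, (B.get b).len ≤ V) (κ : ℝ) (w : Vec d)
    (ℓ : ℕ) : (gradSubEst svd B κ w ℓ).steps ≤ 53 * V ^ 3 := by
  have hg : ∀ j : Fin 2, (forEach fun b => averageGradient ((B.get b).part 2 j) w κ).steps ≤
      V * (15 * V ^ 2 + 1) := fun j =>
    steps_forEach_le hB fun b => steps_averageGradient_le hV hd (Coll.len_part_le (hb b) 2 j) w κ
  have h : (gradSubEst svd B κ w ℓ).steps ≤ V * (V + 2 + 1 + 1) + (V * (15 * V ^ 2 + 1) +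
      (V * (15 * V ^ 2 + 1) + (V * (4 * V ^ 2) + V ^ 2 + 2 + (V ^ 3 + 1 + (2 * V ^ 3 + V))))) := by
    refine Timed.steps_bind_le (steps_forEach_le hB fun b => steps_divide_le _ (hb b) le_rfl) ?_
    refine Timed.steps_bind_le (hg 0) ?_
    refine Timed.steps_bind_le (hg 1) ?_
    refine Timed.steps_bind_le ?_ ?_
    · change B.len * (4 * d ^ 2) + d ^ 2 + 2 ≤ _
      gcongr
    refine Timed.steps_bind_le ?_ ?_
    · change d ^ 3 + 1 ≤ _
      gcongr
    · change 2 * d ^ 3 + d ≤ _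
      gcongr
  have h2 : V ^ 1 ≤ V ^ 3 := Nat.pow_le_pow_right hV (by norm_num)
  have h3 : V ^ 2 ≤ V ^ 3 := Nat.pow_le_pow_right hV (by norm_num)
  have h4 : 1 ≤ V ^ 3 := Nat.one_le_pow _ _ hV
  linarith

theorem steps_gradEst_le (hV : 1 ≤ V) (hd : d ≤ V) (K : Constants)
    {B : Coll (Coll (Sample d))} (hB : B.len ≤ V) (hb : ∀ b, (B.get b).len ≤ V)
    {S : Coll (Sample d)} (hS : S.len ≤ V) (κ : ℝ) (w : Vec d) (P : Matrix (Fin d) (Fin d) ℝ)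
    (ε₂ C₁ : ℝ) {δ' : ℝ} (hT₁ : ⌈K.cT₁ * Real.log (B.len / δ')⌉₊ ≤ V)
    (hT₂ : ⌈K.cT₂ * Real.log (1 / δ')⌉₊ ≤ V) :
    (gradEst K B S κ w P ε₂ δ' C₁).steps ≤ 300 * V ^ 4 := by
  have hT : ⌈K.cT₁ * Real.log (B.len / δ')⌉₊ + ⌈K.cT₁ * Real.log (B.len / δ')⌉₊ ≤ V + V := by omega
  have h : (gradEst K B S κ w P ε₂ δ' C₁).steps ≤ 4 + (4 + (V * (V + 2 + 1 + 1) +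
      (V * (V + (V + V) + 1 + 1) + (V + (V + V) + 1 + ((V + V) * (15 * V ^ 2 + 1) +
      (V * ((V + V) * (15 * V ^ 2 + 1) + (V * (4 * V ^ 2 + 4 * V + 1) + (V ^ 2 + 3)) + 1) +
      (5 * V + (V * (V + V + 1 + 1) +
      (V * (V * (15 * V ^ 2 + 1) + (V * (2 * V ^ 2 + V + 1) + V + 1) + 1) +
      (V * (V * (3 * V + 1 + 1) + (V ^ 2 + 3) + 1) + (V + V))))))))))) := by
    refine Timed.steps_bind_le le_rfl ?_
    refine Timed.steps_bind_le le_rfl ?_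
    refine Timed.steps_bind_le (steps_forEach_le hB fun b => steps_divide_le _ (hb b) le_rfl) ?_
    refine Timed.steps_bind_le (steps_forEach_le hB fun b => steps_divide_le _
      (Coll.len_part_le (hb b) 2 0) hT) ?_
    refine Timed.steps_bind_le (steps_divide_le S hS hT) ?_
    refine Timed.steps_bind_le (steps_forEach_le hT fun j => steps_averageGradient_le hV hd
      (Coll.len_part_le hS _ j) w κ) ?_
    refine Timed.steps_bind_le (steps_forEach_le hB fun b => ?_) ?_
    · refine Timed.steps_bind_le (steps_forEach_le hT fun j => steps_averageGradient_le hV hd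
        (Coll.len_part_le (Coll.len_part_le (hb b) 2 0) _ j) w κ) ?_
      refine Timed.steps_bind_le (steps_forEach_le hT₁ fun j => ?_) (steps_timedMedian_le hT₁ _)
      change 4 * d ^ 2 + 4 * d ≤ _
      gcongr
    refine Timed.steps_bind_le (Nat.mul_le_mul_left 5 hB) ?_
    refine Timed.steps_bind_le (steps_forEach_le hB fun b => steps_divide_le _
      (Coll.len_part_le (hb b) 2 1) hT₂) ?_
    refine Timed.steps_bind_le (steps_forEach_le hT₂ fun i => ?_) ?_
    · refine Timed.steps_bind_le (steps_forEach_le hB fun b => steps_averageGradient_le hV hd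
        (Coll.len_part_le (Coll.len_part_le (hb b) 2 1) _ i) w κ) ?_
      change B.len * (2 * d ^ 2 + d + 1) + d + 1 ≤ _
      gcongr
    refine Timed.steps_bind_le (steps_forEach_le hT₂ fun i => ?_) (Nat.add_le_add hT₂ hd)
    refine Timed.steps_bind_le (steps_forEach_le hT₂ fun j => ?_) (steps_timedMedian_le hT₂ _)
    change 3 * d + 1 ≤ _
    gcongr
  have h1 : V ^ 1 ≤ V ^ 4 := Nat.pow_le_pow_right hV (by norm_num)
  have h2 : V ^ 2 ≤ V ^ 4 := Nat.pow_le_pow_right hV (by norm_num)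
  have h3 : V ^ 3 ≤ V ^ 4 := Nat.pow_le_pow_right hV (by norm_num)
  have h4 : 1 ≤ V ^ 4 := Nat.one_le_pow _ _ hV
  linarith

/-- There are at most V rounds, each with O(V⁴) steps, mostly for the gradient estimate. -/
theorem steps_mainAlgorithm_le (hV : 1 ≤ V) (hd : d ≤ V) (K : Constants)
    (svd : SingularVectorRoutine d) (p : Params) {L : Layout} (X : Data d L) (s : Seed L)
    (hs : L.numSmall ≤ V) (hs' : ∑ b, L.smallSize b ≤ V) (hm : L.numMedium ≤ V)
    (hm' : ∑ b, L.mediumSize b ≤ V) (hstar : L.starSize ≤ V) (hR : numRounds K p ≤ V)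
    (hT : ⌈K.cT * Real.log (1 / (p.δ / (5 * numRounds K p)))⌉₊ ≤ V)
    (hT₁ : ⌈K.cT₁ * Real.log ((L.numMedium / numRounds K p : ℕ) /
      (p.δ / (5 * numRounds K p)))⌉₊ ≤ V)
    (hT₂ : ⌈K.cT₂ * Real.log (1 / (p.δ / (5 * numRounds K p)))⌉₊ ≤ V) :
    (mainAlgorithm K svd p X s).steps ≤ 500 * V ^ 5 := by
  have hsb : ∀ b, L.smallSize b ≤ V := fun b =>
    (Finset.single_le_sum (fun _ _ => Nat.zero_le _) (Finset.mem_univ b)).trans hs'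
  have hmb : ∀ b, L.mediumSize b ≤ V := fun b =>
    (Finset.single_le_sum (fun _ _ => Nat.zero_le _) (Finset.mem_univ b)).trans hm'
  have h : (mainAlgorithm K svd p X s).steps ≤ 8 + (8 + (6 + (2 + (V + V + (V + V + (V +
      (V + V + 1 + (V + V + 1 + (V + (V + V) + 1 + (1 + numRounds K p *
      (32 * V ^ 3 + (53 * V ^ 3 + (300 * V ^ 4 + (2 * V + 1)))))))))))))) := by
    refine Timed.steps_bind_le le_rfl ?_
    refine Timed.steps_bind_le le_rfl ?_
    refine Timed.steps_bind_le le_rfl ?_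
    refine Timed.steps_bind_le le_rfl ?_
    refine Timed.steps_bind_le (Nat.add_le_add hs hs') ?_
    refine Timed.steps_bind_le (Nat.add_le_add hm hm') ?_
    refine Timed.steps_bind_le hstar ?_
    refine Timed.steps_bind_le (steps_divide_le _ hs hR) ?_
    refine Timed.steps_bind_le (steps_divide_le _ hm hR) ?_
    refine Timed.steps_bind_le (steps_divide_le _ hstar (Nat.add_le_add hR hR)) ?_
    refine steps_loop_le _ (fun r w => ?_) _
    refine Timed.steps_bind_le (steps_clipEst_le hV hd K (Coll.len_part_le hstar _ _) w hT _ _ _) ?_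
    refine Timed.steps_bind_le (steps_gradSubEst_le hV hd svd (Coll.len_part_le hs _ _)
      (by intro b; exact hsb _) _ w _) ?_
    refine Timed.steps_bind_le (steps_gradEst_le hV hd K (Coll.len_part_le hm _ _) (by intro b; exact hmb _)
      (Coll.len_part_le hstar _ _) _ w _ _ _ hT₁ hT₂) ?_
    change 2 * d + 1 ≤ _
    gcongr
  have h0 : numRounds K p * (32 * V ^ 3 + (53 * V ^ 3 + (300 * V ^ 4 + (2 * V + 1)))) ≤
      V * (32 * V ^ 3 + (53 * V ^ 3 + (300 * V ^ 4 + (2 * V + 1)))) := Nat.mul_le_mul_right _ hR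
  have h1 : V ^ 1 ≤ V ^ 5 := Nat.pow_le_pow_right hV (by norm_num)
  have h2 : V ^ 2 ≤ V ^ 5 := Nat.pow_le_pow_right hV (by norm_num)
  have h3 : V ^ 4 ≤ V ^ 5 := Nat.pow_le_pow_right hV (by norm_num)
  have h4 : 1 ≤ V ^ 5 := Nat.one_le_pow _ _ hV
  linarith

end Steps

/-! ### The running time in terms of the size of the instance. -/

section InstanceSize

theorem cast_steps_mainAlgorithm_le {d : ℕ} (svd : SingularVectorRoutine d) (L : Layout) (p : Params)
    (X : Data d L) (s : Seed L) (hC₁ : 1 ≤ p.C₁) (hσ : 0 < p.σ) (hM : 0 ≤ p.M) (hε : 0 < p.ε)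
    (hδ : 0 < p.δ) (hδ1 : p.δ ≤ 1) :
    ((mainAlgorithm algorithmConstants svd p X s).steps : ℝ) ≤
      (500 * 326 ^ 5 : ℕ) * instanceSize d L p ^ 10 := by
  have hμ : 0 ≤ p.M / (p.ε * p.σ) := by positivity
  have hl0 : 0 < Real.log (2 + p.M / (p.ε * p.σ)) := Real.log_pos (by linarith)
  have hl1 : 0 ≤ Real.log (1 / p.δ) := Real.log_nonneg ((one_le_div hδ).mpr hδ1)
  obtain ⟨N, hN⟩ : ∃ N, N = instanceSize d L p := ⟨_, rfl⟩
  obtain ⟨R, hR⟩ : ∃ R, R = numRounds algorithmConstants p := ⟨_, rfl⟩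
  have hN' := hN
  unfold instanceSize at hN'
  rw [← hN]
  have h1 : (0 : ℝ) ≤ d := Nat.cast_nonneg _
  have h2 : (0 : ℝ) ≤ L.numSmall := Nat.cast_nonneg _
  have h3 : (0 : ℝ) ≤ (∑ b, L.smallSize b : ℕ) := Nat.cast_nonneg _
  have h4 : (0 : ℝ) ≤ L.numMedium := Nat.cast_nonneg _
  have h5 : (0 : ℝ) ≤ (∑ b, L.mediumSize b : ℕ) := Nat.cast_nonneg _
  have h6 : (0 : ℝ) ≤ L.starSize := Nat.cast_nonneg _
  have hN1 : 1 ≤ N := by linarith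
  have hNN : N ≤ N ^ 2 := le_self_pow₀ hN1 two_ne_zero
  have hR0 : 0 < R := hR ▸ numRounds_pos hC₁ hM hσ hε
  have hR1 : (1 : ℝ) ≤ R := by exact_mod_cast hR0
  have hRle : (R : ℝ) ≤ 5 * N ^ 2 := by
    rw [hR]
    unfold numRounds algorithmConstants
    refine (Nat.ceil_lt_add_one (by positivity)).le.trans ?_
    have : p.C₁ * Real.log (2 + p.M / (p.ε * p.σ)) ≤ N * N := by
      gcongr <;> linarith
    simp only
    linarith
  have hlog : Real.log (1 / (p.δ / (5 * R))) ≤ 26 * N ^ 2 := by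
    have e : 1 / (p.δ / (5 * R)) = 1 / p.δ * (5 * R) := by field_simp
    rw [e, Real.log_mul (by positivity) (by positivity)]
    linarith [Real.log_le_self (by positivity : (0 : ℝ) ≤ 5 * R)]
  have hlogm : Real.log ((L.numMedium / R : ℕ) / (p.δ / (5 * R))) ≤ 27 * N ^ 2 := by
    -- A round may receive no medium batch. The logarithm is then that of 0, which is 0 by
    -- convention.
    rcases Nat.eq_zero_or_pos (L.numMedium / R) with h0 | h0
    · rw [h0, Nat.cast_zero, zero_div, Real.log_zero]
      positivity
    · have h0' : (0 : ℝ) < (L.numMedium / R : ℕ) := by exact_mod_cast h0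
      have h7 : ((L.numMedium / R : ℕ) : ℝ) ≤ L.numMedium := by
        exact_mod_cast Nat.div_le_self _ _
      rw [div_eq_mul_one_div, Real.log_mul (by positivity) (by positivity)]
      linarith [Real.log_le_self h0'.le]
  -- 12 · 27 = 324, so ⌈325 N²⌉ bounds all numbers of repetitions; its fifth power is of order N¹⁰.
  have hceil : ∀ x : ℝ, x ≤ 27 * N ^ 2 → ⌈12 * x⌉₊ ≤ ⌈325 * N ^ 2⌉₊ := by
    intro x hx
    exact Nat.ceil_mono (by linarith [sq_nonneg N])
  have hnat : ∀ n : ℕ, (n : ℝ) ≤ N ^ 2 * 5 → n ≤ ⌈325 * N ^ 2⌉₊ := by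
    intro n hn
    have : (n : ℝ) ≤ 325 * N ^ 2 := by linarith
    exact_mod_cast this.trans (Nat.le_ceil _)
  have hV : ((⌈325 * N ^ 2⌉₊ : ℕ) : ℝ) ≤ 326 * N ^ 2 := by
    refine (Nat.ceil_lt_add_one (by positivity)).le.trans ?_
    linarith
  have key := steps_mainAlgorithm_le (V := ⌈325 * N ^ 2⌉₊) (Nat.ceil_pos.mpr (by positivity))
    (hnat d (by linarith)) algorithmConstants svd p X s (hnat _ (by linarith)) (hnat _ (by linarith))
    (hnat _ (by linarith)) (hnat _ (by linarith)) (hnat _ (by linarith)) (hnat _ (by rw [← hR]; linarith))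
    (hR ▸ hceil _ (by linarith)) (hR ▸ hceil _ hlogm) (hR ▸ hceil _ (by linarith))
  calc ((mainAlgorithm algorithmConstants svd p X s).steps : ℝ) ≤
      (500 * ⌈325 * N ^ 2⌉₊ ^ 5 : ℕ) := by exact_mod_cast key
    _ = 500 * (⌈325 * N ^ 2⌉₊ : ℝ) ^ 5 := by push_cast; ring
    _ ≤ 500 * (326 * N ^ 2) ^ 5 := by gcongr
    _ = _ := by push_cast; ring

end InstanceSize

/-! ### Conclusion of the proof. -/

theorem pos_and_le_one_of_mul_le {ι : Type*} [Fintype ι] {p : ι → Prop} [DecidablePred p]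
    {α x : ℝ} {n : ℕ} (hn : Fintype.card ι = n) (hx : 0 < x) (h : x ≤ n)
    (hα : α * n ≤ (Finset.univ.filter p).card) : 0 < n ∧ α ≤ 1 := by
  have hn0 : (0 : ℝ) < n := hx.trans_le h
  refine ⟨by exact_mod_cast hn0, ?_⟩
  have h1 : ((Finset.univ.filter p).card : ℝ) ≤ n := by
    rw [← hn]
    exact_mod_cast Finset.card_le_univ _
  by_contra hc
  push Not at hc
  have : (1 : ℝ) * n < α * n := by gcongr
  linarith

end BatchRegression

end

open BatchRegression
theorem mainTheorem1 :
    ∃ K : Constants,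
      (∃ A a : ℕ, ∀ (d : ℕ) (svd : SingularVectorRoutine d) (L : Layout) (p : Params)
        (X : Data d L) (s : Seed L),
        1 ≤ p.C₁ → 0 < p.σ → 0 ≤ p.M → 0 < p.ε → p.ε ≤ 1 → 0 < p.δ → p.δ ≤ 1 →
        ((mainAlgorithm K svd p X s).steps : ℝ) ≤ A * instanceSize d L p ^ a) ∧
      ∃ q : ℕ, ∀ C C₁ C₂ : ℝ, 0 < C₂ → ∃ c : ℝ, 0 < c ∧
        ∀ (d k : ℕ) (D : Fin k → ProbabilityMeasure (Sample d)) (w : Fin k → Vec d)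
          (L : Layout) (smallSource : Fin L.numSmall → Fin k)
          (mediumSource : Fin L.numMedium → Fin k) (n_m : ℕ) (i₀ : Fin k)
          (αs αm σ M ε δ : ℝ) (svd : SingularVectorRoutine d),
          0 < αs → 0 < αm → 0 < σ → 0 < ε → ε ≤ 1 → 0 < δ → δ ≤ 1 →
          (∀ i, ‖Matrix.toEuclideanCLM (𝕜 := ℝ) (secondMoment (D i : Measure (Sample d)))‖ ≤ C₁) →
          (∀ i, ∀ᵐ z ∂(D i : Measure (Sample d)), ‖z.1‖ ≤ C₂ * Real.sqrt d) →
          i₀ ∈ recoverable L D smallSource mediumSource w C C₁ σ αs αm →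
          ‖w i₀‖ ≤ M →
          (∀ b, 2 ≤ L.smallSize b) → (∀ b, n_m ≤ L.mediumSize b) → n_m ≤ L.starSize →
          c * (d / (αs ^ 2 * ε ^ 4)) * logFactor d M σ ε δ ^ q ≤ L.numSmall →
          c * (min (Real.sqrt k) (1 / (ε * Real.sqrt αs)) / ε ^ 2) *
            logFactor L.numMedium M σ ε δ ^ q ≤ n_m →
          c * (min (Real.sqrt k) (1 / (ε * Real.sqrt αs)) / αm) *
            logFactor 1 M σ ε δ ^ q ≤ L.numMedium →
          1 - δ ≤ probability L D smallSource mediumSource i₀ fun X s =>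
            ‖(mainAlgorithm K svd ⟨k, αs, C, C₁, σ, M, ε, δ⟩ X s).val - w i₀‖ ≤ ε * σ := by
  refine ⟨algorithmConstants, ⟨500 * 326 ^ 5, 10, fun d svd L p X s hC₁ hσ hM hε _ hδ hδ1 =>
    cast_steps_mainAlgorithm_le svd L p X s hC₁ hσ hM hε hδ hδ1⟩, 2, fun C C₁ C₂ hC₂ => ?_⟩
  -- The constant must be chosen before the data are known. If C < 1 or C₁ < 1, no component can be
  -- recovered in positive dimension, so any value will do.
  obtain ⟨c, hc, h⟩ : ∃ c : ℝ, 0 < c ∧ ∀ hC : 1 ≤ C ∧ 1 ≤ C₁, _ := by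
    by_cases hC : 1 ≤ C ∧ 1 ≤ C₁
    · obtain ⟨c, hc, h⟩ := exists_sufficientSizes hC.1 hC.2 hC₂
      exact ⟨c, hc, fun _ => h⟩
    · exact ⟨1, one_pos, fun h => absurd h hC⟩
  refine ⟨c, hc, ?_⟩
  intro d k D w L smallSource mediumSource n_m i₀ αs αm σ M ε δ svd hαs hαm hσ hε hε1 hδ hδ1 hnorm
    hbdd hrec hM h2 hmed hstar hsmall hn hm
  have hM0 : 0 ≤ M := (norm_nonneg _).trans hM
  -- In dimension 0 all vectors coincide and the error vanishes. The bound on the number of small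
  -- batches is void there.
  rcases Nat.eq_zero_or_pos d with rfl | hd
  · have := le_probability (D := D) (smallSource := smallSource) (mediumSource := mediumSource)
      (i₀ := i₀) (good := fun _ => True) (a := 0) (b := 0) le_rfl (by simp)
      (event := fun X s => ‖(mainAlgorithm algorithmConstants svd ⟨k, αs, C, C₁, σ, M, ε, δ⟩ X s).val
        - w i₀‖ ≤ ε * σ) (fun s _ => by
        have : 0 ≤ ε * σ := by positivity
        simp [Subsingleton.elim _ (0 : Vec 0), this])
    linarith
  have hd1 : (1 : ℝ) ≤ d := by exact_mod_cast hd
  have hbounded := fun i => boundedInput_of_norm_le (hbdd i) (hnorm i)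
  have hC := one_le_of_isRegressionComponent hd hrec.2.2 (hbounded i₀)
  have hk : 0 < k := i₀.pos
  have hl0 := zero_lt_one.trans_le (one_le_logFactor hM0 hσ hε hδ hδ1 le_rfl)
  have hld0 := zero_lt_one.trans_le (one_le_logFactor hM0 hσ hε hδ hδ1 hd1)
  -- A positive lower bound on the number of batches excludes an empty family; for a nonempty one a
  -- share of batches is at most 1.
  obtain ⟨-, hαs1⟩ := pos_and_le_one_of_mul_le (Fintype.card_fin _) (by positivity) hsmall hrec.1
  have hW : 0 < min (Real.sqrt k) (1 / (ε * Real.sqrt αs)) := by positivity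
  obtain ⟨hNm, hαm1⟩ := pos_and_le_one_of_mul_le (Fintype.card_fin _) (by positivity) hm hrec.2.1
  obtain ⟨n₁, n₂, hsizes⟩ := h hC d k L n_m _ αs αm σ M ε δ _ _ hd hk hαs hαs1 hαm hαm1 hσ hε hε1
    hδ hδ1 hM0 h2 hmed hstar hNm hsmall hn hm rfl rfl rfl
  exact le_probability_of_sufficientSizes hd (by positivity) hαs hαm hσ hε hδ hδ1 hbounded hrec hM rfl
    rfl rfl hsizes svd
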